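/- **Conventions.** Operator spaces are complete; a unital operator algebra is an operator space $A$ with an associative unital algebra structure such that the multiplication is completely contractive on matrix products and $\|1\|\le 1$. Operator modules over $A$ are unital modules that are operator spaces and on which the action is completely contractive on matrix products; in an operator $(A,B)$-bimodule the two actions commute. $\tilde\otimes$ is the completed Haagerup tensor product, and $M\tilde\otimes_A N$ is the quotient of $M\tilde\otimes N$ by the closed span of the elements $ma\otimes n-m\otimes an$. Hilbert spaces $H$ carry the column operator space structure, and $A^n$ the column structure. Everything is ungraded. A right operator $A$-module $E$ is *rigged* if there are integers $n_i\ge 1$ and completely contractive $A$-module maps $\phi_i:E\to A^{n_i}$, $\psi_i:A^{n_i}\to E$ ($i\in\mathbb N$) such that $\psi_i\phi_i\to \mathrm{id}_E$ strongly and, for every $j$, $\phi_j\psi_i\phi_i\to\phi_j$ in norm as $i\to\infty$. It is *projective rigged* if moreover there are a separable Hilbert space $H$, a completely isometric $A$-module map $\iota:E\to H\tilde\otimes A$ and a completely contractive $A$-module map $\pi:H\tilde\otimes A\to E$ with $\pi\iota=\mathrm{id}_E$. Let $\Omega^1(A)=\ker(A\tilde\otimes A\to A)$ be the kernel of the multiplication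 and $da=1\otimes a-a\otimes 1$. A *universal connection* on $E$ is a completely bounded linear map $\nabla:E\to E\tilde\otimes_A\Omega^1(A)$ with $\nabla(ea)=\nabla(e)a+e\otimes da$. **Statement.** Let $A,B$ be unital operator algebras, let $P$ be a right operator $A$-module that is projective rigged over $A$, with a universal connection $\nabla$, and let $P'$ be an operator $(A,B)$-bimodule that is projective rigged as a right $B$-module, with a universal $B$-connection $\nabla'$. Let $$\delta:A\to CB_B\big(P',\,P'\tilde\otimes_B\Omega^1(B)\big),\qquad \delta(a)p'=\nabla'(ap')-a\nabla'(p'),$$ with values in the completely bounded right $B$-module maps. Let $j_\delta:\Omega^1(A)\to CB_B(P',P'\tilde\otimes_B\Omega^1(B))$ be the completely bounded map obtained by restricting $a\otimes b\mapsto a\,\delta(b)$, so that $j_\delta(a\,db)=a\,\delta(b)$, and let $\nabla_\delta=(1\otimes j_\delta)\circ\nabla:P\to P\tilde\otimes_A CB_B(P',P'\tilde\otimes_B\Omega^1(B))$. For $p'\in P'$ write $\nabla_\delta(p)p'\in P\tilde\otimes_A(P'\tilde\otimes_B\Omega^1(B))$ for the image of $\nabla_\delta(p)$ under $x\otimes T\mapsto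 x\otimes T(p')$. Then: 1. $P\tilde\otimes_A P'$ is a projective rigged $B$-module. 2. There is a universal $B$-connection $\nabla''$ on $P\tilde\otimes_AP'$ such that, under the canonical map $P\tilde\otimes_A(P'\tilde\otimes_B\Omega^1(B))\to(P\tilde\otimes_AP')\tilde\otimes_B\Omega^1(B)$, $$\nabla''(p\otimes p')=p\otimes\nabla'(p')+\nabla_\delta(p)p'\qquad(p\in P,\ p'\in P').$$ 3. Suppose that $A$ and $B$ are C*-algebras, that $P$ and $P'$ are right C*-modules over $A$ and $B$ (all with their canonical operator space structures), and that $\langle aq,r\rangle=\langle q,a^*r\rangle$ for $a\in A$, $q,r\in P'$. Call a universal connection on a C*-module *Hermitian* if $\langle e,\nabla f\rangle-\langle\nabla e,f\rangle=d\langle e,f\rangle$ for all $e,f$, where $\langle e,f\otimes\omega\rangle=\langle e,f\rangle\omega$, $\langle \nabla e,f\rangle=\langle f,\nabla e\rangle^*$, and $(a\,db)^*=-d(b^*)\,a^*$. If $\nabla$ and $\nabla'$ are Hermitian, then $P\tilde\otimes_AP'$ is a right C*-module over $B$ (with its operator space structure as the canonical one) for an inner product with $\langle p\otimes q,r\otimes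 s\rangle=\langle q,\langle p,r\rangle s\rangle$, and $\nabla''$ is Hermitian for it. -/

import Mathlib

set_option linter.unusedSectionVars false
set_option synthInstance.maxSize 2000

open scoped TensorProduct
open UniformSpace

namespace OpMod

noncomputable section

/-- The product of an `X`-valued and a `Y`-valued matrix along a pairing `f : X → Y → Z`. -/
def amp {X Y Z : Type*} [AddCommMonoid Z] {m k n : Type} [Fintype k]
    (f : X → Y → Z) (x : Matrix m k X) (y : Matrix k n Y) : Matrix m n Z :=
  fun i j => ∑ s, f (x i s) (y s j)

/-- The operator `ℓ²ₙ → H ⊕ ⋯ ⊕ H` given by an `H`-valued matrix. -/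
def colOp {H : Type*} [SeminormedAddCommGroup H] [NormedSpace ℂ H]
    {m n : Type} [Fintype m] [Fintype n] (x : Matrix m n H) :
    EuclideanSpace ℂ n →L[ℂ] PiLp 2 (fun _ : m => H) :=
  LinearMap.toContinuousLinearMap
    { toFun := fun v => WithLp.toLp 2 (fun i => ∑ j, v j • x i j)
      map_add' := fun v w => by
        ext i; simp [add_smul, Finset.sum_add_distrib]
      map_smul' := fun c v => by
        ext i; simp [mul_smul, Finset.smul_sum] }

/-- The norm of a Hilbert space valued matrix for the column operator space structure; for
`H = ℂ` it is the operator norm of the scalar matrix as a map `ℓ²ₙ → ℓ²ₘ`. -/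
def colNorm {H : Type*} [SeminormedAddCommGroup H] [NormedSpace ℂ H]
    {m n : Type} [Fintype m] [Fintype n] (x : Matrix m n H) : ℝ := ‖colOp x‖

section colNorm

variable {H : Type*} [SeminormedAddCommGroup H] [NormedSpace ℂ H]
  {m n k l : Type} [Fintype m] [Fintype n] [Fintype k] [Fintype l]

theorem colNorm_nonneg (x : Matrix m n H) : 0 ≤ colNorm x := norm_nonneg _

theorem colOp_apply (x : Matrix m n H) (v : EuclideanSpace ℂ n) (i : m) :
    colOp x v i = ∑ j, v j • x i j := rfl

theorem colNorm_le (x : Matrix m n H) {C : ℝ} (hC : 0 ≤ C)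
    (h : ∀ v : n → ℂ, ∑ i, ‖∑ j, v j • x i j‖ ^ 2 ≤ C ^ 2 * ∑ j, ‖v j‖ ^ 2) :
    colNorm x ≤ C := by
  refine ContinuousLinearMap.opNorm_le_bound _ hC fun v => ?_
  rw [← sq_le_sq₀ (norm_nonneg _) (by positivity), mul_pow, PiLp.norm_sq_eq_of_L2,
    EuclideanSpace.norm_sq_eq]
  exact h v

theorem colNorm_bound (x : Matrix m n H) (v : n → ℂ) :
    ∑ i, ‖∑ j, v j • x i j‖ ^ 2 ≤ colNorm x ^ 2 * ∑ j, ‖v j‖ ^ 2 := by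
  have h := (colOp x).le_opNorm (WithLp.toLp 2 v)
  rw [← sq_le_sq₀ (norm_nonneg _) (by positivity), mul_pow, PiLp.norm_sq_eq_of_L2,
    EuclideanSpace.norm_sq_eq] at h
  exact h

open Classical in
/-- The matrix of the coordinate restriction along `f`. -/
def selMat {m k : Type} (f : k → m) : Matrix k m ℂ := fun i j => if j = f i then 1 else 0

theorem colNorm_selMat_le (f : k → m) (hf : f.Injective) : colNorm (selMat f) ≤ 1 := by
  classical
  refine colNorm_le _ zero_le_one fun v => ?_
  simp only [selMat, smul_eq_mul, mul_ite, mul_one, mul_zero, Finset.sum_ite_eq',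
    Finset.mem_univ, if_true, one_pow, one_mul]
  have h := Finset.sum_map Finset.univ ⟨f, hf⟩ (fun j => ‖v j‖ ^ 2)
  simp only [Function.Embedding.coeFn_mk] at h
  rw [← h]
  exact Finset.sum_le_sum_of_subset_of_nonneg (Finset.subset_univ _) fun _ _ _ => by positivity

theorem colNorm_selMat_transpose_le (f : k → m) (hf : f.Injective) :
    colNorm (selMat f).transpose ≤ 1 := by
  classical
  refine colNorm_le _ zero_le_one fun v => ?_
  have key : ∀ i : m, ‖∑ j, v j • (selMat f).transpose i j‖ ^ 2 ≤
      ∑ j, (if i = f j then ‖v j‖ ^ 2 else 0) := by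
    intro i
    simp only [selMat, Matrix.transpose_apply, smul_eq_mul, mul_ite, mul_one, mul_zero]
    by_cases h : ∃ j, i = f j
    · obtain ⟨j, rfl⟩ := h
      simp only [hf.eq_iff, Finset.sum_ite_eq, Finset.mem_univ, if_true, le_refl]
    · push Not at h
      simp [h]
  refine (Finset.sum_le_sum fun i _ => key i).trans ?_
  rw [Finset.sum_comm]
  simp

open Classical in
theorem colNorm_smul_one_le (c : ℂ) : colNorm (c • (1 : Matrix m m ℂ)) ≤ ‖c‖ := by
  refine colNorm_le _ (norm_nonneg _) fun v => ?_
  simp [Matrix.one_apply, mul_pow, Finset.mul_sum, mul_comm]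

open Classical in
theorem colNorm_row_le (a b : ℝ) :
    colNorm (Matrix.fromCols ((a : ℂ) • (1 : Matrix m m ℂ)) ((b : ℂ) • (1 : Matrix m m ℂ))) ≤ √(a ^ 2 + b ^ 2) := by
  refine colNorm_le _ (Real.sqrt_nonneg _) fun v => ?_
  rw [Real.sq_sqrt (by positivity)]
  simp only [Fintype.sum_sum_type, Matrix.fromCols_apply_inl, Matrix.fromCols_apply_inr,
    Matrix.smul_apply, Matrix.one_apply, smul_eq_mul, mul_ite, mul_one, mul_zero,
    Finset.sum_ite_eq, Finset.mem_univ, if_true, Finset.mul_sum, mul_add]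
  rw [← Finset.sum_add_distrib]
  refine Finset.sum_le_sum fun i _ => ?_
  have h := norm_add_le (v (Sum.inl i) * (a : ℂ)) (v (Sum.inr i) * (b : ℂ))
  simp only [norm_mul, Complex.norm_real, Real.norm_eq_abs] at h
  have h2 := pow_le_pow_left₀ (norm_nonneg _) h 2
  refine h2.trans ?_
  nlinarith [sq_nonneg (‖v (Sum.inl i)‖ * |b| - ‖v (Sum.inr i)‖ * |a|), sq_abs a, sq_abs b]

open Classical in
theorem colNorm_col_le (a b : ℝ) :
    colNorm (Matrix.fromRows ((a : ℂ) • (1 : Matrix m m ℂ)) ((b : ℂ) • (1 : Matrix m m ℂ))) ≤ √(a ^ 2 + b ^ 2) := by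
  refine colNorm_le _ (Real.sqrt_nonneg _) fun v => ?_
  rw [Real.sq_sqrt (by positivity)]
  simp only [Fintype.sum_sum_type, Matrix.fromRows_apply_inl, Matrix.fromRows_apply_inr,
    Matrix.smul_apply, Matrix.one_apply, smul_eq_mul, mul_ite, mul_one, mul_zero,
    Finset.sum_ite_eq, Finset.mem_univ, if_true, norm_mul, mul_pow, Complex.norm_real,
    Real.norm_eq_abs, sq_abs, ← Finset.sum_mul]
  exact le_of_eq (by ring)

end colNorm

/-- A matrix seminorm satisfying Ruan's axioms. All finite rectangular formats are
recorded; they are determined by the square ones, by adding zero rows and columns. -/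
structure MatSeminorm (V : Type*) [AddCommGroup V] [Module ℂ V] where
  nrm : ∀ {m n : Type} [Fintype m] [Fintype n], Matrix m n V → ℝ
  nrm_add_le : ∀ {m n : Type} [Fintype m] [Fintype n] (x y : Matrix m n V),
    nrm (x + y) ≤ nrm x + nrm y
  nrm_lsmul_le : ∀ {k m n : Type} [Fintype k] [Fintype m] [Fintype n]
    (α : Matrix k m ℂ) (x : Matrix m n V),
    nrm (amp (fun (c : ℂ) (v : V) => c • v) α x) ≤ colNorm α * nrm x
  nrm_rsmul_le : ∀ {m n k : Type} [Fintype m] [Fintype n] [Fintype k]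
    (x : Matrix m n V) (β : Matrix n k ℂ),
    nrm (amp (fun (v : V) (c : ℂ) => c • v) x β) ≤ nrm x * colNorm β
  nrm_diag_le : ∀ {m n k l : Type} [Fintype m] [Fintype n] [Fintype k] [Fintype l]
    (x : Matrix m n V) (y : Matrix k l V),
    nrm (Matrix.fromBlocks x 0 0 y) ≤ max (nrm x) (nrm y)

namespace MatSeminorm

variable {V : Type*} [AddCommGroup V] [Module ℂ V] (p : MatSeminorm V)
  {m n k l : Type} [Fintype m] [Fintype n] [Fintype k] [Fintype l]

theorem nrm_smul_le (c : ℂ) (x : Matrix m n V) : p.nrm (c • x) ≤ ‖c‖ * p.nrm x := by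
  classical
  have hx : ∀ y : Matrix m n V, 0 ≤ p.nrm y := by
    intro y
    have h0 : p.nrm (0 : Matrix m n V) ≤ p.nrm (0 : Matrix m n V) + p.nrm (0 : Matrix m n V) := by
      simpa using p.nrm_add_le (0 : Matrix m n V) 0
    have hz : amp (fun (c : ℂ) (v : V) => c • v) ((-1 : ℂ) • (1 : Matrix m m ℂ)) y = -y := by
      ext i j; simp [amp, Matrix.one_apply]
    have h1 := p.nrm_lsmul_le ((-1 : ℂ) • (1 : Matrix m m ℂ)) y
    rw [hz] at h1
    have h2 := p.nrm_add_le y (-y)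
    rw [add_neg_cancel] at h2
    have h3 := colNorm_nonneg ((-1 : ℂ) • (1 : Matrix m m ℂ))
    nlinarith
  have hz : amp (fun (c : ℂ) (v : V) => c • v) (c • (1 : Matrix m m ℂ)) x = c • x := by
    ext i j; simp [amp, Matrix.one_apply]
  rw [← hz]
  refine (p.nrm_lsmul_le _ _).trans ?_
  exact mul_le_mul_of_nonneg_right (by convert colNorm_smul_one_le c) (hx x)

theorem nrm_zero : p.nrm (0 : Matrix m n V) = 0 := by
  have h0 := p.nrm_add_le (0 : Matrix m n V) 0
  have h1 := p.nrm_smul_le (0 : ℂ) (0 : Matrix m n V)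
  simp at h0 h1
  linarith

theorem nrm_neg_le (x : Matrix m n V) : p.nrm (-x) ≤ p.nrm x := by
  have h1 := p.nrm_smul_le (-1 : ℂ) x
  simpa using h1

theorem nrm_nonneg (x : Matrix m n V) : 0 ≤ p.nrm x := by
  have h2 := p.nrm_add_le x (-x)
  rw [add_neg_cancel, p.nrm_zero] at h2
  linarith [p.nrm_neg_le x]

theorem nrm_sub_le (x y : Matrix m n V) : p.nrm (x - y) ≤ p.nrm x + p.nrm y := by
  rw [sub_eq_add_neg]
  exact (p.nrm_add_le _ _).trans (by linarith [p.nrm_neg_le y])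

theorem nrm_sum_le {ι : Type*} (s : Finset ι) (x : ι → Matrix m n V) :
    p.nrm (∑ i ∈ s, x i) ≤ ∑ i ∈ s, p.nrm (x i) := by
  classical
  induction s using Finset.induction_on with
  | empty => simp [p.nrm_zero]
  | insert a s ha ih =>
    rw [Finset.sum_insert ha, Finset.sum_insert ha]
    exact (p.nrm_add_le _ _).trans (by linarith)

theorem nrm_lsmul_le_of_le_one (α : Matrix k m ℂ) (hα : colNorm α ≤ 1) (x : Matrix m n V) :
    p.nrm (amp (fun (c : ℂ) (v : V) => c • v) α x) ≤ p.nrm x :=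
  (p.nrm_lsmul_le α x).trans (mul_le_of_le_one_left (p.nrm_nonneg x) hα)

theorem nrm_rsmul_le_of_le_one (x : Matrix m n V) (β : Matrix n k ℂ) (hβ : colNorm β ≤ 1) :
    p.nrm (amp (fun (v : V) (c : ℂ) => c • v) x β) ≤ p.nrm x :=
  (p.nrm_rsmul_le x β).trans (mul_le_of_le_one_right (p.nrm_nonneg x) hβ)

theorem nrm_submatrix_le (f : k → m) (hf : f.Injective) (g : l → n) (hg : g.Injective)
    (x : Matrix m n V) : p.nrm (x.submatrix f g) ≤ p.nrm x := by
  classical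
  have h : x.submatrix f g = amp (fun (v : V) (c : ℂ) => c • v)
      (amp (fun (c : ℂ) (v : V) => c • v) (selMat f) x) (selMat g).transpose := by
    ext i j; simp [amp, selMat]
  rw [h]
  exact (p.nrm_rsmul_le_of_le_one _ _ (colNorm_selMat_transpose_le g hg)).trans
    (p.nrm_lsmul_le_of_le_one _ (colNorm_selMat_le f hf) x)

theorem nrm_entry_le (x : Matrix m n V) (i : m) (j : n) :
    p.nrm (fun _ _ : Unit => x i j) ≤ p.nrm x :=
  p.nrm_submatrix_le (fun _ : Unit => i) (fun _ _ _ => rfl) (fun _ : Unit => j)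
    (fun _ _ _ => rfl) x

theorem nrm_single_le [DecidableEq m] [DecidableEq n] (i : m) (j : n) (v : V) :
    p.nrm (Matrix.single i j v) ≤ p.nrm (fun _ _ : Unit => v) := by
  have h : Matrix.single i j v = amp (fun (v : V) (c : ℂ) => c • v)
      (amp (fun (c : ℂ) (v : V) => c • v) (selMat (fun _ : Unit => i)).transpose
        (fun _ _ : Unit => v)) (selMat (fun _ : Unit => j)) := by
    ext a b
    by_cases ha : i = a <;> by_cases hb : j = b <;>
      simp [amp, selMat, Matrix.single, ha, hb, eq_comm (a := a), eq_comm (a := b)]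
  rw [h]
  exact (p.nrm_rsmul_le_of_le_one _ _ (colNorm_selMat_le _ (fun _ _ _ => rfl))).trans
    (p.nrm_lsmul_le_of_le_one _ (colNorm_selMat_transpose_le _ (fun _ _ _ => rfl)) _)

theorem nrm_le_sum (x : Matrix m n V) :
    p.nrm x ≤ ∑ i, ∑ j, p.nrm (fun _ _ : Unit => x i j) := by
  classical
  conv_lhs => rw [Matrix.matrix_eq_sum_single x]
  refine (p.nrm_sum_le _ _).trans (Finset.sum_le_sum fun i _ => ?_)
  exact (p.nrm_sum_le _ _).trans (Finset.sum_le_sum fun j _ => p.nrm_single_le i j _)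

theorem nrm_fromCols_le {x : Matrix m k V} {y : Matrix m l V} {a b : ℝ} (ha : 0 < a) (hb : 0 < b)
    (hx : p.nrm x ≤ a) (hy : p.nrm y ≤ b) :
    p.nrm (Matrix.fromCols x y) ≤ √(a ^ 2 + b ^ 2) := by
  classical
  have h : Matrix.fromCols x y = amp (fun (c : ℂ) (v : V) => c • v)
      (Matrix.fromCols ((a : ℂ) • (1 : Matrix m m ℂ)) ((b : ℂ) • (1 : Matrix m m ℂ)))
      (Matrix.fromBlocks ((a⁻¹ : ℂ) • x) 0 0 ((b⁻¹ : ℂ) • y)) := by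
    have ha' : (a : ℂ) ≠ 0 := by exact_mod_cast ha.ne'
    have hb' : (b : ℂ) ≠ 0 := by exact_mod_cast hb.ne'
    ext i j
    rcases j with j | j <;>
      simp [amp, Matrix.one_apply, smul_smul, ha', hb']
  rw [h]
  refine (p.nrm_lsmul_le _ _).trans ?_
  have h1 : p.nrm (Matrix.fromBlocks ((a⁻¹ : ℂ) • x) 0 0 ((b⁻¹ : ℂ) • y)) ≤ 1 := by
    refine (p.nrm_diag_le _ _).trans (max_le ?_ ?_)
    · refine (p.nrm_smul_le _ _).trans ?_
      rw [norm_inv, Complex.norm_real, Real.norm_of_nonneg ha.le, inv_mul_le_iff₀ ha]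
      linarith
    · refine (p.nrm_smul_le _ _).trans ?_
      rw [norm_inv, Complex.norm_real, Real.norm_of_nonneg hb.le, inv_mul_le_iff₀ hb]
      linarith
  refine (mul_le_of_le_one_right (colNorm_nonneg _) h1).trans ?_
  convert colNorm_row_le a b

theorem nrm_fromRows_le {x : Matrix k n V} {y : Matrix l n V} {a b : ℝ} (ha : 0 < a) (hb : 0 < b)
    (hx : p.nrm x ≤ a) (hy : p.nrm y ≤ b) :
    p.nrm (Matrix.fromRows x y) ≤ √(a ^ 2 + b ^ 2) := by
  classical
  have h : Matrix.fromRows x y = amp (fun (v : V) (c : ℂ) => c • v)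
      (Matrix.fromBlocks ((a⁻¹ : ℂ) • x) 0 0 ((b⁻¹ : ℂ) • y))
      (Matrix.fromRows ((a : ℂ) • (1 : Matrix n n ℂ)) ((b : ℂ) • (1 : Matrix n n ℂ))) := by
    have ha' : (a : ℂ) ≠ 0 := by exact_mod_cast ha.ne'
    have hb' : (b : ℂ) ≠ 0 := by exact_mod_cast hb.ne'
    ext i j
    rcases i with i | i <;>
      simp [amp, Matrix.one_apply, smul_smul, ha', hb']
  rw [h]
  refine (p.nrm_rsmul_le _ _).trans ?_
  have h1 : p.nrm (Matrix.fromBlocks ((a⁻¹ : ℂ) • x) 0 0 ((b⁻¹ : ℂ) • y)) ≤ 1 := by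
    refine (p.nrm_diag_le _ _).trans (max_le ?_ ?_)
    · refine (p.nrm_smul_le _ _).trans ?_
      rw [norm_inv, Complex.norm_real, Real.norm_of_nonneg ha.le, inv_mul_le_iff₀ ha]
      linarith
    · refine (p.nrm_smul_le _ _).trans ?_
      rw [norm_inv, Complex.norm_real, Real.norm_of_nonneg hb.le, inv_mul_le_iff₀ hb]
      linarith
  refine (mul_le_of_le_one_left (colNorm_nonneg _) h1).trans ?_
  convert colNorm_col_le a b


theorem nrm_smul (c : ℂ) (x : Matrix m n V) : p.nrm (c • x) = ‖c‖ * p.nrm x := by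
  refine le_antisymm (p.nrm_smul_le c x) ?_
  rcases eq_or_ne c 0 with rfl | hc
  · simpa using p.nrm_nonneg _
  · have h := p.nrm_smul_le c⁻¹ (c • x)
    rw [smul_smul, inv_mul_cancel₀ hc, one_smul, norm_inv] at h
    rwa [le_inv_mul_iff₀ (norm_pos_iff.2 hc)] at h

/-- The seminorm of a matrix seminorm on `1 × 1` matrices. -/
@[reducible] def toNorm : Norm V := ⟨fun v => p.nrm (fun _ _ : Unit => v)⟩

theorem core : @SeminormedSpace.Core ℂ V _ _ p.toNorm _ :=
  letI := p.toNorm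
  { norm_nonneg := fun _ => p.nrm_nonneg _
    norm_smul := fun c v => p.nrm_smul c (fun _ _ : Unit => v)
    norm_triangle := fun v w => p.nrm_add_le (fun _ _ : Unit => v) (fun _ _ : Unit => w) }

end MatSeminorm

/-- An operator space structure on a (semi)normed space: matrix norms satisfying Ruan's axioms
that extend the given norm. Completeness is a separate assumption `CompleteSpace X`. -/
class OperatorSpace (X : Type*) [SeminormedAddCommGroup X] [NormedSpace ℂ X] where
  mat : MatSeminorm X
  norm_eq : ∀ x : X, mat.nrm (fun _ _ : Unit => x) = ‖x‖

section OperatorSpace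

variable {X : Type*} [SeminormedAddCommGroup X] [NormedSpace ℂ X] [OperatorSpace X]
  {m n k l : Type} [Fintype m] [Fintype n] [Fintype k] [Fintype l]

/-- The norm of a matrix over an operator space. -/
def mnorm (x : Matrix m n X) : ℝ := (OperatorSpace.mat (X := X)).nrm x

theorem mnorm_nonneg (x : Matrix m n X) : 0 ≤ mnorm x := MatSeminorm.nrm_nonneg _ _

theorem mnorm_unit (x : X) : mnorm (fun _ _ : Unit => x) = ‖x‖ := OperatorSpace.norm_eq x

theorem mnorm_le_sum (x : Matrix m n X) : mnorm x ≤ ∑ i, ∑ j, ‖x i j‖ := by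
  simp only [← mnorm_unit]
  exact MatSeminorm.nrm_le_sum _ x

theorem norm_entry_le (x : Matrix m n X) (i : m) (j : n) : ‖x i j‖ ≤ mnorm x := by
  rw [← mnorm_unit]
  exact MatSeminorm.nrm_entry_le _ x i j

theorem mnorm_add_le (x y : Matrix m n X) : mnorm (x + y) ≤ mnorm x + mnorm y :=
  MatSeminorm.nrm_add_le _ x y

theorem mnorm_sub_le (x y : Matrix m n X) : mnorm (x - y) ≤ mnorm x + mnorm y :=
  MatSeminorm.nrm_sub_le _ x y

theorem mnorm_submatrix_le (f : k → m) (hf : f.Injective) (g : l → n) (hg : g.Injective)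
    (x : Matrix m n X) : mnorm (x.submatrix f g) ≤ mnorm x :=
  MatSeminorm.nrm_submatrix_le _ f hf g hg x

theorem mnorm_le_add_sum (x y : Matrix m n X) :
    mnorm x ≤ mnorm y + ∑ i, ∑ j, ‖x i j - y i j‖ := by
  have h := mnorm_add_le y (x - y)
  rw [add_sub_cancel] at h
  exact h.trans (by linarith [mnorm_le_sum (x - y), (show ∑ i, ∑ j, ‖(x - y) i j‖ =
    ∑ i, ∑ j, ‖x i j - y i j‖ from rfl)])

theorem continuous_of_le_add_sum {f : Matrix m n X → ℝ}
    (hf : ∀ x y, f x ≤ f y + ∑ i, ∑ j, ‖x i j - y i j‖) : Continuous f := by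
  refine continuous_iff_continuousAt.2 fun x => ?_
  rw [ContinuousAt, tendsto_iff_norm_sub_tendsto_zero]
  have hc : Continuous fun y : Matrix m n X => ∑ i, ∑ j, ‖y i j - x i j‖ := by
    refine continuous_finsetSum _ fun i _ => continuous_finsetSum _ fun j _ => ?_
    exact ((continuous_apply_apply i j).sub continuous_const).norm
  have h0 := hc.tendsto x
  simp only [sub_self, norm_zero, Finset.sum_const_zero] at h0
  refine squeeze_zero (fun _ => norm_nonneg _) (fun y => ?_) h0
  rw [Real.norm_eq_abs, abs_le]
  have h1 := hf y x
  have h2 := hf x y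
  simp only [norm_sub_rev (x _ _)] at h2
  constructor <;> linarith

theorem continuous_mnorm : Continuous (mnorm : Matrix m n X → ℝ) :=
  continuous_of_le_add_sum mnorm_le_add_sum

end OperatorSpace

section Completion

variable {V : Type*} [SeminormedAddCommGroup V] [NormedSpace ℂ V] [OperatorSpace V]
  {m n k l : Type} [Fintype m] [Fintype n] [Fintype k] [Fintype l]

/-- The continuous extension of the matrix norms of `V` to the completion of `V`. -/
def complNrm (x : Matrix m n (Completion V)) : ℝ :=
  ⨅ u : Matrix m n V, (mnorm u + ∑ i, ∑ j, ‖x i j - (u i j : Completion V)‖)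

theorem complNrm_bdd (x : Matrix m n (Completion V)) : BddBelow (Set.range fun u : Matrix m n V =>
    (mnorm u + ∑ i, ∑ j, ‖x i j - (u i j : Completion V)‖)) :=
  ⟨0, by
    rintro _ ⟨u, rfl⟩
    exact add_nonneg (mnorm_nonneg _) (Finset.sum_nonneg fun _ _ => Finset.sum_nonneg fun _ _ =>
      norm_nonneg _)⟩

theorem complNrm_le_add_sum (x y : Matrix m n (Completion V)) :
    complNrm x ≤ complNrm y + ∑ i, ∑ j, ‖x i j - y i j‖ := by
  rw [← sub_le_iff_le_add]
  refine le_ciInf fun u => ?_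
  rw [sub_le_iff_le_add]
  refine (ciInf_le (complNrm_bdd x) u).trans ?_
  rw [add_assoc, ← Finset.sum_add_distrib]
  gcongr with i
  rw [← Finset.sum_add_distrib]
  gcongr with j
  rw [add_comm]
  exact norm_sub_le_norm_sub_add_norm_sub _ _ _

theorem continuous_complNrm : Continuous (complNrm : Matrix m n (Completion V) → ℝ) := by
  refine continuous_iff_continuousAt.2 fun x => ?_
  rw [ContinuousAt, tendsto_iff_norm_sub_tendsto_zero]
  have hc : Continuous fun y : Matrix m n (Completion V) => ∑ i, ∑ j, ‖y i j - x i j‖ := by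
    refine continuous_finsetSum _ fun i _ => continuous_finsetSum _ fun j _ => ?_
    exact ((continuous_apply_apply i j).sub continuous_const).norm
  have h0 := hc.tendsto x
  simp only [sub_self, norm_zero, Finset.sum_const_zero] at h0
  refine squeeze_zero (fun _ => norm_nonneg _) (fun y => ?_) h0
  rw [Real.norm_eq_abs, abs_le]
  have h1 := complNrm_le_add_sum y x
  have h2 := complNrm_le_add_sum x y
  simp only [norm_sub_rev (x _ _)] at h2
  constructor <;> linarith

theorem complNrm_coe (u : Matrix m n V) :
    complNrm (u.map fun v => (v : Completion V)) = mnorm u := by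
  refine le_antisymm ((ciInf_le (complNrm_bdd _) u).trans (by simp)) (le_ciInf fun w => ?_)
  refine (mnorm_le_add_sum u w).trans (le_of_eq ?_)
  simp only [Matrix.map_apply, ← Completion.coe_sub, Completion.norm_coe]

/-- Closed properties of matrices over a completion can be checked on matrices over the dense
subspace. -/
theorem compl_induction {P : Matrix m n (Completion V) → Prop} (x : Matrix m n (Completion V))
    (hc : IsClosed {x | P x}) (h : ∀ u : Matrix m n V, P (u.map fun v => (v : Completion V))) :
    P x := by
  have hd : DenseRange (fun (u : Matrix m n V) (i : m) (j : n) => (u i j : Completion V)) :=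
    DenseRange.piMap fun _ => DenseRange.piMap fun _ => Completion.denseRange_coe
  exact hd.induction_on x hc h

theorem continuous_amp_right {X Y Z : Type*} [TopologicalSpace Y]
    [TopologicalSpace Z] [AddCommMonoid Z] [ContinuousAdd Z] {f : X → Y → Z}
    (hf : ∀ x, Continuous (f x)) (x : Matrix m k X) :
    Continuous fun y : Matrix k n Y => amp f x y := by
  refine continuous_pi fun i => continuous_pi fun j => continuous_finsetSum _ fun s _ => ?_
  exact (hf _).comp (continuous_apply_apply s j)

theorem continuous_amp_left {X Y Z : Type*} [TopologicalSpace X]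
    [TopologicalSpace Z] [AddCommMonoid Z] [ContinuousAdd Z] {f : X → Y → Z}
    (hf : ∀ y, Continuous fun x => f x y) (y : Matrix k n Y) :
    Continuous fun x : Matrix m k X => amp f x y := by
  refine continuous_pi fun i => continuous_pi fun j => continuous_finsetSum _ fun s _ => ?_
  exact (hf _).comp (continuous_apply_apply i s)

theorem continuous_fromBlocks {Z : Type*} [TopologicalSpace Z] [Zero Z] :
    Continuous fun q : Matrix m n Z × Matrix k l Z => Matrix.fromBlocks q.1 0 0 q.2 := by
  refine continuous_pi fun i => continuous_pi fun j => ?_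
  rcases i with i | i <;> rcases j with j | j
  · exact (continuous_apply_apply i j).comp continuous_fst
  · exact continuous_const
  · exact continuous_const
  · exact (continuous_apply_apply i j).comp continuous_snd

instance completionOperatorSpace : OperatorSpace (Completion V) where
  mat :=
    { nrm := complNrm
      nrm_add_le := fun x y => by
        refine compl_induction x (isClosed_le (continuous_complNrm.comp
          (continuous_id.add continuous_const)) (continuous_complNrm.add continuous_const)) ?_
        intro u
        refine compl_induction y (isClosed_le (continuous_complNrm.comp
          (continuous_const.add continuous_id)) (continuous_const.add continuous_complNrm)) ?_
        intro w
        have h : ((u.map fun v => (v : Completion V)) + w.map fun v => (v : Completion V)) =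
          (u + w).map fun v => (v : Completion V) := by
          ext i j; simp [Completion.coe_add]
        simp only [Function.comp_apply, Pi.add_apply, id]
        rw [h, complNrm_coe, complNrm_coe, complNrm_coe]
        exact mnorm_add_le u w
      nrm_lsmul_le := fun α x => by
        refine compl_induction x (isClosed_le (continuous_complNrm.comp
          (continuous_amp_right (fun c => continuous_const_smul c) α))
          (continuous_const.mul continuous_complNrm)) ?_
        intro u
        have h : amp (fun (c : ℂ) (v : Completion V) => c • v) α
            (u.map fun v => (v : Completion V)) =
          (amp (fun (c : ℂ) (v : V) => c • v) α u).map fun v => (v : Completion V) := by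
          ext i j
          simp only [amp, Matrix.map_apply, ← Completion.coe_smul]
          exact (map_sum (Completion.toCompl (α := V)) _ _).symm
        simp only [Function.comp_apply, Pi.mul_apply]
        rw [h, complNrm_coe, complNrm_coe]
        exact MatSeminorm.nrm_lsmul_le _ α u
      nrm_rsmul_le := fun x β => by
        refine compl_induction x (isClosed_le (continuous_complNrm.comp
          (continuous_amp_left (fun c => continuous_const_smul c) β))
          (continuous_complNrm.mul continuous_const)) ?_
        intro u
        have h : amp (fun (v : Completion V) (c : ℂ) => c • v)
            (u.map fun v => (v : Completion V)) β =
          (amp (fun (v : V) (c : ℂ) => c • v) u β).map fun v => (v : Completion V) := by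
          ext i j
          simp only [amp, Matrix.map_apply, ← Completion.coe_smul]
          exact (map_sum (Completion.toCompl (α := V)) _ _).symm
        simp only [Function.comp_apply, Pi.mul_apply]
        rw [h, complNrm_coe, complNrm_coe]
        exact MatSeminorm.nrm_rsmul_le _ u β
      nrm_diag_le := fun x y => by
        refine compl_induction x (isClosed_le (continuous_complNrm.comp
          (continuous_fromBlocks.comp (continuous_id.prodMk continuous_const)))
          (continuous_complNrm.max continuous_const)) ?_
        intro u
        refine compl_induction y (isClosed_le (continuous_complNrm.comp
          (continuous_fromBlocks.comp (continuous_const.prodMk continuous_id)))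
          (continuous_const.max continuous_complNrm)) ?_
        intro w
        have h : Matrix.fromBlocks (u.map fun v => (v : Completion V)) 0 0
            (w.map fun v => (v : Completion V)) =
          (Matrix.fromBlocks u 0 0 w).map fun v => (v : Completion V) := by
          rw [Matrix.fromBlocks_map, Matrix.map_zero _ Completion.coe_zero,
            Matrix.map_zero _ Completion.coe_zero]
        simp only [Function.comp_apply, id]
        rw [h, complNrm_coe, complNrm_coe, complNrm_coe]
        exact MatSeminorm.nrm_diag_le _ u w }
  norm_eq := fun x => by
    refine Completion.induction_on (p := fun x => complNrm (fun _ _ : Unit => x) = ‖x‖) x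
      (isClosed_eq (continuous_complNrm.comp
        (continuous_pi fun _ => continuous_pi fun _ => continuous_id)) continuous_norm) ?_
    intro v
    exact (complNrm_coe (fun _ _ : Unit => v)).trans ((mnorm_unit v).trans
      (Completion.norm_coe v).symm)

theorem mnorm_coe (u : Matrix m n V) :
    mnorm (u.map fun v => (v : Completion V)) = mnorm u := complNrm_coe u

end Completion

/-- A subspace of an operator space, with the restricted matrix norms. -/
instance submoduleOperatorSpace {X : Type*} [SeminormedAddCommGroup X] [NormedSpace ℂ X]
    [OperatorSpace X] (S : Submodule ℂ X) : OperatorSpace S where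
  mat :=
    { nrm := fun x => mnorm (x.map fun v => (v : X))
      nrm_add_le := fun x y => mnorm_add_le (x.map fun v => (v : X)) (y.map fun v => (v : X))
      nrm_lsmul_le := fun α x => by
        have h : ((amp (fun (c : ℂ) (v : S) => c • v) α x).map fun v => (v : X)) =
          amp (fun (c : ℂ) (v : X) => c • v) α (x.map fun v => (v : X)) := by
          ext i j; simp [amp]
        rw [h]
        exact MatSeminorm.nrm_lsmul_le _ α _
      nrm_rsmul_le := fun x β => by
        have h : ((amp (fun (v : S) (c : ℂ) => c • v) x β).map fun v => (v : X)) =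
          amp (fun (v : X) (c : ℂ) => c • v) (x.map fun v => (v : X)) β := by
          ext i j; simp [amp]
        rw [h]
        exact MatSeminorm.nrm_rsmul_le _ _ β
      nrm_diag_le := fun x y => by
        have h : ((Matrix.fromBlocks x 0 0 y).map fun v => (v : X)) =
          Matrix.fromBlocks (x.map fun v => (v : X)) 0 0 (y.map fun v => (v : X)) := by
          rw [Matrix.fromBlocks_map, Matrix.map_zero _ rfl, Matrix.map_zero _ rfl]
        rw [h]
        exact MatSeminorm.nrm_diag_le _ _ _ }
  norm_eq := fun x => mnorm_unit (x : X)

/-- A Hilbert space, seen as an operator space with the column structure `H = B(ℂ, H)`. -/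
def Column (H : Type*) : Type _ := H

section Column

variable {H : Type*} [NormedAddCommGroup H] [InnerProductSpace ℂ H]
  {m n k l : Type} [Fintype m] [Fintype n] [Fintype k] [Fintype l]

instance : NormedAddCommGroup (Column H) := inferInstanceAs (NormedAddCommGroup H)
instance : InnerProductSpace ℂ (Column H) := inferInstanceAs (InnerProductSpace ℂ H)

theorem sum_norm_sq_le (α : Matrix k m ℂ) (h : m → H) :
    ∑ i, ‖∑ s, α i s • h s‖ ^ 2 ≤ colNorm α ^ 2 * ∑ s, ‖h s‖ ^ 2 := by
  let W : Submodule ℂ H := Submodule.span ℂ (Set.range h)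
  have hfin : FiniteDimensional ℂ W := FiniteDimensional.span_of_finite ℂ (Set.finite_range h)
  let e := stdOrthonormalBasis ℂ W
  let w : m → W := fun s => ⟨h s, Submodule.subset_span ⟨s, rfl⟩⟩
  have hw : ∀ v : W, ‖(v : H)‖ ^ 2 = ∑ b, ‖e.repr v b‖ ^ 2 := fun v => by
    rw [← Submodule.coe_norm, ← e.repr.norm_map v, EuclideanSpace.norm_sq_eq]
  have h1 : ∀ i, ‖∑ s, α i s • h s‖ ^ 2 = ∑ b, ‖∑ s, e.repr (w s) b • α i s‖ ^ 2 := by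
    intro i
    have : ∑ s, α i s • h s = ((∑ s, α i s • w s : W) : H) := by simp [w]
    rw [this, hw]
    simp [mul_comm]
  have h2 : ∀ s, ‖h s‖ ^ 2 = ∑ b, ‖e.repr (w s) b‖ ^ 2 := fun s => hw (w s)
  simp only [h1, h2]
  rw [Finset.sum_comm, Finset.sum_comm (s := (Finset.univ : Finset m)), Finset.mul_sum]
  exact Finset.sum_le_sum fun b _ => colNorm_bound α fun s => e.repr (w s) b

instance columnOperatorSpace : OperatorSpace (Column H) where
  mat :=
    { nrm := fun x => colNorm x
      nrm_add_le := fun x y => by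
        have h : colOp (x + y) = colOp x + colOp y := by
          ext v i
          simp [colOp_apply, Finset.sum_add_distrib]
        show ‖colOp (x + y)‖ ≤ ‖colOp x‖ + ‖colOp y‖
        rw [h]
        exact norm_add_le (colOp x) (colOp y)
      nrm_lsmul_le := fun α x => by
        refine colNorm_le _ (mul_nonneg (colNorm_nonneg _) (colNorm_nonneg _)) fun v => ?_
        have h : ∀ i, ∑ j, v j • amp (fun (c : ℂ) (h : Column H) => c • h) α x i j =
            ∑ s, α i s • ∑ j, v j • x s j := by
          intro i
          simp only [amp, Finset.smul_sum]
          rw [Finset.sum_comm]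
          exact Finset.sum_congr rfl fun s _ => Finset.sum_congr rfl fun j _ => smul_comm _ _ _
        simp only [h]
        refine (sum_norm_sq_le α _).trans ?_
        rw [mul_pow, mul_assoc]
        exact mul_le_mul_of_nonneg_left (colNorm_bound x v) (by positivity)
      nrm_rsmul_le := fun x β => by
        refine colNorm_le _ (mul_nonneg (colNorm_nonneg _) (colNorm_nonneg _)) fun v => ?_
        have h : ∀ i, ∑ j, v j • amp (fun (h : Column H) (c : ℂ) => c • h) x β i j =
            ∑ s, (∑ j, v j • β s j) • x i s := by
          intro i
          simp only [amp, Finset.smul_sum, Finset.sum_smul]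
          rw [Finset.sum_comm]
          simp only [smul_smul, smul_eq_mul]
        simp only [h]
        refine (colNorm_bound x _).trans ?_
        rw [mul_pow, mul_assoc]
        exact mul_le_mul_of_nonneg_left (colNorm_bound β v) (by positivity)
      nrm_diag_le := fun x y => by
        refine colNorm_le _ (le_max_of_le_left (colNorm_nonneg _)) fun v => ?_
        simp only [Fintype.sum_sum_type, Matrix.fromBlocks_apply₁₁, Matrix.fromBlocks_apply₁₂,
          Matrix.fromBlocks_apply₂₁, Matrix.fromBlocks_apply₂₂, Matrix.zero_apply, smul_zero,
          Finset.sum_const_zero, add_zero, zero_add, mul_add]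
        refine add_le_add ((colNorm_bound x _).trans ?_) ((colNorm_bound y _).trans ?_)
        · gcongr
          · exact colNorm_nonneg _
          · exact le_max_left _ _
        · gcongr
          · exact colNorm_nonneg _
          · exact le_max_right _ _ }
  norm_eq := fun x => by
    refine le_antisymm (colNorm_le _ (norm_nonneg _) fun v => ?_) ?_
    · simp [norm_smul, mul_pow, mul_comm]
    · have h := colNorm_bound (fun _ _ : Unit => x) (fun _ => 1)
      simp only [Finset.univ_unique, Finset.sum_const, Finset.card_singleton, one_smul, norm_one,
        one_pow, mul_one] at h
      exact (sq_le_sq₀ (norm_nonneg _) (colNorm_nonneg _)).1 h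

end Column
/-! ### Completely bounded maps -/

section CB

variable {X Y Z : Type*} [SeminormedAddCommGroup X] [NormedSpace ℂ X] [OperatorSpace X]
  [SeminormedAddCommGroup Y] [NormedSpace ℂ Y] [OperatorSpace Y]
  [SeminormedAddCommGroup Z] [NormedSpace ℂ Z] [OperatorSpace Z]

/-- `f` is bounded by `C` on all matrices, that is, `‖f‖_cb ≤ C` if `f` is linear. -/
def CBWith (f : X → Y) (C : ℝ) : Prop :=
  ∀ {m n : Type} [Fintype m] [Fintype n] (x : Matrix m n X), mnorm (x.map f) ≤ C * mnorm x

/-- Completely bounded maps. -/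
def IsCB (f : X → Y) : Prop := ∃ C : ℝ, 0 ≤ C ∧ CBWith f C

/-- Completely contractive maps. -/
def IsCC (f : X → Y) : Prop := CBWith f 1

/-- Completely isometric maps. -/
def IsCI (f : X → Y) : Prop :=
  ∀ {m n : Type} [Fintype m] [Fintype n] (x : Matrix m n X), mnorm (x.map f) = mnorm x

/-- A pairing `X × Y → Z` is bounded by `C` on all matrix products. -/
def MBWith (f : X → Y → Z) (C : ℝ) : Prop :=
  ∀ {m k n : Type} [Fintype m] [Fintype k] [Fintype n] (x : Matrix m k X) (y : Matrix k n Y),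
    mnorm (amp f x y) ≤ C * (mnorm x * mnorm y)

theorem CBWith.norm_le {f : X → Y} {C : ℝ} (hf : CBWith f C) (x : X) : ‖f x‖ ≤ C * ‖x‖ := by
  rw [← mnorm_unit, ← mnorm_unit]
  exact hf fun _ _ : Unit => x

theorem MBWith.norm_le {f : X → Y → Z} {C : ℝ} (hf : MBWith f C) (x : X) (y : Y) :
    ‖f x y‖ ≤ C * (‖x‖ * ‖y‖) := by
  rw [← mnorm_unit, ← mnorm_unit, ← mnorm_unit]
  refine le_trans (le_of_eq ?_) (hf (fun _ _ : Unit => x) (fun _ _ : Unit => y))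
  congr 1
  ext i j
  simp [amp]

end CB

/-! ### Operator algebras and operator modules -/

/-- A unital operator algebra: a complete operator space with a completely contractive
associative multiplication and a unit of norm at most one. -/
class OperatorAlgebra (A : Type*) [NormedRing A] [NormedAlgebra ℂ A] [OperatorSpace A] : Prop
    extends CompleteSpace A where
  mul_le : MBWith (fun a b : A => a * b) 1
  norm_one_le : ‖(1 : A)‖ ≤ 1

/-- A left operator module: the action `A × X → X` is completely contractive. -/
class LeftOpModule (A X : Type*) [NormedRing A] [NormedAlgebra ℂ A] [OperatorSpace A]
    [SeminormedAddCommGroup X] [NormedSpace ℂ X] [OperatorSpace X] [Module A X]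
    [IsScalarTower ℂ A X] : Prop where
  smul_le : MBWith (fun (a : A) (x : X) => a • x) 1

/-- A right operator module: the action `X × A → X` is completely contractive. -/
class RightOpModule (A X : Type*) [NormedRing A] [NormedAlgebra ℂ A] [OperatorSpace A]
    [SeminormedAddCommGroup X] [NormedSpace ℂ X] [OperatorSpace X] [Module Aᵐᵒᵖ X]
    [IsScalarTower ℂ Aᵐᵒᵖ X] : Prop where
  smul_le : MBWith (fun (x : X) (a : A) => MulOpposite.op a • x) 1

instance selfLeftOpModule (A : Type*) [NormedRing A] [NormedAlgebra ℂ A] [OperatorSpace A]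
    [OperatorAlgebra A] : LeftOpModule A A := ⟨OperatorAlgebra.mul_le⟩

instance selfRightOpModule (A : Type*) [NormedRing A] [NormedAlgebra ℂ A] [OperatorSpace A]
    [OperatorAlgebra A] : RightOpModule A A := ⟨OperatorAlgebra.mul_le⟩

/-! ### The Haagerup tensor product -/

section Haagerup

variable {X Y Z : Type*} [SeminormedAddCommGroup X] [NormedSpace ℂ X] [OperatorSpace X]
  [SeminormedAddCommGroup Y] [NormedSpace ℂ Y] [OperatorSpace Y]
  [NormedAddCommGroup Z] [NormedSpace ℂ Z] [OperatorSpace Z]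
  (N : Submodule ℂ (X ⊗[ℂ] Y))
  {m n k l : Type} [Fintype m] [Fintype n] [Fintype k] [Fintype l]

/-- The matrix product `x ⊙ y` with entries `∑ₛ xᵢₛ ⊗ yₛⱼ`. -/
def odot (x : Matrix m k X) (y : Matrix k n Y) : Matrix m n (X ⊗[ℂ] Y) :=
  amp (fun (x : X) (y : Y) => x ⊗ₜ[ℂ] y) x y

/-- The norms `‖x‖ ‖y‖` of all factorizations `u = x ⊙ y` modulo `N`. -/
def haagerupSet (u : Matrix m n (X ⊗[ℂ] Y)) : Set ℝ :=
  {t | ∃ (k : Type) (_ : Fintype k) (x : Matrix m k X) (y : Matrix k n Y),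
    (∀ i j, u i j - odot x y i j ∈ N) ∧ mnorm x * mnorm y = t}

/-- The Haagerup matrix norm on `X ⊗ Y`, or rather its quotient norm modulo `N`. -/
def haagerupNrm (u : Matrix m n (X ⊗[ℂ] Y)) : ℝ := sInf (haagerupSet N u)

variable {N}

theorem odot_fromCols (x : Matrix m k X) (x' : Matrix m l X) (y : Matrix k n Y)
    (y' : Matrix l n Y) :
    odot (Matrix.fromCols x x') (Matrix.fromRows y y') = odot x y + odot x' y' := by
  ext i j
  simp [odot, amp]

theorem exists_odot (u : Matrix m n (X ⊗[ℂ] Y)) :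
    ∃ (k : Type) (_ : Fintype k) (x : Matrix m k X) (y : Matrix k n Y), u = odot x y := by
  classical
  have hadd : ∀ u v : Matrix m n (X ⊗[ℂ] Y),
      (∃ (k : Type) (_ : Fintype k) (x : Matrix m k X) (y : Matrix k n Y), u = odot x y) →
      (∃ (k : Type) (_ : Fintype k) (x : Matrix m k X) (y : Matrix k n Y), v = odot x y) →
      ∃ (k : Type) (_ : Fintype k) (x : Matrix m k X) (y : Matrix k n Y), u + v = odot x y := by
    rintro _ _ ⟨k, _, x, y, rfl⟩ ⟨l, _, x', y', rfl⟩
    exact ⟨k ⊕ l, inferInstance, _, _, (odot_fromCols x x' y y').symm⟩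
  have hzero : ∃ (k : Type) (_ : Fintype k) (x : Matrix m k X) (y : Matrix k n Y),
      (0 : Matrix m n (X ⊗[ℂ] Y)) = odot x y :=
    ⟨Unit, inferInstance, 0, 0, by ext i j; simp [odot, amp]⟩
  have hsum : ∀ {ι : Type} (s : Finset ι) (f : ι → Matrix m n (X ⊗[ℂ] Y)),
      (∀ a, ∃ (k : Type) (_ : Fintype k) (x : Matrix m k X) (y : Matrix k n Y),
        f a = odot x y) →
      ∃ (k : Type) (_ : Fintype k) (x : Matrix m k X) (y : Matrix k n Y),
        ∑ a ∈ s, f a = odot x y := by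
    intro ι s f hf
    induction s using Finset.induction_on with
    | empty => simpa using hzero
    | insert a s ha ih => rw [Finset.sum_insert ha]; exact hadd _ _ (hf a) ih
  rw [Matrix.matrix_eq_sum_single u]
  refine hsum _ _ fun i => hsum _ _ fun j => ?_
  induction u i j using TensorProduct.induction_on with
  | zero => simpa using hzero
  | tmul x y =>
    refine ⟨Unit, inferInstance, fun a _ => if a = i then x else 0,
      fun _ b => if b = j then y else 0, ?_⟩
    ext a b
    by_cases ha : a = i <;> by_cases hb : b = j <;>
      simp [odot, amp, Matrix.single, ha, hb, eq_comm (a := i), eq_comm (a := j)]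
  | add u v hu hv => rw [Matrix.single_add]; exact hadd _ _ hu hv

theorem haagerupSet_nonempty (u : Matrix m n (X ⊗[ℂ] Y)) : (haagerupSet N u).Nonempty := by
  obtain ⟨k, hk, x, y, rfl⟩ := exists_odot u
  exact ⟨_, k, hk, x, y, fun i j => by simp, rfl⟩

theorem haagerupSet_bdd (u : Matrix m n (X ⊗[ℂ] Y)) : BddBelow (haagerupSet N u) :=
  ⟨0, by
    rintro _ ⟨k, hk, x, y, -, rfl⟩
    exact mul_nonneg (mnorm_nonneg _) (mnorm_nonneg _)⟩

theorem haagerupNrm_le (u : Matrix m n (X ⊗[ℂ] Y)) (x : Matrix m k X) (y : Matrix k n Y)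
    (h : ∀ i j, u i j - odot x y i j ∈ N) : haagerupNrm N u ≤ mnorm x * mnorm y :=
  csInf_le (haagerupSet_bdd u) ⟨k, inferInstance, x, y, h, rfl⟩

theorem haagerupNrm_nonneg (u : Matrix m n (X ⊗[ℂ] Y)) : 0 ≤ haagerupNrm N u :=
  le_csInf (haagerupSet_nonempty u) (by
    rintro _ ⟨k, hk, x, y, -, rfl⟩
    exact mul_nonneg (mnorm_nonneg _) (mnorm_nonneg _))

theorem exists_factor (u : Matrix m n (X ⊗[ℂ] Y)) {c : ℝ} (hc : haagerupNrm N u < c) :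
    ∃ (k : Type) (_ : Fintype k) (x : Matrix m k X) (y : Matrix k n Y),
      (∀ i j, u i j - odot x y i j ∈ N) ∧ mnorm x * mnorm y < c := by
  obtain ⟨_, ⟨k, hk, x, y, h, rfl⟩, hlt⟩ := exists_lt_of_csInf_lt (haagerupSet_nonempty u) hc
  exact ⟨k, hk, x, y, h, hlt⟩

theorem exists_factor_balanced (u : Matrix m n (X ⊗[ℂ] Y)) {c : ℝ} (hc : haagerupNrm N u < c) :
    ∃ (k : Type) (_ : Fintype k) (x : Matrix m k X) (y : Matrix k n Y),
      (∀ i j, u i j - odot x y i j ∈ N) ∧ mnorm x ≤ √c ∧ mnorm y ≤ √c := by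
  obtain ⟨k, hk, x, y, h, hlt⟩ := exists_factor u hc
  have hx := mnorm_nonneg x
  have hy := mnorm_nonneg y
  have hc0 : 0 < c := (haagerupNrm_nonneg u).trans_lt hc
  have hs : 0 < √c := Real.sqrt_pos.2 hc0
  have hss : √c * √c = c := Real.mul_self_sqrt hc0.le
  obtain ⟨t, ht, h1, h2⟩ : ∃ t : ℝ, 0 < t ∧ t * mnorm x ≤ √c ∧ t⁻¹ * mnorm y ≤ √c := by
    rcases hx.eq_or_lt with h0 | h0
    · refine ⟨mnorm y / √c + 1, by positivity, by rw [← h0]; simp [hs.le], ?_⟩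
      rw [inv_mul_le_iff₀ (by positivity), add_mul, div_mul_cancel₀ _ hs.ne']
      linarith
    · refine ⟨√c / mnorm x, by positivity, by rw [div_mul_cancel₀ _ h0.ne'], ?_⟩
      rw [inv_mul_le_iff₀ (by positivity), div_mul_eq_mul_div, le_div_iff₀ h0]
      nlinarith
  refine ⟨k, hk, (t : ℂ) • x, ((t⁻¹ : ℝ) : ℂ) • y, ?_, ?_, ?_⟩
  · have : odot ((t : ℂ) • x) (((t⁻¹ : ℝ) : ℂ) • y) = odot x y := by
      ext i j
      show ∑ s, ((t : ℂ) • x i s) ⊗ₜ[ℂ] (((t⁻¹ : ℝ) : ℂ) • y s j) = ∑ s, x i s ⊗ₜ[ℂ] y s j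
      simp only [TensorProduct.smul_tmul_smul, ← Complex.ofReal_mul, mul_inv_cancel₀ ht.ne',
        Complex.ofReal_one, one_smul]
    rwa [this]
  · refine (MatSeminorm.nrm_smul_le _ _ _).trans ?_
    rwa [Complex.norm_real, Real.norm_of_nonneg ht.le]
  · refine (MatSeminorm.nrm_smul_le _ _ _).trans ?_
    rwa [Complex.norm_real, Real.norm_of_nonneg (inv_nonneg.2 ht.le)]

theorem amp_assoc {W X Y V Z U : Type*} [AddCommMonoid W] [AddCommMonoid U] [AddCommMonoid Z]
    {m k l n : Type} [Fintype k] [Fintype l]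
    {f : W → Y → Z} {g : V → X → W} {h : V → U → Z} {p : X → Y → U} (a : Matrix m k V)
    (x : Matrix k l X) (y : Matrix l n Y)
    (hf : ∀ y, ∃ F : W →+ Z, ∀ w, F w = f w y) (hh : ∀ a, ∃ F : U →+ Z, ∀ w, F w = h a w)
    (hc : ∀ a x y, f (g a x) y = h a (p x y)) :
    amp f (amp g a x) y = amp h a (amp p x y) := by
  ext i j
  simp only [amp]
  have h1 : ∀ s, f (∑ t, g (a i t) (x t s)) (y s j) = ∑ t, h (a i t) (p (x t s) (y s j)) := by
    intro s
    obtain ⟨F, hF⟩ := hf (y s j)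
    rw [← hF, map_sum]
    simp only [hF, hc]
  have h2 : ∀ t, h (a i t) (∑ s, p (x t s) (y s j)) = ∑ s, h (a i t) (p (x t s) (y s j)) := by
    intro t
    obtain ⟨F, hF⟩ := hh (a i t)
    rw [← hF, map_sum]
    simp only [hF]
  simp only [h1, h2]
  exact Finset.sum_comm

/-- An action on the left leg passes through `⊙`. -/
theorem odot_left {V : Type*} (g : V → X →ₗ[ℂ] X) (a : Matrix l m V)
    (x : Matrix m k X) (y : Matrix k n Y) :
    odot (amp (fun a x => g a x) a x) y =
      amp (fun a (u : X ⊗[ℂ] Y) => (g a).rTensor Y u) a (odot x y) :=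
  amp_assoc a x y (fun y => ⟨((TensorProduct.mk ℂ X Y).flip y).toAddMonoidHom, fun _ => rfl⟩)
    (fun a => ⟨((g a).rTensor Y).toAddMonoidHom, fun _ => rfl⟩) (fun _ _ _ => rfl)

/-- An action on the right leg passes through `⊙`. -/
theorem odot_right {V : Type*} (g : V → Y →ₗ[ℂ] Y)
    (x : Matrix m k X) (y : Matrix k n Y) (a : Matrix n l V) :
    odot x (amp (fun y a => g a y) y a) =
      amp (fun (u : X ⊗[ℂ] Y) a => (g a).lTensor X u) (odot x y) a := by
  ext i j
  simp only [odot, amp, TensorProduct.tmul_sum, map_sum, LinearMap.lTensor_tmul]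
  exact Finset.sum_comm

theorem le_mul_csInf {b C : ℝ} {S : Set ℝ} (hC : 0 ≤ C) (hS : S.Nonempty)
    (h : ∀ t ∈ S, b ≤ C * t) : b ≤ C * sInf S := by
  rw [← smul_eq_mul, ← Real.sInf_smul_of_nonneg hC]
  refine le_csInf hS.smul_set ?_
  rintro _ ⟨t, ht, rfl⟩
  exact h t ht

theorem haagerupNrm_left {V : Type*} (g : V → X →ₗ[ℂ] X)
    (hN : ∀ a u, u ∈ N → (g a).rTensor Y u ∈ N) (a : Matrix l m V) {C : ℝ} (hC : 0 ≤ C)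
    (h : ∀ {k : Type} [Fintype k] (x : Matrix m k X),
      mnorm (amp (fun a x => g a x) a x) ≤ C * mnorm x) (u : Matrix m n (X ⊗[ℂ] Y)) :
    haagerupNrm N (amp (fun a (u : X ⊗[ℂ] Y) => (g a).rTensor Y u) a u) ≤
      C * haagerupNrm N u := by
  refine le_mul_csInf hC (haagerupSet_nonempty u) ?_
  rintro _ ⟨k, _, x, y, hu, rfl⟩
  rw [← mul_assoc]
  refine (haagerupNrm_le _ (amp (fun a x => g a x) a x) y fun i j => ?_).trans
    (mul_le_mul_of_nonneg_right (h x) (mnorm_nonneg _))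
  rw [odot_left g]
  simp only [amp, ← Finset.sum_sub_distrib, ← map_sub]
  exact N.sum_mem fun s _ => hN _ _ (hu s j)

theorem haagerupNrm_right {V : Type*} (g : V → Y →ₗ[ℂ] Y)
    (hN : ∀ a u, u ∈ N → (g a).lTensor X u ∈ N) (a : Matrix n l V) {C : ℝ} (hC : 0 ≤ C)
    (h : ∀ {k : Type} [Fintype k] (y : Matrix k n Y),
      mnorm (amp (fun y a => g a y) y a) ≤ C * mnorm y) (u : Matrix m n (X ⊗[ℂ] Y)) :
    haagerupNrm N (amp (fun (u : X ⊗[ℂ] Y) a => (g a).lTensor X u) u a) ≤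
      C * haagerupNrm N u := by
  refine le_mul_csInf hC (haagerupSet_nonempty u) ?_
  rintro _ ⟨k, _, x, y, hu, rfl⟩
  rw [mul_left_comm]
  refine (haagerupNrm_le _ x (amp (fun y a => g a y) y a) fun i j => ?_).trans
    (mul_le_mul_of_nonneg_left (h y) (mnorm_nonneg _))
  rw [odot_right g]
  simp only [amp, ← Finset.sum_sub_distrib, ← map_sub]
  exact N.sum_mem fun s _ => hN _ _ (hu i s)

variable (N)

/-- The Haagerup matrix seminorm of `X ⊗ Y` modulo `N`. -/
def haagerup : MatSeminorm (X ⊗[ℂ] Y) where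
  nrm := fun u => haagerupNrm N u
  nrm_add_le := fun u v => by
    refine le_of_forall_pos_le_add fun ε hε => ?_
    obtain ⟨k, _, x, y, h, hx, hy⟩ := exists_factor_balanced (N := N) u
      (show _ < haagerupNrm N u + ε / 2 by linarith)
    obtain ⟨l, _, x', y', h', hx', hy'⟩ := exists_factor_balanced (N := N) v
      (show _ < haagerupNrm N v + ε / 2 by linarith)
    have h0 := haagerupNrm_nonneg (N := N) u
    have h0' := haagerupNrm_nonneg (N := N) v
    have hs : 0 < √(haagerupNrm N u + ε / 2) := Real.sqrt_pos.2 (by linarith)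
    have hs' : 0 < √(haagerupNrm N v + ε / 2) := Real.sqrt_pos.2 (by linarith)
    have h1 := MatSeminorm.nrm_fromCols_le _ hs hs' hx hx'
    have h2 := MatSeminorm.nrm_fromRows_le _ hs hs' hy hy'
    rw [Real.sq_sqrt (by linarith), Real.sq_sqrt (by linarith)] at h1 h2
    refine (haagerupNrm_le _ (Matrix.fromCols x x') (Matrix.fromRows y y') ?_).trans
      ((mul_le_mul h1 h2 (MatSeminorm.nrm_nonneg _ _) (Real.sqrt_nonneg _)).trans ?_)
    · intro i j
      rw [odot_fromCols]
      have := N.add_mem (h i j) (h' i j)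
      simp only [Matrix.add_apply]
      convert this using 1
      abel
    · rw [Real.mul_self_sqrt (by linarith)]
      linarith
  nrm_lsmul_le := fun α u => by
    have e : ∀ (c : ℂ) (u : X ⊗[ℂ] Y),
        (c • (LinearMap.id : X →ₗ[ℂ] X)).rTensor Y u = c • u := fun c u => by
      rw [LinearMap.rTensor_smul, LinearMap.rTensor_id]; rfl
    have h := haagerupNrm_left (N := N) (fun c : ℂ => c • (LinearMap.id : X →ₗ[ℂ] X))
      (fun c u hu => by rw [e]; exact N.smul_mem c hu) α (colNorm_nonneg α)
      (fun x => MatSeminorm.nrm_lsmul_le _ α x) u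
    simp only [e] at h
    exact h
  nrm_rsmul_le := fun u β => by
    have e : ∀ (c : ℂ) (u : X ⊗[ℂ] Y),
        (c • (LinearMap.id : Y →ₗ[ℂ] Y)).lTensor X u = c • u := fun c u => by
      rw [LinearMap.lTensor_smul, LinearMap.lTensor_id]; rfl
    have h := haagerupNrm_right (N := N) (fun c : ℂ => c • (LinearMap.id : Y →ₗ[ℂ] Y))
      (fun c u hu => by rw [e]; exact N.smul_mem c hu) β (colNorm_nonneg β)
      (fun x => (MatSeminorm.nrm_rsmul_le _ x β).trans (le_of_eq (mul_comm _ _))) u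
    simp only [e] at h
    rw [mul_comm]
    exact h
  nrm_diag_le := fun u v => by
    refine le_of_forall_gt_imp_ge_of_dense fun c hc => ?_
    obtain ⟨k, _, x, y, h, hx, hy⟩ := exists_factor_balanced (N := N) u
      ((le_max_left _ _).trans_lt hc)
    obtain ⟨l, _, x', y', h', hx', hy'⟩ := exists_factor_balanced (N := N) v
      ((le_max_right _ _).trans_lt hc)
    have hc0 : 0 ≤ c := (haagerupNrm_nonneg u).trans ((le_max_left _ _).trans_lt hc).le
    have h1 := (MatSeminorm.nrm_diag_le _ x x').trans (max_le hx hx')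
    have h2 := (MatSeminorm.nrm_diag_le _ y y').trans (max_le hy hy')
    refine (haagerupNrm_le _ (Matrix.fromBlocks x 0 0 x') (Matrix.fromBlocks y 0 0 y') ?_).trans
      ((mul_le_mul h1 h2 (MatSeminorm.nrm_nonneg _ _) (Real.sqrt_nonneg _)).trans ?_)
    · rintro (i | i) (j | j)
      · simpa [odot, amp] using h i j
      · simp [odot, amp]
      · simp [odot, amp]
      · simpa [odot, amp] using h' i j
    · rw [Real.mul_self_sqrt hc0]

end Haagerup

/-! ### Tensor products as operator spaces -/

section HAlg

variable {X Y Z : Type*} [SeminormedAddCommGroup X] [NormedSpace ℂ X] [OperatorSpace X]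
  [SeminormedAddCommGroup Y] [NormedSpace ℂ Y] [OperatorSpace Y]

/-- `X ⊗ Y` with the Haagerup seminorm modulo `N`. -/
def HAlg (_N : Submodule ℂ (X ⊗[ℂ] Y)) : Type _ := X ⊗[ℂ] Y

variable (N : Submodule ℂ (X ⊗[ℂ] Y))

instance : AddCommGroup (HAlg N) := inferInstanceAs (AddCommGroup (X ⊗[ℂ] Y))
instance hAlgModule : Module ℂ (HAlg N) := inferInstanceAs (Module ℂ (X ⊗[ℂ] Y))

/-- The Haagerup matrix seminorms. -/
def hAlgMat : MatSeminorm (HAlg N) := haagerup N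

instance : SeminormedAddCommGroup (HAlg N) :=
  @SeminormedAddCommGroup.ofCore ℂ (HAlg N) _ _ (hAlgMat N).toNorm _ (hAlgMat N).core

instance : NormedSpace ℂ (HAlg N) where
  toModule := hAlgModule N
  norm_smul_le := fun c v => le_of_eq ((hAlgMat N).core.norm_smul c v)

instance hAlgOperatorSpace : OperatorSpace (HAlg N) := ⟨hAlgMat N, fun _ => rfl⟩

theorem mnorm_hAlg {m n : Type} [Fintype m] [Fintype n] (u : Matrix m n (HAlg N)) :
    mnorm u = haagerupNrm N u := rfl

/-- The completion of `X ⊗ Y` in the Haagerup seminorm modulo `N`, that is, the quotient of the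
Haagerup tensor product by the closure of `N`. -/
abbrev HT : Type _ := Completion (HAlg N)

/-- The image of `x ⊗ y` in the completed tensor product. -/
def tm (x : X) (y : Y) : HT N := ((show HAlg N from x ⊗ₜ[ℂ] y : HAlg N) : HT N)

end HAlg

section modules

variable (A B : Type*) [NormedRing A] [NormedAlgebra ℂ A] [OperatorSpace A]
  [NormedRing B] [NormedAlgebra ℂ B] [OperatorSpace B]
  {X Y : Type*} [SeminormedAddCommGroup X] [NormedSpace ℂ X] [OperatorSpace X]
  [SeminormedAddCommGroup Y] [NormedSpace ℂ Y] [OperatorSpace Y]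
  [Module A X] [IsScalarTower ℂ A X] [Module Bᵐᵒᵖ Y] [IsScalarTower ℂ Bᵐᵒᵖ Y]
  (N : Submodule ℂ (X ⊗[ℂ] Y))

/-- `N` is stable under the action of `A` on the left leg. -/
class LeftStable : Prop where
  mem : ∀ (a : A) (u : X ⊗[ℂ] Y), u ∈ N → (Algebra.lsmul ℂ ℂ X a).rTensor Y u ∈ N

/-- `N` is stable under the action of `B` on the right leg. -/
class RightStable : Prop where
  mem : ∀ (b : Bᵐᵒᵖ) (u : X ⊗[ℂ] Y), u ∈ N → (Algebra.lsmul ℂ ℂ Y b).lTensor X u ∈ N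

instance : LeftStable A (⊥ : Submodule ℂ (X ⊗[ℂ] Y)) :=
  ⟨fun a u hu => by rw [Submodule.mem_bot] at hu ⊢; rw [hu, map_zero]⟩

instance : RightStable B (⊥ : Submodule ℂ (X ⊗[ℂ] Y)) :=
  ⟨fun a u hu => by rw [Submodule.mem_bot] at hu ⊢; rw [hu, map_zero]⟩

variable {A B N}

section left

variable [OperatorAlgebra A] [LeftOpModule A X] [LeftStable A N]

instance hAlgLeftModule : Module A (HAlg N) :=
  Module.compHom (R := Module.End ℂ (X ⊗[ℂ] Y)) (X ⊗[ℂ] Y)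
    ((Module.End.rTensorAlgHom ℂ X Y).comp (Algebra.lsmul ℂ ℂ X : A →ₐ[ℂ] Module.End ℂ X)).toRingHom

theorem left_smul_def (a : A) (u : HAlg N) :
    a • u = (Algebra.lsmul ℂ ℂ X a).rTensor Y u := rfl

instance : IsScalarTower ℂ A (HAlg N) :=
  ⟨fun c a u => by
    rw [left_smul_def, left_smul_def, map_smul, LinearMap.rTensor_smul]; rfl⟩

theorem left_amp_le {l m n : Type} [Fintype l] [Fintype m] [Fintype n] (a : Matrix l m A)
    (u : Matrix m n (HAlg N)) :
    mnorm (amp (fun (a : A) (v : HAlg N) => a • v) a u) ≤ mnorm a * mnorm u :=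
  haagerupNrm_left (N := N) (fun a : A => Algebra.lsmul ℂ ℂ X a) LeftStable.mem a
    (mnorm_nonneg _) (fun x => (LeftOpModule.smul_le a x).trans_eq (one_mul _)) u

instance hAlgLeftOpModule : LeftOpModule A (HAlg N) :=
  ⟨fun a u => (left_amp_le a u).trans_eq (one_mul _).symm⟩

end left

section right

variable [OperatorAlgebra B] [RightOpModule B Y] [RightStable B N]

instance hAlgRightModule : Module Bᵐᵒᵖ (HAlg N) :=
  Module.compHom (R := Module.End ℂ (X ⊗[ℂ] Y)) (X ⊗[ℂ] Y)
    ((Module.End.lTensorAlgHom ℂ Y X).comp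
      (Algebra.lsmul ℂ ℂ Y : Bᵐᵒᵖ →ₐ[ℂ] Module.End ℂ Y)).toRingHom

theorem right_smul_def (b : Bᵐᵒᵖ) (u : HAlg N) :
    b • u = (Algebra.lsmul ℂ ℂ Y b).lTensor X u := rfl

instance : IsScalarTower ℂ Bᵐᵒᵖ (HAlg N) :=
  ⟨fun c a u => by
    rw [right_smul_def, right_smul_def, map_smul, LinearMap.lTensor_smul]; rfl⟩

theorem right_amp_le {l m n : Type} [Fintype l] [Fintype m] [Fintype n]
    (u : Matrix m n (HAlg N)) (b : Matrix n l B) :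
    mnorm (amp (fun (v : HAlg N) (b : B) => MulOpposite.op b • v) u b) ≤ mnorm u * mnorm b := by
  rw [mul_comm]
  exact haagerupNrm_right (N := N) (fun b : B => Algebra.lsmul ℂ ℂ Y (MulOpposite.op b))
    (fun b => RightStable.mem (MulOpposite.op b)) b (mnorm_nonneg _)
    (fun y => (RightOpModule.smul_le y b).trans_eq (by rw [one_mul, mul_comm])) u

instance hAlgRightOpModule : RightOpModule B (HAlg N) :=
  ⟨fun a u => (right_amp_le a u).trans_eq (one_mul _).symm⟩

end right

theorem rTensor_lTensor_comm {X Y : Type*} [AddCommGroup X] [Module ℂ X] [AddCommGroup Y]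
    [Module ℂ Y] (f : X →ₗ[ℂ] X) (g : Y →ₗ[ℂ] Y) (u : X ⊗[ℂ] Y) :
    f.rTensor Y (g.lTensor X u) = g.lTensor X (f.rTensor Y u) := by
  rw [← LinearMap.comp_apply, ← LinearMap.comp_apply, LinearMap.rTensor_comp_lTensor,
    LinearMap.lTensor_comp_rTensor]

instance hAlgBimodule [OperatorAlgebra A] [LeftOpModule A X] [LeftStable A N]
    [OperatorAlgebra B] [RightOpModule B Y] [RightStable B N] : SMulCommClass A Bᵐᵒᵖ (HAlg N) :=
  ⟨fun a b u => rTensor_lTensor_comm (Algebra.lsmul ℂ ℂ X a) (Algebra.lsmul ℂ ℂ Y b) u⟩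

end modules

/-! ### Operator modules and completions -/

section complmodules

variable {A B V : Type*} [NormedRing A] [NormedAlgebra ℂ A] [OperatorSpace A]
  [NormedRing B] [NormedAlgebra ℂ B] [OperatorSpace B]
  [SeminormedAddCommGroup V] [NormedSpace ℂ V] [OperatorSpace V]

section left

variable [Module A V] [IsScalarTower ℂ A V] [LeftOpModule A V]

theorem norm_left_smul_le (a : A) (v : V) : ‖a • v‖ ≤ ‖a‖ * ‖v‖ :=
  (MBWith.norm_le (LeftOpModule.smul_le (A := A) (X := V)) a v).trans_eq (one_mul _)

instance leftUniform : UniformContinuousConstSMul A V :=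
  ⟨fun a => AddMonoidHomClass.uniformContinuous_of_bound (DistribSMul.toAddMonoidHom V a) ‖a‖
    fun v => norm_left_smul_le a v⟩

instance complLeftOpModule : LeftOpModule A (Completion V) where
  smul_le := fun a x => by
    rw [one_mul]
    refine compl_induction x (isClosed_le (continuous_mnorm.comp
      (continuous_amp_right (fun c => continuous_const_smul c) a))
      (continuous_const.mul continuous_mnorm)) ?_
    intro u
    have h : amp (fun (c : A) (v : Completion V) => c • v) a
        (u.map fun v => (v : Completion V)) =
      (amp (fun (c : A) (v : V) => c • v) a u).map fun v => (v : Completion V) := by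
      ext i j
      simp only [amp, Matrix.map_apply, ← Completion.coe_smul]
      exact (map_sum (Completion.toCompl (α := V)) _ _).symm
    simp only [Function.comp_apply, Pi.mul_apply]
    rw [h, mnorm_coe, mnorm_coe]
    exact (LeftOpModule.smul_le a u).trans_eq (one_mul _)

end left

section right

variable [Module Bᵐᵒᵖ V] [IsScalarTower ℂ Bᵐᵒᵖ V] [RightOpModule B V]

theorem norm_right_smul_le (b : B) (v : V) : ‖MulOpposite.op b • v‖ ≤ ‖v‖ * ‖b‖ :=
  (MBWith.norm_le (RightOpModule.smul_le (A := B) (X := V)) v b).trans_eq (one_mul _)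

instance rightUniform : UniformContinuousConstSMul Bᵐᵒᵖ V :=
  ⟨fun b => AddMonoidHomClass.uniformContinuous_of_bound (DistribSMul.toAddMonoidHom V b) ‖b.unop‖
    fun v => (norm_right_smul_le b.unop v).trans_eq (mul_comm _ _)⟩

instance complRightOpModule : RightOpModule B (Completion V) where
  smul_le := fun x b => by
    rw [one_mul]
    refine compl_induction x (isClosed_le (continuous_mnorm.comp
      (continuous_amp_left (fun c => continuous_const_smul _) b))
      (continuous_mnorm.mul continuous_const)) ?_
    intro u
    have h : amp (fun (v : Completion V) (c : B) => MulOpposite.op c • v)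
        (u.map fun v => (v : Completion V)) b =
      (amp (fun (v : V) (c : B) => MulOpposite.op c • v) u b).map
        fun v => (v : Completion V) := by
      ext i j
      simp only [amp, Matrix.map_apply, ← Completion.coe_smul]
      exact (map_sum (Completion.toCompl (α := V)) _ _).symm
    simp only [Function.comp_apply, Pi.mul_apply]
    rw [h, mnorm_coe, mnorm_coe]
    exact (RightOpModule.smul_le u b).trans_eq (one_mul _)

end right

end complmodules


/-! ### Module tensor products -/

section balanced

variable (A B C : Type*) [NormedRing A] [NormedAlgebra ℂ A] [OperatorSpace A]
  [NormedRing B] [NormedAlgebra ℂ B] [OperatorSpace B]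
  [NormedRing C] [NormedAlgebra ℂ C] [OperatorSpace C]
  (X Y : Type*) [SeminormedAddCommGroup X] [NormedSpace ℂ X] [OperatorSpace X]
  [SeminormedAddCommGroup Y] [NormedSpace ℂ Y] [OperatorSpace Y]
  [Module Aᵐᵒᵖ X] [IsScalarTower ℂ Aᵐᵒᵖ X] [Module A Y] [IsScalarTower ℂ A Y]

/-- The span of the elements `xa ⊗ y - x ⊗ ay`. -/
def balanced : Submodule ℂ (X ⊗[ℂ] Y) :=
  Submodule.span ℂ {t | ∃ (a : A) (x : X) (y : Y),
    t = (MulOpposite.op a • x) ⊗ₜ[ℂ] y - x ⊗ₜ[ℂ] (a • y)}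

instance [Module C X] [IsScalarTower ℂ C X] [SMulCommClass C Aᵐᵒᵖ X] :
    LeftStable C (balanced A X Y) where
  mem := fun c u hu => by
    have h : balanced A X Y ≤ (balanced A X Y).comap ((Algebra.lsmul ℂ ℂ X c).rTensor Y) := by
      refine Submodule.span_le.2 ?_
      rintro _ ⟨a, x, y, rfl⟩
      refine Submodule.subset_span ⟨a, c • x, y, ?_⟩
      simp [smul_comm c (MulOpposite.op a) x]
    exact h hu

instance [Module Bᵐᵒᵖ Y] [IsScalarTower ℂ Bᵐᵒᵖ Y] [SMulCommClass A Bᵐᵒᵖ Y] :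
    RightStable B (balanced A X Y) where
  mem := fun c u hu => by
    have h : balanced A X Y ≤ (balanced A X Y).comap ((Algebra.lsmul ℂ ℂ Y c).lTensor X) := by
      refine Submodule.span_le.2 ?_
      rintro _ ⟨a, x, y, rfl⟩
      refine Submodule.subset_span ⟨a, x, c • y, ?_⟩
      simp [smul_comm a c y]
    exact h hu

/-- The Haagerup tensor product of operator spaces. -/
abbrev HTensor (X Y : Type*) [SeminormedAddCommGroup X] [NormedSpace ℂ X] [OperatorSpace X]
    [SeminormedAddCommGroup Y] [NormedSpace ℂ Y] [OperatorSpace Y] : Type _ :=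
  HT (⊥ : Submodule ℂ (X ⊗[ℂ] Y))

/-- The module Haagerup tensor product over `A`. It is realized as the completion of `X ⊗ Y` in
the quotient Haagerup seminorm, which is the same as the quotient of `HTensor X Y` by the closed
span of the elements `xa ⊗ y - x ⊗ ay`. -/
abbrev ModTensor : Type _ := HT (balanced A X Y)

end balanced

/-! ### Universal property -/

section lift

variable {X Y Z : Type*} [SeminormedAddCommGroup X] [NormedSpace ℂ X] [OperatorSpace X]
  [SeminormedAddCommGroup Y] [NormedSpace ℂ Y] [OperatorSpace Y]
  [NormedAddCommGroup Z] [NormedSpace ℂ Z] [OperatorSpace Z]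
  {N : Submodule ℂ (X ⊗[ℂ] Y)}
  {m n k l : Type} [Fintype m] [Fintype n] [Fintype k] [Fintype l]

theorem tm_add_left (x x' : X) (y : Y) : tm N (x + x') y = tm N x y + tm N x' y := by
  rw [tm, tm, tm, ← Completion.coe_add]
  exact congrArg _ (TensorProduct.add_tmul x x' y)

theorem tm_add_right (x : X) (y y' : Y) : tm N x (y + y') = tm N x y + tm N x y' := by
  rw [tm, tm, tm, ← Completion.coe_add]
  exact congrArg _ (TensorProduct.tmul_add x y y')

theorem tm_smul_left (c : ℂ) (x : X) (y : Y) : tm N (c • x) y = c • tm N x y := by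
  rw [tm, tm, ← Completion.coe_smul]
  exact congrArg _ (TensorProduct.smul_tmul' c x y).symm

theorem tm_smul_right (c : ℂ) (x : X) (y : Y) : tm N x (c • y) = c • tm N x y := by
  rw [tm, tm, ← Completion.coe_smul]
  exact congrArg _ (TensorProduct.tmul_smul c x y)

/-- The map `(x, y) ↦ x ⊗ y` as a bilinear map. -/
def tmₗ (N : Submodule ℂ (X ⊗[ℂ] Y)) : X →ₗ[ℂ] Y →ₗ[ℂ] HT N :=
  LinearMap.mk₂ ℂ (tm N) tm_add_left tm_smul_left tm_add_right tm_smul_right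

theorem tm_mb (N : Submodule ℂ (X ⊗[ℂ] Y)) : MBWith (tm N) 1 := by
  intro m k n _ _ _ x y
  have h : amp (tm N) x y = Matrix.map (show Matrix m n (HAlg N) from odot x y)
      fun v => (v : HT N) := by
    ext i j
    exact (map_sum (Completion.toCompl (α := HAlg N)) _ _).symm
  rw [h, mnorm_coe, one_mul]
  exact haagerupNrm_le _ x y fun i j => by simp

theorem coe_eq_zero_of_mem (u : HAlg N) (hu : (show X ⊗[ℂ] Y from u) ∈ N) : (u : HT N) = 0 := by
  rw [← norm_eq_zero, Completion.norm_coe]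
  refine le_antisymm ?_ (norm_nonneg _)
  refine (haagerupNrm_le (N := N) (fun _ _ : Unit => u) (0 : Matrix Unit Unit X)
    (0 : Matrix Unit Unit Y) fun i j => ?_).trans ?_
  · have e : odot (0 : Matrix Unit Unit X) (0 : Matrix Unit Unit Y) i j = 0 := by
      simp [odot, amp]
    rw [e]
    exact (sub_zero (show X ⊗[ℂ] Y from u)).symm ▸ hu
  · rw [show mnorm (0 : Matrix Unit Unit X) = 0 from MatSeminorm.nrm_zero _, zero_mul]

/-- The linear map on `X ⊗ Y` of a bounded pairing, before completion. -/
def liftAlg (φ : X →ₗ[ℂ] Y →ₗ[ℂ] Z) : HAlg N →ₗ[ℂ] Z := TensorProduct.lift φ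

theorem liftAlg_cb (φ : X →ₗ[ℂ] Y →ₗ[ℂ] Z) {C : ℝ} (hC : 0 ≤ C)
    (hφ : MBWith (fun x y => φ x y) C)
    (hN : N ≤ LinearMap.ker (TensorProduct.lift φ)) :
    CBWith (liftAlg φ : HAlg N →ₗ[ℂ] Z) C := by
  intro m n _ _ u
  refine le_mul_csInf hC (haagerupSet_nonempty (N := N) u) ?_
  rintro _ ⟨k, _, x, y, hu, rfl⟩
  refine le_trans (le_of_eq ?_) (hφ x y)
  congr 1
  ext i j
  have h : TensorProduct.lift φ ((show X ⊗[ℂ] Y from u i j) - odot x y i j) = 0 := hN (hu i j)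
  rw [map_sub, sub_eq_zero] at h
  refine h.trans ?_
  simp [odot, amp]

/-- The bounded linear extension of a linear map from `V` to its completion, given a bound. -/
def complLift {V : Type*} [SeminormedAddCommGroup V] [NormedSpace ℂ V] [CompleteSpace Z]
    (f : V →ₗ[ℂ] Z) (C : ℝ) (hf : ∀ v, ‖f v‖ ≤ C * ‖v‖) : Completion V →L[ℂ] Z :=
  (f.mkContinuous C hf).extend (Completion.toComplL (𝕜 := ℂ) (E := V))

theorem complLift_coe {V : Type*} [SeminormedAddCommGroup V] [NormedSpace ℂ V] [CompleteSpace Z]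
    (f : V →ₗ[ℂ] Z) (C : ℝ) (hf : ∀ v, ‖f v‖ ≤ C * ‖v‖) (v : V) :
    complLift f C hf (v : Completion V) = f v :=
  (ContinuousLinearMap.extend_eq (f.mkContinuous C hf) Completion.denseRange_coe
    (Completion.isUniformInducing_coe V) v).trans rfl

theorem complLift_cb {V : Type*} [SeminormedAddCommGroup V] [NormedSpace ℂ V] [OperatorSpace V]
    [CompleteSpace Z] (f : V →ₗ[ℂ] Z) {C : ℝ} (hf : ∀ v, ‖f v‖ ≤ C * ‖v‖) (h : CBWith f C) :
    CBWith (complLift f C hf) C := by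
  intro m n _ _ x
  have hc : Continuous fun x : Matrix m n (Completion V) => x.map (complLift f C hf) :=
    continuous_pi fun i => continuous_pi fun j =>
      (complLift f C hf).continuous.comp (continuous_apply_apply i j)
  refine compl_induction x (isClosed_le (continuous_mnorm.comp hc)
    (continuous_const.mul continuous_mnorm)) fun u => ?_
  · have e : (u.map fun v => (v : Completion V)).map (complLift f C hf) = u.map f := by
      ext i j; exact complLift_coe f C hf _
    simp only [Function.comp_apply, Pi.mul_apply]
    rw [e, mnorm_coe]
    exact h u

/-- Completely bounded pairings, in the sense of the Haagerup tensor product. -/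
def IsMB {X Y Z : Type*} [SeminormedAddCommGroup X] [NormedSpace ℂ X] [OperatorSpace X]
    [SeminormedAddCommGroup Y] [NormedSpace ℂ Y] [OperatorSpace Y]
    [SeminormedAddCommGroup Z] [NormedSpace ℂ Z] [OperatorSpace Z] (f : X → Y → Z) : Prop :=
  ∃ C : ℝ, 0 ≤ C ∧ MBWith f C

/-- The map on a tensor product determined by a completely bounded pairing. -/
def HT.lift [CompleteSpace Z] (φ : X →ₗ[ℂ] Y →ₗ[ℂ] Z) (hφ : IsMB fun x y => φ x y)
    (hN : N ≤ LinearMap.ker (TensorProduct.lift φ)) : HT N →L[ℂ] Z :=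
  complLift (liftAlg φ) hφ.choose
    (CBWith.norm_le (liftAlg_cb φ hφ.choose_spec.1 hφ.choose_spec.2 hN))

theorem HT.lift_tm [CompleteSpace Z] (φ : X →ₗ[ℂ] Y →ₗ[ℂ] Z) (hφ : IsMB fun x y => φ x y)
    (hN : N ≤ LinearMap.ker (TensorProduct.lift φ)) (x : X) (y : Y) :
    HT.lift φ hφ hN (tm N x y) = φ x y :=
  (complLift_coe _ _ _ _).trans (TensorProduct.lift.tmul x y)

theorem HT.lift_cb [CompleteSpace Z] (φ : X →ₗ[ℂ] Y →ₗ[ℂ] Z) (hφ : IsMB fun x y => φ x y)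
    (hN : N ≤ LinearMap.ker (TensorProduct.lift φ)) : IsCB (HT.lift φ hφ hN) :=
  ⟨_, hφ.choose_spec.1, complLift_cb _ _
    (liftAlg_cb φ hφ.choose_spec.1 hφ.choose_spec.2 hN)⟩

theorem balanced_le_ker {A : Type*} [NormedRing A] [NormedAlgebra ℂ A] [OperatorSpace A]
    [Module Aᵐᵒᵖ X] [IsScalarTower ℂ Aᵐᵒᵖ X] [Module A Y] [IsScalarTower ℂ A Y]
    (φ : X →ₗ[ℂ] Y →ₗ[ℂ] Z) (h : ∀ (a : A) x y, φ (MulOpposite.op a • x) y = φ x (a • y)) :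
    balanced A X Y ≤ LinearMap.ker (TensorProduct.lift φ) := by
  refine Submodule.span_le.2 ?_
  rintro _ ⟨a, x, y, rfl⟩
  simp [h]

end lift

/-! ### Universal forms -/

section forms

variable (A : Type*) [NormedRing A] [NormedAlgebra ℂ A] [OperatorSpace A] [OperatorAlgebra A]

/-- The multiplication map `A ⊗ A → A`. -/
def mulMap : HTensor A A →L[ℂ] A :=
  HT.lift (LinearMap.mul ℂ A) ⟨1, zero_le_one, OperatorAlgebra.mul_le⟩ bot_le

variable {A}

theorem mulMap_tm (a b : A) : mulMap A (tm ⊥ a b) = a * b :=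
  HT.lift_tm (LinearMap.mul ℂ A) ⟨1, zero_le_one, OperatorAlgebra.mul_le⟩ bot_le a b

theorem smul_tm (a b c : A) : a • (tm ⊥ b c : HTensor A A) = tm ⊥ (a * b) c := by
  rw [tm, tm, ← Completion.coe_smul]; rfl

theorem op_smul_tm (a b c : A) :
    MulOpposite.op a • (tm ⊥ b c : HTensor A A) = tm ⊥ b (c * a) := by
  rw [tm, tm, ← Completion.coe_smul]; rfl

/-- Two continuous additive maps that agree on elementary tensors are equal. -/
theorem HT.ext_tm {X Y Z : Type*} [SeminormedAddCommGroup X] [NormedSpace ℂ X] [OperatorSpace X]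
    [SeminormedAddCommGroup Y] [NormedSpace ℂ Y] [OperatorSpace Y] [AddCommMonoid Z]
    [TopologicalSpace Z] [T2Space Z]
    {N : Submodule ℂ (X ⊗[ℂ] Y)} {f g : HT N →+ Z} (hf : Continuous f) (hg : Continuous g)
    (h : ∀ x y, f (tm N x y) = g (tm N x y)) (u : HT N) : f u = g u := by
  refine Completion.induction_on u (isClosed_eq hf hg) fun v => ?_
  refine TensorProduct.induction_on (motive := fun v : X ⊗[ℂ] Y =>
    f ((show HAlg N from v : HAlg N) : HT N) = g ((show HAlg N from v : HAlg N) : HT N)) v ?_ h ?_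
  · have e : ((show HAlg N from (0 : X ⊗[ℂ] Y) : HAlg N) : HT N) = 0 := Completion.coe_zero
    rw [e, map_zero, map_zero]
  · intro x y hx hy
    have e : ((show HAlg N from x + y : HAlg N) : HT N) =
      ((show HAlg N from x : HAlg N) : HT N) + ((show HAlg N from y : HAlg N) : HT N) :=
      Completion.coe_add (α := HAlg N) x y
    rw [e, map_add, map_add, hx, hy]

theorem mulMap_smul (a : A) (u : HTensor A A) : mulMap A (a • u) = a * mulMap A u :=
  HT.ext_tm (f := ((mulMap A : HTensor A A →+ A).comp (DistribSMul.toAddMonoidHom _ a)))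
    (g := (AddMonoidHom.mulLeft a).comp (mulMap A : HTensor A A →+ A))
    ((mulMap A).continuous.comp (continuous_const_smul a))
    (continuous_const.mul (mulMap A).continuous)
    (fun b c => by
      show mulMap A (a • tm ⊥ b c) = a * mulMap A (tm ⊥ b c)
      rw [smul_tm, mulMap_tm, mulMap_tm, mul_assoc]) u

theorem mulMap_op_smul (a : A) (u : HTensor A A) :
    mulMap A (MulOpposite.op a • u) = mulMap A u * a :=
  HT.ext_tm (f := ((mulMap A : HTensor A A →+ A).comp
      (DistribSMul.toAddMonoidHom _ (MulOpposite.op a))))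
    (g := (AddMonoidHom.mulRight a).comp (mulMap A : HTensor A A →+ A))
    ((mulMap A).continuous.comp (continuous_const_smul _))
    ((mulMap A).continuous.mul continuous_const)
    (fun b c => by
      show mulMap A (MulOpposite.op a • tm ⊥ b c) = mulMap A (tm ⊥ b c) * a
      rw [op_smul_tm, mulMap_tm, mulMap_tm, mul_assoc]) u

variable (A)

/-- The kernel of the multiplication map. -/
def omegaSub : Submodule ℂ (HTensor A A) := LinearMap.ker (mulMap A).toLinearMap

/-- The bimodule `Ω¹(A)` of universal `1`-forms, the kernel of `A ⊗ A → A`. -/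
def Omega1 : Type _ := omegaSub A

instance : NormedAddCommGroup (Omega1 A) := inferInstanceAs (NormedAddCommGroup (omegaSub A))
instance : NormedSpace ℂ (Omega1 A) := inferInstanceAs (NormedSpace ℂ (omegaSub A))
instance : OperatorSpace (Omega1 A) := inferInstanceAs (OperatorSpace (omegaSub A))
instance : CompleteSpace (Omega1 A) :=
  (ContinuousLinearMap.isClosed_ker (mulMap A)).isComplete.completeSpace_coe

/-- The inclusion `Ω¹(A) → A ⊗ A`. -/
def omegaIncl : Omega1 A →L[ℂ] HTensor A A := (omegaSub A).subtypeL

theorem omegaIncl_injective : Function.Injective (omegaIncl A) := Subtype.coe_injective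

theorem mnorm_omega {m n : Type} [Fintype m] [Fintype n] (x : Matrix m n (Omega1 A)) :
    mnorm x = mnorm (x.map (omegaIncl A)) := rfl

instance omegaSMul : SMul A (Omega1 A) :=
  ⟨fun a ω => ⟨a • omegaIncl A ω, by
    show mulMap A (a • omegaIncl A ω) = 0
    rw [mulMap_smul, show mulMap A (omegaIncl A ω) = 0 from ω.2, mul_zero]⟩⟩

instance omegaOpSMul : SMul Aᵐᵒᵖ (Omega1 A) :=
  ⟨fun a ω => ⟨a • omegaIncl A ω, by
    show mulMap A (MulOpposite.op a.unop • omegaIncl A ω) = 0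
    rw [mulMap_op_smul, show mulMap A (omegaIncl A ω) = 0 from ω.2, zero_mul]⟩⟩

variable {A}

theorem omegaIncl_smul (a : A) (ω : Omega1 A) : omegaIncl A (a • ω) = a • omegaIncl A ω := rfl

theorem omegaIncl_op_smul (a : Aᵐᵒᵖ) (ω : Omega1 A) :
    omegaIncl A (a • ω) = a • omegaIncl A ω := rfl

instance omegaLeftModule : Module A (Omega1 A) :=
  Function.Injective.module A (omegaIncl A : Omega1 A →+ HTensor A A) (omegaIncl_injective A)
    omegaIncl_smul

instance omegaRightModule : Module Aᵐᵒᵖ (Omega1 A) :=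
  Function.Injective.module Aᵐᵒᵖ (omegaIncl A : Omega1 A →+ HTensor A A) (omegaIncl_injective A)
    omegaIncl_op_smul

instance : IsScalarTower ℂ A (Omega1 A) :=
  ⟨fun c a ω => omegaIncl_injective A (smul_assoc c a (omegaIncl A ω))⟩

instance : IsScalarTower ℂ Aᵐᵒᵖ (Omega1 A) :=
  ⟨fun c a ω => omegaIncl_injective A (smul_assoc c a (omegaIncl A ω))⟩

instance : SMulCommClass A Aᵐᵒᵖ (Omega1 A) :=
  ⟨fun a b ω => omegaIncl_injective A (smul_comm a b (omegaIncl A ω))⟩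

instance : LeftOpModule A (Omega1 A) where
  smul_le := fun a x => by
    have e : (amp (fun (a : A) (ω : Omega1 A) => a • ω) a x).map (omegaIncl A) =
        amp (fun (a : A) (ω : HTensor A A) => a • ω) a (x.map (omegaIncl A)) := by
      ext i j
      simp only [amp, Matrix.map_apply, map_sum, omegaIncl_smul]
    rw [mnorm_omega, mnorm_omega, e]
    exact LeftOpModule.smul_le a (x.map (omegaIncl A))

instance : RightOpModule A (Omega1 A) where
  smul_le := fun x a => by
    have e : (amp (fun (ω : Omega1 A) (a : A) => MulOpposite.op a • ω) x a).map (omegaIncl A) =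
        amp (fun (ω : HTensor A A) (a : A) => MulOpposite.op a • ω) (x.map (omegaIncl A)) a := by
      ext i j
      simp only [amp, Matrix.map_apply, map_sum, omegaIncl_op_smul]
    rw [mnorm_omega, mnorm_omega, e]
    exact RightOpModule.smul_le (x.map (omegaIncl A)) a

variable (A)

/-- The universal derivation `d a = 1 ⊗ a - a ⊗ 1`. -/
def univD (a : A) : Omega1 A :=
  ⟨tm ⊥ 1 a - tm ⊥ a 1, by
    show mulMap A (tm ⊥ 1 a - tm ⊥ a 1) = 0
    rw [map_sub, mulMap_tm, mulMap_tm, one_mul, mul_one, sub_self]⟩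

end forms

/-! ### Spaces of completely bounded module maps -/

section kron

open Classical in
/-- The matrix `x ⊗ 1`. -/
def kronOne {V : Type*} [Zero V] {m n : Type} (k : Type) (x : Matrix m n V) :
    Matrix (m × k) (n × k) V :=
  Matrix.of fun p q => if p.2 = q.2 then x p.1 q.1 else 0

variable {V : Type*} [AddCommGroup V] [Module ℂ V]
  {m n k l : Type} [Fintype m] [Fintype n] [Fintype k] [Fintype l]

theorem MatSeminorm.nrm_kronOne_le (p : MatSeminorm V) (x : Matrix m n V) :
    p.nrm (kronOne k x) ≤ p.nrm x := by
  revert x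
  refine Fintype.induction_empty_option
    (P := fun k _ => ∀ x : Matrix m n V, p.nrm (kronOne k x) ≤ p.nrm x) ?_ ?_ ?_ k
  · intro α β _ e h x
    let _ := Fintype.ofEquiv β e.symm
    have e1 : kronOne β x = (kronOne α x).submatrix (Prod.map id e.symm)
        (Prod.map id e.symm) := by
      ext i j; by_cases h : i.2 = j.2 <;> simp [kronOne, h]
    rw [e1]
    refine (p.nrm_submatrix_le _ (Function.injective_id.prodMap e.symm.injective) _
      (Function.injective_id.prodMap e.symm.injective) _).trans ?_
    convert h x
  · intro x
    refine (p.nrm_le_sum _).trans ?_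
    simpa using p.nrm_nonneg x
  · intro α _ h x
    have e1 : kronOne (Option α) x = (Matrix.fromBlocks x 0 0 (kronOne α x)).submatrix
        (fun p : m × Option α => p.2.elim (Sum.inl p.1) fun a => Sum.inr (p.1, a))
        (fun p : n × Option α => p.2.elim (Sum.inl p.1) fun a => Sum.inr (p.1, a)) := by
      ext ⟨i, a⟩ ⟨j, b⟩
      rcases a with _ | a <;> rcases b with _ | b <;> try simp [kronOne]
      by_cases h : a = b <;> simp [h]
    rw [e1]
    refine (p.nrm_submatrix_le _ ?_ _ ?_ _).trans
      ((p.nrm_diag_le _ _).trans (max_le le_rfl (h x)))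
    all_goals
      rintro ⟨i, _ | a⟩ ⟨j, _ | b⟩ h <;> simp_all

theorem colNorm_kronOne_le (x : Matrix m n ℂ) : colNorm (kronOne k x) ≤ colNorm x :=
  MatSeminorm.nrm_kronOne_le (columnOperatorSpace (H := ℂ)).mat x

end kron

section outer

variable {X Y Z : Type*} [SeminormedAddCommGroup X] [NormedSpace ℂ X] [OperatorSpace X]
  [SeminormedAddCommGroup Y] [NormedSpace ℂ Y] [OperatorSpace Y]
  [SeminormedAddCommGroup Z] [NormedSpace ℂ Z] [OperatorSpace Z]
  {m n k l : Type} [Fintype m] [Fintype n] [Fintype k] [Fintype l]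

/-- The matrix of all values of a pairing on the entries of two matrices. -/
def outer (f : X → Y → Z) (x : Matrix m n X) (y : Matrix k l Y) : Matrix (m × k) (n × l) Z :=
  Matrix.of fun p q => f (x p.1 q.1) (y p.2 q.2)

theorem mnorm_kronOne_le (x : Matrix m n X) : mnorm (kronOne k x) ≤ mnorm x :=
  MatSeminorm.nrm_kronOne_le _ x

theorem mnorm_outer_le {f : X → Y → Z} {C : ℝ} (hC : 0 ≤ C) (hf : MBWith f C)
    (h0 : ∀ y, f 0 y = 0) (h0' : ∀ x, f x 0 = 0) (x : Matrix m n X) (y : Matrix k l Y) :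
    mnorm (outer f x y) ≤ C * (mnorm x * mnorm y) := by
  classical
  have e : outer f x y = amp f (kronOne k x)
      ((kronOne n y).submatrix Prod.swap Prod.swap) := by
    ext ⟨i, a⟩ ⟨j, b⟩
    simp only [outer, amp, kronOne, Matrix.of_apply, Matrix.submatrix_apply, Prod.fst_swap,
      Prod.snd_swap, Fintype.sum_prod_type]
    rw [Finset.sum_eq_single j, Finset.sum_eq_single a]
    · simp
    · intro b' _ hb'
      simp [Ne.symm hb', h0]
    · simp
    · intro j' _ hj'
      simp [hj', h0']
    · simp
  rw [e]
  refine (hf _ _).trans (mul_le_mul_of_nonneg_left ?_ hC)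
  refine mul_le_mul (mnorm_kronOne_le x) ?_ (mnorm_nonneg _) (mnorm_nonneg _)
  exact (mnorm_submatrix_le _ Prod.swap_injective _ Prod.swap_injective _).trans
    (mnorm_kronOne_le y)

/-- The corner `k × l` matrix placed in position `(i, j)` of an `m × n` block matrix. -/
theorem mnorm_block_le [DecidableEq m] [DecidableEq n] (i : m) (j : n) (y : Matrix k l Y) :
    mnorm (Matrix.of fun (p : m × k) (q : n × l) =>
      if i = p.1 ∧ j = q.1 then y p.2 q.2 else 0) ≤ mnorm y := by
  classical
  have h : (Matrix.of fun (p : m × k) (q : n × l) =>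
      if i = p.1 ∧ j = q.1 then y p.2 q.2 else 0) = amp (fun (v : Y) (c : ℂ) => c • v)
      (amp (fun (c : ℂ) (v : Y) => c • v) (selMat (fun a : k => (i, a))).transpose y)
      (selMat (fun b : l => (j, b))) := by
    ext ⟨i', a⟩ ⟨j', b⟩
    simp only [amp, selMat, Matrix.transpose_apply, Matrix.of_apply, Prod.mk.injEq]
    by_cases hi : i = i' <;> by_cases hj : j = j' <;> simp [hi, hj, eq_comm (a := i'),
      eq_comm (a := j')]
  rw [h]
  exact (MatSeminorm.nrm_rsmul_le_of_le_one _ _ _ (colNorm_selMat_le _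
    fun _ _ h => (Prod.mk.inj h).2)).trans (MatSeminorm.nrm_lsmul_le_of_le_one _ _
    (colNorm_selMat_transpose_le _ fun _ _ h => (Prod.mk.inj h).2) _)

end outer

section CBHom

variable (B : Type*) [NormedRing B] [NormedAlgebra ℂ B] [OperatorSpace B]
  (X Y : Type*) [SeminormedAddCommGroup X] [NormedSpace ℂ X] [OperatorSpace X]
  [NormedAddCommGroup Y] [NormedSpace ℂ Y] [OperatorSpace Y]
  [Module Bᵐᵒᵖ X] [IsScalarTower ℂ Bᵐᵒᵖ X] [Module Bᵐᵒᵖ Y] [IsScalarTower ℂ Bᵐᵒᵖ Y]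

variable {X Y} in
theorem IsCB.add {f g : X → Y} (hf : IsCB f) (hg : IsCB g) : IsCB fun x => f x + g x := by
  obtain ⟨C, hC, hf⟩ := hf
  obtain ⟨D, hD, hg⟩ := hg
  exact ⟨C + D, add_nonneg hC hD, fun x => (mnorm_add_le (x.map f) (x.map g)).trans
    ((add_le_add (hf x) (hg x)).trans_eq (add_mul _ _ _).symm)⟩

variable {X Y} in
theorem IsCB.smul {f : X → Y} (hf : IsCB f) (c : ℂ) : IsCB fun x => c • f x := by
  obtain ⟨C, hC, hf⟩ := hf
  refine ⟨‖c‖ * C, mul_nonneg (norm_nonneg _) hC, fun x => ?_⟩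
  refine (MatSeminorm.nrm_smul_le _ c (x.map f)).trans ?_
  rw [mul_assoc]
  exact mul_le_mul_of_nonneg_left (hf x) (norm_nonneg _)

variable {X Y} in
theorem IsCB.zero : IsCB fun _ : X => (0 : Y) :=
  ⟨0, le_rfl, fun _ => (MatSeminorm.nrm_zero _).le.trans_eq (zero_mul _).symm⟩

/-- The completely bounded right `B`-module maps `X → Y`. -/
def cbHomSub : Submodule ℂ (X →ₗ[ℂ] Y) where
  carrier := {T | IsCB T ∧ ∀ (b : B) (x : X), T (MulOpposite.op b • x) = MulOpposite.op b • T x}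
  add_mem' := fun hS hT => ⟨hS.1.add hT.1, fun b x => by
    rw [LinearMap.add_apply, LinearMap.add_apply, hS.2, hT.2, smul_add]⟩
  zero_mem' := ⟨IsCB.zero, fun b x => by simp⟩
  smul_mem' := fun c T hT => ⟨hT.1.smul c, fun b x => by
    rw [LinearMap.smul_apply, LinearMap.smul_apply, hT.2, smul_comm]⟩

/-- The space of completely bounded right `B`-module maps `X → Y`. -/
def CBHom : Type _ := cbHomSub B X Y

instance : AddCommGroup (CBHom B X Y) := inferInstanceAs (AddCommGroup (cbHomSub B X Y))
instance cbHomModule : Module ℂ (CBHom B X Y) := inferInstanceAs (Module ℂ (cbHomSub B X Y))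

variable {B X Y}

/-- The underlying linear map. -/
def CBHom.app (T : CBHom B X Y) : X →ₗ[ℂ] Y := (show cbHomSub B X Y from T).1

/-- Evaluation at `x`. -/
def CBHom.eval (x : X) : CBHom B X Y →ₗ[ℂ] Y :=
  (LinearMap.applyₗ x).comp (cbHomSub B X Y).subtype

theorem CBHom.eval_apply (x : X) (T : CBHom B X Y) : CBHom.eval x T = T.app x := rfl

theorem CBHom.app_injective : Function.Injective (CBHom.app (B := B) (X := X) (Y := Y)) :=
  Subtype.coe_injective

theorem CBHom.cb (T : CBHom B X Y) : IsCB T.app := (show cbHomSub B X Y from T).2.1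

theorem CBHom.app_op_smul (T : CBHom B X Y) (b : B) (x : X) :
    T.app (MulOpposite.op b • x) = MulOpposite.op b • T.app x :=
  (show cbHomSub B X Y from T).2.2 b x

/-- The matrix with entries `Tᵢⱼ(xₖₗ)`. -/
def ampMap {m n k l : Type} (T : Matrix m n (CBHom B X Y)) (x : Matrix k l X) :
    Matrix (m × k) (n × l) Y :=
  Matrix.of fun p q => CBHom.eval (x p.2 q.2) (T p.1 q.1)

/-- The bounds of `[Tᵢⱼ]` as a map from `X` to matrices over `Y`, for all amplifications. -/
def cbSet {m n : Type} [Fintype m] [Fintype n] (T : Matrix m n (CBHom B X Y)) : Set ℝ :=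
  {C | 0 ≤ C ∧ ∀ {k l : Type} [Fintype k] [Fintype l] (x : Matrix k l X),
    mnorm (ampMap T x) ≤ C * mnorm x}

/-- The completely bounded norm of `[Tᵢⱼ]` as a map from `X` to matrices over `Y`. -/
def cbNrm {m n : Type} [Fintype m] [Fintype n] (T : Matrix m n (CBHom B X Y)) : ℝ :=
  sInf (cbSet T)

variable {m n k l : Type} [Fintype m] [Fintype n] [Fintype k] [Fintype l]

theorem cbSet_nonempty (T : Matrix m n (CBHom B X Y)) : (cbSet T).Nonempty := by
  classical
  choose C hC hT using fun i j => (T i j).cb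
  refine ⟨∑ i, ∑ j, C i j, Finset.sum_nonneg fun i _ => Finset.sum_nonneg fun j _ => hC i j,
    fun {k l} _ _ x => ?_⟩
  have e : ampMap T x = ∑ i, ∑ j, Matrix.of fun (p : m × k) (q : n × l) =>
      if i = p.1 ∧ j = q.1 then (x.map (T i j).app) p.2 q.2 else 0 := by
    ext ⟨i, a⟩ ⟨j, b⟩
    simp only [Matrix.sum_apply, Matrix.of_apply, ite_and]
    simp [ampMap, CBHom.eval_apply]
  rw [e, Finset.sum_mul]
  refine (MatSeminorm.nrm_sum_le _ _ _).trans (Finset.sum_le_sum fun i _ => ?_)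
  rw [Finset.sum_mul]
  refine (MatSeminorm.nrm_sum_le _ _ _).trans (Finset.sum_le_sum fun j _ => ?_)
  exact (mnorm_block_le i j _).trans (hT i j x)

theorem cbNrm_nonneg (T : Matrix m n (CBHom B X Y)) : 0 ≤ cbNrm T :=
  le_csInf (cbSet_nonempty T) fun _ h => h.1

theorem cbNrm_bound (T : Matrix m n (CBHom B X Y)) (x : Matrix k l X) :
    mnorm (ampMap T x) ≤ cbNrm T * mnorm x := by
  rw [mul_comm]
  exact le_mul_csInf (mnorm_nonneg _) (cbSet_nonempty T)
    fun t ht => (ht.2 x).trans_eq (mul_comm _ _)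

theorem cbNrm_le (T : Matrix m n (CBHom B X Y)) {C : ℝ} (hC : 0 ≤ C)
    (h : ∀ {k l : Type} [Fintype k] [Fintype l] (x : Matrix k l X),
      mnorm (ampMap T x) ≤ C * mnorm x) : cbNrm T ≤ C :=
  csInf_le ⟨0, fun _ h => h.1⟩ ⟨hC, h⟩

variable (B X Y) in
/-- The matrix norms on the space of completely bounded module maps. -/
def cbHomMat : MatSeminorm (CBHom B X Y) where
  nrm := fun T => cbNrm T
  nrm_add_le := fun S T => by
    refine cbNrm_le _ (add_nonneg (cbNrm_nonneg S) (cbNrm_nonneg T)) fun x => ?_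
    have e : ampMap (S + T) x = ampMap S x + ampMap T x := by
      ext p q; simp [ampMap]
    rw [e, add_mul]
    exact (mnorm_add_le _ _).trans (add_le_add (cbNrm_bound S x) (cbNrm_bound T x))
  nrm_lsmul_le := fun α T => by
    refine cbNrm_le _ (mul_nonneg (colNorm_nonneg α) (cbNrm_nonneg T)) fun {k l} _ _ x => ?_
    have e : ampMap (amp (fun (c : ℂ) (v : CBHom B X Y) => c • v) α T) x =
        amp (fun (c : ℂ) (v : Y) => c • v) (kronOne k α) (ampMap T x) := by
      classical
      ext p q
      simp [ampMap, amp, kronOne, Fintype.sum_prod_type]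
    rw [e, mul_assoc]
    refine (MatSeminorm.nrm_lsmul_le _ _ _).trans (mul_le_mul (colNorm_kronOne_le α)
      (cbNrm_bound T x) (mnorm_nonneg _) (colNorm_nonneg _))
  nrm_rsmul_le := fun T β => by
    refine cbNrm_le _ (mul_nonneg (cbNrm_nonneg T) (colNorm_nonneg β)) fun {k l} _ _ x => ?_
    have e : ampMap (amp (fun (v : CBHom B X Y) (c : ℂ) => c • v) T β) x =
        amp (fun (v : Y) (c : ℂ) => c • v) (ampMap T x) (kronOne l β) := by
      classical
      ext p q
      simp [ampMap, amp, kronOne, Fintype.sum_prod_type]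
    rw [e, mul_right_comm]
    refine (MatSeminorm.nrm_rsmul_le _ _ _).trans (mul_le_mul (cbNrm_bound T x)
      (colNorm_kronOne_le β) (colNorm_nonneg _)
      (mul_nonneg (cbNrm_nonneg T) (mnorm_nonneg _)))
  nrm_diag_le := fun S T => by
    refine cbNrm_le _ (le_max_of_le_left (cbNrm_nonneg S)) fun x => ?_
    have e : ampMap (Matrix.fromBlocks S 0 0 T) x =
        (Matrix.fromBlocks (ampMap S x) 0 0 (ampMap T x)).submatrix
          (Equiv.sumProdDistrib _ _ _) (Equiv.sumProdDistrib _ _ _) := by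
      ext ⟨i, a⟩ ⟨j, b⟩
      rcases i with i | i <;> rcases j with j | j <;> simp [ampMap]
    rw [e]
    refine (mnorm_submatrix_le _ (Equiv.injective _) _ (Equiv.injective _) _).trans
      ((MatSeminorm.nrm_diag_le _ _ _).trans (max_le ?_ ?_))
    · exact (cbNrm_bound S x).trans
        (mul_le_mul_of_nonneg_right (le_max_left _ _) (mnorm_nonneg _))
    · exact (cbNrm_bound T x).trans
        (mul_le_mul_of_nonneg_right (le_max_right _ _) (mnorm_nonneg _))

theorem CBHom.eval_norm_le (T : CBHom B X Y) (x : X) :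
    ‖T.app x‖ ≤ cbNrm (fun _ _ : Unit => T) * ‖x‖ := by
  have h := cbNrm_bound (fun _ _ : Unit => T) (fun _ _ : Unit => x)
  rw [mnorm_unit] at h
  exact (norm_entry_le (ampMap (fun _ _ : Unit => T) (fun _ _ : Unit => x)) ((), ())
    ((), ())).trans h

instance : NormedAddCommGroup (CBHom B X Y) :=
  @NormedAddCommGroup.ofCore ℂ (CBHom B X Y) _ _ _ (cbHomMat B X Y).toNorm
    (letI := (cbHomMat B X Y).toNorm
    { toCore := (cbHomMat B X Y).core
      norm_eq_zero_iff := fun T => by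
        refine ⟨fun h => ?_, fun h => ?_⟩
        · refine CBHom.app_injective (LinearMap.ext fun x => ?_)
          have h1 := T.eval_norm_le x
          have h2 : cbNrm (fun _ _ : Unit => T) = 0 := h
          rw [h2, zero_mul] at h1
          exact norm_le_zero_iff.1 h1
        · rw [h]
          exact (cbHomMat B X Y).nrm_zero })

instance : NormedSpace ℂ (CBHom B X Y) where
  toModule := cbHomModule B X Y
  norm_smul_le := fun c v => le_of_eq ((cbHomMat B X Y).core.norm_smul c v)

instance cbHomOperatorSpace : OperatorSpace (CBHom B X Y) := ⟨cbHomMat B X Y, fun _ => rfl⟩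

theorem mnorm_cbHom (T : Matrix m n (CBHom B X Y)) : mnorm T = cbNrm T := rfl

theorem CBHom.eval_cb (x : X) : CBWith (CBHom.eval (B := B) (Y := Y) x) ‖x‖ := by
  intro m n _ _ T
  have h := cbNrm_bound T (fun _ _ : Unit => x)
  rw [mnorm_unit, mul_comm] at h
  refine le_trans ?_ h
  exact mnorm_submatrix_le (fun i : m => (i, ())) (fun _ _ h => (Prod.mk.inj h).1)
    (fun j : n => (j, ())) (fun _ _ h => (Prod.mk.inj h).1)
    (ampMap T (fun _ _ : Unit => x))

end CBHom

section CBHomComplete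

variable {B : Type*} [NormedRing B] [NormedAlgebra ℂ B] [OperatorSpace B]
  {X Y : Type*} [SeminormedAddCommGroup X] [NormedSpace ℂ X] [OperatorSpace X]
  [NormedAddCommGroup Y] [NormedSpace ℂ Y] [OperatorSpace Y]
  [Module Bᵐᵒᵖ X] [IsScalarTower ℂ Bᵐᵒᵖ X] [Module Bᵐᵒᵖ Y] [IsScalarTower ℂ Bᵐᵒᵖ Y]
  {m n k l : Type} [Fintype m] [Fintype n] [Fintype k] [Fintype l]

theorem CBHom.norm_app_le (T : CBHom B X Y) (x : X) : ‖T.app x‖ ≤ ‖T‖ * ‖x‖ :=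
  T.eval_norm_le x

theorem CBHom.cbWith_norm (T : CBHom B X Y) : CBWith T.app ‖T‖ := by
  intro m n _ _ x
  have h := cbNrm_bound (fun _ _ : Unit => T) x
  refine le_trans ?_ h
  exact mnorm_submatrix_le (fun i : m => ((), i)) (fun _ _ h => (Prod.mk.inj h).2)
    (fun j : n => ((), j)) (fun _ _ h => (Prod.mk.inj h).2)
    (ampMap (fun _ _ : Unit => T) x)

theorem CBHom.norm_le (T : CBHom B X Y) {C : ℝ} (hC : 0 ≤ C) (h : CBWith T.app C) :
    ‖T‖ ≤ C := by
  refine cbNrm_le _ hC fun {k l} _ _ x => ?_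
  refine le_trans ?_ (h x)
  exact mnorm_submatrix_le (fun i : Unit × k => i.2) (fun _ _ h => Prod.ext rfl h)
    (fun j : Unit × l => j.2) (fun _ _ h => Prod.ext rfl h) (x.map T.app)

theorem CBHom.app_sub (S T : CBHom B X Y) (x : X) : (S - T).app x = S.app x - T.app x := rfl

instance cbHomComplete [CompleteSpace Y] [ContinuousConstSMul Bᵐᵒᵖ Y] :
    CompleteSpace (CBHom B X Y) := by
  refine Metric.complete_of_cauchySeq_tendsto fun u hu => ?_
  have h1 : ∀ x, CauchySeq fun n => (u n).app x := by
    intro x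
    rw [Metric.cauchySeq_iff] at hu ⊢
    intro ε hε
    obtain ⟨N, hN⟩ := hu (ε / (‖x‖ + 1)) (by positivity)
    refine ⟨N, fun a ha b hb => ?_⟩
    have h := hN a ha b hb
    rw [dist_eq_norm] at h ⊢
    rw [← CBHom.app_sub]
    refine (CBHom.norm_app_le _ x).trans_lt ?_
    rw [lt_div_iff₀ (by positivity)] at h
    nlinarith [norm_nonneg (u a - u b), norm_nonneg x]
  choose L hL using fun x => cauchySeq_tendsto_of_complete (h1 x)
  have hLm : ∀ {m n : Type} [Fintype m] [Fintype n] (x : Matrix m n X),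
      Filter.Tendsto (fun a => x.map (u a).app) Filter.atTop (nhds (x.map L)) :=
    fun x => tendsto_pi_nhds.2 fun i => tendsto_pi_nhds.2 fun j => hL (x i j)
  let L' : X →ₗ[ℂ] Y :=
    { toFun := L
      map_add' := fun x y => tendsto_nhds_unique (hL (x + y)) (by
        simp only [map_add]; exact (hL x).add (hL y))
      map_smul' := fun c x => tendsto_nhds_unique (hL (c • x)) (by
        simp only [map_smul]; exact (hL x).const_smul c) }
  obtain ⟨M, hM⟩ := hu.norm_bddAbove
  have hM' : ∀ a, ‖u a‖ ≤ M := fun a => hM ⟨a, rfl⟩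
  have hM0 : 0 ≤ M := (norm_nonneg _).trans (hM' 0)
  have hcb : CBWith L M := fun x => by
    refine le_of_tendsto ((continuous_mnorm.tendsto _).comp (hLm x))
      (Filter.Eventually.of_forall fun a => ?_)
    exact ((u a).cbWith_norm x).trans (mul_le_mul_of_nonneg_right (hM' a) (mnorm_nonneg _))
  let T : CBHom B X Y := ⟨L', ⟨M, hM0, hcb⟩, fun b x => tendsto_nhds_unique (hL _) (by
    simp only [CBHom.app_op_smul]; exact (hL x).const_smul _)⟩
  refine ⟨T, Metric.tendsto_atTop.2 fun ε hε => ?_⟩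
  obtain ⟨N, hN⟩ := Metric.cauchySeq_iff.1 hu (ε / 2) (by positivity)
  refine ⟨N, fun a ha => ?_⟩
  rw [dist_eq_norm]
  refine lt_of_le_of_lt (CBHom.norm_le _ (by positivity : 0 ≤ ε / 2) fun x => ?_)
    (half_lt_self hε)
  have h2 : Filter.Tendsto (fun b => x.map (u a - u b).app) Filter.atTop
      (nhds (x.map (u a - T).app)) :=
    tendsto_pi_nhds.2 fun i => tendsto_pi_nhds.2 fun j => tendsto_const_nhds.sub (hL (x i j))
  refine le_of_tendsto ((continuous_mnorm.tendsto _).comp h2)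
    (Filter.eventually_atTop.2 ⟨N, fun b hb => ?_⟩)
  refine ((u a - u b).cbWith_norm x).trans (mul_le_mul_of_nonneg_right ?_ (mnorm_nonneg _))
  rw [← dist_eq_norm]
  exact (hN a ha b hb).le

section left

variable {A : Type*} [NormedRing A] [NormedAlgebra ℂ A] [OperatorSpace A]
  [Module A Y] [IsScalarTower ℂ A Y] [SMulCommClass A Bᵐᵒᵖ Y] [LeftOpModule A Y]

theorem isCB_left_smul (a : A) : IsCB fun y : Y => a • y := by
  refine ⟨‖a‖, norm_nonneg _, fun {m n} _ _ y => ?_⟩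
  have h := mnorm_outer_le zero_le_one (LeftOpModule.smul_le (A := A) (X := Y))
    (fun y => zero_smul A y) (fun a => smul_zero a) (fun _ _ : Unit => a) y
  rw [one_mul, mnorm_unit] at h
  exact (mnorm_submatrix_le (fun i : m => ((), i)) (fun _ _ h => (Prod.mk.inj h).2)
    (fun j : n => ((), j)) (fun _ _ h => (Prod.mk.inj h).2)
    (outer (fun (a : A) (y : Y) => a • y) (fun _ _ : Unit => a) y)).trans h

theorem IsCB.comp {X Y Z : Type*} [SeminormedAddCommGroup X] [NormedSpace ℂ X] [OperatorSpace X]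
    [SeminormedAddCommGroup Y] [NormedSpace ℂ Y] [OperatorSpace Y]
    [SeminormedAddCommGroup Z] [NormedSpace ℂ Z] [OperatorSpace Z] {g : Y → Z} {f : X → Y}
    (hg : IsCB g) (hf : IsCB f) : IsCB fun x => g (f x) := by
  obtain ⟨C, hC, hf⟩ := hf
  obtain ⟨D, hD, hg⟩ := hg
  refine ⟨D * C, mul_nonneg hD hC, fun x => (hg (x.map f)).trans ?_⟩
  rw [mul_assoc]
  exact mul_le_mul_of_nonneg_left (hf x) hD

/-- The left action `(aT)(x) = a T(x)`. -/
instance cbHomSMul : SMul A (CBHom B X Y) :=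
  ⟨fun a T => ⟨(Algebra.lsmul ℂ ℂ Y a).comp T.app, (isCB_left_smul a).comp T.cb, fun b x => by
    simp [CBHom.app_op_smul, smul_comm a (MulOpposite.op b)]⟩⟩

theorem CBHom.smul_app (a : A) (T : CBHom B X Y) (x : X) : (a • T).app x = a • T.app x := rfl

instance cbHomLeftModule : Module A (CBHom B X Y) where
  one_smul T := CBHom.app_injective (LinearMap.ext fun x => one_smul A (T.app x))
  mul_smul a b T := CBHom.app_injective (LinearMap.ext fun x => mul_smul a b (T.app x))
  smul_zero a := CBHom.app_injective (LinearMap.ext fun _ => smul_zero a)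
  smul_add a S T := CBHom.app_injective (LinearMap.ext fun x => smul_add a (S.app x) (T.app x))
  add_smul a b T := CBHom.app_injective (LinearMap.ext fun x => add_smul a b (T.app x))
  zero_smul T := CBHom.app_injective (LinearMap.ext fun x => zero_smul A (T.app x))

instance : IsScalarTower ℂ A (CBHom B X Y) :=
  ⟨fun c a T => CBHom.app_injective (LinearMap.ext fun x => smul_assoc c a (T.app x))⟩

instance cbHomLeftOpModule : LeftOpModule A (CBHom B X Y) where
  smul_le := fun a T => by
    rw [one_mul]
    refine cbNrm_le _ (mul_nonneg (mnorm_nonneg a) (cbNrm_nonneg T)) fun {k _} _ _ x => ?_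
    have e : ampMap (amp (fun (a : A) (v : CBHom B X Y) => a • v) a T) x =
        amp (fun (a : A) (v : Y) => a • v) (kronOne k a) (ampMap T x) := by
      classical
      ext p q
      simp only [ampMap, amp, kronOne, Fintype.sum_prod_type, Matrix.of_apply, map_sum, ite_smul,
        zero_smul, Finset.sum_ite_eq, Finset.mem_univ, if_true]
      rfl
    rw [e, mul_assoc]
    refine (LeftOpModule.smul_le _ _).trans ?_
    rw [one_mul]
    exact mul_le_mul (mnorm_kronOne_le a) (cbNrm_bound T x) (mnorm_nonneg _) (mnorm_nonneg _)

end left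

end CBHomComplete

/-! ### Functoriality and associativity of module tensor products -/

section functor

variable {A B : Type*} [NormedRing A] [NormedAlgebra ℂ A] [OperatorSpace A] [OperatorAlgebra A]
  [NormedRing B] [NormedAlgebra ℂ B] [OperatorSpace B] [OperatorAlgebra B]

section elementary

variable {X Y : Type*} [SeminormedAddCommGroup X] [NormedSpace ℂ X] [OperatorSpace X]
  [SeminormedAddCommGroup Y] [NormedSpace ℂ Y] [OperatorSpace Y] {N : Submodule ℂ (X ⊗[ℂ] Y)}

theorem left_smul_tm [Module A X] [IsScalarTower ℂ A X] [LeftOpModule A X] [LeftStable A N]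
    (a : A) (x : X) (y : Y) : a • tm N x y = tm N (a • x) y := by
  rw [tm, tm, ← Completion.coe_smul]; rfl

theorem right_smul_tm [Module Bᵐᵒᵖ Y] [IsScalarTower ℂ Bᵐᵒᵖ Y] [RightOpModule B Y]
    [RightStable B N] (b : B) (x : X) (y : Y) :
    MulOpposite.op b • tm N x y = tm N x (MulOpposite.op b • y) := by
  rw [tm, tm, ← Completion.coe_smul]; rfl

theorem tm_balanced [Module Aᵐᵒᵖ X] [IsScalarTower ℂ Aᵐᵒᵖ X] [Module A Y] [IsScalarTower ℂ A Y]
    (a : A) (x : X) (y : Y) :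
    tm (balanced A X Y) (MulOpposite.op a • x) y = tm (balanced A X Y) x (a • y) := by
  rw [← sub_eq_zero, tm, tm, ← Completion.coe_sub]
  exact coe_eq_zero_of_mem _ (Submodule.subset_span ⟨a, x, y, rfl⟩)

/-- Two bounded maps that agree on elementary tensors are equal. -/
theorem HT.clm_ext {Z : Type*} [NormedAddCommGroup Z] [NormedSpace ℂ Z] {f g : HT N →L[ℂ] Z}
    (h : ∀ x y, f (tm N x y) = g (tm N x y)) : f = g :=
  ContinuousLinearMap.ext fun u => HT.ext_tm (f := (f : HT N →+ Z)) (g := (g : HT N →+ Z))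
    f.continuous g.continuous h u

end elementary

section map

variable (P : Type*) [SeminormedAddCommGroup P] [NormedSpace ℂ P] [OperatorSpace P]
  [Module Aᵐᵒᵖ P] [IsScalarTower ℂ Aᵐᵒᵖ P]
  {M M' : Type*} [SeminormedAddCommGroup M] [NormedSpace ℂ M] [OperatorSpace M]
  [Module A M] [IsScalarTower ℂ A M]
  [SeminormedAddCommGroup M'] [NormedSpace ℂ M'] [OperatorSpace M']
  [Module A M'] [IsScalarTower ℂ A M']

theorem IsMB.tm_comp {N : Submodule ℂ (P ⊗[ℂ] M')} {f : M → M'} (hf : IsCB f) :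
    IsMB fun (p : P) (x : M) => tm N p (f x) := by
  obtain ⟨C, hC, hf⟩ := hf
  refine ⟨C, hC, fun p x => ?_⟩
  have h := tm_mb N p (x.map f)
  rw [one_mul] at h
  refine h.trans ?_
  rw [mul_left_comm]
  exact mul_le_mul_of_nonneg_left (hf x) (mnorm_nonneg _)

/-- The map `1 ⊗ f : P ⊗ M → P ⊗ M'` for a completely bounded left `A`-module map `f`. -/
def mapRight (f : M →ₗ[ℂ] M') (hf : IsCB f) (hA : ∀ (a : A) (x : M), f (a • x) = a • f x) :
    ModTensor A P M →L[ℂ] ModTensor A P M' :=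
  HT.lift ((tmₗ (balanced A P M')).compl₂ f) (IsMB.tm_comp P hf)
    (balanced_le_ker _ fun a p x => (tm_balanced a p (f x)).trans
      (congrArg (tm (balanced A P M') p) (hA a x).symm))

theorem mapRight_tm (f : M →ₗ[ℂ] M') (hf : IsCB f)
    (hA : ∀ (a : A) (x : M), f (a • x) = a • f x) (p : P) (x : M) :
    mapRight P f hf hA (tm _ p x) = tm _ p (f x) :=
  HT.lift_tm _ _ _ p x

end map

section assoc

variable {P Q R : Type*} [SeminormedAddCommGroup P] [NormedSpace ℂ P] [OperatorSpace P]
  [SeminormedAddCommGroup Q] [NormedSpace ℂ Q] [OperatorSpace Q]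
  [SeminormedAddCommGroup R] [NormedSpace ℂ R] [OperatorSpace R]
  [Module Aᵐᵒᵖ P] [IsScalarTower ℂ Aᵐᵒᵖ P]
  [Module A Q] [IsScalarTower ℂ A Q] [LeftOpModule A Q]
  [Module Bᵐᵒᵖ Q] [IsScalarTower ℂ Bᵐᵒᵖ Q] [SMulCommClass A Bᵐᵒᵖ Q] [RightOpModule B Q]
  [Module B R] [IsScalarTower ℂ B R]

/-- The pairing `(q, r) ↦ (p ⊗ q) ⊗ r`. -/
def assocPair (p : P) : Q →ₗ[ℂ] R →ₗ[ℂ] ModTensor B (ModTensor A P Q) R :=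
  (tmₗ (balanced B (ModTensor A P Q) R)).comp (tmₗ (balanced A P Q) p)

variable (B R) in
theorem tm_tm_mb {m k l n : Type} [Fintype m] [Fintype k] [Fintype l] [Fintype n]
    (p : Matrix m k P) (q : Matrix k l Q) (r : Matrix l n R) :
    mnorm (amp (tm (balanced B (ModTensor A P Q) R)) (amp (tm (balanced A P Q)) p q) r) ≤
      mnorm p * (mnorm q * mnorm r) := by
  have h1 := tm_mb (balanced B (ModTensor A P Q) R) (amp (tm (balanced A P Q)) p q) r
  have h2 := tm_mb (balanced A P Q) p q
  rw [one_mul] at h1 h2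
  refine h1.trans ?_
  rw [← mul_assoc]
  exact mul_le_mul_of_nonneg_right h2 (mnorm_nonneg _)

theorem assocPair_mb (p : P) : IsMB fun (q : Q) (r : R) => assocPair (A := A) (B := B) p q r := by
  refine ⟨‖p‖, norm_nonneg _, fun {m k n} _ _ _ q r => ?_⟩
  have h1 : CBWith (tm (balanced A P Q) p) ‖p‖ := fun {m n} _ _ x => by
    have h := mnorm_outer_le zero_le_one (tm_mb (balanced A P Q))
      (fun q => LinearMap.map_zero₂ (tmₗ (balanced A P Q)) q)
      (fun p => (tmₗ (balanced A P Q) p).map_zero) (fun _ _ : Unit => p) x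
    rw [one_mul, mnorm_unit] at h
    exact (mnorm_submatrix_le (fun i : m => ((), i)) (fun _ _ h => (Prod.mk.inj h).2)
      (fun j : n => ((), j)) (fun _ _ h => (Prod.mk.inj h).2)
      (outer (tm (balanced A P Q)) (fun _ _ : Unit => p) x)).trans h
  have h2 := tm_mb (balanced B (ModTensor A P Q) R) (q.map (tm (balanced A P Q) p)) r
  rw [one_mul] at h2
  refine h2.trans ?_
  rw [← mul_assoc]
  exact mul_le_mul_of_nonneg_right (h1 q) (mnorm_nonneg _)

/-- The map `q ⊗ r ↦ (p ⊗ q) ⊗ r`. -/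
def assocInner (p : P) : ModTensor B Q R →L[ℂ] ModTensor B (ModTensor A P Q) R :=
  HT.lift (assocPair p) (assocPair_mb p) (balanced_le_ker _ fun b q r =>
    (congrArg (fun t => tm (balanced B (ModTensor A P Q) R) t r)
      (right_smul_tm (N := balanced A P Q) b p q).symm).trans (tm_balanced b _ r))

theorem assocInner_tm (p : P) (q : Q) (r : R) :
    assocInner (A := A) (B := B) p (tm _ q r) = tm _ (tm _ p q) r :=
  HT.lift_tm _ _ _ q r

/-- The pairing `(p, q ⊗ r) ↦ (p ⊗ q) ⊗ r`. -/
def assocOuter : P →ₗ[ℂ] ModTensor B Q R →ₗ[ℂ] ModTensor B (ModTensor A P Q) R where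
  toFun p := (assocInner p).toLinearMap
  map_add' p p' := by
    have h : assocInner (A := A) (B := B) (Q := Q) (R := R) (p + p') =
        assocInner p + assocInner p' :=
      HT.clm_ext fun q r => by
        rw [add_apply, assocInner_tm, assocInner_tm, assocInner_tm,
          tm_add_left, tm_add_left]
    rw [h]; rfl
  map_smul' c p := by
    have h : assocInner (A := A) (B := B) (Q := Q) (R := R) (c • p) = c • assocInner p :=
      HT.clm_ext fun q r => by
        rw [smul_apply, assocInner_tm, assocInner_tm, tm_smul_left,
          tm_smul_left]
    rw [h]; rfl

theorem assocOuter_mb :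
    IsMB fun (p : P) (w : ModTensor B Q R) => assocOuter (A := A) (B := B) p w := by
  refine ⟨1, zero_le_one, fun {m k n} _ _ _ p w => ?_⟩
  rw [one_mul]
  have hc : Continuous fun w : Matrix k n (ModTensor B Q R) =>
      amp (fun (p : P) (w : ModTensor B Q R) => assocOuter (A := A) (B := B) p w) p w :=
    continuous_amp_right (fun p => (assocInner p).continuous) p
  refine compl_induction w (isClosed_le (continuous_mnorm.comp hc)
    (continuous_const.mul continuous_mnorm)) fun u => ?_
  simp only [Function.comp_apply, Pi.mul_apply]
  rw [mnorm_coe]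
  refine le_mul_csInf (mnorm_nonneg p) (haagerupSet_nonempty (N := balanced B Q R) u) ?_
  rintro _ ⟨l, _, q, r, hu, rfl⟩
  have e1 : (u.map fun v => (v : ModTensor B Q R)) = amp (tm (balanced B Q R)) q r := by
    ext i j
    have h := coe_eq_zero_of_mem (N := balanced B Q R) _ (hu i j)
    have h' : ((u i j : HAlg (balanced B Q R)) : ModTensor B Q R) -
        ((show HAlg (balanced B Q R) from odot q r i j : HAlg (balanced B Q R)) :
          ModTensor B Q R) = 0 := by
      rw [← Completion.coe_sub]; exact h
    rw [sub_eq_zero] at h'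
    exact h'.trans (map_sum (Completion.toCompl (α := HAlg (balanced B Q R))) _ _)
  have e2 : amp (fun (p : P) (w : ModTensor B Q R) => assocOuter (A := A) (B := B) p w) p
      (amp (tm (balanced B Q R)) q r) =
      amp (tm (balanced B (ModTensor A P Q) R)) (amp (tm (balanced A P Q)) p q) r := by
    refine (amp_assoc (f := tm (balanced B (ModTensor A P Q) R)) (g := tm (balanced A P Q))
      (h := fun (p : P) (w : ModTensor B Q R) => assocOuter (A := A) (B := B) p w)
      (p := tm (balanced B Q R)) p q r
      (fun r => ⟨((tmₗ (balanced B (ModTensor A P Q) R)).flip r).toAddMonoidHom, fun _ => rfl⟩)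
      (fun p => ⟨(assocOuter p).toAddMonoidHom, fun _ => rfl⟩) fun p q r => ?_).symm
    exact (assocInner_tm p q r).symm
  rw [e1, e2]
  exact tm_tm_mb B R p q r

theorem assocInner_balanced (a : A) (p : P) (w : ModTensor B Q R) :
    assocInner (A := A) (B := B) (MulOpposite.op a • p) w = assocInner p (a • w) := by
  refine HT.ext_tm (N := balanced B Q R) (Z := ModTensor B (ModTensor A P Q) R)
    (f := ((assocInner (MulOpposite.op a • p) :
      ModTensor B Q R →L[ℂ] ModTensor B (ModTensor A P Q) R) :
        ModTensor B Q R →+ ModTensor B (ModTensor A P Q) R))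
    (g := ((assocInner p : ModTensor B Q R →L[ℂ] ModTensor B (ModTensor A P Q) R) :
        ModTensor B Q R →+ ModTensor B (ModTensor A P Q) R).comp
      (DistribSMul.toAddMonoidHom (ModTensor B Q R) a))
    (assocInner _).continuous ((assocInner p).continuous.comp (continuous_const_smul a)) ?_ w
  intro q r
  show assocInner _ (tm _ q r) = assocInner p (a • tm _ q r)
  rw [left_smul_tm, assocInner_tm, assocInner_tm, tm_balanced]

/-- The associativity map `P ⊗ (Q ⊗ R) → (P ⊗ Q) ⊗ R`. -/
def assocMap : ModTensor A P (ModTensor B Q R) →L[ℂ] ModTensor B (ModTensor A P Q) R :=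
  HT.lift assocOuter assocOuter_mb (balanced_le_ker _ assocInner_balanced)

theorem assocMap_tm (p : P) (q : Q) (r : R) :
    assocMap (A := A) (B := B) (tm _ p (tm _ q r)) = tm _ (tm _ p q) r :=
  (HT.lift_tm _ _ _ p _).trans (assocInner_tm p q r)

end assoc

end functor


/-! ### Connections -/

section connections

variable (A : Type*) [NormedRing A] [NormedAlgebra ℂ A] [OperatorSpace A] [OperatorAlgebra A]
  (E : Type*) [SeminormedAddCommGroup E] [NormedSpace ℂ E] [OperatorSpace E]
  [Module Aᵐᵒᵖ E] [IsScalarTower ℂ Aᵐᵒᵖ E]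

/-- A universal connection on a right operator module: a completely bounded linear map
`∇ : E → E ⊗ Ω¹(A)` with `∇(ea) = ∇(e)a + e ⊗ da`. -/
structure UnivConnection where
  toFun : E →ₗ[ℂ] ModTensor A E (Omega1 A)
  cb : IsCB toFun
  leibniz : ∀ (e : E) (a : A),
    toFun (MulOpposite.op a • e) = MulOpposite.op a • toFun e + tm _ e (univD A a)

variable {A}

section formLift

variable {M : Type*} [NormedAddCommGroup M] [NormedSpace ℂ M] [OperatorSpace M] [CompleteSpace M]
  [Module A M] [IsScalarTower ℂ A M] [LeftOpModule A M]

theorem IsMB.smul_comp {δ : A → M} (h : IsCB δ) : IsMB fun a b : A => a • δ b := by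
  obtain ⟨C, hC, h⟩ := h
  refine ⟨C, hC, fun a b => ((LeftOpModule.smul_le a (b.map δ)).trans_eq (one_mul _)).trans ?_⟩
  rw [mul_left_comm]
  exact mul_le_mul_of_nonneg_left (h b) (mnorm_nonneg _)

/-- The map `A ⊗ A → M`, `a ⊗ b ↦ a δ(b)`. -/
def formPre (δ : A →ₗ[ℂ] M) (h : IsCB δ) : HTensor A A →L[ℂ] M :=
  HT.lift ((Algebra.lsmul ℂ ℂ M : A →ₐ[ℂ] Module.End ℂ M).toLinearMap.compl₂ δ)
    (IsMB.smul_comp h) bot_le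

theorem formPre_tm (δ : A →ₗ[ℂ] M) (h : IsCB δ) (a b : A) :
    formPre δ h (tm ⊥ a b) = a • δ b := HT.lift_tm _ _ _ a b

/-- The map `Ω¹(A) → M` induced by a completely bounded derivation `δ : A → M`, that is, the
restriction to `Ω¹(A)` of `a ⊗ b ↦ a δ(b)`. It is the bimodule map with `da ↦ δ(a)`. -/
def formLift (δ : A →ₗ[ℂ] M) (h : IsCB δ) : Omega1 A →L[ℂ] M :=
  (formPre δ h).comp (omegaIncl A)

theorem formLift_smul_d (δ : A →ₗ[ℂ] M) (h : IsCB δ) (h1 : δ 1 = 0) (a b : A) :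
    formLift δ h (a • univD A b) = a • δ b := by
  show formPre δ h (a • (tm ⊥ 1 b - tm ⊥ b 1)) = a • δ b
  rw [smul_sub, smul_tm, smul_tm, map_sub, formPre_tm, formPre_tm, h1]
  simp

theorem formLift_cb (δ : A →ₗ[ℂ] M) (h : IsCB δ) : IsCB (formLift δ h) := by
  obtain ⟨C, hC, hb⟩ := HT.lift_cb (N := ⊥)
    ((Algebra.lsmul ℂ ℂ M : A →ₐ[ℂ] Module.End ℂ M).toLinearMap.compl₂ δ)
    (IsMB.smul_comp h) bot_le
  exact ⟨C, hC, fun x => hb (x.map (omegaIncl A))⟩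

theorem formLift_smul (δ : A →ₗ[ℂ] M) (h : IsCB δ) (a : A) (ω : Omega1 A) :
    formLift δ h (a • ω) = a • formLift δ h ω := by
  show formPre δ h (a • omegaIncl A ω) = a • formPre δ h (omegaIncl A ω)
  refine HT.ext_tm (N := (⊥ : Submodule ℂ (A ⊗[ℂ] A))) (Z := M)
    (f := (formPre δ h : HTensor A A →+ M).comp (DistribSMul.toAddMonoidHom (HTensor A A) a))
    (g := (DistribSMul.toAddMonoidHom M a).comp (formPre δ h : HTensor A A →+ M))
    ((formPre δ h).continuous.comp (continuous_const_smul a))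
    ((continuous_const_smul a).comp (formPre δ h).continuous) ?_ (omegaIncl A ω)
  intro b c
  show formPre δ h (a • tm ⊥ b c) = a • formPre δ h (tm ⊥ b c)
  rw [smul_tm, formPre_tm, formPre_tm, mul_smul]

end formLift

end connections

/-! ### Product connections -/

section product

variable {A B : Type*} [NormedRing A] [NormedAlgebra ℂ A] [OperatorSpace A] [OperatorAlgebra A]
  [NormedRing B] [NormedAlgebra ℂ B] [OperatorSpace B] [OperatorAlgebra B]
  {P Q : Type*} [SeminormedAddCommGroup P] [NormedSpace ℂ P] [OperatorSpace P]
  [SeminormedAddCommGroup Q] [NormedSpace ℂ Q] [OperatorSpace Q]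
  [Module Aᵐᵒᵖ P] [IsScalarTower ℂ Aᵐᵒᵖ P]
  [Module A Q] [IsScalarTower ℂ A Q] [LeftOpModule A Q]
  [Module Bᵐᵒᵖ Q] [IsScalarTower ℂ Bᵐᵒᵖ Q] [SMulCommClass A Bᵐᵒᵖ Q] [RightOpModule B Q]

/-- The values of `q ↦ ∇'(aq) - a∇'(q)`, as a bilinear map in `a` and `q`. -/
def commAux (D : UnivConnection B Q) : A →ₗ[ℂ] Q →ₗ[ℂ] ModTensor B Q (Omega1 B) :=
  LinearMap.mk₂ ℂ (fun a q => D.toFun (a • q) - a • D.toFun q)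
    (fun a a' q => by rw [add_smul, add_smul, map_add]; abel)
    (fun c a q => by rw [smul_assoc, smul_assoc, map_smul, smul_sub])
    (fun a q q' => by rw [smul_add, map_add, map_add, smul_add]; abel)
    (fun c a q => by rw [smul_comm a c q, map_smul, map_smul D.toFun, smul_comm a c (D.toFun q), smul_sub])

theorem commAux_apply (D : UnivConnection B Q) (a : A) (q : Q) :
    commAux D a q = D.toFun (a • q) - a • D.toFun q := rfl

theorem commAux_bound (D : UnivConnection B Q) : ∃ C : ℝ, 0 ≤ C ∧
    ∀ {m n k l : Type} [Fintype m] [Fintype n] [Fintype k] [Fintype l] (a : Matrix m n A)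
      (q : Matrix k l Q), mnorm (outer (fun a q => commAux D a q) a q) ≤
        C * mnorm a * mnorm q := by
  obtain ⟨C, hC, hD⟩ := D.cb
  refine ⟨C + C, add_nonneg hC hC, fun {m n k l} _ _ _ _ a q => ?_⟩
  have e : outer (fun a q => commAux D a q) a q =
      (outer (fun (a : A) (q : Q) => a • q) a q).map D.toFun -
        outer (fun (a : A) (w : ModTensor B Q (Omega1 B)) => a • w) a (q.map D.toFun) := by
    ext i j; rfl
  have h1 := mnorm_outer_le zero_le_one (LeftOpModule.smul_le (A := A) (X := Q))
    (fun y => zero_smul A y) (fun a => smul_zero a) a q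
  have h2 := mnorm_outer_le zero_le_one
    (LeftOpModule.smul_le (A := A) (X := ModTensor B Q (Omega1 B)))
    (fun y => zero_smul A y) (fun a => smul_zero a) a (q.map D.toFun)
  rw [one_mul] at h1 h2
  rw [e]
  refine (mnorm_sub_le _ _).trans ?_
  have h3 := (hD (outer (fun (a : A) (q : Q) => a • q) a q)).trans
    (mul_le_mul_of_nonneg_left h1 hC)
  have h4 := h2.trans (mul_le_mul_of_nonneg_left (hD q) (mnorm_nonneg a))
  refine (add_le_add h3 h4).trans (le_of_eq (by ring))

/-- The derivation `a ↦ [∇', a]` with values in the completely bounded `B`-module maps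
`Q → Q ⊗ Ω¹(B)`. -/
def commutator (D : UnivConnection B Q) : A →ₗ[ℂ] CBHom B Q (ModTensor B Q (Omega1 B)) :=
  LinearMap.codRestrict (cbHomSub B Q (ModTensor B Q (Omega1 B))) (commAux D) fun a => by
    obtain ⟨C, hC, hb⟩ := commAux_bound (A := A) D
    refine ⟨⟨C * ‖a‖, mul_nonneg hC (norm_nonneg _), fun {m n} _ _ x => ?_⟩, fun b q => ?_⟩
    · have h := hb (fun _ _ : Unit => a) x
      rw [mnorm_unit] at h
      exact (mnorm_submatrix_le (fun i : m => ((), i)) (fun _ _ h => (Prod.mk.inj h).2)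
        (fun j : n => ((), j)) (fun _ _ h => (Prod.mk.inj h).2)
        (outer (fun a q => commAux D a q) (fun _ _ : Unit => a) x)).trans h
    · rw [commAux_apply, commAux_apply, smul_comm a (MulOpposite.op b) q, D.leibniz, D.leibniz,
        smul_add, left_smul_tm, smul_sub, smul_comm a (MulOpposite.op b) (D.toFun q)]
      abel

theorem commutator_app (D : UnivConnection B Q) (a : A) (q : Q) :
    (commutator D a).app q = D.toFun (a • q) - a • D.toFun q := rfl

theorem commutator_cb (D : UnivConnection B Q) : IsCB (commutator (A := A) D) := by
  obtain ⟨C, hC, hb⟩ := commAux_bound (A := A) D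
  refine ⟨C, hC, fun a => cbNrm_le _ (mul_nonneg hC (mnorm_nonneg a)) fun x => hb a x⟩

/-- The map `∇_δ : P → P ⊗ CB_B(Q, Q ⊗ Ω¹(B))` induced by a universal connection `∇` on `P` and the
derivation `δ = [∇', ·]`. -/
def inducedConn (D : UnivConnection A P) (D' : UnivConnection B Q) :
    P →ₗ[ℂ] ModTensor A P (CBHom B Q (ModTensor B Q (Omega1 B))) :=
  (mapRight P (formLift (commutator D') (commutator_cb D')).toLinearMap
    (formLift_cb _ _) (formLift_smul _ _)).toLinearMap.comp D.toFun

variable (A B P) in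
/-- The evaluation `p ⊗ T ↦ p ⊗ T(q)`. -/
def evalRight (q : Q) : ModTensor A P (CBHom B Q (ModTensor B Q (Omega1 B))) →L[ℂ]
    ModTensor A P (ModTensor B Q (Omega1 B)) :=
  mapRight P (CBHom.eval q) ⟨‖q‖, norm_nonneg q, CBHom.eval_cb q⟩ fun _ _ => rfl

/-- `D''` is the product connection of `D` and `D'`: it sends `p ⊗ q` to
`p ⊗ ∇'(q) + ∇_δ(p)q`. -/
def IsProduct (D : UnivConnection A P) (D' : UnivConnection B Q)
    (D'' : UnivConnection B (ModTensor A P Q)) : Prop :=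
  ∀ (p : P) (q : Q), D''.toFun (tm _ p q) =
    assocMap (tm _ p (D'.toFun q) + evalRight A B P q (inducedConn D D' p))

end product

/-! ### Rigged and projective modules -/

section rigged

variable (A : Type*) [NormedRing A] [NormedAlgebra ℂ A] [OperatorSpace A] [OperatorAlgebra A]
  (E : Type*) [SeminormedAddCommGroup E] [NormedSpace ℂ E] [OperatorSpace E]
  [Module Aᵐᵒᵖ E] [IsScalarTower ℂ Aᵐᵒᵖ E]

variable {A} in
/-- A matrix over the column space `Aⁿ`, seen as a matrix over `A`. The operator space `Aⁿ` is the
space of `n × 1` matrices over `A`. -/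
def flat {k l : Type} {n : ℕ} (x : Matrix k l (Fin n → A)) : Matrix (k × Fin n) l A :=
  Matrix.of fun p j => x p.1 j p.2

/-- Rigged modules: there are completely contractive module maps `φᵢ : E → A^{nᵢ}` and
`ψᵢ : A^{nᵢ} → E` with `ψᵢ φᵢ → 1` strongly, and `φⱼ ψᵢ φᵢ → φⱼ` uniformly for every `j`. -/
def IsRigged : Prop :=
  ∃ (n : ℕ → ℕ) (φ : ∀ i, E →ₗ[ℂ] (Fin (n i) → A)) (ψ : ∀ i, (Fin (n i) → A) →ₗ[ℂ] E),
    (∀ i, 0 < n i) ∧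
    (∀ i (a : A) (e : E), φ i (MulOpposite.op a • e) = MulOpposite.op a • φ i e) ∧
    (∀ i (a : A) (v : Fin (n i) → A),
      ψ i (MulOpposite.op a • v) = MulOpposite.op a • ψ i v) ∧
    (∀ i {k l : Type} [Fintype k] [Fintype l] (x : Matrix k l E),
      mnorm (flat (x.map (φ i))) ≤ mnorm x) ∧
    (∀ i {k l : Type} [Fintype k] [Fintype l] (v : Matrix k l (Fin (n i) → A)),
      mnorm (v.map (ψ i)) ≤ mnorm (flat v)) ∧
    (∀ e : E, Filter.Tendsto (fun i => ψ i (φ i e)) Filter.atTop (nhds e)) ∧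
    (∀ j, ∀ ε > 0, ∃ N, ∀ i ≥ N, ∀ e : E,
      mnorm (flat (fun _ _ : Unit => φ j (ψ i (φ i e)) - φ j e)) ≤ ε * ‖e‖)

/-- Projective rigged modules: rigged modules that are completely isometric to a direct summand
of `H ⊗ A` for a separable Hilbert space `H`. The summand is given by its inclusion `ι` and by the
completely contractive projection `π` onto it. -/
def IsProjectiveRigged : Prop :=
  IsRigged A E ∧
  ∃ (H : Type) (_ : NormedAddCommGroup H) (_ : InnerProductSpace ℂ H) (_ : CompleteSpace H)
    (_ : TopologicalSpace.SeparableSpace H)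
    (ι : E →ₗ[ℂ] HTensor (Column H) A) (π : HTensor (Column H) A →ₗ[ℂ] E),
    IsCI ι ∧ IsCC π ∧
    (∀ (a : A) (e : E), ι (MulOpposite.op a • e) = MulOpposite.op a • ι e) ∧
    (∀ (a : A) (v : HTensor (Column H) A), π (MulOpposite.op a • v) = MulOpposite.op a • π v) ∧
    ∀ e, π (ι e) = e

end rigged

/-! ### Hermitian connections -/

section hermitian

variable (A : Type*) [NormedRing A] [NormedAlgebra ℂ A] [OperatorSpace A] [OperatorAlgebra A]
  [StarRing A] [StarModule ℂ A]
  {E : Type*} [SeminormedAddCommGroup E] [NormedSpace ℂ E] [OperatorSpace E]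
  [Module Aᵐᵒᵖ E] [IsScalarTower ℂ Aᵐᵒᵖ E]

/-- The matrix norms of `A` are those of a C*-algebra: `‖x*x‖ = ‖x‖²` for all matrices. -/
def IsCStar : Prop :=
  ∀ {m n : Type} [Fintype m] [Fintype n] (x : Matrix m n A),
    mnorm (x.conjTranspose * x) = mnorm x ^ 2

variable {A}

/-- `ip` is an `A`-valued inner product that makes `E` a right C*-module, with the given matrix
norms as the canonical ones. -/
structure IsCStarModule (ip : E → E → A) : Prop where
  add_right : ∀ e f g, ip e (f + g) = ip e f + ip e g
  smul_right : ∀ (c : ℂ) (e f : E), ip e (c • f) = c • ip e f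
  op_smul_right : ∀ (a : A) (e f : E), ip e (MulOpposite.op a • f) = ip e f * a
  star_ip : ∀ e f, star (ip e f) = ip f e
  nonneg : ∀ e, ∃ b, ip e e = star b * b
  definite : ∀ e, ip e e = 0 → e = 0
  mnorm_sq : ∀ {m n : Type} [Fintype m] [Fintype n] (x : Matrix m n E),
    mnorm x ^ 2 = mnorm (Matrix.of fun i j : n => ∑ k, ip (x k i) (x k j))

/-- `∇` is Hermitian: `⟨e, ∇f⟩ - ⟨∇e, f⟩ = d⟨e, f⟩`. Here `inv` is the involution
`(a db)* = -d(b*) a*` of `Ω¹(A)`, `pair e` is the pairing `f ⊗ ω ↦ ⟨e, f⟩ω`, and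
`⟨∇e, f⟩ = ⟨f, ∇e⟩*`. Both maps are determined by these formulas. -/
def IsHermitian (ip : E → E → A) (D : UnivConnection A E) : Prop :=
  ∃ (inv : Omega1 A →L⋆[ℂ] Omega1 A) (pair : E → (ModTensor A E (Omega1 A) →L[ℂ] Omega1 A)),
    (∀ a b : A, inv (a • univD A b) = -(MulOpposite.op (star a) • univD A (star b))) ∧
    (∀ (e f : E) (ω : Omega1 A), pair e (tm _ f ω) = ip e f • ω) ∧
    ∀ e f : E, pair e (D.toFun f) - inv (pair f (D.toFun e)) = univD A (ip e f)

end hermitian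

end

end OpMod

namespace OpMod

noncomputable section

/-! ### Bounds for pairings and for maps on tensor products -/

section general

variable {X Y Z W : Type*} [SeminormedAddCommGroup X] [NormedSpace ℂ X] [OperatorSpace X]
  [SeminormedAddCommGroup Y] [NormedSpace ℂ Y] [OperatorSpace Y]
  [SeminormedAddCommGroup Z] [NormedSpace ℂ Z] [OperatorSpace Z]
  [SeminormedAddCommGroup W] [NormedSpace ℂ W] [OperatorSpace W]
  {N : Submodule ℂ (X ⊗[ℂ] Y)} {m n k l : Type} [Fintype m] [Fintype n] [Fintype k] [Fintype l]

/-! A projective rigged module is the range of a completely contractive idempotent module map `T =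
ιπ` on `H ⊗ A`, with `H` separable. Everything is computed in coordinates. For a basis `e` of `H`
let `P_N` be the truncation to the first `N` coordinates. Then `P_N v` is the row `(e_s ⊗ 1)`, of
norm at most one, times the column of coordinates of `v`, of norm at most `‖v‖`, and `P_N → 1`
strongly. Haagerup norms are infima over such row-times-column forms, so completely contractive
bounds come out of this picture.

Projectivity of `P ⊗_A Q`. The pairing `(h ⊗ a, q) ↦ h ⊙ ι'(aq)` gives a completely contractive map
`P ⊗_A Q → (H ⊗ H') ⊗ B` (`inclTensor`). The map `h ⊙ w ↦ π(h ⊗ 1) ⊗ π'(w)` is a completely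
contractive left inverse (`exists_projTensor`), so the first map is completely isometric and its
range is a direct summand.

Riggedness. The coordinates of `ι` and their synthesis followed by `π` serve as `φ` and `ψ`, and
strong convergence is clear. Convergence in norm of `φ_j ψ_i φ_i` amounts to `P_M T P_N → P_M T` in
norm. The columns `(1 - P_N) T P_M` are small because only finitely many vectors are involved, but
over a general operator algebra there is no adjoint that would turn columns into rows. The
substitute is that the reflection `U = 1 - 2T` is contractive (`norm_reflection_le`). To see this, a
plane rotation mixes one entry of a long column with an auxiliary entry, `T` acts on the auxiliary
entry, and the auxiliary entry is chosen so that it returns to itself. Repeating this over `n`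
entries and letting `n → ∞` bounds the stationary transformation of a single entry, whose limit is
`U`. Now let `g'` be killed by `P_N` and put `w = P_M U g'`. The vector `U(cw)` lies almost in the
range of `P_N`, so by the Pythagorean inequality adding `g'` raises the square of the norm by a
bounded amount. Applying `P_M U` again turns `cw` into `(c + 1)w`. Hence `‖nw‖²` grows at most
linearly in `n`, and `w` is of order `n^(-1/2)` (`trunc_reflection_le`).

The connection. The term `∇_δ(p)q` has to be bounded in `p` and `q` jointly on matrix products, so
the evaluation `(T, q) ↦ T(q)` must have this bound. On a column summand it does: `T` is determined
on truncations by its values on the row of basis vectors, and `T(q)` becomes a row times a column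
(`CBHom.app_mb`). The pairing `p ⊗ ∇'q + ∇_δ(p)q` is balanced because the failure of `p ⊗ ∇'q` to be
balanced is `p ⊗ δ(a)q`, which is also the Leibniz term of `∇_δ` (`sumPair_balanced`).

C*-modules. The matrix norms determine the inner product (`IsCStarModule.unique`), so the inner
products of `P` and `Q` are the restrictions of those of `H ⊗ A` and `H' ⊗ B`, and `P ⊗_A Q`
inherits one from `(H ⊗ H') ⊗ B`. For the Hermitian property, the commutator representation `j_δ` of
forms respects the involutions (`inv_formLift_app`). On elementary tensors the identity for `∇''` is
then that for `∇`, transported by `j_δ`, added to that for `∇'`. -/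

theorem mnorm_smul (c : ℂ) (x : Matrix m n X) : mnorm (c • x) = ‖c‖ * mnorm x :=
  MatSeminorm.nrm_smul _ c x

theorem mnorm_zero : mnorm (0 : Matrix m n X) = 0 := MatSeminorm.nrm_zero _

/-- A column with two blocks is bounded by the root of the sum of the squares. -/
theorem mnorm_fromRows_sq_le (x : Matrix k n X) (y : Matrix l n X) :
    mnorm (Matrix.fromRows x y) ^ 2 ≤ mnorm x ^ 2 + mnorm y ^ 2 := by
  -- The block bound requires strictly positive bounds on the two blocks. Both norms are enlarged by
  -- `t`, and `t` tends to zero at the end.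
  have h : ∀ t > 0, mnorm (Matrix.fromRows x y) ^ 2 ≤ (mnorm x + t) ^ 2 + (mnorm y + t) ^ 2 := by
    intro t ht
    have hx := mnorm_nonneg x
    have hy := mnorm_nonneg y
    have := MatSeminorm.nrm_fromRows_le (OperatorSpace.mat (X := X)) (x := x) (y := y)
      (a := mnorm x + t) (b := mnorm y + t) (by linarith) (by linarith)
      (show mnorm x ≤ mnorm x + t by linarith) (show mnorm y ≤ mnorm y + t by linarith)
    rw [← Real.sqrt_le_sqrt_iff (by positivity), Real.sqrt_sq (mnorm_nonneg _)]
    exact this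
  have hc : Filter.Tendsto (fun t : ℝ => (mnorm x + t) ^ 2 + (mnorm y + t) ^ 2)
      (nhdsWithin 0 (Set.Ioi 0)) (nhds ((mnorm x + 0) ^ 2 + (mnorm y + 0) ^ 2)) :=
    ((by fun_prop : Continuous fun t : ℝ => (mnorm x + t) ^ 2 + (mnorm y + t) ^ 2).tendsto
      0).mono_left nhdsWithin_le_nhds
  simp only [add_zero] at hc
  exact ge_of_tendsto hc (Filter.eventually_of_mem self_mem_nhdsWithin fun t ht => h t ht)

theorem mnorm_fromCols_sq_le (x : Matrix m k X) (y : Matrix m l X) :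
    mnorm (Matrix.fromCols x y) ^ 2 ≤ mnorm x ^ 2 + mnorm y ^ 2 := by
  have h : ∀ t > 0, mnorm (Matrix.fromCols x y) ^ 2 ≤ (mnorm x + t) ^ 2 + (mnorm y + t) ^ 2 := by
    intro t ht
    have hx := mnorm_nonneg x
    have hy := mnorm_nonneg y
    have := MatSeminorm.nrm_fromCols_le (OperatorSpace.mat (X := X)) (x := x) (y := y)
      (a := mnorm x + t) (b := mnorm y + t) (by linarith) (by linarith)
      (show mnorm x ≤ mnorm x + t by linarith) (show mnorm y ≤ mnorm y + t by linarith)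
    rw [← Real.sqrt_le_sqrt_iff (by positivity), Real.sqrt_sq (mnorm_nonneg _)]
    exact this
  have hc : Filter.Tendsto (fun t : ℝ => (mnorm x + t) ^ 2 + (mnorm y + t) ^ 2)
      (nhdsWithin 0 (Set.Ioi 0)) (nhds ((mnorm x + 0) ^ 2 + (mnorm y + 0) ^ 2)) :=
    ((by fun_prop : Continuous fun t : ℝ => (mnorm x + t) ^ 2 + (mnorm y + t) ^ 2).tendsto
      0).mono_left nhdsWithin_le_nhds
  simp only [add_zero] at hc
  exact ge_of_tendsto hc (Filter.eventually_of_mem self_mem_nhdsWithin fun t ht => h t ht)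

theorem MBWith.cbWith_right {f : X → Y → Z} {C : ℝ} (hC : 0 ≤ C) (hf : MBWith f C)
    (h0 : ∀ y, f 0 y = 0) (h0' : ∀ x, f x 0 = 0) (x : X) : CBWith (f x) (C * ‖x‖) := by
  intro m n _ _ y
  have h := mnorm_outer_le hC hf h0 h0' (fun _ _ : Unit => x) y
  rw [mnorm_unit, ← mul_assoc] at h
  exact (mnorm_submatrix_le (fun i : m => ((), i)) (fun _ _ h => (Prod.mk.inj h).2)
    (fun j : n => ((), j)) (fun _ _ h => (Prod.mk.inj h).2)
    (outer f (fun _ _ : Unit => x) y)).trans h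

theorem MBWith.cbWith_left {f : X → Y → Z} {C : ℝ} (hC : 0 ≤ C) (hf : MBWith f C)
    (h0 : ∀ y, f 0 y = 0) (h0' : ∀ x, f x 0 = 0) (y : Y) :
    CBWith (fun x => f x y) (C * ‖y‖) := by
  intro m n _ _ x
  have h := mnorm_outer_le hC hf h0 h0' x (fun _ _ : Unit => y)
  rw [mnorm_unit, mul_comm (mnorm x), ← mul_assoc] at h
  exact (mnorm_submatrix_le (fun i : m => (i, ())) (fun _ _ h => (Prod.mk.inj h).1)
    (fun j : n => (j, ())) (fun _ _ h => (Prod.mk.inj h).1)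
    (outer f x (fun _ _ : Unit => y))).trans h

theorem coe_odot (x : Matrix m k X) (y : Matrix k n Y) (i : m) (j : n) :
    ((show HAlg N from odot x y i j : HAlg N) : HT N) = amp (tm N) x y i j :=
  map_sum (Completion.toCompl (α := HAlg N)) _ _

theorem coe_eq_of_sub_mem {u v : X ⊗[ℂ] Y} (h : u - v ∈ N) :
    ((show HAlg N from u : HAlg N) : HT N) = ((show HAlg N from v : HAlg N) : HT N) := by
  rw [← sub_eq_zero, ← Completion.coe_sub]
  exact coe_eq_zero_of_mem (N := N) _ h

/-- A continuous function on matrices over a tensor product is bounded by a multiple of the norm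
if it is bounded in this way on matrix products. -/
theorem HT.le_of_amp {F : Matrix m n (HT N) → ℝ} (hF : Continuous F) {C : ℝ} (hC : 0 ≤ C)
    (h : ∀ {k : Type} [Fintype k] (x : Matrix m k X) (y : Matrix k n Y),
      F (amp (tm N) x y) ≤ C * (mnorm x * mnorm y)) (u : Matrix m n (HT N)) :
    F u ≤ C * mnorm u := by
  refine compl_induction u (isClosed_le hF (continuous_const.mul continuous_mnorm)) fun v => ?_
  show F (v.map fun v => (v : HT N)) ≤ C * mnorm (v.map fun v => (v : HT N))
  rw [mnorm_coe]
  refine le_mul_csInf hC (haagerupSet_nonempty (N := N) v) ?_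
  rintro _ ⟨k, _, x, y, hu, rfl⟩
  -- The matrix `v` and its factorization differ by elements of `N`, which become zero in the
  -- completion.
  refine le_trans (le_of_eq ?_) (h x y)
  congr 1
  ext i j
  exact (coe_eq_of_sub_mem (N := N) (hu i j)).trans (coe_odot x y i j)

theorem continuous_map {f : X → Y} (hf : Continuous f) :
    Continuous fun x : Matrix m n X => x.map f :=
  continuous_pi fun i => continuous_pi fun j => hf.comp (continuous_apply_apply i j)

theorem map_amp {F : Type*} [FunLike F Z W] [AddMonoidHomClass F Z W] (g : F)
    (f : X → Y → Z) (x : Matrix m k X) (y : Matrix k n Y) :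
    (amp f x y).map g = amp (fun a b => g (f a b)) x y := by
  ext i j
  simp only [Matrix.map_apply, amp, map_sum]

/-- A continuous linear map on a tensor product that comes from a bounded pairing is completely
bounded, with the same bound. -/
theorem HT.cbWith {f : HT N →ₗ[ℂ] W} (hc : Continuous f) {C : ℝ} (hC : 0 ≤ C)
    (h : MBWith (fun x y => f (tm N x y)) C) : CBWith f C := by
  intro m n _ _ u
  refine HT.le_of_amp (F := fun u => mnorm (u.map f)) (continuous_mnorm.comp
    (continuous_map hc)) hC (fun x y => ?_) u
  refine (le_of_eq (congrArg mnorm ?_)).trans (h x y)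
  exact map_amp f (tm N) x y

/-- A pairing on `(X ⊗ Y) × Z` is bounded on matrix products if this is so for the corresponding
triple products. -/
theorem HT.mbWith_left {G : HT N → Z → W} (hc : ∀ z, Continuous fun u => G u z)
    (hadd : ∀ z, ∃ g : HT N →+ W, ∀ u, g u = G u z) {C : ℝ} (hC : 0 ≤ C)
    (h : ∀ {m k l n : Type} [Fintype m] [Fintype k] [Fintype l] [Fintype n] (x : Matrix m k X)
      (y : Matrix k l Y) (z : Matrix l n Z),
      mnorm (Matrix.of fun i j => ∑ s, ∑ t, G (tm N (x i s) (y s t)) (z t j)) ≤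
        C * (mnorm x * (mnorm y * mnorm z))) : MBWith G C := by
  intro m k n _ _ _ u z
  rw [mul_comm (mnorm u), ← mul_assoc]
  refine HT.le_of_amp (F := fun u => mnorm (amp G u z)) (continuous_mnorm.comp
    (continuous_amp_left hc z)) (mul_nonneg hC (mnorm_nonneg z)) (fun x y => ?_) u
  refine le_trans (le_of_eq ?_) ((h x y z).trans (le_of_eq (by ring)))
  congr 1
  ext i j
  choose g hg using hadd
  simp only [amp, Matrix.of_apply, ← hg, map_sum]
  exact Finset.sum_comm

/-- A pairing on `Z × (X ⊗ Y)` is bounded on matrix products if this is so for the corresponding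
triple products. -/
theorem HT.mbWith_right {G : Z → HT N → W} (hc : ∀ z, Continuous (G z))
    (hadd : ∀ z, ∃ g : HT N →+ W, ∀ u, g u = G z u) {C : ℝ} (hC : 0 ≤ C)
    (h : ∀ {m k l n : Type} [Fintype m] [Fintype k] [Fintype l] [Fintype n] (z : Matrix m k Z)
      (x : Matrix k l X) (y : Matrix l n Y),
      mnorm (Matrix.of fun i j => ∑ s, ∑ t, G (z i s) (tm N (x s t) (y t j))) ≤
        C * (mnorm z * (mnorm x * mnorm y))) : MBWith G C := by
  intro m k n _ _ _ z u
  rw [← mul_assoc]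
  refine HT.le_of_amp (F := fun u => mnorm (amp G z u)) (continuous_mnorm.comp
    (continuous_amp_right hc z)) (mul_nonneg hC (mnorm_nonneg z)) (fun x y => ?_) u
  refine le_trans (le_of_eq ?_) ((h z x y).trans (le_of_eq (by ring)))
  congr 1
  ext i j
  choose g hg using hadd
  simp only [amp, Matrix.of_apply, ← hg, map_sum]

end general

section lift

variable {X Y Z : Type*} [SeminormedAddCommGroup X] [NormedSpace ℂ X] [OperatorSpace X]
  [SeminormedAddCommGroup Y] [NormedSpace ℂ Y] [OperatorSpace Y]
  [NormedAddCommGroup Z] [NormedSpace ℂ Z] [OperatorSpace Z]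
  {N : Submodule ℂ (X ⊗[ℂ] Y)}

theorem HT.lift_cbWith [CompleteSpace Z] (φ : X →ₗ[ℂ] Y →ₗ[ℂ] Z) (hφ : IsMB fun x y => φ x y)
    (hN : N ≤ LinearMap.ker (TensorProduct.lift φ)) {C : ℝ} (hC : 0 ≤ C)
    (h : MBWith (fun x y => φ x y) C) : CBWith (HT.lift φ hφ hN) C :=
  HT.cbWith (f := (HT.lift φ hφ hN).toLinearMap) (HT.lift φ hφ hN).continuous hC
    fun x y => by
      simp only [ContinuousLinearMap.coe_coe, HT.lift_tm]
      exact h x y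

theorem CBWith.continuous {f : X →ₗ[ℂ] Y} {C : ℝ} (h : CBWith f C) : Continuous f :=
  (f.mkContinuous C h.norm_le).continuous

theorem IsCB.continuous {f : X →ₗ[ℂ] Y} (h : IsCB f) : Continuous f :=
  CBWith.continuous h.choose_spec.2

end lift

section tensor

variable {X Y : Type*} [SeminormedAddCommGroup X] [NormedSpace ℂ X] [OperatorSpace X]
  [SeminormedAddCommGroup Y] [NormedSpace ℂ Y] [OperatorSpace Y]
  {N : Submodule ℂ (X ⊗[ℂ] Y)}

theorem tm_zero_left (y : Y) : tm N 0 y = 0 := LinearMap.map_zero₂ (tmₗ N) y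

theorem tm_zero_right (x : X) : tm N x 0 = 0 := (tmₗ N x).map_zero

theorem tm_cbWith_right (x : X) : CBWith (tm N x) ‖x‖ := fun {m n} _ _ y => by
  have h := MBWith.cbWith_right zero_le_one (tm_mb N) tm_zero_left tm_zero_right x y
  rwa [one_mul] at h

theorem tm_cbWith_left (y : Y) : CBWith (fun x => tm N x y) ‖y‖ := fun {m n} _ _ x => by
  have h := MBWith.cbWith_left zero_le_one (tm_mb N) tm_zero_left tm_zero_right y x
  rwa [one_mul] at h

theorem continuous_tm_right (x : X) : Continuous (tm N x) :=
  CBWith.continuous (f := tmₗ N x) (tm_cbWith_right x)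

theorem continuous_tm_left (y : Y) : Continuous fun x => tm N x y :=
  CBWith.continuous (f := (tmₗ N).flip y) (tm_cbWith_left y)

end tensor

/-! ### Coordinates on `H ⊗ A` -/

section density

variable {X Y : Type*} [SeminormedAddCommGroup X] [NormedSpace ℂ X] [OperatorSpace X]
  [SeminormedAddCommGroup Y] [NormedSpace ℂ Y] [OperatorSpace Y] {N : Submodule ℂ (X ⊗[ℂ] Y)}

/-- Closed additive properties can be checked on elementary tensors. -/
theorem HT.induction {p : HT N → Prop} (hc : IsClosed {u | p u}) (h0 : p 0)
    (hadd : ∀ u v, p u → p v → p (u + v)) (htm : ∀ x y, p (tm N x y)) (u : HT N) : p u := by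
  refine Completion.induction_on u hc fun v => ?_
  refine TensorProduct.induction_on (motive := fun v : X ⊗[ℂ] Y =>
    p ((show HAlg N from v : HAlg N) : HT N)) v ?_ htm ?_
  · have e : ((show HAlg N from (0 : X ⊗[ℂ] Y) : HAlg N) : HT N) = 0 := Completion.coe_zero
    rwa [e]
  · intro x y hx hy
    have e : ((show HAlg N from x + y : HAlg N) : HT N) =
      ((show HAlg N from x : HAlg N) : HT N) + ((show HAlg N from y : HAlg N) : HT N) :=
      Completion.coe_add (α := HAlg N) x y
    rw [e]
    exact hadd _ _ hx hy

/-- Strong convergence of uniformly bounded additive maps holds on a closed set. -/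
theorem isClosed_tendsto_of_bounded {V W : Type*} [SeminormedAddCommGroup V]
    [SeminormedAddCommGroup W] {f : ℕ → V → W} {g : V → W} {C : ℝ}
    (hf : ∀ n v w, ‖f n v - f n w‖ ≤ C * ‖v - w‖) (hg : ∀ v w, ‖g v - g w‖ ≤ C * ‖v - w‖) :
    IsClosed {v | Filter.Tendsto (fun n => f n v) Filter.atTop (nhds (g v))} := by
  -- The constant `C` may vanish or be negative. It is replaced by `|C| + 1`, by which one can
  -- divide in the choice of the approximating `w`.
  have hC : ∀ v w : V, C * ‖v - w‖ ≤ (|C| + 1) * ‖v - w‖ := fun v w =>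
    mul_le_mul_of_nonneg_right (by linarith [le_abs_self C]) (norm_nonneg _)
  refine isClosed_of_closure_subset fun v hv => ?_
  rw [Set.mem_ofPred_eq, Metric.tendsto_atTop]
  intro ε hε
  have hD : 0 < |C| + 1 := by positivity
  obtain ⟨w, hw, hvw⟩ := Metric.mem_closure_iff.1 hv (ε / (3 * (|C| + 1))) (by positivity)
  obtain ⟨n, hn⟩ := Metric.tendsto_atTop.1 hw (ε / 3) (by positivity)
  refine ⟨n, fun k hk => ?_⟩
  have h1 := hn k hk
  rw [dist_eq_norm] at h1 hvw ⊢
  have h2 := (hf k v w).trans (hC v w)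
  have h3 := (hg v w).trans (hC v w)
  rw [lt_div_iff₀ (by positivity)] at hvw
  have e : f k v - g v = (f k v - f k w) + (f k w - g w) - (g v - g w) := by abel
  rw [e]
  refine (norm_sub_le _ _).trans_lt ?_
  have h4 := norm_add_le (f k v - f k w) (f k w - g w)
  nlinarith

end density

/-! ### Countable orthonormal systems that may contain zero vectors. -/

section frame

variable {H : Type*} [NormedAddCommGroup H] [InnerProductSpace ℂ H]

/-- An orthonormal basis indexed by `ℕ`, with some vectors possibly replaced by zero. -/
structure IsPaddedBasis (e : ℕ → Column H) : Prop where
  orth : ∀ s t, s ≠ t → inner ℂ (e s) (e t) = 0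
  norm : ∀ s, e s = 0 ∨ ‖e s‖ = 1
  dense : Dense (Submodule.span ℂ (Set.range e) : Set (Column H))

/-- Gram-Schmidt is applied to a dense sequence, and vectors that depend on their predecessors
become zero. Admitting zeros keeps the index set `ℕ` in every dimension, including finite dimension
and `H = 0`. -/
theorem exists_paddedBasis [TopologicalSpace.SeparableSpace H] :
    ∃ e : ℕ → Column H, IsPaddedBasis e := by
  let f : ℕ → H := TopologicalSpace.denseSeq H
  refine ⟨InnerProductSpace.gramSchmidtNormed ℂ f, ?_, ?_, ?_⟩
  · intro s t hst
    show inner ℂ (InnerProductSpace.gramSchmidtNormed ℂ f s)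
      (InnerProductSpace.gramSchmidtNormed ℂ f t) = 0
    simp only [InnerProductSpace.gramSchmidtNormed, inner_smul_left, inner_smul_right,
      InnerProductSpace.gramSchmidt_orthogonal ℂ f hst, mul_zero]
  · intro s
    by_cases h : InnerProductSpace.gramSchmidtNormed ℂ f s = 0
    · exact Or.inl h
    · exact Or.inr (InnerProductSpace.gramSchmidtNormed_unit_length' h)
  · have h : Dense (Submodule.span ℂ (Set.range (InnerProductSpace.gramSchmidtNormed ℂ f)) :
        Set H) := by
      rw [InnerProductSpace.span_gramSchmidtNormed_range, InnerProductSpace.span_gramSchmidt]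
      exact (TopologicalSpace.denseRange_denseSeq H).mono Submodule.subset_span
    exact h

namespace IsPaddedBasis

variable {e : ℕ → Column H} (he : IsPaddedBasis e)

include he

theorem inner_smul_self (s : ℕ) (h : Column H) :
    inner ℂ (e s) (e s) * inner ℂ (e s) h = inner ℂ (e s) h := by
  rcases he.norm s with h0 | h1
  · rw [h0, inner_zero_left, zero_mul, inner_zero_left]
  · rw [inner_self_eq_norm_sq_to_K, h1]
    simp

theorem norm_sum_sq_le {n : ℕ} (v : Fin n → ℂ) :
    ‖∑ s, v s • e s‖ ^ 2 ≤ ∑ s, ‖v s‖ ^ 2 := by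
  have h : (inner ℂ (∑ s, v s • e s) (∑ s, v s • e s) : ℂ) =
      ∑ s, ((‖v s‖ ^ 2 * ‖e s‖ ^ 2 : ℝ) : ℂ) := by
    rw [sum_inner]
    refine Finset.sum_congr rfl fun s _ => ?_
    rw [inner_sum, Finset.sum_eq_single s]
    · rw [inner_smul_left, inner_smul_right, inner_self_eq_norm_sq_to_K, ← mul_assoc,
        Complex.conj_mul']
      simp
    · intro t _ ht
      rw [inner_smul_left, inner_smul_right, he.orth s t (fun h => ht (Fin.ext h.symm)),
        mul_zero, mul_zero]
    · simp
  rw [inner_self_eq_norm_sq_to_K, ← Complex.ofReal_sum] at h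
  have h' : ‖∑ s, v s • e s‖ ^ 2 = ∑ s : Fin n, ‖v s‖ ^ 2 * ‖e s‖ ^ 2 := by
    have := congrArg Complex.re h
    rw [Complex.ofReal_re] at this
    rw [← this]
    norm_cast
  rw [h']
  refine Finset.sum_le_sum fun s _ => mul_le_of_le_one_right (by positivity) ?_
  rcases he.norm s with h0 | h1
  · simp [h0]
  · simp [h1]

theorem bessel (n : ℕ) (h : Column H) :
    ∑ s : Fin n, ‖(inner ℂ (e s) h : ℂ)‖ ^ 2 ≤ ‖h‖ ^ 2 := by
  set S := ∑ s : Fin n, ‖(inner ℂ (e s) h : ℂ)‖ ^ 2 with hS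
  set p := ∑ s : Fin n, (inner ℂ (e s) h : ℂ) • e s with hp
  have h1 : ‖p‖ ^ 2 ≤ S := he.norm_sum_sq_le fun s : Fin n => (inner ℂ (e s) h : ℂ)
  have h2 : (inner ℂ p h : ℂ) = (S : ℂ) := by
    rw [hp, sum_inner, hS, Complex.ofReal_sum]
    refine Finset.sum_congr rfl fun s _ => ?_
    rw [inner_smul_left, Complex.conj_mul']
    norm_cast
  have h3 : S ≤ ‖p‖ * ‖h‖ := by
    have := norm_inner_le_norm (𝕜 := ℂ) p h
    rw [h2, Complex.norm_real, Real.norm_eq_abs] at this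
    exact (le_abs_self S).trans this
  have hS0 : 0 ≤ S := Finset.sum_nonneg fun _ _ => by positivity
  -- From `S ≤ ‖p‖‖h‖` and `‖p‖² ≤ S` one gets `2S ≤ ‖p‖² + ‖h‖² ≤ S + ‖h‖²`.
  nlinarith [norm_nonneg p, norm_nonneg h, sq_nonneg (‖p‖ - ‖h‖)]

/-- The partial sums are contractive by Bessel's inequality, so the vectors where they converge form
a closed set. On each `e t` the sums are eventually constant, and the span of these vectors is
dense. -/
theorem tendsto (h : Column H) : Filter.Tendsto
    (fun n => ∑ s : Fin n, (inner ℂ (e s) h : ℂ) • e s) Filter.atTop (nhds h) := by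
  have hb : ∀ (n : ℕ) (h : Column H), ‖∑ s : Fin n, (inner ℂ (e s) h : ℂ) • e s‖ ≤ ‖h‖ := by
    intro n h
    rw [← sq_le_sq₀ (norm_nonneg _) (norm_nonneg _)]
    exact (he.norm_sum_sq_le _).trans (he.bessel n h)
  have hcl : IsClosed {h : Column H | Filter.Tendsto
      (fun n => ∑ s : Fin n, (inner ℂ (e s) h : ℂ) • e s) Filter.atTop (nhds (id h))} := by
    refine isClosed_tendsto_of_bounded (C := 1) (fun n v w => ?_) (fun v w => by simp)
    rw [one_mul, ← Finset.sum_sub_distrib]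
    simp only [← sub_smul, ← inner_sub_right]
    exact hb n _
  have hsp : (Submodule.span ℂ (Set.range e) : Set (Column H)) ⊆ {h : Column H | Filter.Tendsto
      (fun n => ∑ s : Fin n, (inner ℂ (e s) h : ℂ) • e s) Filter.atTop (nhds (id h))} := by
    intro h hh
    refine Submodule.span_induction ?_ ?_ ?_ ?_ hh
    · rintro _ ⟨t, rfl⟩
      refine tendsto_const_nhds.congr' ?_
      filter_upwards [Filter.eventually_gt_atTop t] with n hn
      rw [Finset.sum_eq_single ⟨t, hn⟩]
      · rcases he.norm t with h0 | h1
        · simp [h0]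
        · simp [inner_self_eq_norm_sq_to_K, h1]
      · intro s _ hs
        rw [he.orth s t (fun h => hs (Fin.ext h)), zero_smul]
      · simp
    · simp only [Set.mem_ofPred_eq, inner_zero_right, zero_smul, Finset.sum_const_zero, id]
      exact tendsto_const_nhds
    · intro x y _ _ hx hy
      simp only [Set.mem_ofPred_eq, inner_add_right, add_smul, Finset.sum_add_distrib, id]
      exact Filter.Tendsto.add hx hy
    · intro c x _ hx
      simp only [Set.mem_ofPred_eq, inner_smul_right, mul_smul, ← Finset.smul_sum, id]
      exact Filter.Tendsto.const_smul hx c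
  have := hcl.closure_subset_iff.2 hsp
  rw [he.dense.closure_eq] at this
  exact this (Set.mem_univ h)

/-- This is Bessel's inequality, applied row by row to the combinations `∑ v j • h i j`. -/
theorem colNorm_coords_le {m k : Type} [Fintype m] [Fintype k] (n : ℕ)
    (h : Matrix m k (Column H)) :
    colNorm (Matrix.of fun (p : m × Fin n) t => (inner ℂ (e p.2) (h p.1 t) : ℂ)) ≤ colNorm h := by
  refine colNorm_le _ (colNorm_nonneg h) fun v => (le_trans ?_ (colNorm_bound h v))
  rw [Fintype.sum_prod_type]
  refine Finset.sum_le_sum fun i _ => ?_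
  refine le_trans (le_of_eq ?_) (he.bessel n _)
  refine Finset.sum_congr rfl fun s _ => ?_
  rw [inner_sum]
  simp only [inner_smul_right, Matrix.of_apply, smul_eq_mul]

theorem colNorm_row_le (n : ℕ) :
    colNorm (Matrix.of fun (_ : Unit) (s : Fin n) => e s) ≤ 1 := by
  refine colNorm_le _ zero_le_one fun v => ?_
  simpa using he.norm_sum_sq_le v

end IsPaddedBasis

end frame

section coordinates

variable {A : Type*} [NormedRing A] [NormedAlgebra ℂ A] [OperatorSpace A] [OperatorAlgebra A]
  {H : Type*} [NormedAddCommGroup H] [InnerProductSpace ℂ H]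
  {m n k l : Type} [Fintype m] [Fintype n] [Fintype k] [Fintype l]

/-- The pairing `(h, a) ↦ ⟨h₀, h⟩ a`. -/
def coordPair (A : Type*) [NormedRing A] [NormedAlgebra ℂ A] (h₀ : Column H) :
    Column H →ₗ[ℂ] A →ₗ[ℂ] A :=
  (LinearMap.lsmul ℂ A).comp (innerSL ℂ h₀).toLinearMap

theorem coordPair_mbWith (h₀ : Column H) :
    MBWith (fun (h : Column H) (a : A) => coordPair A h₀ h a) ‖h₀‖ := by
  intro m k n _ _ _ h a
  have e : amp (fun (h : Column H) (a : A) => coordPair A h₀ h a) h a =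
      amp (fun (c : ℂ) (a : A) => c • a) (h.map fun h => (inner ℂ h₀ h : ℂ)) a := rfl
  rw [e, ← mul_assoc]
  refine (MatSeminorm.nrm_lsmul_le _ _ a).trans (mul_le_mul_of_nonneg_right ?_ (mnorm_nonneg a))
  refine colNorm_le _ (mul_nonneg (norm_nonneg _) (mnorm_nonneg h)) fun v => ?_
  have h1 := colNorm_bound h v
  rw [mul_pow, mul_assoc]
  refine le_trans ?_ (mul_le_mul_of_nonneg_left h1 (sq_nonneg _))
  rw [Finset.mul_sum]
  refine Finset.sum_le_sum fun i _ => ?_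
  rw [← mul_pow]
  refine pow_le_pow_left₀ (norm_nonneg _) (le_trans (le_of_eq ?_) (norm_inner_le_norm (𝕜 := ℂ) _ _)) 2
  rw [inner_sum]
  simp only [inner_smul_right, Matrix.map_apply, smul_eq_mul]

theorem coordPair_mb (h₀ : Column H) : IsMB fun (h : Column H) (a : A) => coordPair A h₀ h a :=
  ⟨‖h₀‖, norm_nonneg _, coordPair_mbWith h₀⟩

variable (A) in
/-- The coordinate map `h ⊗ a ↦ ⟨h₀, h⟩ a`. -/
def coord (h₀ : Column H) : HTensor (Column H) A →L[ℂ] A :=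
  HT.lift (coordPair A h₀) (coordPair_mb h₀) bot_le

theorem coord_tm (h₀ h : Column H) (a : A) : coord A h₀ (tm ⊥ h a) = (inner ℂ h₀ h : ℂ) • a :=
  HT.lift_tm (coordPair A h₀) (coordPair_mb h₀) bot_le h a

theorem coord_op_smul (h₀ : Column H) (a : A) (v : HTensor (Column H) A) :
    coord A h₀ (MulOpposite.op a • v) = coord A h₀ v * a := by
  refine HT.induction (p := fun v : HTensor (Column H) A =>
    coord A h₀ (MulOpposite.op a • v) = coord A h₀ v * a) ?_ ?_ ?_ ?_ v
  · exact isClosed_eq ((coord A h₀).continuous.comp (continuous_const_smul _))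
      ((coord A h₀).continuous.mul continuous_const)
  · simp
  · intro u v hu hv
    rw [smul_add, map_add, map_add, hu, hv, add_mul]
  · intro h b
    rw [right_smul_tm, coord_tm, coord_tm, smul_mul_assoc]; rfl

/-- The coordinates of a matrix over `H ⊗ A`. -/
def coords (e : ℕ → Column H) (N : ℕ) (x : Matrix k l (HTensor (Column H) A)) :
    Matrix (k × Fin N) l A :=
  Matrix.of fun p j => coord A (e p.2) (x p.1 j)

/-- The matrix over `H ⊗ A` with given coordinates. -/
def synth (e : ℕ → Column H) (N : ℕ) (a : Matrix (k × Fin N) l A) :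
    Matrix k l (HTensor (Column H) A) :=
  Matrix.of fun i j => ∑ s : Fin N, tm ⊥ (e s) (a (i, s) j)

variable {e : ℕ → Column H} (he : IsPaddedBasis e)

include he

/-- On a product `h ⊙ a` the coordinates are the scalar matrix of the inner products `⟨e s, h⟩`
times `a`. Bessel's inequality bounds the scalar factor by the norm of `h`. -/
theorem mnorm_coords_le (N : ℕ) (x : Matrix k l (HTensor (Column H) A)) :
    mnorm (coords e N x) ≤ mnorm x := by
  have hc : Continuous fun x : Matrix k l (HTensor (Column H) A) => mnorm (coords e N x) :=
    continuous_mnorm.comp (continuous_pi fun p => continuous_pi fun j =>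
      (coord A (e p.2)).continuous.comp (continuous_apply_apply p.1 j))
  rw [← one_mul (mnorm x)]
  refine HT.le_of_amp hc zero_le_one (fun {r} _ h a => ?_) x
  have e1 : coords e N (amp (tm ⊥) h a) = amp (fun (c : ℂ) (a : A) => c • a)
      (Matrix.of fun (p : k × Fin N) t => (inner ℂ (e p.2) (h p.1 t) : ℂ)) a := by
    ext p j
    simp only [coords, amp, Matrix.of_apply, map_sum, coord_tm]
  rw [e1, one_mul]
  exact (MatSeminorm.nrm_lsmul_le _ _ a).trans
    (mul_le_mul_of_nonneg_right (he.colNorm_coords_le N h) (mnorm_nonneg a))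

/-- The synthesized matrix is a product `x ⊙ a`, where `x` repeats the row of basis vectors along
the diagonal. That row has norm at most one. -/
theorem mnorm_synth_le (N : ℕ) (a : Matrix (k × Fin N) l A) :
    mnorm (synth e N a) ≤ mnorm a := by
  classical
  have e1 : synth e N a = amp (tm ⊥)
      ((kronOne k (Matrix.of fun (_ : Unit) (s : Fin N) => e s)).submatrix (fun i => ((), i))
        Prod.swap) a := by
    ext i j
    simp only [synth, amp, Matrix.of_apply, kronOne, Matrix.submatrix_apply,
      Fintype.sum_prod_type, Prod.snd_swap, Prod.fst_swap]
    rw [Finset.sum_eq_single i]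
    · simp
    · intro b _ hb
      refine Finset.sum_eq_zero fun s _ => ?_
      rw [if_neg (Ne.symm hb)]
      exact LinearMap.map_zero₂ (tmₗ (⊥ : Submodule ℂ (Column H ⊗[ℂ] A))) _
    · simp
  rw [e1]
  refine (tm_mb ⊥ _ a).trans ?_
  rw [one_mul]
  refine mul_le_of_le_one_left (mnorm_nonneg a) ?_
  refine (mnorm_submatrix_le _ (fun _ _ h => (Prod.mk.inj h).2) _ Prod.swap_injective _).trans ?_
  exact (mnorm_kronOne_le _).trans (he.colNorm_row_le N)

theorem coord_synth {N : ℕ} (a : Matrix (k × Fin N) l A) (t : Fin N) (i : k) (j : l) :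
    coord A (e t) (synth e N a i j) = (inner ℂ (e t) (e t) : ℂ) • a (i, t) j := by
  simp only [synth, Matrix.of_apply, map_sum, coord_tm]
  rw [Finset.sum_eq_single t]
  · intro s _ hs
    rw [he.orth t s (fun h => hs (Fin.ext h.symm)), zero_smul]
  · simp

theorem inner_smul_coord (s : ℕ) (v : HTensor (Column H) A) :
    (inner ℂ (e s) (e s) : ℂ) • coord A (e s) v = coord A (e s) v := by
  refine HT.induction (p := fun v : HTensor (Column H) A =>
    (inner ℂ (e s) (e s) : ℂ) • coord A (e s) v = coord A (e s) v) ?_ ?_ ?_ ?_ v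
  · exact isClosed_eq ((coord A (e s)).continuous.const_smul _) (coord A (e s)).continuous
  · simp
  · intro u v hu hv
    rw [map_add, smul_add, hu, hv]
  · intro h b
    rw [coord_tm, smul_smul, he.inner_smul_self]

theorem coords_synth_coords (N : ℕ) (x : Matrix k l (HTensor (Column H) A)) :
    coords e N (synth e N (coords e N x)) = coords e N x := by
  ext p j
  show coord A (e p.2) (synth e N (coords e N x) p.1 j) = _
  rw [coord_synth he]
  exact inner_smul_coord he _ _

/-- The truncation of `v` to the first `N` coordinates. -/
def trunc (e : ℕ → Column H) (N : ℕ) : HTensor (Column H) A →ₗ[ℂ] HTensor (Column H) A :=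
  ∑ s : Fin N, (tmₗ (⊥ : Submodule ℂ (Column H ⊗[ℂ] A)) (e s)).comp (coord A (e s)).toLinearMap

omit he in
theorem trunc_apply (N : ℕ) (v : HTensor (Column H) A) :
    trunc e N v = ∑ s : Fin N, tm ⊥ (e s) (coord A (e s) v) := by
  simp only [trunc, LinearMap.sum_apply]; rfl

omit he in
theorem map_trunc (N : ℕ) (x : Matrix k l (HTensor (Column H) A)) :
    x.map (trunc e N) = synth e N (coords e N x) := by
  ext i j
  exact trunc_apply N _

theorem trunc_cc (N : ℕ) : IsCC (trunc (A := A) e N) := by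
  intro m n _ _ x
  rw [map_trunc, one_mul]
  exact (mnorm_synth_le he N _).trans (mnorm_coords_le he N x)

/-- Synthesis and coordinates are both contractive, and taking coordinates after synthesis changes
nothing on actual coordinates. Norms of truncations can therefore be computed exactly on finite
columns over `A`. -/
theorem mnorm_map_trunc (N : ℕ) (x : Matrix k l (HTensor (Column H) A)) :
    mnorm (x.map (trunc e N)) = mnorm (coords e N x) := by
  rw [map_trunc]
  refine le_antisymm (mnorm_synth_le he N _) ?_
  have h := mnorm_coords_le he N (synth e N (coords e N x))
  rwa [coords_synth_coords he] at h

theorem norm_trunc_le (N : ℕ) (v : HTensor (Column H) A) : ‖trunc e N v‖ ≤ ‖v‖ := by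
  simpa using CBWith.norm_le (trunc_cc he N) v

theorem trunc_tendsto (v : HTensor (Column H) A) :
    Filter.Tendsto (fun N => trunc e N v) Filter.atTop (nhds v) := by
  refine HT.induction (p := fun v : HTensor (Column H) A =>
    Filter.Tendsto (fun N => trunc e N v) Filter.atTop (nhds (id v))) ?_ ?_ ?_ ?_ v
  · refine isClosed_tendsto_of_bounded (C := 1) (fun N v w => ?_) (fun v w => by simp)
    rw [← map_sub, one_mul]
    exact norm_trunc_le he N _
  · simp
  · intro u v hu hv
    simp only [map_add]
    exact hu.add hv
  · intro h a
    have h1 := ((continuous_tm_left (N := (⊥ : Submodule ℂ (Column H ⊗[ℂ] A))) a).tendsto h).comp (he.tendsto h)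
    refine h1.congr fun N => ?_
    rw [Function.comp_apply, trunc_apply]
    refine (map_sum ((tmₗ (⊥ : Submodule ℂ (Column H ⊗[ℂ] A))).flip a) _ _).trans ?_
    refine Finset.sum_congr rfl fun s _ => ?_
    rw [coord_tm, tm_smul_right, map_smul]; rfl

omit he in
theorem mnorm_one_le (N : ℕ) :
    mnorm (kronOne (Fin N) (fun _ _ : Unit => (1 : A))) ≤ 1 :=
  (mnorm_kronOne_le _).trans ((mnorm_unit (1 : A)).trans_le OperatorAlgebra.norm_one_le)

/-- The row `(e s ⊗ 1)` is the synthesis of the identity matrix over `A`, which has norm at most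
`‖1‖ ≤ 1`. -/
theorem mnorm_basis_le (N : ℕ) :
    mnorm (Matrix.of fun (_ : Unit) (s : Fin N) => tm (⊥ : Submodule ℂ (Column H ⊗[ℂ] A))
      (e s) 1) ≤ 1 := by
  classical
  have h : (Matrix.of fun (_ : Unit) (s : Fin N) => tm (⊥ : Submodule ℂ (Column H ⊗[ℂ] A))
      (e s) 1) = (synth e N (kronOne (Fin N) (fun _ _ : Unit => (1 : A)))).submatrix id
        (fun s => ((), s)) := by
    ext i s
    simp only [synth, kronOne, Matrix.of_apply, Matrix.submatrix_apply]
    rw [Finset.sum_eq_single s]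
    · simp
    · intro t _ ht
      rw [if_neg ht, tm_zero_right]
    · simp
  rw [h]
  exact (mnorm_submatrix_le _ Function.injective_id _ (fun _ _ h => (Prod.mk.inj h).2) _).trans
    ((mnorm_synth_le he N _).trans (mnorm_one_le N))

/-- This is the row-times-column form of a truncation. It shows that a module map is determined on
truncations by its values on the vectors `e s ⊗ 1`. -/
theorem trunc_eq_sum_smul (N : ℕ) (v : HTensor (Column H) A) :
    trunc e N v = ∑ s : Fin N, MulOpposite.op (coord A (e s) v) •
      tm (⊥ : Submodule ℂ (Column H ⊗[ℂ] A)) (e s) 1 := by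
  rw [trunc_apply]
  refine Finset.sum_congr rfl fun s _ => ?_
  rw [right_smul_tm, MulOpposite.smul_eq_mul_unop, one_mul]; rfl

theorem trunc_op_smul (N : ℕ) (a : A) (v : HTensor (Column H) A) :
    trunc e N (MulOpposite.op a • v) = MulOpposite.op a • trunc e N v := by
  rw [trunc_apply, trunc_apply, Finset.smul_sum]
  refine Finset.sum_congr rfl fun s _ => ?_
  rw [right_smul_tm, coord_op_smul]; rfl

/-- The Pythagorean inequality for truncations. -/
theorem norm_sq_le_trunc (N : ℕ) (v : HTensor (Column H) A) :
    ‖v‖ ^ 2 ≤ ‖trunc e N v‖ ^ 2 + ‖v - trunc e N v‖ ^ 2 := by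
  -- Among the first `M` coordinates of `v`, those beyond `N` are also coordinates of `v - P_N v`.
  -- The norm of a column with two blocks then gives the bound for `P_M v`, and `M → ∞`.
  have key : ∀ M ≥ N, ‖trunc e M v‖ ^ 2 ≤ ‖trunc e N v‖ ^ 2 + ‖v - trunc e N v‖ ^ 2 := by
    intro M hM
    have hn : ∀ (K : ℕ) (w : HTensor (Column H) A),
        ‖trunc e K w‖ = mnorm (coords e K (fun _ _ : Unit => w)) := fun K w => by
      exact (mnorm_unit _).symm.trans (mnorm_map_trunc he K (fun _ _ : Unit => w))
    obtain ⟨d, rfl⟩ := Nat.exists_eq_add_of_le hM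
    let x : Matrix Unit Unit (HTensor (Column H) A) := fun _ _ => v
    let y : Matrix Unit Unit (HTensor (Column H) A) := fun _ _ => v - trunc e N v
    have h1 : coords e (N + d) x = (Matrix.fromRows (coords e N x)
        ((coords e (N + d) y).submatrix (fun s : Fin d => ((), Fin.natAdd N s)) id)).submatrix
        (fun p => Fin.addCases (motive := fun _ => (Unit × Fin N) ⊕ Fin d)
          (fun i => Sum.inl ((), i)) (fun i => Sum.inr i) p.2) id := by
      ext ⟨_, s⟩ j
      refine Fin.addCases (fun i => ?_) (fun i => ?_) s
      · simp [coords]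
      · simp only [coords, Matrix.submatrix_apply, Fin.addCases_right, Matrix.fromRows_apply_inr,
          Matrix.of_apply, x, y, id]
        rw [map_sub, trunc_apply, map_sum, Finset.sum_eq_zero, sub_zero]
        intro t _
        rw [coord_tm, he.orth, zero_smul]
        simp only [Fin.val_natAdd]
        omega
    rw [hn, hn, h1]
    refine (pow_le_pow_left₀ (mnorm_nonneg _) (mnorm_submatrix_le _ ?_ _
      Function.injective_id _) 2).trans ((mnorm_fromRows_sq_le _ _).trans ?_)
    · rintro ⟨_, s⟩ ⟨_, t⟩
      refine Fin.addCases (fun i => ?_) (fun i => ?_) s <;>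
      refine Fin.addCases (fun j => ?_) (fun j => ?_) t <;> simp
    · refine add_le_add le_rfl (pow_le_pow_left₀ (mnorm_nonneg _) ?_ 2)
      refine (mnorm_submatrix_le _ (fun s t h => ?_) _ Function.injective_id _).trans
        ((mnorm_coords_le he _ y).trans (mnorm_unit _).le)
      simpa using h
  refine le_of_tendsto (((trunc_tendsto he v).norm).pow 2) ?_
  filter_upwards [Filter.eventually_ge_atTop N] with M hM using key M hM

theorem trunc_trunc {M N : ℕ} (h : M ≤ N) (v : HTensor (Column H) A) :
    trunc e M (trunc e N v) = trunc e M v := by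
  rw [trunc_apply M (trunc e N v), trunc_apply M v]
  refine Finset.sum_congr rfl fun s _ => congrArg (tm (⊥ : Submodule ℂ (Column H ⊗[ℂ] A)) (e s)) ?_
  rw [trunc_apply, map_sum, Finset.sum_eq_single ⟨s, s.2.trans_le h⟩]
  · rw [coord_tm]
    exact inner_smul_coord he s v
  · intro t _ ht
    rw [coord_tm, he.orth, zero_smul]
    exact fun h => ht (Fin.ext h.symm)
  · simp

end coordinates

/-! ### Evaluation of completely bounded module maps on projective modules -/

section evaluation

variable {A : Type*} [NormedRing A] [NormedAlgebra ℂ A] [OperatorSpace A] [OperatorAlgebra A]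
  {H : Type*} [NormedAddCommGroup H] [InnerProductSpace ℂ H]
  {E Y : Type*} [SeminormedAddCommGroup E] [NormedSpace ℂ E] [OperatorSpace E]
  [Module Aᵐᵒᵖ E] [IsScalarTower ℂ Aᵐᵒᵖ E]
  [NormedAddCommGroup Y] [NormedSpace ℂ Y] [OperatorSpace Y]
  [Module Aᵐᵒᵖ Y] [IsScalarTower ℂ Aᵐᵒᵖ Y] [RightOpModule A Y]

/-- On a direct summand of `H ⊗ A`, the evaluation of completely bounded module maps is bounded on
matrix products. -/
theorem CBHom.app_mb {e : ℕ → Column H} (he : IsPaddedBasis e)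
    {ι : E →ₗ[ℂ] HTensor (Column H) A} {π : HTensor (Column H) A →ₗ[ℂ] E}
    (hι : IsCC ι) (hπ : IsCC π)
    (hπA : ∀ (a : A) (v : HTensor (Column H) A), π (MulOpposite.op a • v) = MulOpposite.op a • π v)
    (hπι : ∀ x, π (ι x) = x) : MBWith (fun (T : CBHom A E Y) (x : E) => T.app x) 1 := by
  intro m k n _ _ _ T x
  -- The entries `x` are replaced by `π(P_N(ι x))`, which converge to `π(ι x) = x`.
  let f : ℕ → Matrix m n Y := fun N => amp (fun (T : CBHom A E Y) (x : E) => T.app x) T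
    (x.map fun x => π (trunc e N (ι x)))
  have hf : Filter.Tendsto f Filter.atTop
      (nhds (amp (fun (T : CBHom A E Y) (x : E) => T.app x) T x)) := by
    refine tendsto_pi_nhds.2 fun i => tendsto_pi_nhds.2 fun j => tendsto_finsetSum _ fun s _ => ?_
    have h1 := ((CBWith.continuous hπ).tendsto _).comp (trunc_tendsto he (ι (x s j)))
    rw [hπι] at h1
    exact ((IsCB.continuous (T i s).cb).tendsto _).comp h1
  refine le_of_tendsto ((continuous_mnorm.tendsto _).comp hf)
    (Filter.Eventually.of_forall fun N => ?_)
  -- With `r` the row of the vectors `π(e s ⊗ 1)`, the module property turns each evaluation into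
  -- the sum of the `T(r s)` times the coordinates of `ι x`. This is a matrix product for the right
  -- action on `Y`. The cb norm of `T` controls the matrix of all values on `r`, and `r` has norm at
  -- most one.
  let r : Matrix Unit (Fin N) E := (Matrix.of fun (_ : Unit) (s : Fin N) =>
    tm (⊥ : Submodule ℂ (Column H ⊗[ℂ] A)) (e s) 1).map π
  have e1 : f N = amp (fun (y : Y) (a : A) => MulOpposite.op a • y)
      ((ampMap T r).submatrix (fun i => (i, ())) id) (coords e N (x.map ι)) := by
    ext i j
    simp only [f, amp, Fintype.sum_prod_type, Matrix.map_apply]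
    refine Finset.sum_congr rfl fun t _ => ?_
    rw [trunc_eq_sum_smul he, map_sum, map_sum]
    refine Finset.sum_congr rfl fun s _ => ?_
    rw [hπA, CBHom.app_op_smul]
    rfl
  have hr : mnorm r ≤ 1 :=
    (hπ _).trans (by rw [one_mul]; exact mnorm_basis_le he N)
  rw [Function.comp_apply, e1]
  refine (RightOpModule.smul_le _ _).trans (mul_le_mul_of_nonneg_left ?_ zero_le_one)
  refine mul_le_mul ?_ ?_ (mnorm_nonneg _) (mnorm_nonneg _)
  · refine (mnorm_submatrix_le _ (fun _ _ h => (Prod.mk.inj h).1) _ Function.injective_id _).trans ?_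
    exact (cbNrm_bound T r).trans (mul_le_of_le_one_right (cbNrm_nonneg T) hr)
  · refine (mnorm_coords_le he N _).trans ((hι x).trans_eq (one_mul _))

end evaluation

/-! ### Contractive idempotents on `H ⊗ A` -/

section columns

variable {X : Type*} [SeminormedAddCommGroup X] [NormedSpace ℂ X] [OperatorSpace X]
  {k : Type} [Fintype k]

/-- The norm of the column with entries `z i` and a last entry `x`. -/
def colVec (z : k → X) (x : X) : Matrix (k ⊕ Unit) Unit X :=
  Matrix.fromRows (Matrix.of fun i _ => z i) (Matrix.of fun _ _ => x)

theorem colVec_inl (z : k → X) (x : X) (i : k) (q : Unit) : colVec z x (Sum.inl i) q = z i := rfl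

theorem colVec_inr (z : k → X) (x : X) (i q : Unit) : colVec z x (Sum.inr i) q = x := rfl

theorem mnorm_const_col_sq_le (n : ℕ) (x : X) :
    mnorm (Matrix.of fun (_ : Fin n) (_ : Unit) => x) ^ 2 ≤ n * ‖x‖ ^ 2 := by
  have e : (Matrix.of fun (_ : Fin n) (_ : Unit) => x) = amp (fun (c : ℂ) (x : X) => c • x)
      (Matrix.of fun (_ : Fin n) (_ : Unit) => (1 : ℂ)) (fun _ _ : Unit => x) := by
    ext i j; simp [amp]
  have hn : colNorm (Matrix.of fun (_ : Fin n) (_ : Unit) => (1 : ℂ)) ≤ √n := by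
    refine colNorm_le _ (Real.sqrt_nonneg _) fun v => ?_
    rw [Real.sq_sqrt n.cast_nonneg]
    simp
  rw [e]
  have h := (MatSeminorm.nrm_lsmul_le (OperatorSpace.mat (X := X))
    (Matrix.of fun (_ : Fin n) (_ : Unit) => (1 : ℂ)) (fun _ _ : Unit => x)).trans
    (mul_le_mul_of_nonneg_right hn (mnorm_nonneg (fun _ _ : Unit => x)))
  have h' := pow_le_pow_left₀ (mnorm_nonneg _) h 2
  rw [mul_pow, Real.sq_sqrt n.cast_nonneg] at h'
  refine h'.trans_eq ?_
  rw [← mnorm_unit]; rfl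

/-- The row of `n` ones has norm `√n` and maps the constant column to `n • x`. Together with the
upper bound, the constant column has norm exactly `√n ‖x‖`. Such long columns allow `n` steps to be
averaged. -/
theorem mul_norm_sq_le_mnorm_const_col (n : ℕ) (x : X) :
    n * ‖x‖ ^ 2 ≤ mnorm (Matrix.of fun (_ : Fin n) (_ : Unit) => x) ^ 2 := by
  rcases Nat.eq_zero_or_pos n with rfl | hn0
  · simpa using sq_nonneg _
  have e : (fun _ _ : Unit => (n : ℂ) • x) = amp (fun (c : ℂ) (x : X) => c • x)
      (Matrix.of fun (_ : Unit) (_ : Fin n) => (1 : ℂ))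
      (Matrix.of fun (_ : Fin n) (_ : Unit) => x) := by
    ext i j; simp [amp, Nat.cast_smul_eq_nsmul]
  have hn : colNorm (Matrix.of fun (_ : Unit) (_ : Fin n) => (1 : ℂ)) ≤ √n := by
    refine colNorm_le _ (Real.sqrt_nonneg _) fun v => ?_
    rw [Real.sq_sqrt n.cast_nonneg]
    simp only [Matrix.of_apply, smul_eq_mul, mul_one, Finset.univ_unique, Finset.sum_const,
      Finset.card_singleton, one_smul]
    refine (pow_le_pow_left₀ (norm_nonneg _) (norm_sum_le _ _) 2).trans ?_
    have := sq_sum_le_card_mul_sum_sq (s := (Finset.univ : Finset (Fin n))) (f := fun i => ‖v i‖)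
    simpa using this
  have h := (MatSeminorm.nrm_lsmul_le (OperatorSpace.mat (X := X))
    (Matrix.of fun (_ : Unit) (_ : Fin n) => (1 : ℂ))
    (Matrix.of fun (_ : Fin n) (_ : Unit) => x)).trans
    (mul_le_mul_of_nonneg_right hn (mnorm_nonneg _))
  rw [← e] at h
  have h' := pow_le_pow_left₀ (MatSeminorm.nrm_nonneg _ _) h 2
  rw [mul_pow, Real.sq_sqrt n.cast_nonneg] at h'
  have e2 : (OperatorSpace.mat (X := X)).nrm (fun _ _ : Unit => (n : ℂ) • x) = n * ‖x‖ := by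
    rw [OperatorSpace.norm_eq, norm_smul]; simp
  rw [e2, mul_pow, sq (n : ℝ), mul_assoc] at h'
  exact le_of_mul_le_mul_left h' (by exact_mod_cast hn0)

/-- The rotation in the plane of the coordinate `j` and the last coordinate. -/
def rotation [DecidableEq k] (j : k) (α β : ℝ) : Matrix (k ⊕ Unit) (k ⊕ Unit) ℂ :=
  Matrix.fromBlocks (Matrix.of fun i i' => if i = i' then (if i = j then (α : ℂ) else 1) else 0)
    (Matrix.of fun i _ => if i = j then (β : ℂ) else 0)
    (Matrix.of fun _ i => if i = j then (-β : ℂ) else 0) (Matrix.of fun _ _ => (α : ℂ))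

/-- For real `α`, `β` one has `|aα + bβ|² + |bα - aβ|² = (α² + β²)(|a|² + |b|²)`, and the other
coordinates are fixed. -/
theorem colNorm_rotation_le [DecidableEq k] (j : k) {α β : ℝ} (h : α ^ 2 + β ^ 2 = 1) :
    colNorm (rotation j α β) ≤ 1 := by
  refine colNorm_le _ zero_le_one fun v => ?_
  have h1 : ∀ i : k, ‖∑ q, v q • rotation j α β (Sum.inl i) q‖ ^ 2 = ‖v (Sum.inl i)‖ ^ 2 +
      (if i = j then ‖v (Sum.inl j) * α + v (Sum.inr ()) * β‖ ^ 2 - ‖v (Sum.inl j)‖ ^ 2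
        else 0) := by
    intro i
    by_cases hi : i = j
    · subst hi
      simp [rotation, Fintype.sum_sum_type]
    · simp [rotation, Fintype.sum_sum_type, hi]
  have h2 : ‖∑ q, v q • rotation j α β (Sum.inr ()) q‖ ^ 2 =
      ‖v (Sum.inr ()) * α - v (Sum.inl j) * β‖ ^ 2 := by
    simp [rotation, Fintype.sum_sum_type]
    congr 2
    ring
  rw [Fintype.sum_sum_type, Fintype.sum_sum_type]
  simp only [h1, Finset.sum_add_distrib, Finset.sum_ite_eq', Finset.mem_univ, if_true,
    Finset.univ_unique, Finset.sum_singleton, PUnit.default_eq_unit, h2]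
  have h3 : ‖v (Sum.inl j) * α + v (Sum.inr ()) * β‖ ^ 2 +
      ‖v (Sum.inr ()) * α - v (Sum.inl j) * β‖ ^ 2 =
      (α ^ 2 + β ^ 2) * (‖v (Sum.inl j)‖ ^ 2 + ‖v (Sum.inr ())‖ ^ 2) := by
    simp only [Complex.sq_norm, Complex.normSq_apply, Complex.add_re, Complex.sub_re,
      Complex.add_im, Complex.sub_im, Complex.mul_re, Complex.mul_im, Complex.ofReal_re,
      Complex.ofReal_im]
    ring
  rw [h] at h3
  linarith

theorem amp_rotation [DecidableEq k] (j : k) (α β : ℝ) (z : k → X) (x : X) :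
    amp (fun (c : ℂ) (x : X) => c • x) (rotation j α β) (colVec z x) =
      colVec (Function.update z j ((α : ℂ) • z j + (β : ℂ) • x))
        (-((β : ℂ) • z j) + (α : ℂ) • x) := by
  ext p q
  rcases p with i | _
  · by_cases hi : i = j
    · subst hi
      simp [amp, rotation, colVec_inl, colVec_inr, Fintype.sum_sum_type, ite_smul]
    · simp [amp, rotation, colVec_inl, colVec_inr, Fintype.sum_sum_type, ite_smul, hi]
  · simp [amp, rotation, colVec_inl, colVec_inr, Fintype.sum_sum_type, ite_smul]

end columns

section idempotent

variable {A : Type*} [NormedRing A] [NormedAlgebra ℂ A] [OperatorSpace A] [OperatorAlgebra A]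
  {H : Type*} [NormedAddCommGroup H] [InnerProductSpace ℂ H]
  {e : ℕ → Column H} (he : IsPaddedBasis e)
  {T : HTensor (Column H) A →ₗ[ℂ] HTensor (Column H) A} (hT : IsCC T)
  (hTA : ∀ (a : A) (v : HTensor (Column H) A), T (MulOpposite.op a • v) = MulOpposite.op a • T v)
  {k : Type} [Fintype k]

include he hT hTA

/-- A completely contractive module map of `H ⊗ A` acts contractively on one entry of a column. -/
theorem mnorm_colVec_apply_le (z : k → HTensor (Column H) A) (x : HTensor (Column H) A) :
    mnorm (colVec z (T x)) ≤ mnorm (colVec z x) := by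
  classical
  let I : CBHom A (HTensor (Column H) A) (HTensor (Column H) A) :=
    ⟨LinearMap.id, ⟨1, zero_le_one, fun x => by simp⟩, fun _ _ => rfl⟩
  let T' : CBHom A (HTensor (Column H) A) (HTensor (Column H) A) :=
    ⟨T, ⟨1, zero_le_one, fun x => hT x⟩, hTA⟩
  have hI : ‖I‖ ≤ 1 := CBHom.norm_le I zero_le_one fun {m n} _ _ x => by
    rw [one_mul]; exact le_of_eq (congrArg mnorm (by ext i j; rfl))
  have hT' : ‖T'‖ ≤ 1 := CBHom.norm_le T' zero_le_one fun x => hT x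
  -- The matrix `diag(1, …, 1, T)` over the completely bounded module maps has norm at most one.
  let D := Matrix.fromBlocks ((kronOne k (fun _ _ : Unit => I)).submatrix (fun i => ((), i))
    (fun i => ((), i))) 0 0 (Matrix.of fun _ _ : Unit => T')
  have hD : mnorm D ≤ 1 := by
    refine (MatSeminorm.nrm_diag_le _ _ _).trans (max_le ?_ ?_)
    · refine (mnorm_submatrix_le _ (fun _ _ h => (Prod.mk.inj h).2) _
        (fun _ _ h => (Prod.mk.inj h).2) _).trans ((mnorm_kronOne_le _).trans ?_)
      exact (mnorm_unit I).trans_le hI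
    · exact (mnorm_unit T').trans_le hT'
  -- Here `H ⊗ A` is a summand of itself, with identity maps, so evaluation is contractive on the
  -- product of the diagonal matrix with the column.
  have h := CBHom.app_mb (A := A) (Y := HTensor (Column H) A) he (ι := LinearMap.id)
    (π := LinearMap.id) (fun x => by simp) (fun x => by simp) (fun _ _ => rfl) (fun _ => rfl)
    D (colVec z x)
  have e1 : amp (fun (T : CBHom A (HTensor (Column H) A) (HTensor (Column H) A))
      (x : HTensor (Column H) A) => T.app x) D (colVec z x) = colVec z (T x) := by
    ext p q
    simp only [← CBHom.eval_apply]
    rcases p with i | _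
    · simp only [amp, D, colVec_inl, colVec_inr, Fintype.sum_sum_type, Matrix.fromBlocks_apply₁₁,
        Matrix.fromBlocks_apply₁₂, Matrix.zero_apply, map_zero, Finset.sum_const_zero, add_zero,
        Matrix.submatrix_apply, kronOne, Matrix.of_apply]
      rw [Finset.sum_eq_single i]
      · rw [if_pos rfl]; rfl
      · intro b _ hb
        rw [if_neg (Ne.symm hb)]
        exact map_zero (CBHom.eval (z b))
      · simp
    · simp only [amp, D, colVec_inl, colVec_inr, Fintype.sum_sum_type, Matrix.fromBlocks_apply₂₁,
        Matrix.fromBlocks_apply₂₂, Matrix.zero_apply, map_zero, Finset.sum_const_zero, zero_add,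
        Finset.univ_unique, Finset.sum_singleton]
      rfl
  rw [e1, one_mul] at h
  exact h.trans (mul_le_of_le_one_left (mnorm_nonneg _) hD)

theorem mnorm_colVec_rotate_le [DecidableEq k] (j : k) {α β : ℝ} (h : α ^ 2 + β ^ 2 = 1)
    (z : k → HTensor (Column H) A) (x : HTensor (Column H) A) :
    mnorm (colVec (Function.update z j ((α : ℂ) • z j + (β : ℂ) • x))
      (T (-((β : ℂ) • z j) + (α : ℂ) • x))) ≤ mnorm (colVec z x) := by
  refine (mnorm_colVec_apply_le he hT hTA _ _).trans ?_
  rw [← amp_rotation]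
  exact MatSeminorm.nrm_lsmul_le_of_le_one _ _ (colNorm_rotation_le j h) _

/-- The stationary iteration of rotations and of the map `T`. -/
theorem norm_rotate_le {α β : ℝ} (h : α ^ 2 + β ^ 2 = 1) (ξ x : HTensor (Column H) A)
    (hx : T (-((β : ℂ) • ξ) + (α : ℂ) • x) = x) : ‖(α : ℂ) • ξ + (β : ℂ) • x‖ ≤ ‖ξ‖ := by
  set y := (α : ℂ) • ξ + (β : ℂ) • x with hy
  -- The start is a column of `n` copies of `ξ` with `x` in the last place. For each entry in turn
  -- one rotates it against the last place and applies `T` there. By `hx` the last place returns to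
  -- `x` while the entry becomes `y`. No step increases the norm, so `n` copies of `y` are bounded
  -- by the initial column.
  have key : ∀ n : ℕ, n * ‖y‖ ^ 2 ≤ n * ‖ξ‖ ^ 2 + ‖x‖ ^ 2 := by
    intro n
    have hs : ∀ s : Finset (Fin n), mnorm (colVec (fun i => if i ∈ s then y else ξ) x) ≤
        mnorm (colVec (fun _ : Fin n => ξ) x) := by
      intro s
      induction s using Finset.induction_on with
      | empty => simp
      | insert j s hj ih =>
        refine le_trans (le_of_eq ?_) ((mnorm_colVec_rotate_le he hT hTA j h
          (fun i => if i ∈ s then y else ξ) x).trans ih)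
        simp only [if_neg hj, hx, ← hy]
        congr 2
        ext1 i
        by_cases hi : i = j
        · subst hi; simp
        · simp [hi]
    have h1 := hs Finset.univ
    simp only [Finset.mem_univ, if_true] at h1
    have h2 : mnorm (Matrix.of fun (_ : Fin n) (_ : Unit) => y) ≤ mnorm (colVec (fun _ => y) x) :=
      mnorm_submatrix_le Sum.inl Sum.inl_injective id Function.injective_id
        (colVec (fun _ : Fin n => y) x)
    have h3 : mnorm (colVec (fun _ : Fin n => ξ) x) ^ 2 ≤ n * ‖ξ‖ ^ 2 + ‖x‖ ^ 2 := by
      refine (mnorm_fromRows_sq_le _ _).trans (add_le_add (mnorm_const_col_sq_le n ξ) ?_)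
      exact (congrArg (· ^ 2) (mnorm_unit x)).le
    exact (mul_norm_sq_le_mnorm_const_col n y).trans
      ((pow_le_pow_left₀ (mnorm_nonneg _) (h2.trans h1) 2).trans h3)
  rw [← sq_le_sq₀ (norm_nonneg _) (norm_nonneg _)]
  -- If `‖y‖ > ‖ξ‖`, the excess `n(‖y‖² - ‖ξ‖²)` would exceed the fixed number `‖x‖²` for large `n`.
  by_contra hlt
  push Not at hlt
  obtain ⟨n, hn⟩ := exists_nat_gt (‖x‖ ^ 2 / (‖y‖ ^ 2 - ‖ξ‖ ^ 2))
  rw [div_lt_iff₀ (by linarith)] at hn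
  have := key n
  linarith

/-- The reflection `1 - 2T` of a completely contractive idempotent module map `T` of `H ⊗ A` is
contractive. -/
theorem norm_reflection_le (hTT : ∀ v, T (T v) = T v) (ξ : HTensor (Column H) A) :
    ‖ξ - (2 : ℂ) • T ξ‖ ≤ ‖ξ‖ := by
  -- With `β² = 1 - α²`, the vector `x = -(β/(1 - α)) Tξ` is stationary because `-β - αβ/(1 - α) =
  -- -β/(1 - α)`. The rotated entry is then `αξ + βx = αξ - (1 + α)Tξ`, since `β²/(1 - α) = 1 + α`.
  have key : ∀ α : ℝ, 0 < α → α < 1 → ‖(α : ℂ) • ξ - ((1 + α : ℝ) : ℂ) • T ξ‖ ≤ ‖ξ‖ := by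
    intro α h0 h1
    have hβ : 0 ≤ 1 - α ^ 2 := by nlinarith
    set β := √(1 - α ^ 2) with hβd
    have hβ2 : β ^ 2 = 1 - α ^ 2 := Real.sq_sqrt hβ
    have hα : (1 - α) ≠ 0 := by linarith
    have e1 : ((β : ℂ)) • (-((β / (1 - α) : ℝ) : ℂ)) • T ξ = -((1 + α : ℝ) : ℂ) • T ξ := by
      rw [smul_smul]
      congr 1
      rw [← Complex.ofReal_neg, ← Complex.ofReal_neg, ← Complex.ofReal_mul]
      congr 1
      field_simp
      rw [hβ2]; ring
    have h := norm_rotate_le he hT hTA (α := α) (β := β) (by rw [hβ2]; ring) ξ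
      ((-((β / (1 - α) : ℝ) : ℂ)) • T ξ) ?_
    · rw [e1, neg_smul, ← sub_eq_add_neg] at h
      exact h
    · rw [map_add, map_neg, map_smul, map_smul, map_smul, hTT, smul_smul, ← neg_smul, ← add_smul]
      congr 1
      have h : -β + α * -(β / (1 - α)) = -(β / (1 - α)) := by
        field_simp
        ring
      exact_mod_cast congrArg (fun t : ℝ => (t : ℂ)) h
  have hc : Continuous fun α : ℝ => ‖(α : ℂ) • ξ - ((1 + α : ℝ) : ℂ) • T ξ‖ := by fun_prop
  -- At `α = 1` the stationary vector is not defined, so the reflection `ξ - 2Tξ` is reached as the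
  -- limit from the left.
  have ht := (hc.tendsto 1).mono_left (nhdsWithin_le_nhds (s := Set.Iio 1))
  have h2 := le_of_tendsto ht (by
    filter_upwards [Ioo_mem_nhdsLT (show (0 : ℝ) < 1 by norm_num)] with α hα
    exact key α hα.1 hα.2)
  simpa [one_add_one_eq_two] using h2

/-- The rows of the reflection `1 - 2T` are small where its columns are. -/
theorem trunc_reflection_le (hTT : ∀ v, T (T v) = T v) {M N : ℕ} (hMN : M ≤ N) {δ : ℝ}
    (hδ : 0 ≤ δ)
    (hb : ∀ f, ‖(trunc e M f - (2 : ℂ) • T (trunc e M f)) -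
      trunc e N (trunc e M f - (2 : ℂ) • T (trunc e M f))‖ ≤ δ * ‖f‖) (n : ℕ) (hn : n * δ ≤ 1)
    (g : HTensor (Column H) A) :
    n * ‖trunc e M (T (g - trunc e N g))‖ ^ 2 ≤ 4 * ‖g‖ ^ 2 := by
  set g' := g - trunc e N g with hg'
  have hg1 : trunc e N g' = 0 := by rw [hg', map_sub, trunc_trunc he le_rfl, sub_self]
  have hg2 : trunc e M g' = 0 := by rw [← trunc_trunc he hMN, hg1, map_zero]
  have hg3 : ‖g'‖ ≤ 2 * ‖g‖ := by
    have := norm_sub_le g (trunc e N g)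
    have := norm_trunc_le he N g
    rw [hg']; linarith
  set w := trunc e M (g' - (2 : ℂ) • T g') with hw
  have hw1 : ‖w‖ ≤ ‖g'‖ := (norm_trunc_le he M _).trans (norm_reflection_le he hT hTA hTT g')
  have hwM : trunc e M w = w := by rw [hw, trunc_trunc he le_rfl]
  have hw2 : w = -((2 : ℂ) • trunc e M (T g')) := by
    rw [hw, map_sub, hg2, map_smul, zero_sub]
  -- Write `U = 1 - 2T`, `f = cw` and `u = Uf`. Then `P_M U(u + g') = f + w = (c + 1)w`, so the left
  -- side is at most `‖u + g'‖²`. The Pythagorean inequality at `N` splits this into `P_N u`, of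
  -- norm at most `‖f‖`, and `(u - P_N u) + g'`, where the first summand is small by `hb`.
  have step : ∀ c : ℝ, 0 ≤ c → ‖((c + 1 : ℝ) : ℂ) • w‖ ^ 2 ≤
      ‖(c : ℂ) • w‖ ^ 2 + (δ * ‖(c : ℂ) • w‖ + ‖g'‖) ^ 2 := by
    intro c hc
    obtain ⟨f, hf⟩ : ∃ f, f = (c : ℂ) • w := ⟨_, rfl⟩
    rw [← hf]
    have hfM : trunc e M f = f := by rw [hf, map_smul, hwM]
    set u := f - (2 : ℂ) • T f with hu
    -- As `T` is idempotent, the reflection is an involution.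
    have hTu : u - (2 : ℂ) • T u = f := by
      have h : T ((2 : ℂ) • T f) = (2 : ℂ) • T f := by rw [map_smul, hTT]
      rw [hu, map_sub, h, two_smul ℂ (T f), two_smul ℂ (T f - _)]; abel
    have h1 := norm_reflection_le he hT hTA hTT (u + g')
    have h2 : trunc e M ((u + g') - (2 : ℂ) • T (u + g')) = ((c + 1 : ℝ) : ℂ) • w := by
      have : (u + g') - (2 : ℂ) • T (u + g') = (u - (2 : ℂ) • T u) + (g' - (2 : ℂ) • T g') := by
        rw [map_add, smul_add]; abel
      rw [this, hTu, map_add, hfM, ← hw, hf, Complex.ofReal_add, Complex.ofReal_one, add_smul,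
        one_smul]
    have h3 := norm_sq_le_trunc he N (u + g')
    have h4 : u + g' - trunc e N (u + g') = (u - trunc e N u) + g' := by
      rw [map_add, hg1, add_zero]; abel
    have h5 := hb f
    rw [hfM, ← hu] at h5
    rw [map_add, hg1, add_zero] at h3
    have h6 : ‖u + g' - trunc e N u‖ ≤ δ * ‖f‖ + ‖g'‖ := by
      rw [map_add, hg1, add_zero] at h4
      rw [h4]
      exact (norm_add_le _ _).trans (add_le_add h5 le_rfl)
    have h7 : ‖trunc e N u‖ ≤ ‖f‖ :=
      (norm_trunc_le he N u).trans (norm_reflection_le he hT hTA hTT f)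
    rw [← h2]
    have h8 := (norm_trunc_le he M ((u + g') - (2 : ℂ) • T (u + g'))).trans h1
    refine (pow_le_pow_left₀ (norm_nonneg _) h8 2).trans (h3.trans (add_le_add ?_ ?_))
    · exact pow_le_pow_left₀ (norm_nonneg _) h7 2
    · exact pow_le_pow_left₀ (norm_nonneg _) h6 2
  -- For `r ≤ n` one has `rδ ≤ 1`, and `‖w‖ ≤ ‖g'‖`, so the error term is at most `‖g'‖`. Each step
  -- therefore adds at most `(2‖g'‖)² = 4‖g'‖²`.
  have ind : ∀ r : ℕ, r ≤ n → ‖((r : ℝ) : ℂ) • w‖ ^ 2 ≤ 4 * ‖g'‖ ^ 2 * r := by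
    intro r
    induction r with
    | zero => intro _; simp
    | succ r ih =>
      intro hr
      have h1 := ih (by omega)
      have h2 := step r r.cast_nonneg
      have h3 : δ * ‖((r : ℝ) : ℂ) • w‖ ≤ ‖g'‖ := by
        rw [norm_smul, Complex.norm_real, Real.norm_of_nonneg r.cast_nonneg]
        have h4 : (r : ℝ) ≤ n := by exact_mod_cast (by omega : r ≤ n)
        have h5 : δ * r ≤ 1 := by
          rw [mul_comm]
          exact (mul_le_mul_of_nonneg_right h4 hδ).trans hn
        rw [← mul_assoc]
        exact (mul_le_mul_of_nonneg_right h5 (norm_nonneg w)).trans (by rwa [one_mul])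
      have h4 : 0 ≤ δ * ‖((r : ℝ) : ℂ) • w‖ := mul_nonneg hδ (norm_nonneg _)
      have h5 := pow_le_pow_left₀ (add_nonneg h4 (norm_nonneg g')) (add_le_add_left h3 ‖g'‖) 2
      rw [Nat.cast_succ]
      refine h2.trans ((add_le_add h1 h5).trans_eq ?_)
      ring
  have h1 := ind n le_rfl
  rw [norm_smul, Complex.norm_real, Real.norm_of_nonneg n.cast_nonneg, hw2, norm_neg, norm_smul,
    Complex.norm_ofNat] at h1
  rcases Nat.eq_zero_or_pos n with h0 | h0
  · rw [h0]; simp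
  have h0' : (0 : ℝ) < n := by exact_mod_cast h0
  -- Since `w = -2 P_M T g'`, the last bound reads `4n²t² ≤ 4n‖g'‖²`. Dividing by `4n` and using
  -- `‖g'‖ ≤ 2‖g‖` gives the constant `4`.
  generalize ‖trunc e M (T g')‖ = t at h1 ⊢
  have h2 : (n : ℝ) * (n * t ^ 2) ≤ n * ‖g'‖ ^ 2 := by
    have : (n : ℝ) * (2 * t) * (n * (2 * t)) = 4 * (n * (n * t ^ 2)) := by ring
    rw [sq (_ * _), this] at h1
    linarith
  have h3 := le_of_mul_le_mul_left h2 h0'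
  have h4 := pow_le_pow_left₀ (norm_nonneg _) hg3 2
  rw [mul_pow] at h4
  linarith

/-- A truncation to `M` coordinates involves only the `M` vectors `e s ⊗ 1`, with coefficients
bounded by `‖f‖`. The operator norm of the columns is thus bounded by finitely many vector norms,
each of which tends to zero with `N` by strong convergence. -/
theorem norm_trunc_compl_le {M N : ℕ} (f : HTensor (Column H) A) :
    ‖(trunc e M f - (2 : ℂ) • T (trunc e M f)) -
      trunc e N (trunc e M f - (2 : ℂ) • T (trunc e M f))‖ ≤
    (∑ s : Fin M, ‖(tm (⊥ : Submodule ℂ (Column H ⊗[ℂ] A)) (e s) 1 -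
        (2 : ℂ) • T (tm ⊥ (e s) 1)) - trunc e N (tm (⊥ : Submodule ℂ (Column H ⊗[ℂ] A)) (e s) 1 -
        (2 : ℂ) • T (tm ⊥ (e s) 1))‖) * ‖f‖ := by
  have e1 : (trunc e M f - (2 : ℂ) • T (trunc e M f)) -
      trunc e N (trunc e M f - (2 : ℂ) • T (trunc e M f)) =
      ∑ s : Fin M, MulOpposite.op (coord A (e s) f) •
        ((tm (⊥ : Submodule ℂ (Column H ⊗[ℂ] A)) (e s) 1 -
        (2 : ℂ) • T (tm ⊥ (e s) 1)) - trunc e N (tm (⊥ : Submodule ℂ (Column H ⊗[ℂ] A)) (e s) 1 -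
        (2 : ℂ) • T (tm ⊥ (e s) 1))) := by
    rw [trunc_eq_sum_smul he M f]
    simp only [map_sum, map_sub, map_smul, Finset.smul_sum, ← Finset.sum_sub_distrib, hTA,
      trunc_op_smul he]
    refine Finset.sum_congr rfl fun s _ => ?_
    simp only [smul_sub, smul_comm (2 : ℂ)]
  rw [e1, Finset.sum_mul]
  refine (norm_sum_le _ _).trans (Finset.sum_le_sum fun s _ => ?_)
  refine (norm_right_smul_le _ _).trans (mul_le_mul_of_nonneg_left ?_ (norm_nonneg _))
  exact (norm_entry_le (coords e M (fun _ _ : Unit => f)) ((), s) ()).trans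
    ((mnorm_coords_le he M _).trans (mnorm_unit f).le)

/-- For a completely contractive idempotent module map `T`, the maps `P_M T P_N` converge to
`P_M T` in norm. -/
theorem trunc_idempotent_tendsto (hTT : ∀ v, T (T v) = T v) (M : ℕ) {ε : ℝ} (hε : 0 < ε) :
    ∃ N₀, ∀ N ≥ N₀, ∀ g : HTensor (Column H) A,
      ‖trunc e M (T (g - trunc e N g))‖ ≤ ε * ‖g‖ := by
  -- The number `n` of iterations is fixed first, so that `4/n < ε²`. Then `N` is taken so large
  -- that the column defect is below `1/n`, which keeps the iteration valid for `n` steps.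
  obtain ⟨n, hn⟩ := exists_nat_gt (4 / ε ^ 2)
  have hn0 : (0 : ℝ) < n := lt_of_le_of_lt (by positivity) hn
  let b : Fin M → HTensor (Column H) A := fun s =>
    tm (⊥ : Submodule ℂ (Column H ⊗[ℂ] A)) (e s) 1 - (2 : ℂ) • T (tm ⊥ (e s) 1)
  have ht : Filter.Tendsto (fun N => ∑ s, ‖b s - trunc e N (b s)‖) Filter.atTop (nhds 0) := by
    have h : Filter.Tendsto (fun N => ∑ s, ‖b s - trunc e N (b s)‖) Filter.atTop
        (nhds (∑ s, ‖b s - b s‖)) :=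
      tendsto_finsetSum _ fun s _ => (tendsto_const_nhds.sub (trunc_tendsto he (b s))).norm
    simpa using h
  obtain ⟨N₁, h1⟩ := Filter.eventually_atTop.1
    (ht.eventually (gt_mem_nhds (show (0 : ℝ) < 1 / n by positivity)))
  refine ⟨max M N₁, fun N hN g => ?_⟩
  have hδ := h1 N ((le_max_right _ _).trans hN)
  have h2 := trunc_reflection_le he hT hTA hTT ((le_max_left M N₁).trans hN)
    (Finset.sum_nonneg fun s _ => norm_nonneg _) (norm_trunc_compl_le he hT hTA) n (by
      rw [lt_div_iff₀ hn0] at hδ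
      rw [mul_comm]
      exact hδ.le) g
  rw [← sq_le_sq₀ (norm_nonneg _) (by positivity), mul_pow]
  rw [div_lt_iff₀ (by positivity)] at hn
  have h3 : (n : ℝ) * ‖trunc e M (T (g - trunc e N g))‖ ^ 2 ≤ n * (ε ^ 2 * ‖g‖ ^ 2) := by
    nlinarith [sq_nonneg ‖g‖]
  exact le_of_mul_le_mul_left h3 hn0

end idempotent

/-! ### Direct summands of `H ⊗ A` are rigged -/

section rigged

variable {A : Type*} [NormedRing A] [NormedAlgebra ℂ A] [OperatorSpace A] [OperatorAlgebra A]
  {H : Type*} [NormedAddCommGroup H] [InnerProductSpace ℂ H]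
  {E : Type*} [SeminormedAddCommGroup E] [NormedSpace ℂ E] [OperatorSpace E]
  [Module Aᵐᵒᵖ E] [IsScalarTower ℂ Aᵐᵒᵖ E]

/-- Here `ψ_i φ_i = π P_{i+1} ι`, which tends to `πι = 1` strongly. The difference `φ_j ψ_i φ_i -
φ_j` is the column of coordinates of `P_{j+1} T (P_{i+1} - 1) ι` with `T = ιπ`, and
`trunc_idempotent_tendsto` makes it small in norm. -/
theorem isRigged_of_summand [TopologicalSpace.SeparableSpace H]
    {ι : E →ₗ[ℂ] HTensor (Column H) A} {π : HTensor (Column H) A →ₗ[ℂ] E}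
    (hι : IsCC ι) (hπ : IsCC π)
    (hιA : ∀ (a : A) (x : E), ι (MulOpposite.op a • x) = MulOpposite.op a • ι x)
    (hπA : ∀ (a : A) (v : HTensor (Column H) A), π (MulOpposite.op a • v) = MulOpposite.op a • π v)
    (hπι : ∀ x, π (ι x) = x) : IsRigged A E := by
  obtain ⟨e, he⟩ := exists_paddedBasis (H := H)
  have hT : IsCC (ι.comp π) := fun {m n} _ _ x => by
    rw [one_mul]
    have h1 := hι (x.map π)
    have h2 := hπ x
    rw [one_mul] at h1 h2
    exact h1.trans h2
  -- The number of coordinates is `i + 1` rather than `i` because the ranks have to be positive.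
  refine ⟨fun i => i + 1, fun i => LinearMap.pi fun s : Fin (i + 1) => (coord A (e s)).toLinearMap.comp ι,
    fun i => π.comp (∑ s : Fin (i + 1), (tmₗ (⊥ : Submodule ℂ (Column H ⊗[ℂ] A)) (e s)).comp
      (LinearMap.proj s : (Fin (i + 1) → A) →ₗ[ℂ] A)), fun i => Nat.succ_pos i, fun i a x => ?_, fun i a v => ?_,
      fun i {k l} _ _ x => ?_, fun i {k l} _ _ v => ?_, fun x => ?_, fun j ε hε => ?_⟩
  · ext s
    simp only [LinearMap.pi_apply, LinearMap.comp_apply, hιA, ContinuousLinearMap.coe_coe,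
      coord_op_smul, Pi.smul_apply, MulOpposite.smul_eq_mul_unop, MulOpposite.unop_op]
  · simp only [LinearMap.comp_apply, LinearMap.sum_apply, LinearMap.proj_apply, Pi.smul_apply]
    rw [← hπA, Finset.smul_sum]
    congr 1
    refine Finset.sum_congr rfl fun s _ => ?_
    exact (right_smul_tm a _ _).symm
  · have h := (mnorm_coords_le he (i + 1) (x.map ι)).trans ((hι x).trans_eq (one_mul _))
    exact h
  · have h := (hπ (synth e (i + 1) (flat v))).trans
      ((one_mul _).trans_le (mnorm_synth_le he (i + 1) (flat v)))
    refine le_trans (le_of_eq (congrArg mnorm ?_)) h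
    ext a b
    simp only [Matrix.map_apply, LinearMap.comp_apply, LinearMap.sum_apply, synth, Matrix.of_apply]
    rfl
  · have h := ((CBWith.continuous hπ).tendsto _).comp
      ((trunc_tendsto he (ι x)).comp (Filter.tendsto_add_atTop_nat 1))
    rw [hπι] at h
    refine h.congr fun i => ?_
    simp only [Function.comp_apply, LinearMap.comp_apply, LinearMap.sum_apply, trunc_apply]
    rfl
  · obtain ⟨N, hN⟩ := trunc_idempotent_tendsto he hT (fun a v => by
      rw [LinearMap.comp_apply, LinearMap.comp_apply, hπA, hιA]) (fun v => by
      simp only [LinearMap.comp_apply, hπι]) (j + 1) hε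
    refine ⟨N, fun i hi x => ?_⟩
    have h1 := hN (i + 1) (by omega) (ι x)
    have h2 : ‖ι x‖ ≤ ‖x‖ := by simpa using CBWith.norm_le hι x
    refine le_trans (le_of_eq ?_) (h1.trans (mul_le_mul_of_nonneg_left h2 hε.le))
    -- The rigging condition measures a column of coordinates, and the estimate concerns a
    -- truncation in `H ⊗ A`. The two norms agree, and the sign of the difference is immaterial.
    have h3 : ‖trunc e (j + 1) ((ι.comp π) (ι x - trunc e (i + 1) (ι x)))‖ =
        mnorm (coords e (j + 1)
          (fun _ _ : Unit => (ι.comp π) (trunc e (i + 1) (ι x)) - ι x)) := by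
      have h4 : (ι.comp π) (ι x - trunc e (i + 1) (ι x)) =
          -((ι.comp π) (trunc e (i + 1) (ι x)) - ι x) := by
        rw [map_sub, LinearMap.comp_apply, hπι, neg_sub]
      rw [h4, map_neg, norm_neg]
      exact (mnorm_unit _).symm.trans (mnorm_map_trunc he (j + 1) (fun _ _ : Unit =>
        (ι.comp π) (trunc e (i + 1) (ι x)) - ι x))
    rw [h3]
    congr 1
    ext p q
    simp only [flat, coords, Matrix.of_apply, Pi.sub_apply, LinearMap.pi_apply,
      LinearMap.comp_apply, ContinuousLinearMap.coe_coe, map_sub, LinearMap.sum_apply,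
      LinearMap.proj_apply, trunc_apply]
    rfl

end rigged

/-! ### Triple products -/

section triple

variable {X Y Z W : Type*} [SeminormedAddCommGroup X] [NormedSpace ℂ X] [OperatorSpace X]
  [SeminormedAddCommGroup Y] [NormedSpace ℂ Y] [OperatorSpace Y]
  [SeminormedAddCommGroup Z] [NormedSpace ℂ Z] [OperatorSpace Z]
  [NormedAddCommGroup W] [NormedSpace ℂ W] [OperatorSpace W]
  {m n k l : Type} [Fintype m] [Fintype n] [Fintype k] [Fintype l]

/-- A trilinear pairing is bounded by `C` on all triple matrix products. -/
def TMBWith (T : X → Y → Z → W) (C : ℝ) : Prop :=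
  ∀ {m k l n : Type} [Fintype m] [Fintype k] [Fintype l] [Fintype n] (x : Matrix m k X)
    (y : Matrix k l Y) (z : Matrix l n Z),
    mnorm (Matrix.of fun i j => ∑ s, ∑ t, T (x i s) (y s t) (z t j)) ≤
      C * (mnorm x * (mnorm y * mnorm z))

theorem TMBWith.of_left {U : Type*} [SeminormedAddCommGroup U] [NormedSpace ℂ U] [OperatorSpace U]
    {f : X → Y → U} {g : U → Z → W} (hg0 : ∀ z, ∃ F : U →+ W, ∀ u, F u = g u z) {C D E : ℝ}
    (hD : 0 ≤ D) (hf : MBWith f C) (hg : MBWith g D) (hE : D * C = E) :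
    TMBWith (fun x y z => g (f x y) z) E := by
  subst hE
  intro m k l n _ _ _ _ x y z
  have e : (Matrix.of fun i j => ∑ s, ∑ t, g (f (x i s) (y s t)) (z t j)) = amp g (amp f x y) z := by
    ext i j
    choose F hF using hg0
    simp only [amp, Matrix.of_apply, ← hF, map_sum]
    exact Finset.sum_comm
  rw [e]
  refine (hg _ _).trans ((mul_le_mul_of_nonneg_left (mul_le_mul_of_nonneg_right (hf x y)
    (mnorm_nonneg z)) hD).trans_eq (by ring))

theorem TMBWith.of_right {U : Type*} [SeminormedAddCommGroup U] [NormedSpace ℂ U] [OperatorSpace U]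
    {f : Y → Z → U} {g : X → U → W} (hg0 : ∀ x, ∃ F : U →+ W, ∀ u, F u = g x u) {C D E : ℝ}
    (hD : 0 ≤ D) (hf : MBWith f C) (hg : MBWith g D) (hE : D * C = E) :
    TMBWith (fun x y z => g x (f y z)) E := by
  subst hE
  intro m k l n _ _ _ _ x y z
  have e : (Matrix.of fun i j => ∑ s, ∑ t, g (x i s) (f (y s t) (z t j))) = amp g x (amp f y z) := by
    ext i j
    choose F hF using hg0
    simp only [amp, Matrix.of_apply, ← hF, map_sum]
  rw [e]
  refine (hg _ _).trans ((mul_le_mul_of_nonneg_left (mul_le_mul_of_nonneg_left (hf y z)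
    (mnorm_nonneg x)) hD).trans_eq (by ring))

/-- The diagonal matrix with all diagonal entries equal to `x`. -/
def scalarMat (k : Type) (x : X) : Matrix k k X :=
  (kronOne k (fun _ _ : Unit => x)).submatrix (fun i => ((), i)) (fun i => ((), i))

theorem scalarMat_self (x : X) (i : k) : scalarMat k x i i = x := if_pos rfl

theorem scalarMat_ne (x : X) {i j : k} (h : i ≠ j) : scalarMat k x i j = 0 := if_neg h

theorem mnorm_scalarMat_le (x : X) : mnorm (scalarMat k x) ≤ ‖x‖ :=
  (mnorm_submatrix_le _ (fun _ _ h => (Prod.mk.inj h).2) _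
    (fun _ _ h => (Prod.mk.inj h).2) _).trans ((mnorm_kronOne_le _).trans (mnorm_unit x).le)

/-- To freeze the last variable, the diagonal matrix with entries `z` is inserted as third factor.
Its norm is at most `‖z‖` and it collapses the second inner sum. -/
theorem TMBWith.fix_right {T : X →ₗ[ℂ] Y →ₗ[ℂ] Z →ₗ[ℂ] W} {C : ℝ} (hC : 0 ≤ C)
    (hT : TMBWith (fun x y z => T x y z) C) (z : Z) :
    IsMB fun x y => T.compr₂ (LinearMap.applyₗ z) x y := by
  classical
  refine ⟨C * ‖z‖, mul_nonneg hC (norm_nonneg _), fun {m k n} _ _ _ x y => ?_⟩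
  refine le_trans (le_of_eq (congrArg mnorm ?_)) ((hT x y (scalarMat n z)).trans
    ((mul_le_mul_of_nonneg_left (mul_le_mul_of_nonneg_left (mul_le_mul_of_nonneg_left
      (mnorm_scalarMat_le z) (mnorm_nonneg y)) (mnorm_nonneg x)) hC).trans_eq (by ring)))
  ext i j
  simp only [amp, Matrix.of_apply]
  refine Finset.sum_congr rfl fun s _ => ?_
  rw [Finset.sum_eq_single j]
  · rw [scalarMat_self]; rfl
  · intro t _ ht
    rw [scalarMat_ne z ht, map_zero]
  · simp

theorem TMBWith.fix_left {T : X →ₗ[ℂ] Y →ₗ[ℂ] Z →ₗ[ℂ] W} {C : ℝ} (hC : 0 ≤ C)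
    (hT : TMBWith (fun x y z => T x y z) C) (x : X) : IsMB fun y z => T x y z := by
  classical
  refine ⟨C * ‖x‖, mul_nonneg hC (norm_nonneg _), fun {m k n} _ _ _ y z => ?_⟩
  refine le_trans (le_of_eq (congrArg mnorm ?_)) ((hT (scalarMat m x) y z).trans
    ((mul_le_mul_of_nonneg_left (mul_le_mul_of_nonneg_right (mnorm_scalarMat_le x)
      (mul_nonneg (mnorm_nonneg y) (mnorm_nonneg z))) hC).trans_eq (by ring)))
  ext i j
  simp only [amp, Matrix.of_apply]
  rw [Finset.sum_eq_single i]
  · rw [scalarMat_self]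
  · intro t _ ht
    simp [scalarMat_ne x ht.symm]
  · simp

variable [CompleteSpace W]

/-- The pairing on `(X ⊗ Y) × Z` determined by a trilinear pairing. -/
def HT.liftLeft {N : Submodule ℂ (X ⊗[ℂ] Y)} (T : X →ₗ[ℂ] Y →ₗ[ℂ] Z →ₗ[ℂ] W) {C : ℝ}
    (hC : 0 ≤ C) (hT : TMBWith (fun x y z => T x y z) C)
    (hN : ∀ z, N ≤ LinearMap.ker (TensorProduct.lift (T.compr₂ (LinearMap.applyₗ z)))) :
    HT N →ₗ[ℂ] Z →ₗ[ℂ] W :=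
  LinearMap.mk₂ ℂ (fun u z => HT.lift (T.compr₂ (LinearMap.applyₗ z)) (hT.fix_right hC z) (hN z) u)
    (fun _ _ _ => map_add _ _ _) (fun _ _ _ => map_smul _ _ _)
    (fun u z z' => DFunLike.congr_fun (HT.clm_ext (f := HT.lift _ (hT.fix_right hC (z + z')) (hN _))
      (g := HT.lift _ (hT.fix_right hC z) (hN z) + HT.lift _ (hT.fix_right hC z') (hN z'))
      fun x y => by
        rw [add_apply, HT.lift_tm, HT.lift_tm, HT.lift_tm]
        exact map_add (T x y) z z') u)
    (fun c u z => DFunLike.congr_fun (HT.clm_ext (f := HT.lift _ (hT.fix_right hC (c • z)) (hN _))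
      (g := c • HT.lift _ (hT.fix_right hC z) (hN z)) fun x y => by
        rw [smul_apply, HT.lift_tm, HT.lift_tm]
        exact map_smul (T x y) c z) u)

/-- The pairing on `X × (Y ⊗ Z)` determined by a trilinear pairing. -/
def HT.liftRight {N : Submodule ℂ (Y ⊗[ℂ] Z)} (T : X →ₗ[ℂ] Y →ₗ[ℂ] Z →ₗ[ℂ] W) {C : ℝ}
    (hC : 0 ≤ C) (hT : TMBWith (fun x y z => T x y z) C)
    (hN : ∀ x, N ≤ LinearMap.ker (TensorProduct.lift (T x))) :
    X →ₗ[ℂ] HT N →ₗ[ℂ] W :=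
  LinearMap.mk₂ ℂ (fun x u => HT.lift (T x) (hT.fix_left hC x) (hN x) u)
    (fun x x' u => DFunLike.congr_fun (HT.clm_ext (f := HT.lift _ (hT.fix_left hC (x + x')) (hN _))
      (g := HT.lift _ (hT.fix_left hC x) (hN x) + HT.lift _ (hT.fix_left hC x') (hN x'))
      fun y z => by
        rw [add_apply, HT.lift_tm, HT.lift_tm, HT.lift_tm, map_add]; rfl) u)
    (fun c x u => DFunLike.congr_fun (HT.clm_ext (f := HT.lift _ (hT.fix_left hC (c • x)) (hN _))
      (g := c • HT.lift _ (hT.fix_left hC x) (hN x)) fun y z => by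
        rw [smul_apply, HT.lift_tm, HT.lift_tm, map_smul]; rfl) u)
    (fun _ _ _ => map_add _ _ _) (fun _ _ _ => map_smul _ _ _)

section left

variable {N : Submodule ℂ (X ⊗[ℂ] Y)} (T : X →ₗ[ℂ] Y →ₗ[ℂ] Z →ₗ[ℂ] W) {C : ℝ}
    (hC : 0 ≤ C) (hT : TMBWith (fun x y z => T x y z) C)
    (hN : ∀ z, N ≤ LinearMap.ker (TensorProduct.lift (T.compr₂ (LinearMap.applyₗ z))))

theorem HT.liftLeft_tm (x : X) (y : Y) (z : Z) : HT.liftLeft T hC hT hN (tm N x y) z = T x y z :=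
  HT.lift_tm _ _ _ x y

theorem HT.continuous_liftLeft (z : Z) : Continuous fun u => HT.liftLeft T hC hT hN u z :=
  (HT.lift _ (hT.fix_right hC z) (hN z)).continuous

theorem HT.liftLeft_mb : MBWith (fun u z => HT.liftLeft T hC hT hN u z) C :=
  HT.mbWith_left (HT.continuous_liftLeft T hC hT hN)
    (fun z => ⟨((HT.liftLeft T hC hT hN).flip z).toAddMonoidHom, fun _ => rfl⟩) hC
    fun x y z => by
      simp only [HT.liftLeft_tm]
      exact hT x y z

end left

section right

variable {N : Submodule ℂ (Y ⊗[ℂ] Z)} (T : X →ₗ[ℂ] Y →ₗ[ℂ] Z →ₗ[ℂ] W) {C : ℝ}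
    (hC : 0 ≤ C) (hT : TMBWith (fun x y z => T x y z) C)
    (hN : ∀ x, N ≤ LinearMap.ker (TensorProduct.lift (T x)))

theorem HT.liftRight_tm (x : X) (y : Y) (z : Z) : HT.liftRight T hC hT hN x (tm N y z) = T x y z :=
  HT.lift_tm _ _ _ y z

theorem HT.continuous_liftRight (x : X) : Continuous (HT.liftRight T hC hT hN x) :=
  (HT.lift _ (hT.fix_left hC x) (hN x)).continuous

theorem HT.liftRight_mb : MBWith (fun x u => HT.liftRight T hC hT hN x u) C :=
  HT.mbWith_right (HT.continuous_liftRight T hC hT hN)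
    (fun x => ⟨(HT.liftRight T hC hT hN x).toAddMonoidHom, fun _ => rfl⟩) hC
    fun x y z => by
      simp only [HT.liftRight_tm]
      exact hT x y z

end right

end triple

/-! ### Tensor products of column Hilbert spaces -/

section hilbert

variable {H H' : Type*} [NormedAddCommGroup H] [InnerProductSpace ℂ H]
  [NormedAddCommGroup H'] [InnerProductSpace ℂ H']
  {m n k l : Type} [Fintype m] [Fintype n] [Fintype k] [Fintype l]

/-- The Hilbert space tensor product. -/
def HilbertTensor (H H' : Type*) [NormedAddCommGroup H] [InnerProductSpace ℂ H]
    [NormedAddCommGroup H'] [InnerProductSpace ℂ H'] : Type _ := Completion (H ⊗[ℂ] H')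

instance : NormedAddCommGroup (HilbertTensor H H') :=
  inferInstanceAs (NormedAddCommGroup (Completion (H ⊗[ℂ] H')))

instance : InnerProductSpace ℂ (HilbertTensor H H') :=
  inferInstanceAs (InnerProductSpace ℂ (Completion (H ⊗[ℂ] H')))

instance : CompleteSpace (HilbertTensor H H') :=
  inferInstanceAs (CompleteSpace (Completion (H ⊗[ℂ] H')))

variable (H H') in
/-- The elementary tensors of Hilbert spaces. -/
def hilbertTmul : H →ₗ[ℂ] H' →ₗ[ℂ] Completion (H ⊗[ℂ] H') :=
  LinearMap.mk₂ ℂ (fun h h' => ((h ⊗ₜ[ℂ] h' : H ⊗[ℂ] H') : Completion (H ⊗[ℂ] H')))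
    (fun x x' y => by rw [TensorProduct.add_tmul, Completion.coe_add])
    (fun c x y => by rw [← TensorProduct.smul_tmul', Completion.coe_smul])
    (fun x y y' => by rw [TensorProduct.tmul_add, Completion.coe_add])
    (fun c x y => by rw [TensorProduct.tmul_smul, Completion.coe_smul])

/-- The elementary tensors of column spaces. -/
def colTensor : Column H →ₗ[ℂ] Column H' →ₗ[ℂ] Column (HilbertTensor H H') := hilbertTmul H H'

theorem inner_colTensor (h g : Column H) (h' g' : Column H') :
    inner ℂ (colTensor h h') (colTensor g g') = (inner ℂ h g : ℂ) * inner ℂ h' g' := by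
  refine (Completion.inner_coe (𝕜 := ℂ) (E := H ⊗[ℂ] H') _ _).trans ?_
  exact TensorProduct.inner_tmul (𝕜 := ℂ) (E := H) (F := H') h g h' g'

theorem norm_colTensor (h : Column H) (h' : Column H') : ‖colTensor h h'‖ = ‖h‖ * ‖h'‖ :=
  (Completion.norm_coe (E := H ⊗[ℂ] H') _).trans (TensorProduct.norm_tmul (E := H) (F := H') h h')

/-- Closed additive properties of vectors in a Hilbert space tensor product can be checked on
elementary tensors. -/
theorem colTensor_induction {p : Column (HilbertTensor H H') → Prop} (hc : IsClosed {u | p u})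
    (h0 : p 0) (hadd : ∀ u v, p u → p v → p (u + v)) (ht : ∀ h h', p (colTensor h h'))
    (u : Column (HilbertTensor H H')) : p u := by
  refine Completion.induction_on (α := H ⊗[ℂ] H') u hc fun v => ?_
  refine TensorProduct.induction_on (motive := fun v : H ⊗[ℂ] H' =>
    p (show Column (HilbertTensor H H') from (v : Completion (H ⊗[ℂ] H')))) v ?_ ht ?_
  · exact (Completion.coe_zero (α := H ⊗[ℂ] H')).symm ▸ h0
  · intro x y hx hy
    exact (Completion.coe_add x y).symm ▸ hadd _ _ hx hy

/-- The elementary tensors are the image of a separable space under a continuous map, and their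
closed span is everything. -/
theorem separableSpace_hilbertTensor [TopologicalSpace.SeparableSpace H]
    [TopologicalSpace.SeparableSpace H'] :
    TopologicalSpace.SeparableSpace (HilbertTensor H H') := by
  have hc : Continuous fun q : Column H × Column H' => colTensor q.1 q.2 := by
    have h : IsBoundedBilinearMap ℂ fun q : Column H × Column H' => colTensor q.1 q.2 :=
      { add_left := fun _ _ _ => LinearMap.map_add₂ _ _ _ _
        smul_left := fun _ _ _ => LinearMap.map_smul₂ _ _ _ _
        add_right := fun _ _ _ => map_add _ _ _
        smul_right := fun _ _ _ => map_smul _ _ _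
        bound := ⟨1, one_pos, fun x y => by rw [norm_colTensor, one_mul]⟩ }
    exact h.continuous
  have : TopologicalSpace.SeparableSpace (Column H × Column H') :=
    inferInstanceAs (TopologicalSpace.SeparableSpace (H × H'))
  have h1 : TopologicalSpace.IsSeparable (closure
      (Submodule.span ℂ (Set.range fun q : Column H × Column H' => colTensor q.1 q.2) :
        Set (Column (HilbertTensor H H')))) :=
    ((TopologicalSpace.isSeparable_range hc).span (R := ℂ)).closure
  refine TopologicalSpace.isSeparable_univ_iff.1 (h1.mono fun u _ => ?_)
  refine colTensor_induction (p := fun u => u ∈ closure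
      (Submodule.span ℂ (Set.range fun q : Column H × Column H' => colTensor q.1 q.2) :
        Set (Column (HilbertTensor H H')))) isClosed_closure ?_ ?_ ?_ u
  · exact subset_closure (Submodule.zero_mem _)
  · intro u v hu hv
    exact (Submodule.span ℂ _).topologicalClosure.add_mem hu hv
  · intro h h'
    exact subset_closure (Submodule.subset_span ⟨(h, h'), rfl⟩)

theorem norm_sum_colTensor_sq {ι : Type*} [Fintype ι] (f : ι → Column H')
    (hf : Orthonormal ℂ f) (u : ι → Column H) :
    ‖∑ r, colTensor (u r) (f r)‖ ^ 2 = ∑ r, ‖u r‖ ^ 2 := by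
  classical
  have h : (inner ℂ (∑ r, colTensor (u r) (f r)) (∑ r, colTensor (u r) (f r)) : ℂ) =
      ∑ r, ((‖u r‖ ^ 2 : ℝ) : ℂ) := by
    rw [sum_inner]
    refine Finset.sum_congr rfl fun r _ => ?_
    rw [inner_sum, Finset.sum_eq_single r]
    · rw [inner_colTensor, inner_self_eq_norm_sq_to_K, inner_self_eq_norm_sq_to_K, hf.1 r]
      simp
    · intro t _ ht
      rw [inner_colTensor, hf.2 ht.symm, mul_zero]
    · simp
  rw [inner_self_eq_norm_sq_to_K] at h
  refine Complex.ofReal_injective ?_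
  push_cast at h ⊢
  exact h

/-- In an orthonormal basis of the span of the `w s` the norms split into one sum for each basis
vector, and each of these is an instance of the bound defining the column norm of `x`. -/
theorem sum_norm_colTensor_le (x : Matrix m k (Column H)) (w : k → Column H') :
    ∑ i, ‖∑ s, colTensor (x i s) (w s)‖ ^ 2 ≤ colNorm x ^ 2 * ∑ s, ‖w s‖ ^ 2 := by
  let W : Submodule ℂ (Column H') := Submodule.span ℂ (Set.range w)
  have hfin : FiniteDimensional ℂ W := FiniteDimensional.span_of_finite ℂ (Set.finite_range w)
  let e := stdOrthonormalBasis ℂ W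
  let w' : k → W := fun s => ⟨w s, Submodule.subset_span ⟨s, rfl⟩⟩
  have hw : ∀ s, ‖w s‖ ^ 2 = ∑ b, ‖e.repr (w' s) b‖ ^ 2 := fun s => by
    have : ‖w s‖ = ‖w' s‖ := rfl
    rw [this, ← e.repr.norm_map (w' s), EuclideanSpace.norm_sq_eq]
  have he : Orthonormal ℂ fun b => (e b : Column H') :=
    e.orthonormal.comp_linearIsometry W.subtypeₗᵢ
  have h1 : ∀ i, ∑ s, colTensor (x i s) (w s) =
      ∑ b, colTensor (∑ s, e.repr (w' s) b • x i s) (e b : Column H') := by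
    intro i
    simp only [map_sum, LinearMap.sum_apply, map_smul, LinearMap.smul_apply]
    rw [Finset.sum_comm]
    refine Finset.sum_congr rfl fun s _ => ?_
    have h2 : w s = ∑ b, e.repr (w' s) b • (e b : Column H') := by
      have := congrArg (fun v : W => (v : Column H')) (e.sum_repr (w' s))
      simpa using this.symm
    conv_lhs => rw [h2, map_sum]
    simp only [map_smul]
  simp only [h1, norm_sum_colTensor_sq _ he, hw]
  rw [Finset.sum_comm, Finset.sum_comm (s := (Finset.univ : Finset k)), Finset.mul_sum]
  exact Finset.sum_le_sum fun b _ => colNorm_bound x fun s => e.repr (w' s) b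

/-- Scalar combinations of the columns of the product act on the second leg alone. They are
estimated by the column norm of `y`, and the remaining sum over the first leg by that of `x`. -/
theorem colTensor_mb : MBWith (fun (h : Column H) (h' : Column H') => colTensor h h') 1 := by
  intro m k n _ _ _ x y
  rw [one_mul]
  refine colNorm_le _ (mul_nonneg (mnorm_nonneg x) (mnorm_nonneg y)) fun v => ?_
  have e : ∀ i, ∑ j, v j • amp (fun (h : Column H) (h' : Column H') => colTensor h h') x y i j =
      ∑ s, colTensor (x i s) (∑ j, v j • y s j) := by
    intro i
    simp only [amp, Finset.smul_sum, map_sum, map_smul]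
    exact Finset.sum_comm
  simp only [e]
  refine (sum_norm_colTensor_le x _).trans ?_
  rw [mul_pow, mul_assoc]
  exact mul_le_mul_of_nonneg_left (colNorm_bound y v) (sq_nonneg _)

end hilbert

/-! ### Products of direct summands -/

section slices

variable {H H' : Type*} [NormedAddCommGroup H] [InnerProductSpace ℂ H]
  [NormedAddCommGroup H'] [InnerProductSpace ℂ H']
  {m n k l : Type} [Fintype m] [Fintype n] [Fintype k] [Fintype l]

instance [CompleteSpace H] : CompleteSpace (Column H) := inferInstanceAs (CompleteSpace H)

variable (H') in
/-- The map `h' ↦ h ⊗ h'`. -/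
def colTensorL (h : Column H) : Column H' →L[ℂ] Column (HilbertTensor H H') :=
  (colTensor h).mkContinuous ‖h‖ fun h' => (norm_colTensor h h').le

theorem colTensorL_apply (h : Column H) (h' : Column H') :
    colTensorL H' h h' = colTensor h h' := rfl

variable [CompleteSpace H']

variable (H') in
/-- The map `h ⊗ h' ↦ ⟨h₀, h⟩ h'`. -/
def slice (h₀ : Column H) : Column (HilbertTensor H H') →L[ℂ] Column H' :=
  ContinuousLinearMap.adjoint (colTensorL H' h₀)

theorem slice_colTensor (h₀ h : Column H) (h' : Column H') :
    slice H' h₀ (colTensor h h') = (inner ℂ h₀ h : ℂ) • h' := by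
  refine ext_inner_left ℂ fun g => ?_
  rw [slice, ContinuousLinearMap.adjoint_inner_right, colTensorL_apply, inner_colTensor,
    inner_smul_right]

/-- This is Bessel's inequality for the mutually orthogonal subspaces `e s ⊗ H'`. The slices are the
adjoints of the maps `h' ↦ e s ⊗ h'`. -/
theorem IsPaddedBasis.sum_norm_slice_sq_le {e : ℕ → Column H} (he : IsPaddedBasis e) (N : ℕ)
    (u : Column (HilbertTensor H H')) : ∑ s : Fin N, ‖slice H' (e s) u‖ ^ 2 ≤ ‖u‖ ^ 2 := by
  set S := ∑ s : Fin N, ‖slice H' (e s) u‖ ^ 2 with hS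
  let w := ∑ s : Fin N, colTensor (e s) (slice H' (e s) u)
  have h1 : (inner ℂ w u : ℂ) = (S : ℂ) := by
    simp only [w, sum_inner, hS]
    push_cast
    refine Finset.sum_congr rfl fun s _ => ?_
    rw [← colTensorL_apply, ← ContinuousLinearMap.adjoint_inner_right]
    exact inner_self_eq_norm_sq_to_K _
  have h2 : ‖w‖ ^ 2 ≤ S := by
    have h3 : (inner ℂ w w : ℂ) = ((∑ s : Fin N, ‖e s‖ ^ 2 * ‖slice H' (e s) u‖ ^ 2 : ℝ) : ℂ) := by
      simp only [w]
      rw [sum_inner]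
      push_cast
      refine Finset.sum_congr rfl fun s _ => ?_
      rw [inner_sum, Finset.sum_eq_single s]
      · rw [inner_colTensor, inner_self_eq_norm_sq_to_K, inner_self_eq_norm_sq_to_K]; rfl
      · intro t _ ht
        rw [inner_colTensor, he.orth s t fun h => ht (Fin.ext h.symm), zero_mul]
      · simp
    rw [inner_self_eq_norm_sq_to_K] at h3
    have h4 : ‖w‖ ^ 2 = ∑ s : Fin N, ‖e s‖ ^ 2 * ‖slice H' (e s) u‖ ^ 2 := by
      refine Complex.ofReal_injective ?_
      push_cast at h3 ⊢
      exact h3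
    rw [h4]
    refine Finset.sum_le_sum fun s _ => mul_le_of_le_one_left (sq_nonneg _) ?_
    rcases he.norm s with h | h <;> simp [h]
  have h0 : 0 ≤ S := Finset.sum_nonneg fun s _ => sq_nonneg _
  have h5 : S ≤ ‖w‖ * ‖u‖ := by
    have h6 := norm_inner_le_norm (𝕜 := ℂ) w u
    rw [h1, Complex.norm_real, Real.norm_of_nonneg h0] at h6
    exact h6
  -- Cauchy-Schwarz gives `S² ≤ ‖w‖²‖u‖² ≤ S‖u‖²`, and `S` can be cancelled unless it is zero.
  rcases h0.eq_or_lt with h | h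
  · rw [← h]; positivity
  · have h7 := pow_le_pow_left₀ h0 h5 2
    rw [mul_pow, sq S] at h7
    exact le_of_mul_le_mul_left (h7.trans (mul_le_mul_of_nonneg_right h2 (sq_nonneg _))) h

theorem IsPaddedBasis.colNorm_slices_le {e : ℕ → Column H} (he : IsPaddedBasis e) (N : ℕ)
    (u : Matrix k l (Column (HilbertTensor H H'))) :
    colNorm (Matrix.of fun (p : k × Fin N) j => slice H' (e p.2) (u p.1 j)) ≤ colNorm u := by
  refine colNorm_le _ (colNorm_nonneg _) fun v => ?_
  refine le_trans ?_ (colNorm_bound u v)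
  rw [Fintype.sum_prod_type]
  refine Finset.sum_le_sum fun i _ => ?_
  refine le_trans (le_of_eq ?_) (he.sum_norm_slice_sq_le N (∑ j, v j • u i j))
  refine Finset.sum_congr rfl fun s _ => ?_
  simp only [Matrix.of_apply, map_sum, map_smul]

theorem colNorm_map_le (T : Column H →L[ℂ] Column H') (x : Matrix m n (Column H)) :
    colNorm (x.map T) ≤ ‖T‖ * colNorm x := by
  refine colNorm_le _ (mul_nonneg (norm_nonneg _) (colNorm_nonneg _)) fun v => ?_
  rw [mul_pow, mul_assoc]
  refine le_trans ?_ (mul_le_mul_of_nonneg_left (colNorm_bound x v) (sq_nonneg _))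
  rw [Finset.mul_sum]
  refine Finset.sum_le_sum fun i _ => ?_
  have h : ∑ j, v j • x.map T i j = T (∑ j, v j • x i j) := by
    simp only [Matrix.map_apply, map_sum, map_smul]
  rw [h, ← mul_pow]
  exact pow_le_pow_left₀ (norm_nonneg _) (T.le_opNorm _) 2

end slices

section action

variable {X Y W R : Type*} [SeminormedAddCommGroup X] [NormedSpace ℂ X] [OperatorSpace X]
  [SeminormedAddCommGroup Y] [NormedSpace ℂ Y] [OperatorSpace Y] {N : Submodule ℂ (X ⊗[ℂ] Y)}
  [Monoid R] [AddCommGroup W] [TopologicalSpace W] [T2Space W]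

theorem HT.eq_smul_of_tm [DistribMulAction R W] [ContinuousConstSMul R W] {f g : HT N →+ W}
    (hf : Continuous f) (hg : Continuous g) (r : R)
    (h : ∀ x y, f (tm N x y) = r • g (tm N x y)) (u : HT N) : f u = r • g u :=
  HT.ext_tm (g := (DistribSMul.toAddMonoidHom W r).comp g) hf
    ((continuous_const_smul r).comp hg) h u

theorem HT.map_smul_of_tm [DistribMulAction R W] [ContinuousConstSMul R W]
    [DistribMulAction R (HT N)] [ContinuousConstSMul R (HT N)] {f : HT N →+ W}
    (hf : Continuous f) (r : R) (h : ∀ x y, f (r • tm N x y) = r • f (tm N x y)) (u : HT N) :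
    f (r • u) = r • f u :=
  HT.eq_smul_of_tm (f := f.comp (DistribSMul.toAddMonoidHom (HT N) r)) (g := f)
    (hf.comp (continuous_const_smul r)) hf r h u

end action

/-! ### The product of `H` with `H' ⊗ B`, and its slices. -/

section colMul

variable {B : Type*} [NormedRing B] [NormedAlgebra ℂ B] [OperatorSpace B] [OperatorAlgebra B]
  {H H' : Type*} [NormedAddCommGroup H] [InnerProductSpace ℂ H]
  [NormedAddCommGroup H'] [InnerProductSpace ℂ H']
  {m n k l : Type} [Fintype m] [Fintype n] [Fintype k] [Fintype l]

theorem colMul_tmb : TMBWith (fun (h : Column H) (h' : Column H') (b : B) =>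
    (colTensor.compr₂ (tmₗ (⊥ : Submodule ℂ (Column (HilbertTensor H H') ⊗[ℂ] B)))) h h' b)
    1 :=
  TMBWith.of_left (f := fun (h : Column H) (h' : Column H') => colTensor h h')
    (g := tm (⊥ : Submodule ℂ (Column (HilbertTensor H H') ⊗[ℂ] B)))
    (fun b => ⟨((tmₗ _).flip b).toAddMonoidHom, fun _ => rfl⟩) zero_le_one colTensor_mb (tm_mb _) (one_mul 1)

/-- The product `(h, h' ⊗ b) ↦ (h ⊗ h') ⊗ b`. -/
def colMul : Column H →ₗ[ℂ] HTensor (Column H') B →ₗ[ℂ]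
    HTensor (Column (HilbertTensor H H')) B :=
  HT.liftRight (colTensor.compr₂ (tmₗ ⊥)) zero_le_one colMul_tmb fun _ => bot_le

theorem colMul_tm (h : Column H) (h' : Column H') (b : B) :
    colMul h (tm ⊥ h' b) = tm ⊥ (colTensor h h') b := HT.liftRight_tm _ _ _ _ h h' b

theorem continuous_colMul (h : Column H) :
    Continuous (colMul h : HTensor (Column H') B → HTensor (Column (HilbertTensor H H')) B) :=
  HT.continuous_liftRight _ _ _ _ h

theorem colMul_mb : MBWith (fun (h : Column H) (w : HTensor (Column H') B) => colMul h w) 1 :=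
  HT.liftRight_mb _ _ _ _

attribute [irreducible] colMul

theorem colMul_op_smul (h : Column H) (w : HTensor (Column H') B) (b : B) :
    colMul h (MulOpposite.op b • w) = MulOpposite.op b • colMul h w :=
  HT.map_smul_of_tm (f := (colMul h).toAddMonoidHom) (continuous_colMul h) (MulOpposite.op b)
    (fun h' c => by
      show colMul h (MulOpposite.op b • tm ⊥ h' c) = MulOpposite.op b • colMul h (tm ⊥ h' c)
      rw [colMul_tm h h' c, right_smul_tm b h' c, right_smul_tm b (colTensor h h') c]
      exact colMul_tm h h' _) w

/-- Closed additive properties can be checked on products. -/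
theorem colMul_induction {p : HTensor (Column (HilbertTensor H H')) B → Prop}
    (hc : IsClosed {u | p u}) (h0 : p 0) (hadd : ∀ u v, p u → p v → p (u + v))
    (hm : ∀ (h : Column H) (w : HTensor (Column H') B), p (colMul h w))
    (u : HTensor (Column (HilbertTensor H H')) B) : p u := by
  refine HT.induction hc h0 hadd (fun x b => ?_) u
  refine colTensor_induction (p := fun x => p (tm ⊥ x b))
    (hc.preimage (continuous_tm_left b)) ?_ ?_ ?_ x
  · rwa [tm_zero_left]
  · intro x y hx hy
    rw [tm_add_left]
    exact hadd _ _ hx hy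
  · intro h h'
    rw [← colMul_tm]
    exact hm _ _

/-- Continuous additive maps that agree on products are equal. -/
theorem colMul_ext {Z : Type*} [AddCommMonoid Z] [TopologicalSpace Z] [T2Space Z]
    {f g : HTensor (Column (HilbertTensor H H')) B →+ Z} (hf : Continuous f) (hg : Continuous g)
    (h : ∀ (h : Column H) (w : HTensor (Column H') B), f (colMul h w) = g (colMul h w))
    (u : HTensor (Column (HilbertTensor H H')) B) : f u = g u :=
  colMul_induction (p := fun u => f u = g u) (isClosed_eq hf hg) (by rw [map_zero, map_zero])
    (fun u v hu hv => (map_add f u v).trans ((congrArg₂ (· + ·) hu hv).trans (map_add g u v).symm))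
    h u

theorem colMul_map_smul {R W : Type*} [Monoid R] [AddCommGroup W] [TopologicalSpace W] [T2Space W]
    [DistribMulAction R W] [ContinuousConstSMul R W]
    [DistribMulAction R (HTensor (Column (HilbertTensor H H')) B)]
    [ContinuousConstSMul R (HTensor (Column (HilbertTensor H H')) B)]
    {f : HTensor (Column (HilbertTensor H H')) B →+ W} (hf : Continuous f) (r : R)
    (h : ∀ (h : Column H) (w : HTensor (Column H') B), f (r • colMul h w) = r • f (colMul h w))
    (u : HTensor (Column (HilbertTensor H H')) B) : f (r • u) = r • f u :=
  colMul_ext (f := f.comp (DistribSMul.toAddMonoidHom _ r))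
    (g := (DistribSMul.toAddMonoidHom W r).comp f) (hf.comp (continuous_const_smul r))
    ((continuous_const_smul r).comp hf) h u

variable [CompleteSpace H']

theorem slicePair_mb (h₀ : Column H) : IsMB fun (u : Column (HilbertTensor H H')) (b : B) =>
    ((tmₗ (⊥ : Submodule ℂ (Column H' ⊗[ℂ] B))).comp (slice H' h₀).toLinearMap) u b := by
  refine ⟨‖slice H' h₀‖, norm_nonneg _, fun {m k n} _ _ _ u b => ?_⟩
  refine (tm_mb ⊥ (u.map (slice H' h₀)) b).trans ?_
  rw [one_mul, ← mul_assoc]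
  exact mul_le_mul_of_nonneg_right (colNorm_map_le _ _) (mnorm_nonneg _)

variable (H' B) in
/-- The map `(h ⊗ h') ⊗ b ↦ ⟨h₀, h⟩ h' ⊗ b`. -/
def sliceMap (h₀ : Column H) :
    HTensor (Column (HilbertTensor H H')) B →L[ℂ] HTensor (Column H') B :=
  HT.lift ((tmₗ ⊥).comp (slice H' h₀).toLinearMap) (slicePair_mb h₀) bot_le

theorem sliceMap_tm (h₀ : Column H) (u : Column (HilbertTensor H H')) (b : B) :
    sliceMap B H' h₀ (tm ⊥ u b) = tm ⊥ (slice H' h₀ u) b := HT.lift_tm _ _ _ u b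

attribute [irreducible] sliceMap

theorem sliceMap_colMul (h₀ h : Column H) (w : HTensor (Column H') B) :
    sliceMap B H' h₀ (colMul h w) = (inner ℂ h₀ h : ℂ) • w := by
  refine HT.induction (p := fun w : HTensor (Column H') B =>
    sliceMap B H' h₀ (colMul h w) = (inner ℂ h₀ h : ℂ) • w) ?_ ?_ ?_ ?_ w
  · exact isClosed_eq ((sliceMap B H' h₀).continuous.comp (continuous_colMul h))
      (continuous_const_smul _)
  · simp
  · intro u v hu hv
    rw [map_add, map_add, hu, hv, smul_add]
  · intro h' c
    rw [colMul_tm, sliceMap_tm, slice_colTensor, tm_smul_left]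

/-- On a product `u ⊙ b` only the Hilbert space factor is sliced, so Bessel's inequality for slices
is enough. -/
theorem mnorm_slices_le {e : ℕ → Column H} (he : IsPaddedBasis e) (N : ℕ)
    (x : Matrix k l (HTensor (Column (HilbertTensor H H')) B)) :
    mnorm (Matrix.of fun (p : k × Fin N) j => sliceMap B H' (e p.2) (x p.1 j)) ≤ mnorm x := by
  have hc : Continuous fun x : Matrix k l (HTensor (Column (HilbertTensor H H')) B) =>
      mnorm (Matrix.of fun (p : k × Fin N) j => sliceMap B H' (e p.2) (x p.1 j)) :=
    continuous_mnorm.comp (continuous_pi fun p => continuous_pi fun j =>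
      (sliceMap B H' (e p.2)).continuous.comp (continuous_apply_apply p.1 j))
  rw [← one_mul (mnorm x)]
  refine HT.le_of_amp hc zero_le_one (fun {r} _ u b => ?_) x
  have e1 : (Matrix.of fun (p : k × Fin N) j => sliceMap B H' (e p.2) (amp (tm ⊥) u b p.1 j)) =
      amp (tm ⊥) (Matrix.of fun (p : k × Fin N) t => slice H' (e p.2) (u p.1 t)) b := by
    ext p j
    simp only [amp, Matrix.of_apply, map_sum, sliceMap_tm]
  rw [e1]
  refine (tm_mb ⊥ _ b).trans (mul_le_mul_of_nonneg_left ?_ zero_le_one)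
  exact mul_le_mul_of_nonneg_right (he.colNorm_slices_le N u) (mnorm_nonneg _)

end colMul

section limits

variable {V W : Type*} [SeminormedAddCommGroup V] [NormedSpace ℂ V] [OperatorSpace V]
  [NormedAddCommGroup W] [NormedSpace ℂ W] [OperatorSpace W] [CompleteSpace W]

theorem isClosed_cauchySeq_of_bounded {V W : Type*} [SeminormedAddCommGroup V]
    [SeminormedAddCommGroup W] {f : ℕ → V → W} {C : ℝ}
    (hf : ∀ n v w, ‖f n v - f n w‖ ≤ C * ‖v - w‖) : IsClosed {v | CauchySeq fun n => f n v} := by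
  refine isClosed_of_closure_subset fun v hv => ?_
  rw [Set.mem_ofPred_eq, Metric.cauchySeq_iff']
  intro ε hε
  have hD : 0 < |C| + 1 := by positivity
  obtain ⟨w, hw, hvw⟩ := Metric.mem_closure_iff.1 hv (ε / (3 * (|C| + 1))) (by positivity)
  obtain ⟨n, hn⟩ := Metric.cauchySeq_iff'.1 hw (ε / 3) (by positivity)
  refine ⟨n, fun k hk => ?_⟩
  have h1 := hn k hk
  rw [dist_eq_norm] at h1 hvw ⊢
  have hC : C * ‖v - w‖ ≤ (|C| + 1) * ‖v - w‖ :=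
    mul_le_mul_of_nonneg_right (by linarith [le_abs_self C]) (norm_nonneg _)
  have h2 := (hf k v w).trans hC
  have h3 := (hf n v w).trans hC
  rw [lt_div_iff₀ (by positivity)] at hvw
  have e : f k v - f n v = (f k v - f k w) + (f k w - f n w) - (f n v - f n w) := by abel
  rw [e]
  refine (norm_sub_le _ _).trans_lt ?_
  have h4 := norm_add_le (f k v - f k w) (f k w - f n w)
  linarith

/-- The pointwise limit of completely contractive maps. -/
theorem exists_limit_cc {T : ℕ → V →ₗ[ℂ] W} (hT : ∀ n, IsCC (T n))
    (h : ∀ v, CauchySeq fun n => T n v) : ∃ S : V →ₗ[ℂ] W, IsCC S ∧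
      ∀ v, Filter.Tendsto (fun n => T n v) Filter.atTop (nhds (S v)) := by
  choose f hf using fun v => cauchySeq_tendsto_of_complete (h v)
  refine ⟨linearMapOfTendsto f T (tendsto_pi_nhds.2 hf), fun {m n} _ _ x => ?_, hf⟩
  have h1 : Filter.Tendsto (fun N => x.map (T N)) Filter.atTop (nhds (x.map f)) :=
    tendsto_pi_nhds.2 fun i => tendsto_pi_nhds.2 fun j => hf (x i j)
  exact le_of_tendsto ((continuous_mnorm.tendsto _).comp h1)
    (Filter.Eventually.of_forall fun N => hT N x)

/-- Repeating the row `x` along a diagonal does not change its norm, and it turns the blockwise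
pairing into a single matrix product. -/
theorem mnorm_row_amp_le {X Y Z : Type*} [SeminormedAddCommGroup X] [NormedSpace ℂ X]
    [OperatorSpace X] [SeminormedAddCommGroup Y] [NormedSpace ℂ Y] [OperatorSpace Y]
    [SeminormedAddCommGroup Z] [NormedSpace ℂ Z] [OperatorSpace Z] {f : X → Y → Z}
    (hf : MBWith f 1) (h0 : ∀ y, f 0 y = 0) {k l r : Type} [Fintype k] [Fintype l] [Fintype r]
    (x : Matrix Unit r X) (y : Matrix (k × r) l Y) :
    mnorm (Matrix.of fun i j => ∑ s, f (x () s) (y (i, s) j)) ≤ mnorm x * mnorm y := by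
  classical
  have e1 : (Matrix.of fun i j => ∑ s, f (x () s) (y (i, s) j)) = amp f
      ((kronOne k x).submatrix (fun i => ((), i)) Prod.swap) y := by
    ext i j
    simp only [amp, Matrix.of_apply, kronOne, Matrix.submatrix_apply, Fintype.sum_prod_type,
      Prod.snd_swap, Prod.fst_swap]
    rw [Finset.sum_eq_single i]
    · simp
    · intro b _ hb
      refine Finset.sum_eq_zero fun s _ => ?_
      rw [if_neg (Ne.symm hb), h0]
    · simp
  rw [e1]
  refine (hf _ y).trans ?_
  rw [one_mul]
  refine mul_le_mul_of_nonneg_right ?_ (mnorm_nonneg y)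
  exact (mnorm_submatrix_le _ (fun _ _ h => (Prod.mk.inj h).2) _ Prod.swap_injective _).trans
    (mnorm_kronOne_le _)

end limits

/-! ### The tensor product of two column summands. -/

section summand

/-- A completely isometric realization of `E` as a direct summand of `H ⊗ A`. -/
structure ColumnSummand (A : Type*) [NormedRing A] [NormedAlgebra ℂ A] [OperatorSpace A]
    [OperatorAlgebra A] (E : Type*) [SeminormedAddCommGroup E] [NormedSpace ℂ E] [OperatorSpace E]
    [Module Aᵐᵒᵖ E] (H : Type*) [NormedAddCommGroup H] [InnerProductSpace ℂ H] where
  incl : E →ₗ[ℂ] HTensor (Column H) A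
  proj : HTensor (Column H) A →ₗ[ℂ] E
  incl_ci : IsCI incl
  proj_cc : IsCC proj
  incl_op_smul : ∀ (a : A) (x : E), incl (MulOpposite.op a • x) = MulOpposite.op a • incl x
  proj_op_smul : ∀ (a : A) (v : HTensor (Column H) A),
    proj (MulOpposite.op a • v) = MulOpposite.op a • proj v
  proj_incl : ∀ x, proj (incl x) = x

variable {A B : Type*} [NormedRing A] [NormedAlgebra ℂ A] [OperatorSpace A] [OperatorAlgebra A]
  [NormedRing B] [NormedAlgebra ℂ B] [OperatorSpace B] [OperatorAlgebra B]
  {P Q : Type*} [SeminormedAddCommGroup P] [NormedSpace ℂ P] [OperatorSpace P]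
  [SeminormedAddCommGroup Q] [NormedSpace ℂ Q] [OperatorSpace Q]
  [Module Aᵐᵒᵖ P] [IsScalarTower ℂ Aᵐᵒᵖ P]
  [Module A Q] [IsScalarTower ℂ A Q] [LeftOpModule A Q]
  [Module Bᵐᵒᵖ Q] [IsScalarTower ℂ Bᵐᵒᵖ Q] [SMulCommClass A Bᵐᵒᵖ Q] [RightOpModule B Q]
  {H H' : Type*} [NormedAddCommGroup H] [InnerProductSpace ℂ H]
  [NormedAddCommGroup H'] [InnerProductSpace ℂ H']

theorem ColumnSummand.incl_cc (S : ColumnSummand A P H) : IsCC S.incl := fun {m n} _ _ x => by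
  rw [one_mul]; exact (S.incl_ci x).le

theorem ColumnSummand.continuous_proj (S : ColumnSummand A P H) : Continuous S.proj :=
  CBWith.continuous S.proj_cc

namespace ColumnSummand

variable (S : ColumnSummand A P H) (S' : ColumnSummand B Q H')

variable (A H) in
/-- The trilinear map `(h, a, q) ↦ h ⊙ ι'(aq)`. -/
def twistTri : Column H →ₗ[ℂ] A →ₗ[ℂ] Q →ₗ[ℂ] HTensor (Column (HilbertTensor H H')) B where
  toFun h := (Algebra.lsmul ℂ ℂ Q : A →ₐ[ℂ] Module.End ℂ Q).toLinearMap.compr₂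
    ((colMul h).comp S'.incl)
  map_add' h g := by ext a q; simp
  map_smul' c h := by ext a q; simp

theorem colMul_incl_mb : MBWith (fun (h : Column H) (q : Q) => colMul h (S'.incl q)) 1 := by
  intro m k n _ _ _ h q
  have h1 := colMul_mb h (q.map S'.incl)
  rwa [S'.incl_ci q] at h1

theorem twistTri_tmb : TMBWith (fun (h : Column H) (a : A) (q : Q) => S'.twistTri A H h a q) 1 :=
  TMBWith.of_right (f := fun (a : A) (q : Q) => a • q)
    (g := fun (h : Column H) (q : Q) => colMul h (S'.incl q))
    (fun h => ⟨((colMul h).comp S'.incl).toAddMonoidHom, fun _ => rfl⟩) zero_le_one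
    LeftOpModule.smul_le S'.colMul_incl_mb (one_mul 1)

variable (A H) in
/-- The pairing `(h ⊗ a, q) ↦ h ⊙ ι'(aq)`. -/
def twist : HTensor (Column H) A →ₗ[ℂ] Q →ₗ[ℂ] HTensor (Column (HilbertTensor H H')) B :=
  HT.liftLeft (S'.twistTri A H) zero_le_one S'.twistTri_tmb fun _ => bot_le

theorem twist_tm (h : Column H) (a : A) (q : Q) :
    S'.twist A H (tm ⊥ h a) q = colMul h (S'.incl (a • q)) := HT.liftLeft_tm _ _ _ _ h a q

theorem continuous_twist (q : Q) : Continuous fun v => S'.twist A H v q :=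
  HT.continuous_liftLeft _ _ _ _ q

theorem twist_mb : MBWith (fun v q => S'.twist A H v q) 1 :=
  HT.liftLeft_mb _ _ _ _

attribute [irreducible] twist

/-- On `h ⊗ b` both sides are `h ⊙ ι'(baq)`. This makes the pairing descend to the tensor product
over `A`. -/
theorem twist_op_smul (a : A) (v : HTensor (Column H) A) (q : Q) :
    S'.twist A H (MulOpposite.op a • v) q = S'.twist A H v (a • q) :=
  HT.ext_tm (f := ((S'.twist A H).flip q).toAddMonoidHom.comp
      (DistribSMul.toAddMonoidHom (HTensor (Column H) A) (MulOpposite.op a)))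
    (g := ((S'.twist A H).flip (a • q)).toAddMonoidHom)
    ((S'.continuous_twist q).comp (continuous_const_smul (MulOpposite.op a)))
    (S'.continuous_twist (a • q)) (fun h b => by
      show S'.twist A H (MulOpposite.op a • tm ⊥ h b) q = S'.twist A H (tm ⊥ h b) (a • q)
      rw [right_smul_tm, twist_tm, twist_tm, MulOpposite.smul_eq_mul_unop, MulOpposite.unop_op,
        mul_smul]) v

theorem twist_smul_right (b : B) (v : HTensor (Column H) A) (q : Q) :
    S'.twist A H v (MulOpposite.op b • q) = MulOpposite.op b • S'.twist A H v q :=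
  HT.eq_smul_of_tm (f := ((S'.twist A H).flip (MulOpposite.op b • q)).toAddMonoidHom)
    (g := ((S'.twist A H).flip q).toAddMonoidHom) (S'.continuous_twist (MulOpposite.op b • q))
    (S'.continuous_twist q) (MulOpposite.op b) (fun h a => by
      show S'.twist A H (tm ⊥ h a) (MulOpposite.op b • q) =
        MulOpposite.op b • S'.twist A H (tm ⊥ h a) q
      rw [twist_tm, twist_tm, smul_comm a (MulOpposite.op b) q, S'.incl_op_smul,
        colMul_op_smul]) v

theorem inclTensor_mb :
    MBWith (fun p q => ((S'.twist A H).comp S.incl) p q) 1 := fun {m k n} _ _ _ p q => by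
  have h := S'.twist_mb (p.map S.incl) q
  rwa [S.incl_ci p] at h

/-- The map `p ⊗ q ↦ ι(p) ⊙ ι'(q)`. -/
def inclTensor : ModTensor A P Q →L[ℂ] HTensor (Column (HilbertTensor H H')) B :=
  HT.lift ((S'.twist A H).comp S.incl) ⟨1, zero_le_one, S.inclTensor_mb S'⟩
    (balanced_le_ker _ fun a p q => by
      rw [LinearMap.comp_apply, S.incl_op_smul, S'.twist_op_smul]; rfl)

theorem inclTensor_tm (p : P) (q : Q) :
    S.inclTensor S' (tm _ p q) = S'.twist A H (S.incl p) q := HT.lift_tm _ _ _ p q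

theorem inclTensor_cc : IsCC (S.inclTensor S') :=
  HT.lift_cbWith _ _ _ zero_le_one (S.inclTensor_mb S')

attribute [irreducible] inclTensor

theorem inclTensor_op_smul (b : B) (x : ModTensor A P Q) :
    S.inclTensor S' (MulOpposite.op b • x) = MulOpposite.op b • S.inclTensor S' x :=
  HT.map_smul_of_tm (f := (S.inclTensor S').toLinearMap.toAddMonoidHom)
    (S.inclTensor S').continuous (MulOpposite.op b) (fun p q => by
      show S.inclTensor S' (MulOpposite.op b • tm _ p q) =
        MulOpposite.op b • S.inclTensor S' (tm _ p q)
      rw [right_smul_tm, inclTensor_tm, inclTensor_tm, twist_smul_right]) x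

/-- The map is the limit of the sums of `π(e s ⊗ 1) ⊗ π'(x_s)`, with `x_s` the slice of `x` along `e
s`. Each partial sum is a row of norm at most one paired with the column of slices, of norm at most
that of `x`, hence is completely contractive. The limit exists on products `h ⊙ w`, and by uniform
boundedness everywhere. -/
theorem exists_projTensor [TopologicalSpace.SeparableSpace H] [CompleteSpace H'] :
    ∃ T : HTensor (Column (HilbertTensor H H')) B →ₗ[ℂ] ModTensor A P Q, IsCC T ∧
      ∀ (h : Column H) (w : HTensor (Column H') B),
        T (colMul h w) = tm _ (S.proj (tm ⊥ h 1)) (S'.proj w) := by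
  obtain ⟨e, he⟩ := exists_paddedBasis (H := H)
  let T : ℕ → HTensor (Column (HilbertTensor H H')) B →ₗ[ℂ] ModTensor A P Q := fun N =>
    ∑ s : Fin N, (tmₗ (balanced A P Q) (S.proj (tm ⊥ (e s) 1))).comp
      (S'.proj.comp (sliceMap B H' (e s)).toLinearMap)
  have hTa : ∀ N x, T N x = ∑ s : Fin N, tm (balanced A P Q) (S.proj (tm ⊥ (e s) 1))
      (S'.proj (sliceMap B H' (e s) x)) := fun N x => by
    simp only [T, LinearMap.sum_apply]; rfl
  have hT : ∀ N, IsCC (T N) := by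
    intro N m n _ _ x
    have h1 : x.map (T N) = Matrix.of fun i j => ∑ s : Fin N, tm (balanced A P Q)
        (((Matrix.of fun (_ : Unit) (s : Fin N) => tm (⊥ : Submodule ℂ (Column H ⊗[ℂ] A))
          (e s) 1).map S.proj) () s)
        (((Matrix.of fun (p : m × Fin N) j => sliceMap B H' (e p.2) (x p.1 j)).map S'.proj)
          (i, s) j) := by
      ext i j
      exact hTa N _
    rw [h1, one_mul]
    refine (mnorm_row_amp_le (tm_mb (balanced A P Q)) tm_zero_left _ _).trans ?_
    have h2 := (S.proj_cc (Matrix.of fun (_ : Unit) (s : Fin N) =>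
      tm (⊥ : Submodule ℂ (Column H ⊗[ℂ] A)) (e s) 1)).trans
        ((one_mul _).trans_le (mnorm_basis_le he N))
    have h3 := (S'.proj_cc (Matrix.of fun (p : m × Fin N) j =>
      sliceMap B H' (e p.2) (x p.1 j))).trans ((one_mul _).trans_le (mnorm_slices_le he N x))
    exact (mul_le_of_le_one_left (mnorm_nonneg _) h2).trans h3
  have hlim : ∀ (h : Column H) (w : HTensor (Column H') B), Filter.Tendsto
      (fun N => T N (colMul h w)) Filter.atTop
      (nhds (tm (balanced A P Q) (S.proj (tm ⊥ h 1)) (S'.proj w))) := by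
    intro h w
    have hc : Continuous fun h : Column H =>
        tm (balanced A P Q) (S.proj (tm ⊥ h 1)) (S'.proj w) :=
      (continuous_tm_left (N := balanced A P Q) (S'.proj w)).comp
        (S.continuous_proj.comp (continuous_tm_left 1))
    -- The slice of `h ⊙ w` along `e s` is `⟨e s, h⟩ w`. The partial sum is thus the value at the
    -- partial expansion of `h`, and continuity in `h` gives the limit.
    refine ((hc.tendsto h).comp (he.tendsto h)).congr fun N => ?_
    rw [Function.comp_apply, hTa]
    let L : Column H →ₗ[ℂ] ModTensor A P Q := ((tmₗ (balanced A P Q)).flip (S'.proj w)).comp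
      (S.proj.comp ((tmₗ (⊥ : Submodule ℂ (Column H ⊗[ℂ] A))).flip 1))
    refine (map_sum L _ _).trans (Finset.sum_congr rfl fun s _ => ?_)
    rw [map_smul, sliceMap_colMul, map_smul, tm_smul_right]
    rfl
  have hb : ∀ N x y, ‖T N x - T N y‖ ≤ 1 * ‖x - y‖ := fun N x y => by
    rw [← map_sub]
    exact CBWith.norm_le (hT N) _
  obtain ⟨R, hR, hR'⟩ := exists_limit_cc hT fun x => by
    refine colMul_induction (p := fun x => CauchySeq fun N => T N x)
      (isClosed_cauchySeq_of_bounded hb) ?_ ?_ ?_ x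
    · simp only [map_zero]
      exact tendsto_const_nhds.cauchySeq
    · intro u v hu hv
      simp only [map_add]
      exact hu.add hv
    · intro h w
      exact (hlim h w).cauchySeq
  exact ⟨R, hR, fun h w => tendsto_nhds_unique (hR' _) (hlim h w)⟩

/-- The tensor product of two direct summands. -/
theorem exists_tensor [TopologicalSpace.SeparableSpace H] [CompleteSpace H'] :
    ∃ R : ColumnSummand B (ModTensor A P Q) (HilbertTensor H H'),
      R.incl = (S.inclTensor S').toLinearMap := by
  obtain ⟨T, hT, hTm⟩ := S.exists_projTensor S'
  have hTc := CBWith.continuous hT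
  have h1 : ∀ (q : Q) (v : HTensor (Column H) A),
      T (S'.twist A H v q) = tm (balanced A P Q) (S.proj v) q := by
    intro q v
    refine HT.induction (p := fun v : HTensor (Column H) A =>
      T (S'.twist A H v q) = tm (balanced A P Q) (S.proj v) q) ?_ ?_ ?_ ?_ v
    · exact isClosed_eq (hTc.comp (S'.continuous_twist q))
        ((continuous_tm_left (N := balanced A P Q) q).comp S.continuous_proj)
    · simp [tm_zero_left]
    · intro u v hu hv
      rw [map_add, LinearMap.add_apply, map_add, hu, hv, map_add, tm_add_left]
    · intro h a
      -- Here the scalar moves across the tensor sign: `π(h ⊗ 1) ⊗ aq = π(h ⊗ 1)a ⊗ q = π(h ⊗ a) ⊗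
      -- q`.
      rw [twist_tm, hTm, S'.proj_incl, ← tm_balanced, ← S.proj_op_smul, right_smul_tm,
        MulOpposite.smul_eq_mul_unop, one_mul, MulOpposite.unop_op]
  have h2 : ∀ x : ModTensor A P Q, T (S.inclTensor S' x) = x := by
    intro x
    refine HT.induction (p := fun x : ModTensor A P Q => T (S.inclTensor S' x) = x) ?_ ?_ ?_ ?_ x
    · exact isClosed_eq (hTc.comp (S.inclTensor S').continuous) continuous_id
    · simp
    · intro u v hu hv
      rw [map_add, map_add, hu, hv]
    · intro p q
      rw [inclTensor_tm, h1, S.proj_incl]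
  refine ⟨⟨(S.inclTensor S').toLinearMap, T, fun {m n} _ _ x => ?_, hT, S.inclTensor_op_smul S',
    fun b x => ?_, h2⟩, rfl⟩
  · refine le_antisymm ((S.inclTensor_cc S' x).trans_eq (one_mul _)) ?_
    have h3 := hT (x.map (S.inclTensor S'))
    rw [one_mul] at h3
    refine le_trans (le_of_eq (congrArg mnorm ?_)) h3
    ext i j
    exact (h2 _).symm
  · refine colMul_map_smul (f := T.toAddMonoidHom) hTc (MulOpposite.op b) (fun h w => ?_) x
    show T (MulOpposite.op b • colMul h w) = MulOpposite.op b • T (colMul h w)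
    rw [← colMul_op_smul, hTm, hTm, S'.proj_op_smul, right_smul_tm]

end ColumnSummand

end summand

/-! ### The product connection -/

section projective

variable {A B : Type*} [NormedRing A] [NormedAlgebra ℂ A] [OperatorSpace A] [OperatorAlgebra A]
  [NormedRing B] [NormedAlgebra ℂ B] [OperatorSpace B] [OperatorAlgebra B]
  {P Q : Type*} [SeminormedAddCommGroup P] [NormedSpace ℂ P] [OperatorSpace P]
  [SeminormedAddCommGroup Q] [NormedSpace ℂ Q] [OperatorSpace Q]
  [Module Aᵐᵒᵖ P] [IsScalarTower ℂ Aᵐᵒᵖ P]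
  [Module A Q] [IsScalarTower ℂ A Q] [LeftOpModule A Q]
  [Module Bᵐᵒᵖ Q] [IsScalarTower ℂ Bᵐᵒᵖ Q] [SMulCommClass A Bᵐᵒᵖ Q] [RightOpModule B Q]

theorem ColumnSummand.isProjectiveRigged {H : Type} [NormedAddCommGroup H] [InnerProductSpace ℂ H]
    [CompleteSpace H] [TopologicalSpace.SeparableSpace H] (S : ColumnSummand A P H) :
    IsProjectiveRigged A P :=
  ⟨isRigged_of_summand S.incl_cc S.proj_cc S.incl_op_smul S.proj_op_smul S.proj_incl,
    H, _, _, ‹_›, ‹_›, S.incl, S.proj, S.incl_ci, S.proj_cc, S.incl_op_smul, S.proj_op_smul,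
    S.proj_incl⟩

theorem IsProjectiveRigged.tensor (hP : IsProjectiveRigged A P) (hQ : IsProjectiveRigged B Q) :
    IsProjectiveRigged B (ModTensor A P Q) := by
  obtain ⟨-, H, _, _, _, _, ι, π, h1, h2, h3, h4, h5⟩ := hP
  obtain ⟨-, H', _, _, _, _, ι', π', h1', h2', h3', h4', h5'⟩ := hQ
  obtain ⟨R, -⟩ := ColumnSummand.exists_tensor (A := A) (B := B) (P := P) (Q := Q)
    ⟨ι, π, h1, h2, h3, h4, h5⟩ ⟨ι', π', h1', h2', h3', h4', h5'⟩
  have : TopologicalSpace.SeparableSpace (HilbertTensor H H') := separableSpace_hilbertTensor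
  exact R.isProjectiveRigged

theorem IsProjectiveRigged.app_mb (hP : IsProjectiveRigged A P) {Y : Type*}
    [NormedAddCommGroup Y] [NormedSpace ℂ Y] [OperatorSpace Y] [Module Aᵐᵒᵖ Y]
    [IsScalarTower ℂ Aᵐᵒᵖ Y] [RightOpModule A Y] :
    MBWith (fun (T : CBHom A P Y) (x : P) => T.app x) 1 := by
  obtain ⟨-, H, _, _, _, _, ι, π, h1, h2, h3, h4, h5⟩ := hP
  obtain ⟨e, he⟩ := exists_paddedBasis (H := H)
  exact CBHom.app_mb he (fun {m n} _ _ x => (h1 x).trans_le (one_mul _).ge) h2 h4 h5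

end projective

section maps

variable {X Y Z W : Type*} [SeminormedAddCommGroup X] [NormedSpace ℂ X] [OperatorSpace X]
  [SeminormedAddCommGroup Y] [NormedSpace ℂ Y] [OperatorSpace Y]
  [SeminormedAddCommGroup Z] [NormedSpace ℂ Z] [OperatorSpace Z]
  [SeminormedAddCommGroup W] [NormedSpace ℂ W] [OperatorSpace W]

theorem IsMB.add {f g : X → Y → Z} (hf : IsMB f) (hg : IsMB g) :
    IsMB fun x y => f x y + g x y := by
  obtain ⟨C, hC, hf⟩ := hf
  obtain ⟨D, hD, hg⟩ := hg
  refine ⟨C + D, add_nonneg hC hD, fun {m k n} _ _ _ x y => ?_⟩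
  have e : amp (fun x y => f x y + g x y) x y = amp f x y + amp g x y := by
    ext i j
    simp only [amp, Finset.sum_add_distrib, Matrix.add_apply]
  rw [e, add_mul]
  exact (mnorm_add_le _ _).trans (add_le_add (hf x y) (hg x y))

theorem IsMB.comp_left {f : X → Y → Z} {g : W → X} (hf : IsMB f) (hg : IsCB g) :
    IsMB fun w y => f (g w) y := by
  obtain ⟨C, hC, hf⟩ := hf
  obtain ⟨D, hD, hg⟩ := hg
  refine ⟨C * D, mul_nonneg hC hD, fun {m k n} _ _ _ x y => (hf (x.map g) y).trans ?_⟩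
  rw [mul_assoc, ← mul_assoc D]
  exact mul_le_mul_of_nonneg_left (mul_le_mul_of_nonneg_right (hg x) (mnorm_nonneg y)) hC

theorem IsCB.comp_mb {f : X → Y → Z} {g : Z →ₗ[ℂ] W} (hg : IsCB g) (hf : IsMB f) :
    IsMB fun x y => g (f x y) := by
  obtain ⟨C, hC, hf⟩ := hf
  obtain ⟨D, hD, hg⟩ := hg
  refine ⟨D * C, mul_nonneg hD hC, fun {m k n} _ _ _ x y => ?_⟩
  rw [← map_amp g f, mul_assoc]
  exact (hg _).trans (mul_le_mul_of_nonneg_left (hf x y) hD)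

end maps

section product

variable {A B : Type*} [NormedRing A] [NormedAlgebra ℂ A] [OperatorSpace A] [OperatorAlgebra A]
  [NormedRing B] [NormedAlgebra ℂ B] [OperatorSpace B] [OperatorAlgebra B]
  {P Q : Type*} [SeminormedAddCommGroup P] [NormedSpace ℂ P] [OperatorSpace P]
  [SeminormedAddCommGroup Q] [NormedSpace ℂ Q] [OperatorSpace Q]
  [Module Aᵐᵒᵖ P] [IsScalarTower ℂ Aᵐᵒᵖ P]
  [Module A Q] [IsScalarTower ℂ A Q] [LeftOpModule A Q]
  [Module Bᵐᵒᵖ Q] [IsScalarTower ℂ Bᵐᵒᵖ Q] [SMulCommClass A Bᵐᵒᵖ Q] [RightOpModule B Q]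
  {R : Type*} [SeminormedAddCommGroup R] [NormedSpace ℂ R] [OperatorSpace R]
  [Module B R] [IsScalarTower ℂ B R]

theorem assocMap_cb : IsCB (assocMap (A := A) (B := B) (P := P) (Q := Q) (R := R)) :=
  HT.lift_cb _ _ _

theorem assocMap_tm_right (p : P) (w : ModTensor B Q R) :
    assocMap (A := A) (B := B) (tm _ p w) = assocInner p w := HT.lift_tm _ _ _ p w

theorem mapRight_cb {M M' : Type*} [SeminormedAddCommGroup M] [NormedSpace ℂ M] [OperatorSpace M]
    [Module A M] [IsScalarTower ℂ A M] [SeminormedAddCommGroup M'] [NormedSpace ℂ M']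
    [OperatorSpace M'] [Module A M'] [IsScalarTower ℂ A M'] (f : M →ₗ[ℂ] M') (hf : IsCB f)
    (hA : ∀ (a : A) (x : M), f (a • x) = a • f x) : IsCB (mapRight P f hf hA) :=
  HT.lift_cb _ _ _

section right

variable [Module Bᵐᵒᵖ R] [IsScalarTower ℂ Bᵐᵒᵖ R] [SMulCommClass B Bᵐᵒᵖ R] [RightOpModule B R]

theorem assocInner_op_smul (b : B) (p : P) (w : ModTensor B Q R) :
    assocInner (A := A) (B := B) p (MulOpposite.op b • w) =
      MulOpposite.op b • assocInner (A := A) (B := B) p w :=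
  HT.map_smul_of_tm
    (f := (assocInner (A := A) (B := B) (R := R) (Q := Q) p).toLinearMap.toAddMonoidHom)
    (assocInner p).continuous (MulOpposite.op b) (fun q r => by
      show assocInner p (MulOpposite.op b • tm _ q r) = MulOpposite.op b • assocInner p (tm _ q r)
      rw [right_smul_tm b q r, assocInner_tm p q r, assocInner_tm, right_smul_tm b _ r]) w

variable [SMulCommClass A Bᵐᵒᵖ (ModTensor B Q R)]

theorem assocMap_op_smul (b : B) (w : ModTensor A P (ModTensor B Q R)) :
    assocMap (A := A) (B := B) (MulOpposite.op b • w) = MulOpposite.op b • assocMap w :=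
  HT.map_smul_of_tm (f := (assocMap (A := A) (B := B) (P := P) (Q := Q)
    (R := R)).toLinearMap.toAddMonoidHom) assocMap.continuous (MulOpposite.op b) (fun p w => by
      show assocMap (MulOpposite.op b • tm _ p w) = MulOpposite.op b • assocMap (tm _ p w)
      rw [right_smul_tm b p w, assocMap_tm_right p w, assocMap_tm_right, assocInner_op_smul]) w

end right

end product

/-! ### Forms acting by commutators, and the jointly bounded evaluation. -/

section evaluation

variable {A B : Type*} [NormedRing A] [NormedAlgebra ℂ A] [OperatorSpace A] [OperatorAlgebra A]
  [NormedRing B] [NormedAlgebra ℂ B] [OperatorSpace B] [OperatorAlgebra B]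
  {P Q : Type*} [SeminormedAddCommGroup P] [NormedSpace ℂ P] [OperatorSpace P]
  [SeminormedAddCommGroup Q] [NormedSpace ℂ Q] [OperatorSpace Q]
  [Module Aᵐᵒᵖ P] [IsScalarTower ℂ Aᵐᵒᵖ P]
  [Module A Q] [IsScalarTower ℂ A Q] [LeftOpModule A Q]
  [Module Bᵐᵒᵖ Q] [IsScalarTower ℂ Bᵐᵒᵖ Q] [SMulCommClass A Bᵐᵒᵖ Q] [RightOpModule B Q]
  {Y : Type*} [NormedAddCommGroup Y] [NormedSpace ℂ Y] [OperatorSpace Y] [CompleteSpace Y]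
  [Module Bᵐᵒᵖ Y] [IsScalarTower ℂ Bᵐᵒᵖ Y] [RightOpModule B Y]
  [Module A Y] [IsScalarTower ℂ A Y] [SMulCommClass A Bᵐᵒᵖ Y] [LeftOpModule A Y]

theorem continuous_app (q : Q) : Continuous fun T : CBHom B Q Y => T.app q :=
  AddMonoidHomClass.continuous_of_bound (CBHom.eval q) ‖q‖ fun T =>
    (CBHom.norm_app_le T q).trans_eq (mul_comm _ _)

theorem continuous_smul_left (y : Y) : Continuous fun c : A => c • y :=
  CBWith.continuous (f := (Algebra.lsmul ℂ ℂ Y : A →ₐ[ℂ] Module.End ℂ Y).toLinearMap.flip y)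
    (MBWith.cbWith_left zero_le_one (LeftOpModule.smul_le (A := A) (X := Y))
      (fun y => zero_smul A y) (fun a => smul_zero a) y)

section forms

variable {d : Q →ₗ[ℂ] Y} {δ : A →ₗ[ℂ] CBHom B Q Y} (hδ : IsCB δ)
  (hd : ∀ a q, (δ a).app q = d (a • q) - a • d q)

include hd

/-- The representation of forms is twisted by the commutators under the right action. -/
theorem formPre_op_smul_app (a : A) (u : HTensor A A) (q : Q) :
    (formPre δ hδ (MulOpposite.op a • u)).app q =
      (formPre δ hδ u).app (a • q) + mulMap A u • (δ a).app q := by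
  let j : HTensor A A →ₗ[ℂ] CBHom B Q Y := (formPre δ hδ).toLinearMap
  have hj : Continuous j := (formPre δ hδ).continuous
  refine HT.ext_tm (f := (((CBHom.eval q).comp j).toAddMonoidHom.comp
      (DistribSMul.toAddMonoidHom (HTensor A A) (MulOpposite.op a))))
    (g := ((CBHom.eval (a • q)).comp j + ((Algebra.lsmul ℂ ℂ Y : A →ₐ[ℂ]
      Module.End ℂ Y).toLinearMap.flip ((δ a).app q)).comp
      (mulMap A).toLinearMap).toAddMonoidHom) ?_ ?_ ?_ u
  · exact (continuous_app q).comp (hj.comp (continuous_const_smul _))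
  · exact ((continuous_app (a • q)).comp hj).add
      ((continuous_smul_left ((δ a).app q)).comp (mulMap A).continuous)
  · intro b c
    show (formPre δ hδ (MulOpposite.op a • tm ⊥ b c)).app q =
      (formPre δ hδ (tm ⊥ b c)).app (a • q) + mulMap A (tm ⊥ b c) • (δ a).app q
    -- On `b ⊗ c` the left side is `b(d(caq) - ca·dq)` and the first term on the right is `b(d(caq)
    -- - c·d(aq))`. They differ by `bc(d(aq) - a·dq) = bc·δ(a)q`.
    rw [op_smul_tm, formPre_tm, formPre_tm, mulMap_tm, CBHom.smul_app, CBHom.smul_app,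
      hd, hd, hd]
    simp only [smul_sub, mul_smul]
    abel

/-- The defect of right linearity on `A ⊗ A` is the product of the two legs times `δ(a)`, and it
vanishes on the kernel of multiplication. -/
theorem formLift_op_smul_app (a : A) (ω : Omega1 A) (q : Q) :
    (formLift δ hδ (MulOpposite.op a • ω)).app q = (formLift δ hδ ω).app (a • q) := by
  have h := formPre_op_smul_app hδ hd a (omegaIncl A ω) q
  have h0 : mulMap A (omegaIncl A ω) = 0 := ω.2
  rw [h0, zero_smul, add_zero] at h
  exact h

theorem formLift_d (b : A) : formLift δ hδ (univD A b) = δ b := by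
  have h1 : δ 1 = 0 := CBHom.app_injective (LinearMap.ext fun q => by
    rw [hd, one_smul, one_smul, sub_self]; rfl)
  have h := formLift_smul_d δ hδ h1 1 b
  rwa [one_smul, one_smul] at h

end forms

variable (A B P Q Y) in
/-- The trilinear map `(p, T, q) ↦ p ⊗ T(q)`. -/
def evalTri : P →ₗ[ℂ] CBHom B Q Y →ₗ[ℂ] Q →ₗ[ℂ] ModTensor A P Y where
  toFun p := (LinearMap.flip (LinearMap.mk₂ ℂ (fun (q : Q) (T : CBHom B Q Y) => T.app q)
    (fun q q' T => map_add _ _ _) (fun c q T => map_smul _ _ _)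
    (fun q T T' => map_add (CBHom.eval q) T T') (fun c q T => map_smul (CBHom.eval q) c T))).compr₂
      (tmₗ _ p)
  map_add' p p' := by ext T q; simp
  map_smul' c p := by ext T q; simp

/-- The Haagerup bound of the evaluation enters here. It makes the triple product a composite of two
pairings that are each contractive on matrix products. -/
theorem evalTri_tmb (hQ : MBWith (fun (T : CBHom B Q Y) (q : Q) => T.app q) 1) :
    TMBWith (fun (p : P) (T : CBHom B Q Y) (q : Q) => evalTri A B P Q Y p T q) 1 :=
  TMBWith.of_right (f := fun (T : CBHom B Q Y) (q : Q) => T.app q) (g := tm (balanced A P Y))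
    (fun p => ⟨(tmₗ _ p).toAddMonoidHom, fun _ => rfl⟩) zero_le_one hQ (tm_mb _) (one_mul 1)

theorem evalTri_balanced (q : Q) : balanced A P (CBHom B Q Y) ≤ LinearMap.ker
    (TensorProduct.lift ((evalTri A B P Q Y).compr₂ (LinearMap.applyₗ q))) :=
  balanced_le_ker _ fun a p T => tm_balanced a p (T.app q)

variable (A P) in
/-- The evaluation `(p ⊗ T, q) ↦ p ⊗ T(q)` as a pairing. -/
def evalPair (hQ : MBWith (fun (T : CBHom B Q Y) (q : Q) => T.app q) 1) :
    ModTensor A P (CBHom B Q Y) →ₗ[ℂ] Q →ₗ[ℂ] ModTensor A P Y :=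
  HT.liftLeft (evalTri A B P Q Y) zero_le_one (evalTri_tmb hQ) evalTri_balanced

variable (hQ : MBWith (fun (T : CBHom B Q Y) (q : Q) => T.app q) 1)

theorem evalPair_tm (p : P) (T : CBHom B Q Y) (q : Q) :
    evalPair A P hQ (tm _ p T) q = tm _ p (T.app q) :=
  HT.liftLeft_tm (evalTri A B P Q Y) zero_le_one (evalTri_tmb hQ) evalTri_balanced p T q

theorem continuous_evalPair (q : Q) : Continuous fun u => evalPair A P hQ u q :=
  HT.continuous_liftLeft (evalTri A B P Q Y) zero_le_one (evalTri_tmb hQ) evalTri_balanced q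

theorem evalPair_mb : MBWith (fun u q => evalPair A P hQ u q) 1 :=
  HT.liftLeft_mb (evalTri A B P Q Y) zero_le_one (evalTri_tmb hQ) evalTri_balanced

attribute [irreducible] evalPair

theorem evalPair_op_smul (b : B) (u : ModTensor A P (CBHom B Q Y)) (q : Q) :
    evalPair A P hQ u (MulOpposite.op b • q) = MulOpposite.op b • evalPair A P hQ u q :=
  HT.eq_smul_of_tm (f := ((evalPair A P hQ).flip (MulOpposite.op b • q)).toAddMonoidHom)
    (g := ((evalPair A P hQ).flip q).toAddMonoidHom) (continuous_evalPair hQ _)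
    (continuous_evalPair hQ q) (MulOpposite.op b) (fun p T => by
      show evalPair A P hQ (tm _ p T) (MulOpposite.op b • q) =
        MulOpposite.op b • evalPair A P hQ (tm _ p T) q
      rw [evalPair_tm hQ p T q, evalPair_tm hQ p T, right_smul_tm b p (T.app q),
        CBHom.app_op_smul]) u

/-- At a fixed `q` the jointly bounded pairing agrees with the evaluation map that appears in the
definition of a product connection. -/
theorem evalPair_eq_of_tm {q : Q} {R : ModTensor A P (CBHom B Q Y) →L[ℂ] ModTensor A P Y}
    (hR : ∀ p T, R (tm _ p T) = tm _ p (T.app q)) (u : ModTensor A P (CBHom B Q Y)) :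
    evalPair A P hQ u q = R u :=
  HT.ext_tm (f := ((evalPair A P hQ).flip q).toAddMonoidHom)
    (g := R.toLinearMap.toAddMonoidHom) (continuous_evalPair hQ q) R.continuous
    (fun p T => (evalPair_tm hQ p T q).trans (hR p T).symm) u

section sums

variable (D : UnivConnection A P) (d : Q →ₗ[ℂ] Y) (δ : A →ₗ[ℂ] CBHom B Q Y) (hδ : IsCB δ)

/-- The map `∇_δ`. -/
def formConn : P →ₗ[ℂ] ModTensor A P (CBHom B Q Y) :=
  (mapRight P (formLift δ hδ).toLinearMap (formLift_cb δ hδ)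
    (formLift_smul δ hδ)).toLinearMap.comp D.toFun

theorem formConn_cb : IsCB (formConn D δ hδ) :=
  IsCB.comp (g := mapRight P (formLift δ hδ).toLinearMap (formLift_cb δ hδ) (formLift_smul δ hδ))
    (f := D.toFun) (mapRight_cb _ _ _) D.cb

variable {d δ}

theorem evalPair_mapRight_op_smul (hd : ∀ a q, (δ a).app q = d (a • q) - a • d q) (a : A)
    (u : ModTensor A P (Omega1 A)) (q : Q) :
    evalPair A P hQ (mapRight P (formLift δ hδ).toLinearMap (formLift_cb δ hδ)
      (formLift_smul δ hδ) (MulOpposite.op a • u)) q =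
    evalPair A P hQ (mapRight P (formLift δ hδ).toLinearMap (formLift_cb δ hδ)
      (formLift_smul δ hδ) u) (a • q) := by
  let L := mapRight P (formLift δ hδ).toLinearMap (formLift_cb δ hδ) (formLift_smul δ hδ)
  exact HT.ext_tm (f := (((evalPair A P hQ).flip q).comp L.toLinearMap).toAddMonoidHom.comp
      (DistribSMul.toAddMonoidHom (ModTensor A P (Omega1 A)) (MulOpposite.op a)))
    (g := (((evalPair A P hQ).flip (a • q)).comp L.toLinearMap).toAddMonoidHom)
    ((continuous_evalPair hQ q).comp (L.continuous.comp (continuous_const_smul _)))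
    ((continuous_evalPair hQ (a • q)).comp L.continuous) (fun p ω => by
      show evalPair A P hQ (L (MulOpposite.op a • tm _ p ω)) q =
        evalPair A P hQ (L (tm _ p ω)) (a • q)
      rw [right_smul_tm a p ω]
      simp only [L, mapRight_tm, evalPair_tm]
      exact congrArg (tm _ p) (formLift_op_smul_app hδ hd a ω q)) u

/-- This is the Leibniz rule of `∇_δ`. The right action on forms becomes precomposition with `a`,
and `p ⊗ da` becomes `p ⊗ δ(a)`. -/
theorem formConn_op_smul (hd : ∀ a q, (δ a).app q = d (a • q) - a • d q) (a : A) (p : P) (q : Q) :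
    evalPair A P hQ (formConn D δ hδ (MulOpposite.op a • p)) q =
      evalPair A P hQ (formConn D δ hδ p) (a • q) + tm _ p ((δ a).app q) := by
  let L := mapRight P (formLift δ hδ).toLinearMap (formLift_cb δ hδ) (formLift_smul δ hδ)
  have h2 : formConn D δ hδ (MulOpposite.op a • p) =
      L (MulOpposite.op a • D.toFun p) + L (tm _ p (univD A a)) :=
    (congrArg L (D.leibniz p a)).trans (map_add L _ _)
  have h3 : L (tm _ p (univD A a)) = tm _ p (δ a) :=
    (mapRight_tm P _ _ _ p _).trans (congrArg (tm _ p) (formLift_d hδ hd a))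
  rw [h2, map_add (evalPair A P hQ), LinearMap.add_apply, h3, evalPair_tm]
  exact congrArg (· + tm _ p ((δ a).app q)) (evalPair_mapRight_op_smul hQ hδ hd a _ q)

variable (d)

/-- The pairing `(p, q) ↦ p ⊗ d(q) + ∇_δ(p)q`. -/
def sumPair : P →ₗ[ℂ] Q →ₗ[ℂ] ModTensor A P Y :=
  (tmₗ (balanced A P Y)).compl₂ d + (evalPair A P hQ).comp (formConn D δ hδ)

theorem sumPair_apply (p : P) (q : Q) :
    sumPair hQ D d hδ p q = tm _ p (d q) + evalPair A P hQ (formConn D δ hδ p) q := rfl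

theorem sumPair_mb (hdc : IsCB d) : IsMB fun p q => sumPair hQ D d hδ p q :=
  IsMB.add (f := fun p q => tm (balanced A P Y) p (d q))
    (g := fun p q => evalPair A P hQ (formConn D δ hδ p) q) (IsMB.tm_comp P hdc)
    (IsMB.comp_left (f := fun u q => evalPair A P hQ u q) (g := formConn D δ hδ)
      ⟨1, zero_le_one, evalPair_mb hQ⟩ (formConn_cb D δ hδ))

variable {d}

/-- Neither summand is balanced. Moving `a` from `p` to `q` changes `p ⊗ dq` by `p ⊗ δ(a)q`, and it
changes `∇_δ(p)q` by the same element with the opposite sign. -/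
theorem sumPair_balanced (hd : ∀ a q, (δ a).app q = d (a • q) - a • d q) (a : A) (p : P) (q : Q) :
    sumPair hQ D d hδ (MulOpposite.op a • p) q = sumPair hQ D d hδ p (a • q) := by
  rw [sumPair_apply, sumPair_apply, formConn_op_smul hQ D hδ hd, hd, tm_balanced a p (d q)]
  have h : tm (balanced A P Y) p (d (a • q) - a • d q) = tm _ p (d (a • q)) - tm _ p (a • d q) :=
    map_sub (tmₗ _ p) _ _
  rw [h]
  abel

/-- The inhomogeneous term comes from `d` alone, as the evaluation is right linear in `q`. -/
theorem sumPair_op_smul {b : B} {q : Q} {y : Y}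
    (h : d (MulOpposite.op b • q) = MulOpposite.op b • d q + y) (p : P) :
    sumPair hQ D d hδ p (MulOpposite.op b • q) =
      MulOpposite.op b • sumPair hQ D d hδ p q + tm _ p y := by
  rw [sumPair_apply, sumPair_apply, h, tm_add_right, evalPair_op_smul,
    ← right_smul_tm b p (d q), smul_add]
  abel

end sums

end evaluation

section connection

variable {A B : Type*} [NormedRing A] [NormedAlgebra ℂ A] [OperatorSpace A] [OperatorAlgebra A]
  [NormedRing B] [NormedAlgebra ℂ B] [OperatorSpace B] [OperatorAlgebra B]
  {P Q : Type*} [SeminormedAddCommGroup P] [NormedSpace ℂ P] [OperatorSpace P]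
  [SeminormedAddCommGroup Q] [NormedSpace ℂ Q] [OperatorSpace Q]
  [Module Aᵐᵒᵖ P] [IsScalarTower ℂ Aᵐᵒᵖ P]
  [Module A Q] [IsScalarTower ℂ A Q] [LeftOpModule A Q]
  [Module Bᵐᵒᵖ Q] [IsScalarTower ℂ Bᵐᵒᵖ Q] [SMulCommClass A Bᵐᵒᵖ Q] [RightOpModule B Q]

/-- A connection on `P ⊗ Q` from its values on elementary tensors. -/
theorem exists_connection (G : P →ₗ[ℂ] Q →ₗ[ℂ] ModTensor B (ModTensor A P Q) (Omega1 B))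
    (hG : IsMB fun p q => G p q)
    (hGA : ∀ (a : A) p q, G (MulOpposite.op a • p) q = G p (a • q))
    (hGB : ∀ (b : B) p q, G p (MulOpposite.op b • q) =
      MulOpposite.op b • G p q + tm _ (tm _ p q) (univD B b)) :
    ∃ D'' : UnivConnection B (ModTensor A P Q), ∀ p q, D''.toFun (tm _ p q) = G p q := by
  let F : ModTensor A P Q →L[ℂ] ModTensor B (ModTensor A P Q) (Omega1 B) :=
    HT.lift G hG (balanced_le_ker G hGA)
  have hF : ∀ p q, F (tm _ p q) = G p q := HT.lift_tm G hG (balanced_le_ker G hGA)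
  refine ⟨⟨F.toLinearMap, HT.lift_cb G hG (balanced_le_ker G hGA), fun x b => ?_⟩, hF⟩
  refine HT.ext_tm (f := F.toLinearMap.toAddMonoidHom.comp
      (DistribSMul.toAddMonoidHom (ModTensor A P Q) (MulOpposite.op b)))
    (g := (DistribSMul.toAddMonoidHom (ModTensor B (ModTensor A P Q) (Omega1 B))
      (MulOpposite.op b)).comp F.toLinearMap.toAddMonoidHom +
      ((tmₗ (balanced B (ModTensor A P Q) (Omega1 B))).flip (univD B b)).toAddMonoidHom)
    (F.continuous.comp (continuous_const_smul (MulOpposite.op b))) ?_ (fun p q => ?_) x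
  · exact ((continuous_const_smul (MulOpposite.op b)).comp F.continuous).add
      (continuous_tm_left (univD B b))
  · show F (MulOpposite.op b • tm _ p q) =
      MulOpposite.op b • F (tm _ p q) + tm _ (tm _ p q) (univD B b)
    rw [right_smul_tm b p q, hF, hF, hGB]

theorem evalRight_tm (q : Q) (p : P) (T : CBHom B Q (ModTensor B Q (Omega1 B))) :
    evalRight A B P q (tm _ p T) = tm _ p (T.app q) := mapRight_tm P _ _ _ p T

theorem exists_productConnection
    (hQ : MBWith (fun (T : CBHom B Q (ModTensor B Q (Omega1 B))) (q : Q) => T.app q) 1)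
    (D : UnivConnection A P) (D' : UnivConnection B Q) :
    ∃ D'' : UnivConnection B (ModTensor A P Q), IsProduct D D' D'' := by
  have hd := commutator_app (A := A) D'
  obtain ⟨D'', h⟩ := exists_connection
    ((sumPair hQ D D'.toFun (commutator_cb D')).compr₂ assocMap.toLinearMap)
    (IsCB.comp_mb (g := assocMap.toLinearMap) assocMap_cb
      (sumPair_mb hQ D D'.toFun (commutator_cb D') D'.cb))
    (fun a p q => congrArg assocMap (sumPair_balanced hQ D (commutator_cb D') hd a p q))
    (fun b p q => (congrArg assocMap
      (sumPair_op_smul hQ D (commutator_cb D') (D'.leibniz q b) p)).trans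
        ((map_add assocMap _ _).trans (congrArg₂ (· + ·) (assocMap_op_smul b _)
          (assocMap_tm p q (univD B b)))))
  refine ⟨D'', fun p q => (h p q).trans (congrArg assocMap ?_)⟩
  -- The construction used the joint pairing. At the given `q` it is replaced by the map
  -- `evalRight`.
  exact congrArg (tm _ p (D'.toFun q) + ·) (evalPair_eq_of_tm hQ (evalRight_tm q) _)

end connection

/-! ### C*-algebras and C*-modules described by matrix norms. -/

section cstar

/-- In a C*-algebra `x*x` is determined by the norms `‖x a‖`. -/
theorem star_mul_self_le_of_norm_mul_eq {A : Type*} [CStarAlgebra A] [PartialOrder A]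
    [StarOrderedRing A] {x y : A} (h : ∀ a, ‖x * a‖ = ‖y * a‖) : star x * x ≤ star y * y := by
  -- By the C*-identity, `z` may be replaced by the square root of `z*z` in all norms `‖zt‖`.
  have hsq : ∀ z t : A, ‖CFC.sqrt (star z * z) * t‖ = ‖z * t‖ := fun z t => by
    have h1 : ‖CFC.sqrt (star z * z) * t‖ * ‖CFC.sqrt (star z * z) * t‖ = ‖z * t‖ * ‖z * t‖ := by
      rw [← CStarRing.norm_star_mul_self, ← CStarRing.norm_star_mul_self, star_mul, star_mul,
        (CFC.sqrt_nonneg (star z * z)).isSelfAdjoint.star_eq, mul_assoc, mul_assoc,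
        ← mul_assoc (CFC.sqrt _), CFC.sqrt_mul_sqrt_self (star z * z) (star_mul_self_nonneg z),
        mul_assoc]
    exact (mul_self_inj (norm_nonneg _) (norm_nonneg _)).1 h1
  -- For an invertible positive `c`, the inequality `x*x ≤ c` means that the square root of `x*x`
  -- times `c^(-1/2)` has norm at most one. This depends only on the norms `‖xt‖`, so `x` can be
  -- exchanged for `y`. The shift by `ε` makes `c = y*y + ε` invertible.
  have key : ∀ ε : ℝ, 0 < ε → star x * x ≤ star y * y + algebraMap ℝ A ε := by
    intro ε hε
    have hpos : IsStrictlyPositive (star y * y + algebraMap ℝ A ε) :=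
      IsStrictlyPositive.nonneg_add (star_mul_self_nonneg y) (isStrictlyPositive_algebraMap hε)
    rw [le_iff_norm_sqrt_mul_rpow _ _ (star_mul_self_nonneg x) hpos, hsq, h, ← hsq,
      ← le_iff_norm_sqrt_mul_rpow _ _ (star_mul_self_nonneg y) hpos]
    exact le_add_of_nonneg_right (isStrictlyPositive_algebraMap hε).nonneg
  have hlim : Filter.Tendsto (fun ε : ℝ => star y * y + algebraMap ℝ A ε)
      (nhdsWithin 0 (Set.Ioi 0)) (nhds (star y * y)) := by
    have hc : Continuous fun ε : ℝ => star y * y + algebraMap ℝ A ε :=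
      continuous_const.add (continuous_algebraMap ℝ A)
    simpa using (hc.tendsto 0).mono_left nhdsWithin_le_nhds
  exact ge_of_tendsto hlim (Filter.eventually_of_mem self_mem_nhdsWithin key)

variable {A : Type*} [NormedRing A] [NormedAlgebra ℂ A] [OperatorSpace A] [OperatorAlgebra A]
  [StarRing A] [StarModule ℂ A]
  {m n k l : Type} [Fintype m] [Fintype n] [Fintype k] [Fintype l]

namespace IsCStar

theorem cstarRing (hA : IsCStar A) : CStarRing A where
  norm_mul_self_le x := by
    have h := hA (Matrix.of fun _ _ : Unit => x)
    rw [show (Matrix.of fun _ _ : Unit => x).conjTranspose * (Matrix.of fun _ _ : Unit => x) =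
      fun _ _ => star x * x by ext; simp [Matrix.mul_apply]] at h
    have e : mnorm (Matrix.of fun _ _ : Unit => x) = ‖x‖ := mnorm_unit x
    rw [mnorm_unit, e, sq] at h
    exact h.ge

/-- A unital operator algebra with C*-matrix norms is a C*-algebra. -/
@[reducible] def cstarAlgebra (hA : IsCStar A) : CStarAlgebra A :=
  let _ := hA.cstarRing
  { (inferInstance : NormedRing A), (inferInstance : StarRing A), (inferInstance : CStarRing A),
    (inferInstance : NormedAlgebra ℂ A), (inferInstance : StarModule ℂ A) with
    toCompleteSpace := OperatorAlgebra.toCompleteSpace }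

theorem continuous_star (hA : IsCStar A) : Continuous (star : A → A) :=
  let _ := hA.cstarRing
  ContinuousStar.continuous_star

theorem mnorm_mul_le (x : Matrix m k A) (y : Matrix k n A) :
    mnorm (x * y) ≤ mnorm x * mnorm y := by
  have h := OperatorAlgebra.mul_le (A := A) x y
  rwa [one_mul] at h

/-- The identity `‖x‖² = ‖x*x‖ ≤ ‖x*‖‖x‖` gives one inequality, and the same for `x*` gives the
other. -/
theorem mnorm_conjTranspose (hA : IsCStar A) (x : Matrix m n A) :
    mnorm x.conjTranspose = mnorm x := by
  have key : ∀ {m n : Type} [Fintype m] [Fintype n] (x : Matrix m n A),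
      mnorm x ≤ mnorm x.conjTranspose := by
    intro m n _ _ x
    rcases (mnorm_nonneg x).eq_or_lt with h0 | h0
    · rw [← h0]; exact mnorm_nonneg _
    · have h1 := mnorm_mul_le x.conjTranspose x
      rw [hA, sq] at h1
      exact le_of_mul_le_mul_right h1 h0
  refine le_antisymm ?_ (key x)
  have h := key x.conjTranspose
  rwa [Matrix.conjTranspose_conjTranspose] at h

theorem eq_of_norm_mul_eq (hA : IsCStar A) {x y : A} (h : ∀ a, ‖x * a‖ = ‖y * a‖) :
    star x * x = star y * y := by
  let _ := hA.cstarAlgebra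
  let _ := CStarAlgebra.spectralOrder A
  let _ := CStarAlgebra.spectralOrderedRing A
  exact le_antisymm (star_mul_self_le_of_norm_mul_eq h)
    (star_mul_self_le_of_norm_mul_eq fun a => (h a).symm)

theorem isClosed_pos (hA : IsCStar A) : IsClosed {a : A | ∃ b, a = star b * b} := by
  let _ := hA.cstarAlgebra
  let _ := CStarAlgebra.spectralOrder A
  let _ := CStarAlgebra.spectralOrderedRing A
  have e : {a : A | ∃ b, a = star b * b} = {a : A | 0 ≤ a} := by
    ext a
    exact CStarAlgebra.nonneg_iff_eq_star_mul_self.symm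
  rw [e]
  exact CStarAlgebra.isClosed_nonneg

theorem sum_pos (hA : IsCStar A) {ι : Type*} (s : Finset ι) (b : ι → A) :
    ∃ c, ∑ i ∈ s, star (b i) * b i = star c * c := by
  let _ := hA.cstarAlgebra
  let _ := CStarAlgebra.spectralOrder A
  let _ := CStarAlgebra.spectralOrderedRing A
  exact CStarAlgebra.nonneg_iff_eq_star_mul_self.1
    (Finset.sum_nonneg fun i _ => star_mul_self_nonneg (b i))

end IsCStar

namespace IsCStarModule

variable {E : Type*} [SeminormedAddCommGroup E] [NormedSpace ℂ E] [OperatorSpace E]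
  [Module Aᵐᵒᵖ E] [IsScalarTower ℂ Aᵐᵒᵖ E] {ip : E → E → A} (h : IsCStarModule ip)

include h

theorem add_left (e f g : E) : ip (e + f) g = ip e g + ip f g := by
  rw [← h.star_ip, h.add_right, star_add, h.star_ip, h.star_ip]

theorem smul_left (c : ℂ) (e f : E) : ip (c • e) f = star c • ip e f := by
  rw [← h.star_ip, h.smul_right, star_smul, h.star_ip]

theorem op_smul_left (a : A) (e f : E) : ip (MulOpposite.op a • e) f = star a * ip e f := by
  rw [← h.star_ip, h.op_smul_right, star_mul, h.star_ip]

theorem zero_right (e : E) : ip e 0 = 0 := by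
  have := h.smul_right 0 e 0
  rwa [zero_smul, zero_smul] at this

theorem norm_sq (e : E) : ‖e‖ ^ 2 = ‖ip e e‖ := by
  have h1 := h.mnorm_sq (Matrix.of fun _ _ : Unit => e)
  have e1 : mnorm (Matrix.of fun _ _ : Unit => e) = ‖e‖ := mnorm_unit e
  rw [e1] at h1
  rw [h1, ← mnorm_unit (ip e e)]
  congr 1
  ext
  simp

/-- The matrix norms of a C*-module determine the inner product. -/
theorem unique (hA : IsCStar A) {ip' : E → E → A} (h' : IsCStarModule ip') (e f : E) :
    ip e f = ip' e f := by
  have hd : ∀ e, ip e e = ip' e e := by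
    intro e
    obtain ⟨b, hb⟩ := h.nonneg e
    obtain ⟨c, hc⟩ := h'.nonneg e
    rw [hb, hc]
    let _ := hA.cstarRing
    -- If `⟨e, e⟩ = b*b`, then `‖ba‖ = ‖ea‖` for all `a`. These norms do not involve the inner
    -- product, and they determine `b*b`.
    have hn : ∀ {ip : E → E → A} (h : IsCStarModule ip) {b : A} (hb : ip e e = star b * b) (a : A),
        ‖b * a‖ ^ 2 = ‖MulOpposite.op a • e‖ ^ 2 := by
      intro ip h b hb a
      rw [h.norm_sq, h.op_smul_right, h.op_smul_left, hb, sq, ← CStarRing.norm_star_mul_self,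
        star_mul]
      simp only [mul_assoc]
    refine hA.eq_of_norm_mul_eq fun a => ?_
    have := (hn h hb a).trans (hn h' hc a).symm
    exact (sq_eq_sq₀ (norm_nonneg _) (norm_nonneg _)).1 this
  -- Polarization with `e + f` and `e + if` recovers the inner product from its diagonal values.
  have h1 := hd (e + f)
  have h2 := hd (e + Complex.I • f)
  rw [h.add_left, h.add_right, h.add_right, h'.add_left, h'.add_right, h'.add_right, hd e, hd f]
    at h1
  rw [h.add_left, h.add_right, h.add_right, h'.add_left, h'.add_right, h'.add_right, hd e,
    hd (Complex.I • f), h.smul_right _ e f, h.smul_left _ f e, h'.smul_right _ e f,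
    h'.smul_left _ f e] at h2
  have h3 : ip e f + ip f e = ip' e f + ip' f e := by
    linear_combination (norm := abel) h1
  have h4 : Complex.I • (ip e f - ip f e) = Complex.I • (ip' e f - ip' f e) := by
    simp only [RCLike.star_def, Complex.conj_I, neg_smul] at h2
    rw [smul_sub, smul_sub]
    linear_combination (norm := abel) h2
  have h5 : ip e f - ip f e = ip' e f - ip' f e :=
    smul_right_injective A Complex.I_ne_zero h4
  have h6 : (2 : ℂ) • ip e f = (2 : ℂ) • ip' e f := by
    rw [two_smul, two_smul]
    linear_combination (norm := abel) h3 + h5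
  exact smul_right_injective A (two_ne_zero' ℂ) h6

/-- The matrix `t⟨x, y i j⟩` is the off-diagonal block of the Gram matrix of the row with blocks
`x·1` and `ty`, whose norm is at most `‖x‖² + t²‖y‖²`. Optimizing over `t` gives a Cauchy-Schwarz
inequality for matrices. The factor `2` does no harm, because only complete boundedness is needed.
-/
theorem mnorm_ip_le (x : E) (y : Matrix m n E) :
    mnorm (Matrix.of fun i j => ip x (y i j)) ≤ 2 * ‖x‖ * mnorm y := by
  set G := mnorm (Matrix.of fun i j => ip x (y i j)) with hG
  have key : ∀ t : ℝ, 0 < t → t * G ≤ ‖x‖ ^ 2 + t ^ 2 * mnorm y ^ 2 := by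
    intro t ht
    have h1 := mnorm_fromCols_sq_le (scalarMat m x) ((t : ℂ) • y)
    have h2 : t * G ≤ mnorm (Matrix.fromCols (scalarMat m x) ((t : ℂ) • y)) ^ 2 := by
      rw [h.mnorm_sq]
      have e1 : ((t : ℂ) • Matrix.of fun i j => ip x (y i j)) =
          (Matrix.of fun i j : m ⊕ n => ∑ k, ip
            (Matrix.fromCols (scalarMat m x) ((t : ℂ) • y) k i)
            (Matrix.fromCols (scalarMat m x) ((t : ℂ) • y) k j)).submatrix Sum.inl Sum.inr := by
        ext i j
        simp only [Matrix.smul_apply, Matrix.of_apply, Matrix.submatrix_apply,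
          Matrix.fromCols_apply_inl, Matrix.fromCols_apply_inr]
        rw [Finset.sum_eq_single i, scalarMat_self, h.smul_right]
        · intro b _ hb
          rw [scalarMat_ne x hb, ← h.star_ip, h.zero_right, star_zero]
        · simp
      have h3 := mnorm_smul (t : ℂ) (Matrix.of fun i j => ip x (y i j))
      rw [Complex.norm_real, Real.norm_of_nonneg ht.le] at h3
      rw [hG, ← h3, e1]
      exact mnorm_submatrix_le _ Sum.inl_injective _ Sum.inr_injective _
    have h4 := mnorm_smul (t : ℂ) y
    rw [Complex.norm_real, Real.norm_of_nonneg ht.le] at h4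
    have h5 := pow_le_pow_left₀ (mnorm_nonneg _) (mnorm_scalarMat_le (k := m) x) 2
    rw [h4, mul_pow] at h1
    linarith
  have hx := norm_nonneg x
  have hy := mnorm_nonneg y
  by_contra! hlt
  have hGp : 0 < G := lt_of_le_of_lt (by positivity) hlt
  -- For `‖y‖ = 0` the chosen `t` makes the left side `‖x‖² + 1`, which is absurd. Otherwise `t =
  -- G/(2‖y‖²)` maximizes `tG - t²‖y‖²`, with value `(G/(2‖y‖))²`.
  rcases hy.eq_or_lt with h0 | h0
  · have := key ((‖x‖ ^ 2 + 1) / G) (by positivity)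
    rw [div_mul_cancel₀ _ hGp.ne', ← h0] at this
    norm_num at this
  · have := key (G / (2 * mnorm y ^ 2)) (by positivity)
    have e2 : G / (2 * mnorm y ^ 2) * G - (G / (2 * mnorm y ^ 2)) ^ 2 * mnorm y ^ 2 =
        (G / (2 * mnorm y)) ^ 2 := by
      field_simp
      ring
    have h6 : (G / (2 * mnorm y)) ^ 2 ≤ ‖x‖ ^ 2 := by linarith
    have h7 : G / (2 * mnorm y) ≤ ‖x‖ := by
      rwa [sq_le_sq₀ (by positivity) hx] at h6
    rw [div_le_iff₀ (by positivity)] at h7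
    linarith

/-- The map `f ↦ ⟨e, f⟩`. -/
def right (e : E) : E →ₗ[ℂ] A where
  toFun := ip e
  map_add' := h.add_right e
  map_smul' c := h.smul_right c e

theorem right_cb (e : E) : IsCB (h.right e) :=
  ⟨2 * ‖e‖, by positivity, fun y => h.mnorm_ip_le e y⟩

theorem continuous_right (e : E) : Continuous (ip e) := (h.right_cb e).continuous

theorem continuous_left (hA : IsCStar A) (f : E) : Continuous fun e => ip e f := by
  have e1 : (fun e => ip e f) = fun e => star (ip f e) := funext fun e => (h.star_ip f e).symm
  rw [e1]
  exact hA.continuous_star.comp (h.continuous_right f)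

/-- The inner product induced on a module by a complete isometry into a C*-module. -/
theorem pullback {F : Type*} [NormedAddCommGroup F] [NormedSpace ℂ F] [OperatorSpace F]
    [Module Aᵐᵒᵖ F] [IsScalarTower ℂ Aᵐᵒᵖ F] {ι : F →ₗ[ℂ] E} (hι : IsCI ι)
    (hs : ∀ (a : A) (f : F), ι (MulOpposite.op a • f) = MulOpposite.op a • ι f) :
    IsCStarModule fun e f : F => ip (ι e) (ι f) where
  add_right e f g := by rw [map_add, h.add_right]
  smul_right c e f := by rw [map_smul, h.smul_right]
  op_smul_right a e f := by rw [hs, h.op_smul_right]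
  star_ip e f := h.star_ip _ _
  nonneg e := h.nonneg _
  definite e he := by
    have h1 := h.norm_sq (ι e)
    rw [he, norm_zero] at h1
    have h2 : ‖ι e‖ = ‖e‖ := by
      have h3 := hι (fun _ _ : Unit => e)
      rw [mnorm_unit] at h3
      rw [← h3]
      exact (mnorm_unit (ι e)).symm
    rw [h2] at h1
    exact norm_eq_zero.1 (pow_eq_zero_iff two_ne_zero |>.1 h1)
  mnorm_sq x := by
    rw [← hι x, h.mnorm_sq]
    rfl

end IsCStarModule

end cstar

/-! ### The C*-module `H ⊗ A`. -/

section columnIp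

variable {A : Type*} [NormedRing A] [NormedAlgebra ℂ A] [OperatorSpace A] [OperatorAlgebra A]
  {H H' : Type*} [NormedAddCommGroup H] [InnerProductSpace ℂ H]
  [NormedAddCommGroup H'] [InnerProductSpace ℂ H']
  {m n k l : Type} [Fintype m] [Fintype n] [Fintype k] [Fintype l]

theorem norm_coord_le (h : Column H) (v : HTensor (Column H) A) : ‖coord A h v‖ ≤ ‖h‖ * ‖v‖ :=
  CBWith.norm_le (HT.lift_cbWith (coordPair A h) (coordPair_mb h) bot_le (norm_nonneg h)
    (coordPair_mbWith h)) v

theorem coord_add (h g : Column H) (v : HTensor (Column H) A) :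
    coord A (h + g) v = coord A h v + coord A g v :=
  HT.ext_tm (f := (coord A (h + g)).toLinearMap.toAddMonoidHom)
    (g := (coord A h + coord A g).toLinearMap.toAddMonoidHom) (coord A (h + g)).continuous
    (coord A h + coord A g).continuous (fun x a => by
      show coord A (h + g) (tm ⊥ x a) = coord A h (tm ⊥ x a) + coord A g (tm ⊥ x a)
      rw [coord_tm, coord_tm, coord_tm, inner_add_left, add_smul]) v

theorem coord_smul (c : ℂ) (h : Column H) (v : HTensor (Column H) A) :
    coord A (c • h) v = star c • coord A h v :=
  HT.ext_tm (f := (coord A (c • h)).toLinearMap.toAddMonoidHom)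
    (g := (star c • coord A h).toLinearMap.toAddMonoidHom) (coord A (c • h)).continuous
    (star c • coord A h).continuous (fun x a => by
      show coord A (c • h) (tm ⊥ x a) = star c • coord A h (tm ⊥ x a)
      rw [coord_tm, coord_tm, inner_smul_left, mul_smul]; rfl) v

theorem coord_colMul (g h : Column H) (g' : Column H') (x : HTensor (Column H') A) :
    coord A (colTensor g g') (colMul h x) = (inner ℂ g h : ℂ) • coord A g' x :=
  HT.ext_tm (f := ((coord A (colTensor g g')).toLinearMap.comp (colMul h)).toAddMonoidHom)
    (g := ((inner ℂ g h : ℂ) • coord A g').toLinearMap.toAddMonoidHom)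
    ((coord A (colTensor g g')).continuous.comp (continuous_colMul h))
    ((inner ℂ g h : ℂ) • coord A g').continuous (fun h' a => by
      show coord A (colTensor g g') (colMul h (tm ⊥ h' a)) =
        (inner ℂ g h : ℂ) • coord A g' (tm ⊥ h' a)
      rw [colMul_tm, coord_tm, coord_tm, inner_colTensor, mul_smul]) x

variable [StarRing A] [StarModule ℂ A]

/-- The partial sums of the inner product of `H ⊗ A`. -/
def partialIp (e : ℕ → Column H) (N : ℕ) (v w : HTensor (Column H) A) : A :=
  ∑ s : Fin N, star (coord A (e s) v) * coord A (e s) w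

/-- The inner product of `H ⊗ A`, for which `⟨h ⊗ a, g ⊗ b⟩ = ⟨h, g⟩ a*b`. -/
def colIp (e : ℕ → Column H) (v w : HTensor (Column H) A) : A :=
  Filter.limUnder Filter.atTop fun N => partialIp e N v w

variable {e : ℕ → Column H}

theorem partialIp_add_right (N : ℕ) (u v w : HTensor (Column H) A) :
    partialIp e N u (v + w) = partialIp e N u v + partialIp e N u w := by
  unfold partialIp
  rw [← Finset.sum_add_distrib]
  exact Finset.sum_congr rfl fun s _ => by rw [map_add, mul_add]

theorem partialIp_smul_right (N : ℕ) (c : ℂ) (v w : HTensor (Column H) A) :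
    partialIp e N v (c • w) = c • partialIp e N v w := by
  unfold partialIp
  rw [Finset.smul_sum]
  exact Finset.sum_congr rfl fun s _ => by rw [map_smul, mul_smul_comm]

theorem partialIp_sub_right (N : ℕ) (u v w : HTensor (Column H) A) :
    partialIp e N u v - partialIp e N u w = partialIp e N u (v - w) := by
  unfold partialIp
  rw [← Finset.sum_sub_distrib]
  exact Finset.sum_congr rfl fun s _ => by rw [map_sub, mul_sub]

/-- The partial sums against an elementary tensor depend only on the partial expansion of `h`, which
reduces their convergence to that of expansions in `H`. -/
theorem partialIp_tm (N : ℕ) (v : HTensor (Column H) A) (h : Column H) (b : A) :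
    partialIp e N v (tm ⊥ h b) =
      star (coord A (∑ s : Fin N, (inner ℂ (e s) h : ℂ) • e s) v) * b := by
  have h1 : ∀ (t : Finset (Fin N)), coord A (∑ s ∈ t, (inner ℂ (e s) h : ℂ) • e s) v =
      ∑ s ∈ t, star (inner ℂ (e s) h : ℂ) • coord A (e s) v := by
    classical
    intro t
    induction t using Finset.induction_on with
    | empty =>
      have := coord_smul (0 : ℂ) (0 : Column H) v
      rw [zero_smul, star_zero, zero_smul] at this
      rw [Finset.sum_empty, Finset.sum_empty, this]
    | insert s t hs ih => rw [Finset.sum_insert hs, Finset.sum_insert hs, coord_add, coord_smul, ih]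
  unfold partialIp
  rw [h1, star_sum, Finset.sum_mul]
  refine Finset.sum_congr rfl fun s _ => ?_
  rw [coord_tm, star_smul, star_star, smul_mul_assoc, mul_smul_comm]

theorem conjTranspose_coords_mul (N : ℕ) (x : Matrix m n (HTensor (Column H) A)) :
    (coords e N x).conjTranspose * coords e N x =
      Matrix.of fun i j => ∑ k, partialIp e N (x k i) (x k j) := by
  ext i j
  simp only [Matrix.mul_apply, Fintype.sum_prod_type, Matrix.conjTranspose_apply, coords,
    Matrix.of_apply, partialIp]

variable (he : IsPaddedBasis e) (hA : IsCStar A)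

include he hA

theorem norm_partialIp_le (N : ℕ) (v w : HTensor (Column H) A) :
    ‖partialIp e N v w‖ ≤ ‖v‖ * ‖w‖ := by
  have h1 := IsCStar.mnorm_mul_le (coords e N (Matrix.of fun _ _ : Unit => v)).conjTranspose
    (coords e N (Matrix.of fun _ _ : Unit => w))
  have e1 : (coords e N (Matrix.of fun _ _ : Unit => v)).conjTranspose *
      (coords e N (Matrix.of fun _ _ : Unit => w)) = fun _ _ => partialIp e N v w := by
    ext i j
    simp only [Matrix.mul_apply, Fintype.sum_prod_type, Matrix.conjTranspose_apply, coords,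
      Matrix.of_apply, partialIp, Finset.univ_unique, Finset.sum_singleton]
  rw [e1, mnorm_unit, hA.mnorm_conjTranspose] at h1
  refine h1.trans (mul_le_mul ?_ ?_ (mnorm_nonneg _) (norm_nonneg _))
  · exact (mnorm_coords_le he N _).trans (mnorm_unit v).le
  · exact (mnorm_coords_le he N _).trans (mnorm_unit w).le

theorem tendsto_partialIp_tm (v : HTensor (Column H) A) (h : Column H) (b : A) :
    Filter.Tendsto (fun N => partialIp e N v (tm ⊥ h b)) Filter.atTop
      (nhds (star (coord A h v) * b)) := by
  have h1 : Filter.Tendsto (fun N => coord A (∑ s : Fin N, (inner ℂ (e s) h : ℂ) • e s) v)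
      Filter.atTop (nhds (coord A h v)) := by
    rw [tendsto_iff_norm_sub_tendsto_zero]
    have h2 := (tendsto_iff_norm_sub_tendsto_zero.1 (he.tendsto h)).mul_const ‖v‖
    rw [zero_mul] at h2
    refine squeeze_zero (fun _ => norm_nonneg _) (fun N => ?_) h2
    refine le_trans (le_of_eq ?_) (norm_coord_le _ v)
    rw [sub_eq_add_neg (∑ s : Fin N, (inner ℂ (e s) h : ℂ) • e s), coord_add,
      ← neg_one_smul ℂ h, coord_smul, star_neg, star_one, neg_one_smul, sub_eq_add_neg]
  simp only [partialIp_tm]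
  exact ((hA.continuous_star.tendsto _).comp h1).mul_const b

/-- The partial sums are uniformly bounded in `w`, so it is enough that they converge for elementary
tensors, whose sums are dense. -/
theorem tendsto_partialIp (v w : HTensor (Column H) A) :
    Filter.Tendsto (fun N => partialIp e N v w) Filter.atTop (nhds (colIp e v w)) := by
  refine CauchySeq.tendsto_limUnder ?_
  refine HT.induction (p := fun w : HTensor (Column H) A =>
    CauchySeq fun N => partialIp e N v w) ?_ ?_ ?_ ?_ w
  · refine isClosed_cauchySeq_of_bounded (C := ‖v‖) fun N w w' => ?_
    rw [partialIp_sub_right]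
    exact norm_partialIp_le he hA N v _
  · have h0 : ∀ N, partialIp e N v 0 = 0 := fun N => by
      have := partialIp_smul_right (e := e) N 0 v 0
      rwa [zero_smul, zero_smul] at this
    simp only [h0]
    exact cauchySeq_const 0
  · intro x y hx hy
    simp only [partialIp_add_right]
    exact hx.add hy
  · intro h b
    exact (tendsto_partialIp_tm he hA v h b).cauchySeq

/-- The right side does not involve the basis, and this formula replaces the limit in all later
computations. -/
theorem colIp_tm (v : HTensor (Column H) A) (h : Column H) (b : A) :
    colIp e v (tm ⊥ h b) = star (coord A h v) * b :=
  tendsto_nhds_unique (tendsto_partialIp he hA v _) (tendsto_partialIp_tm he hA v h b)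

/-- For truncations this is the C*-identity for the matrix of coordinates, whose norm is that of the
truncation. Both sides are continuous in the limit. -/
theorem colIp_mnorm_sq (x : Matrix m n (HTensor (Column H) A)) :
    mnorm x ^ 2 = mnorm (Matrix.of fun i j : n => ∑ k, colIp e (x k i) (x k j)) := by
  have h1 : Filter.Tendsto (fun N => mnorm (x.map (trunc e N)) ^ 2) Filter.atTop
      (nhds (mnorm x ^ 2)) := by
    refine Filter.Tendsto.pow ((continuous_mnorm.tendsto x).comp ?_) 2
    exact tendsto_pi_nhds.2 fun i => tendsto_pi_nhds.2 fun j => trunc_tendsto he (x i j)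
  have h2 : Filter.Tendsto (fun N => mnorm (x.map (trunc e N)) ^ 2) Filter.atTop
      (nhds (mnorm (Matrix.of fun i j : n => ∑ k, colIp e (x k i) (x k j)))) := by
    have e1 : ∀ N, mnorm (x.map (trunc e N)) ^ 2 =
        mnorm (Matrix.of fun i j : n => ∑ k, partialIp e N (x k i) (x k j)) := fun N => by
      rw [mnorm_map_trunc he, ← hA, conjTranspose_coords_mul]
    simp only [e1]
    refine (continuous_mnorm.tendsto _).comp ?_
    exact tendsto_pi_nhds.2 fun i => tendsto_pi_nhds.2 fun j =>
      tendsto_finsetSum _ fun k _ => tendsto_partialIp he hA (x k i) (x k j)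
  exact tendsto_nhds_unique h1 h2

/-- `H ⊗ A` is a C*-module. -/
theorem isCStarModule_colIp : IsCStarModule (A := A) (E := HTensor (Column H) A) (colIp e) where
  add_right u v w := by
    refine tendsto_nhds_unique (tendsto_partialIp he hA u (v + w)) ?_
    simp only [partialIp_add_right]
    exact (tendsto_partialIp he hA u v).add (tendsto_partialIp he hA u w)
  smul_right c v w := by
    refine tendsto_nhds_unique (tendsto_partialIp he hA v (c • w)) ?_
    simp only [partialIp_smul_right]
    exact (tendsto_partialIp he hA v w).const_smul c
  op_smul_right a v w := by
    refine tendsto_nhds_unique (tendsto_partialIp he hA v (MulOpposite.op a • w)) ?_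
    have e1 : ∀ N, partialIp e N v (MulOpposite.op a • w) = partialIp e N v w * a := fun N => by
      unfold partialIp
      rw [Finset.sum_mul]
      exact Finset.sum_congr rfl fun s _ => by rw [coord_op_smul, mul_assoc]
    simp only [e1]
    exact (tendsto_partialIp he hA v w).mul_const a
  star_ip v w := by
    refine tendsto_nhds_unique ((hA.continuous_star.tendsto _).comp (tendsto_partialIp he hA v w)) ?_
    have e1 : ∀ N, star (partialIp e N v w) = partialIp e N w v := fun N => by
      unfold partialIp
      rw [star_sum]
      exact Finset.sum_congr rfl fun s _ => by rw [star_mul, star_star]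
    simp only [Function.comp_def, e1]
    exact tendsto_partialIp he hA w v
  nonneg v := hA.isClosed_pos.mem_of_tendsto (tendsto_partialIp he hA v v)
    (Filter.Eventually.of_forall fun N => IsCStar.sum_pos hA Finset.univ fun s : Fin N => coord A (e s) v)
  definite v hv := by
    have h1 := colIp_mnorm_sq he hA (Matrix.of fun _ _ : Unit => v)
    have e1 : mnorm (Matrix.of fun _ _ : Unit => v) = ‖v‖ := mnorm_unit v
    have e2 : (Matrix.of fun i j : Unit => ∑ k : Unit, colIp e
        ((Matrix.of fun _ _ : Unit => v) k i) ((Matrix.of fun _ _ : Unit => v) k j)) = 0 := by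
      ext i j
      simp [hv]
    rw [e1, e2, mnorm_zero] at h1
    exact norm_eq_zero.1 (pow_eq_zero_iff two_ne_zero |>.1 h1)
  mnorm_sq x := colIp_mnorm_sq he hA x

end columnIp

section columnIp

variable {A : Type*} [NormedRing A] [NormedAlgebra ℂ A] [OperatorSpace A] [OperatorAlgebra A]
  [StarRing A] [StarModule ℂ A]
  {H H' : Type*} [NormedAddCommGroup H] [InnerProductSpace ℂ H]
  [NormedAddCommGroup H'] [InnerProductSpace ℂ H']

theorem colIp_colMul (hA : IsCStar A) {e' : ℕ → Column H'} (he' : IsPaddedBasis e')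
    {e'' : ℕ → Column (HilbertTensor H H')} (he'' : IsPaddedBasis e'') (h g : Column H)
    (x y : HTensor (Column H') A) :
    colIp e'' (colMul h x) (colMul g y) = (inner ℂ h g : ℂ) • colIp e' x y :=
  HT.ext_tm
    (f := (((isCStarModule_colIp he'' hA).right (colMul h x)).comp (colMul g)).toAddMonoidHom)
    (g := ((inner ℂ h g : ℂ) • (isCStarModule_colIp he' hA).right x).toAddMonoidHom)
    (((isCStarModule_colIp he'' hA).continuous_right _).comp (continuous_colMul g))
    (((isCStarModule_colIp he' hA).continuous_right x).const_smul (inner ℂ h g : ℂ))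
    (fun g' b => by
      show colIp e'' (colMul h x) (colMul g (tm ⊥ g' b)) =
        (inner ℂ h g : ℂ) • colIp e' x (tm ⊥ g' b)
      rw [colMul_tm, colIp_tm he'' hA, colIp_tm he' hA, coord_colMul, star_smul, smul_mul_assoc,
        ← inner_conj_symm h g]
      rfl) y

end columnIp

/-! ### The interior tensor product. -/

section tensorIp

variable {A B : Type*} [NormedRing A] [NormedAlgebra ℂ A] [OperatorSpace A] [OperatorAlgebra A]
  [NormedRing B] [NormedAlgebra ℂ B] [OperatorSpace B] [OperatorAlgebra B]
  {P Q : Type*} [NormedAddCommGroup P] [NormedSpace ℂ P] [OperatorSpace P]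
  [NormedAddCommGroup Q] [NormedSpace ℂ Q] [OperatorSpace Q] [CompleteSpace Q]
  [Module Aᵐᵒᵖ P] [IsScalarTower ℂ Aᵐᵒᵖ P]
  [Module A Q] [IsScalarTower ℂ A Q] [LeftOpModule A Q]
  [Module Bᵐᵒᵖ Q] [IsScalarTower ℂ Bᵐᵒᵖ Q] [SMulCommClass A Bᵐᵒᵖ Q] [RightOpModule B Q]
  {H H' : Type*} [NormedAddCommGroup H] [InnerProductSpace ℂ H]
  [NormedAddCommGroup H'] [InnerProductSpace ℂ H']
  [StarRing A] [StarModule ℂ A] [StarRing B] [StarModule ℂ B]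
  {ip' : Q → Q → B}

/-- On elementary tensors the left side is `⟨h, g⟩⟨aq, cs⟩`, and moving `a` to the other side as
`a*` gives `⟨q, ⟨h, g⟩a*c s⟩`. Continuity in each variable extends this to all `v` and `w`. -/
theorem ColumnSummand.colIp_twist (S' : ColumnSummand B Q H') (hA : IsCStar A) (hB : IsCStar B)
    (h' : IsCStarModule ip') (hadj : ∀ (a : A) (q r : Q), ip' (a • q) r = ip' q (star a • r))
    {e : ℕ → Column H} (he : IsPaddedBasis e) {e' : ℕ → Column H'} (he' : IsPaddedBasis e')
    {e'' : ℕ → Column (HilbertTensor H H')} (he'' : IsPaddedBasis e'')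
    (v w : HTensor (Column H) A) (q s : Q) :
    colIp e'' (S'.twist A H v q) (S'.twist A H w s) = ip' q (colIp e v w • s) := by
  have hX := isCStarModule_colIp he hA
  have hK := isCStarModule_colIp he'' hB
  -- The given inner product of `Q` has to be the one restricted from `H' ⊗ B`, as both have the
  -- same matrix norms.
  have hip : ∀ x y, ip' x y = colIp e' (S'.incl x) (S'.incl y) :=
    h'.unique hB ((isCStarModule_colIp he' hB).pullback S'.incl_ci S'.incl_op_smul)
  have hsm : ∀ (s : Q), Continuous fun a : A => a • s := fun s => continuous_smul_left s
  have hbase : ∀ (h g : Column H) (a c : A),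
      colIp e'' (S'.twist A H (tm ⊥ h a) q) (S'.twist A H (tm ⊥ g c) s) =
        ip' q (colIp e (tm ⊥ h a) (tm ⊥ g c) • s) := by
    intro h g a c
    have e1 : colIp e (tm ⊥ h a) (tm ⊥ g c) = (inner ℂ h g : ℂ) • (star a * c) := by
      rw [colIp_tm he hA, coord_tm, star_smul, smul_mul_assoc, ← inner_conj_symm h g]
      rfl
    rw [S'.twist_tm, S'.twist_tm, colIp_colMul hB he' he'', ← hip, e1, hadj, smul_assoc, h'.smul_right,
      mul_smul]
  have hv : ∀ (g : Column H) (c : A) (v : HTensor (Column H) A),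
      colIp e'' (S'.twist A H v q) (S'.twist A H (tm ⊥ g c) s) =
        ip' q (colIp e v (tm ⊥ g c) • s) := fun g c v =>
    HT.ext_tm
      (f := AddMonoidHom.mk' (fun v => colIp e'' (S'.twist A H v q) (S'.twist A H (tm ⊥ g c) s))
        fun v v' => by
          rw [← hK.add_left]
          exact congrArg (fun z => colIp e'' z _) (LinearMap.map_add₂ (S'.twist A H) v v' q))
      (g := AddMonoidHom.mk' (fun v => ip' q (colIp e v (tm ⊥ g c) • s)) fun v v' => by
        rw [← h'.add_right, ← add_smul, hX.add_left])
      ((hK.continuous_left hB _).comp (S'.continuous_twist q))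
      ((h'.continuous_right q).comp ((hsm s).comp (hX.continuous_left hA _)))
      (fun h a => hbase h g a c) v
  exact HT.ext_tm
      (f := AddMonoidHom.mk' (fun w => colIp e'' (S'.twist A H v q) (S'.twist A H w s))
        fun w w' => by
          rw [← hK.add_right]
          exact congrArg (colIp e'' _) (LinearMap.map_add₂ (S'.twist A H) w w' s))
      (g := AddMonoidHom.mk' (fun w => ip' q (colIp e v w • s)) fun w w' => by
        rw [← h'.add_right, ← add_smul, hX.add_right])
      ((hK.continuous_right _).comp (S'.continuous_twist s))
      ((h'.continuous_right q).comp ((hsm s).comp (hX.continuous_right v)))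
      (fun g c => hv g c v) w

/-- The interior tensor product of C*-modules. -/
theorem IsCStarModule.exists_tensor [TopologicalSpace.SeparableSpace H]
    [TopologicalSpace.SeparableSpace H'] [CompleteSpace H']
    (S : ColumnSummand A P H) (S' : ColumnSummand B Q H') (hA : IsCStar A) (hB : IsCStar B)
    {ip : P → P → A} (h : IsCStarModule ip) (h' : IsCStarModule ip')
    (hadj : ∀ (a : A) (q r : Q), ip' (a • q) r = ip' q (star a • r)) :
    ∃ ip'' : ModTensor A P Q → ModTensor A P Q → B, IsCStarModule ip'' ∧
      ∀ (p r : P) (q s : Q), ip'' (tm _ p q) (tm _ r s) = ip' q (ip p r • s) := by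
  obtain ⟨e, he⟩ := exists_paddedBasis (H := H)
  obtain ⟨e', he'⟩ := exists_paddedBasis (H := H')
  have := separableSpace_hilbertTensor (H := H) (H' := H')
  obtain ⟨e'', he''⟩ := exists_paddedBasis (H := HilbertTensor H H')
  obtain ⟨R, hR⟩ := ColumnSummand.exists_tensor S S'
  refine ⟨_, (isCStarModule_colIp he'' hB).pullback R.incl_ci R.incl_op_smul, fun p r q s => ?_⟩
  rw [hR]
  show colIp e'' (S.inclTensor S' (tm _ p q)) (S.inclTensor S' (tm _ r s)) = _
  -- Uniqueness is used for `P` as well, to identify `⟨ι p, ι r⟩` with the given `⟨p, r⟩`.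
  rw [S.inclTensor_tm, S.inclTensor_tm, S'.colIp_twist hA hB h' hadj he he' he'',
    h.unique hA ((isCStarModule_colIp he hA).pullback S.incl_ci S.incl_op_smul)]

end tensorIp

/-! ### Universal forms and their pairings with C*-modules. -/

section forms

variable (A : Type*) [NormedRing A] [NormedAlgebra ℂ A] [OperatorSpace A] [OperatorAlgebra A]

theorem omegaIncl_univD (a : A) : omegaIncl A (univD A a) = tm ⊥ 1 a - tm ⊥ a 1 := rfl

theorem univD_add (a b : A) : univD A (a + b) = univD A a + univD A b := by
  refine omegaIncl_injective A ?_
  have h : omegaIncl A (univD A a + univD A b) =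
    omegaIncl A (univD A a) + omegaIncl A (univD A b) := rfl
  rw [h, omegaIncl_univD, omegaIncl_univD, omegaIncl_univD, tm_add_left, tm_add_right]
  abel

theorem continuous_univD : Continuous (univD A) :=
  Continuous.subtype_mk ((continuous_tm_right 1).sub (continuous_tm_left 1)) _

/-- The projection `a ⊗ b ↦ a db` of `A ⊗ A` onto `Ω¹(A)`. -/
def omegaRetract : HTensor A A →L[ℂ] Omega1 A :=
  (ContinuousLinearMap.id ℂ (HTensor A A) -
    (⟨(tmₗ (⊥ : Submodule ℂ (A ⊗[ℂ] A))).flip 1, continuous_tm_left 1⟩ : A →L[ℂ] HTensor A A).comp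
      (mulMap A)).codRestrict (omegaSub A) fun u => by
    show mulMap A (u - tm ⊥ (mulMap A u) 1) = 0
    rw [map_sub, mulMap_tm, mul_one, sub_self]

theorem omegaIncl_retract (u : HTensor A A) :
    omegaIncl A (omegaRetract A u) = u - tm ⊥ (mulMap A u) 1 := rfl

theorem omegaRetract_incl (ω : Omega1 A) : omegaRetract A (omegaIncl A ω) = ω := by
  refine omegaIncl_injective A ?_
  have h : mulMap A (omegaIncl A ω) = 0 := ω.2
  rw [omegaIncl_retract, h, tm_zero_left, sub_zero]

theorem omegaRetract_tm (a b : A) : omegaRetract A (tm ⊥ a b) = a • univD A b := by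
  refine omegaIncl_injective A ?_
  rw [omegaIncl_retract, omegaIncl_smul, omegaIncl_univD, mulMap_tm, smul_sub, smul_tm, smul_tm,
    mul_one]

variable {A}

/-- Continuous additive maps that agree on the forms `a db` are equal. -/
theorem Omega1.ext {Z : Type*} [AddCommMonoid Z] [TopologicalSpace Z] [T2Space Z]
    {f g : Omega1 A →+ Z} (hf : Continuous f) (hg : Continuous g)
    (h : ∀ a b : A, f (a • univD A b) = g (a • univD A b)) (ω : Omega1 A) : f ω = g ω := by
  have h1 := HT.ext_tm (f := f.comp (omegaRetract A).toLinearMap.toAddMonoidHom)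
    (g := g.comp (omegaRetract A).toLinearMap.toAddMonoidHom)
    (hf.comp (omegaRetract A).continuous) (hg.comp (omegaRetract A).continuous)
    (fun a b => by
      show f (omegaRetract A (tm ⊥ a b)) = g (omegaRetract A (tm ⊥ a b))
      rw [omegaRetract_tm, h]) (omegaIncl A ω)
  have h2 : f (omegaRetract A (omegaIncl A ω)) = g (omegaRetract A (omegaIncl A ω)) := h1
  rwa [omegaRetract_incl] at h2

end forms

/-- Separately continuous biadditive maps vanish if they vanish on elementary tensors. -/
theorem HT.eq_zero_of_tm_tm {X Y X' Y' Z : Type*} [SeminormedAddCommGroup X] [NormedSpace ℂ X]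
    [OperatorSpace X] [SeminormedAddCommGroup Y] [NormedSpace ℂ Y] [OperatorSpace Y]
    [SeminormedAddCommGroup X'] [NormedSpace ℂ X'] [OperatorSpace X']
    [SeminormedAddCommGroup Y'] [NormedSpace ℂ Y'] [OperatorSpace Y']
    [AddCommGroup Z] [TopologicalSpace Z] [T2Space Z]
    {N : Submodule ℂ (X ⊗[ℂ] Y)} {N' : Submodule ℂ (X' ⊗[ℂ] Y')} {R : HT N → HT N' → Z}
    (hl : ∀ u u' v, R (u + u') v = R u v + R u' v) (hr : ∀ u v v', R u (v + v') = R u v + R u v')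
    (hcl : ∀ v, Continuous fun u => R u v) (hcr : ∀ u, Continuous (R u))
    (h : ∀ x y x' y', R (tm N x y) (tm N' x' y') = 0) (u : HT N) (v : HT N') : R u v = 0 :=
  HT.ext_tm (f := AddMonoidHom.mk' (R u) (hr u)) (g := 0) (hcr u) continuous_const
    (fun x' y' => HT.ext_tm (f := AddMonoidHom.mk' (fun u => R u (tm N' x' y'))
      fun u u' => hl u u' _) (g := 0) (hcl _) continuous_const (fun x y => h x y x' y') u) v

section pairing

variable {A : Type*} [NormedRing A] [NormedAlgebra ℂ A] [OperatorSpace A] [OperatorAlgebra A]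
  [StarRing A] [StarModule ℂ A]
  {E : Type*} [SeminormedAddCommGroup E] [NormedSpace ℂ E] [OperatorSpace E]
  [Module Aᵐᵒᵖ E] [IsScalarTower ℂ Aᵐᵒᵖ E] {ip : E → E → A}

namespace IsCStarModule

variable (h : IsCStarModule ip)

include h

theorem pairing_mb (e : E) : MBWith (fun (f : E) (ω : Omega1 A) => ip e f • ω) (2 * ‖e‖) := by
  intro m k n _ _ _ f ω
  have h1 := LeftOpModule.smul_le (Matrix.of fun i j => ip e (f i j)) ω
  rw [one_mul] at h1
  rw [← mul_assoc]
  exact h1.trans (mul_le_mul_of_nonneg_right (h.mnorm_ip_le e f) (mnorm_nonneg ω))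

/-- The pairing `f ⊗ ω ↦ ⟨e, f⟩ω`. -/
def pairing (e : E) : ModTensor A E (Omega1 A) →L[ℂ] Omega1 A :=
  HT.lift ((Algebra.lsmul ℂ ℂ (Omega1 A) : A →ₐ[ℂ] Module.End ℂ (Omega1 A)).toLinearMap.comp
    (h.right e)) ⟨_, by positivity, h.pairing_mb e⟩
    (balanced_le_ker _ fun a f ω => by
      show ip e (MulOpposite.op a • f) • ω = ip e f • a • ω
      rw [h.op_smul_right, mul_smul])

theorem pairing_tm (e f : E) (ω : Omega1 A) : h.pairing e (tm _ f ω) = ip e f • ω :=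
  HT.lift_tm _ _ _ f ω

theorem norm_pairing_le (e : E) (w : ModTensor A E (Omega1 A)) :
    ‖h.pairing e w‖ ≤ 2 * ‖e‖ * ‖w‖ :=
  CBWith.norm_le (HT.lift_cbWith _ _ _ (by positivity) (h.pairing_mb e)) w

attribute [irreducible] pairing

theorem pairing_add (e e' : E) (w : ModTensor A E (Omega1 A)) :
    h.pairing (e + e') w = h.pairing e w + h.pairing e' w :=
  HT.ext_tm (f := (h.pairing (e + e')).toLinearMap.toAddMonoidHom)
    (g := (h.pairing e + h.pairing e').toLinearMap.toAddMonoidHom)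
    (h.pairing (e + e')).continuous (h.pairing e + h.pairing e').continuous
    (fun f ω => by
      show h.pairing (e + e') (tm _ f ω) = h.pairing e (tm _ f ω) + h.pairing e' (tm _ f ω)
      rw [pairing_tm, pairing_tm, pairing_tm, h.add_left, add_smul]) w

theorem continuous_pairing_left (w : ModTensor A E (Omega1 A)) :
    Continuous fun e => h.pairing e w :=
  AddMonoidHomClass.continuous_of_bound
    (AddMonoidHom.mk' (fun e => h.pairing e w) fun e e' => h.pairing_add e e' w) (2 * ‖w‖)
    fun e => (h.norm_pairing_le e w).trans_eq (by ring)

end IsCStarModule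

/-- The pairing in the definition is prescribed on elementary tensors and continuous, so it is the
one constructed above. -/
theorem IsHermitian.exists_inv (h : IsCStarModule ip) {D : UnivConnection A E} (hD : IsHermitian ip D) :
    ∃ inv : Omega1 A →L⋆[ℂ] Omega1 A,
      (∀ a b : A, inv (a • univD A b) = -(MulOpposite.op (star a) • univD A (star b))) ∧
      ∀ e f : E, h.pairing e (D.toFun f) - inv (h.pairing f (D.toFun e)) = univD A (ip e f) := by
  obtain ⟨inv, pair, h1, h2, h3⟩ := hD
  have e1 : ∀ e w, pair e w = h.pairing e w := fun e w =>
    HT.ext_tm (f := (pair e).toLinearMap.toAddMonoidHom)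
      (g := (h.pairing e).toLinearMap.toAddMonoidHom) (pair e).continuous (h.pairing e).continuous
      (fun f ω => (h2 e f ω).trans (h.pairing_tm e f ω).symm) w
  exact ⟨inv, h1, fun e f => by rw [← e1, ← e1]; exact h3 e f⟩

end pairing

/-! ### Hermitian connections and their products. -/

section commutation

variable {A B : Type*} [NormedRing A] [NormedAlgebra ℂ A] [OperatorSpace A] [OperatorAlgebra A]
  [NormedRing B] [NormedAlgebra ℂ B] [OperatorSpace B] [OperatorAlgebra B]
  [StarRing A] [StarModule ℂ A]
  {Q : Type*} [SeminormedAddCommGroup Q] [NormedSpace ℂ Q] [OperatorSpace Q]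
  [Module A Q] [IsScalarTower ℂ A Q] [LeftOpModule A Q]
  [Module Bᵐᵒᵖ Q] [IsScalarTower ℂ Bᵐᵒᵖ Q] [SMulCommClass A Bᵐᵒᵖ Q] [RightOpModule B Q]
  {Y : Type*} [NormedAddCommGroup Y] [NormedSpace ℂ Y] [OperatorSpace Y] [CompleteSpace Y]
  [Module Bᵐᵒᵖ Y] [IsScalarTower ℂ Bᵐᵒᵖ Y] [RightOpModule B Y]
  [Module A Y] [IsScalarTower ℂ A Y] [SMulCommClass A Bᵐᵒᵖ Y] [LeftOpModule A Y]
  {W : Type*} [NormedAddCommGroup W] [NormedSpace ℂ W]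
  {d : Q →ₗ[ℂ] Y} {δ : A →ₗ[ℂ] CBHom B Q Y} (hδ : IsCB δ)
  (hd : ∀ a q, (δ a).app q = d (a • q) - a • d q)
  {Φ : Q → (Y →L[ℂ] W)} (hΦ : ∀ (a : A) q y, Φ (a • q) y = Φ q (star a • y))
  {invA : Omega1 A →L⋆[ℂ] Omega1 A}
  (hinv : ∀ a b : A, invA (a • univD A b) = -(MulOpposite.op (star a) • univD A (star b)))
  {inv : W →L⋆[ℂ] W} {dip : Q → Q → W}
  (hdip : ∀ (a : A) q s, dip (a • q) s = dip q (star a • s))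
  (hH : ∀ q s, Φ q (d s) - inv (Φ s (d q)) = dip q s)

include hd hΦ hinv hdip hH

/-- The representation of forms by commutators with a Hermitian connection is a
*-representation. -/
theorem inv_formLift_app (ω : Omega1 A) (q s : Q) :
    inv (Φ s ((formLift δ hδ ω).app q)) = Φ q ((formLift δ hδ (invA ω)).app s) := by
  have hj := (formLift δ hδ).continuous
  refine Omega1.ext
    (f := AddMonoidHom.mk' (fun ω => inv (Φ s ((formLift δ hδ ω).app q))) fun ω ω' => ?_)
    (g := AddMonoidHom.mk' (fun ω => Φ q ((formLift δ hδ (invA ω)).app s)) fun ω ω' => ?_)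
    ?_ ?_ (fun a b => ?_) ω
  · rw [map_add (formLift δ hδ), ← CBHom.eval_apply, map_add (CBHom.eval q), map_add, map_add]
    rfl
  · rw [map_add invA, map_add (formLift δ hδ), ← CBHom.eval_apply, map_add (CBHom.eval s), map_add]
    rfl
  · exact inv.continuous.comp ((Φ s).continuous.comp ((continuous_app q).comp hj))
  · exact (Φ q).continuous.comp ((continuous_app s).comp (hj.comp invA.continuous))
  · show inv (Φ s ((formLift δ hδ (a • univD A b)).app q)) =
      Φ q ((formLift δ hδ (invA (a • univD A b))).app s)
    have h1 : (formLift δ hδ (a • univD A b)).app q = a • d (b • q) - a • b • d q := by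
      rw [formLift_smul, formLift_d hδ hd, CBHom.smul_app, hd, smul_sub]
    have h2 : (formLift δ hδ (MulOpposite.op (star a) • univD A (star b))).app s =
        d (star b • star a • s) - star b • d (star a • s) := by
      rw [formLift_op_smul_app hδ hd, formLift_d hδ hd, hd]
    have h3 : (formLift δ hδ (-(MulOpposite.op (star a) • univD A (star b)))).app s =
        -(formLift δ hδ (MulOpposite.op (star a) • univD A (star b))).app s := by
      rw [map_neg]
      rfl
    have h4 : ∀ (a : A) q y, Φ q (a • y) = Φ (star a • q) y := fun a q y => by
      rw [hΦ, star_star]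
    rw [hinv, h3, h1, h2, map_neg, map_sub, map_sub, map_sub, h4 a s, h4 a s, h4 b,
      h4 (star b), star_star]
    -- After all scalars have been moved to the outer arguments, the claim is the difference of the
    -- Hermitian identities for the pairs `(bq, a*s)` and `(q, b*a*s)`. Their right sides agree
    -- because `b` can be moved across the inner product.
    have h5 := hH (b • q) (star a • s)
    have h6 := hH q (star b • star a • s)
    rw [hdip, ← h6] at h5
    linear_combination (norm := abel) -h5

/-- This is the check on elementary tensors, with `a = ⟨p, r⟩`, `u = ⟨p, ∇r⟩` and `u' = ⟨r, ∇p⟩`. By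
the *-property the two forms combine to `j_δ(u - u'*) = j_δ(da) = δ(a)`. This completes `a·ds` to
`d(as)`, and the Hermitian identity of `d` for `q` and `as` remains. -/
theorem formLift_hermitian {a : A} {u u' : Omega1 A} (hu : u - invA u' = univD A a) (q s : Q) :
    (Φ q (a • d s) + Φ q ((formLift δ hδ u).app s)) -
      inv (Φ s (star a • d q) + Φ s ((formLift δ hδ u').app q)) = dip q (a • s) := by
  have h1 : (formLift δ hδ u).app s - (formLift δ hδ (invA u')).app s = d (a • s) - a • d s := by
    rw [← CBHom.app_sub, ← map_sub, hu, formLift_d hδ hd, hd]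
  have h2 : Φ s (star a • d q) = Φ (a • s) (d q) := (hΦ a s (d q)).symm
  have h3 := hH q (a • s)
  have h4 := congrArg (Φ q) h1
  rw [map_sub, map_sub] at h4
  rw [map_add inv, inv_formLift_app hδ hd hΦ hinv hdip hH, h2]
  linear_combination (norm := abel) h3 + h4

end commutation

section hermitian

variable {A B : Type*} [NormedRing A] [NormedAlgebra ℂ A] [OperatorSpace A] [OperatorAlgebra A]
  [NormedRing B] [NormedAlgebra ℂ B] [OperatorSpace B] [OperatorAlgebra B]
  {P Q : Type*} [SeminormedAddCommGroup P] [NormedSpace ℂ P] [OperatorSpace P]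
  [SeminormedAddCommGroup Q] [NormedSpace ℂ Q] [OperatorSpace Q]
  [Module Aᵐᵒᵖ P] [IsScalarTower ℂ Aᵐᵒᵖ P]
  [Module A Q] [IsScalarTower ℂ A Q] [LeftOpModule A Q]
  [Module Bᵐᵒᵖ Q] [IsScalarTower ℂ Bᵐᵒᵖ Q] [SMulCommClass A Bᵐᵒᵖ Q] [RightOpModule B Q]
  [StarRing A] [StarModule ℂ A] [StarRing B] [StarModule ℂ B]
  {ip : P → P → A} {ip' : Q → Q → B} {ip'' : ModTensor A P Q → ModTensor A P Q → B}
  (h : IsCStarModule ip) (h' : IsCStarModule ip') (h'' : IsCStarModule ip'')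

theorem IsCStarModule.pairing_smul_left (hadj : ∀ (a : A) (q r : Q), ip' (a • q) r = ip' q (star a • r))
    (a : A) (q : Q) (y : ModTensor B Q (Omega1 B)) :
    h'.pairing (a • q) y = h'.pairing q (star a • y) :=
  HT.ext_tm (f := (h'.pairing (a • q)).toLinearMap.toAddMonoidHom)
    (g := (h'.pairing q).toLinearMap.toAddMonoidHom.comp
      (DistribSMul.toAddMonoidHom (ModTensor B Q (Omega1 B)) (star a)))
    (h'.pairing (a • q)).continuous ((h'.pairing q).continuous.comp (continuous_const_smul (star a)))
    (fun s ω => by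
      show h'.pairing (a • q) (tm _ s ω) = h'.pairing q (star a • tm _ s ω)
      rw [left_smul_tm (star a) s ω, h'.pairing_tm, h'.pairing_tm, hadj]) y

variable (hip : ∀ (p r : P) (q s : Q), ip'' (tm _ p q) (tm _ r s) = ip' q (ip p r • s))

include hip

theorem pairing_assocMap_tm (p r : P) (q : Q) (y : ModTensor B Q (Omega1 B)) :
    h''.pairing (tm _ p q) (assocMap (tm _ r y)) = h'.pairing q (ip p r • y) :=
  (congrArg (h''.pairing (tm _ p q)) (assocMap_tm_right r y)).trans <|
  HT.ext_tm (f := ((h''.pairing (tm _ p q)).comp (assocInner r)).toLinearMap.toAddMonoidHom)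
    (g := (h'.pairing q).toLinearMap.toAddMonoidHom.comp
      (DistribSMul.toAddMonoidHom (ModTensor B Q (Omega1 B)) (ip p r)))
    ((h''.pairing (tm _ p q)).comp (assocInner r)).continuous
    ((h'.pairing q).continuous.comp (continuous_const_smul (ip p r)))
    (fun s ω => by
      show h''.pairing (tm _ p q) (assocInner r (tm _ s ω)) = h'.pairing q (ip p r • tm _ s ω)
      rw [assocInner_tm r s ω, left_smul_tm (ip p r) s ω, h''.pairing_tm, h'.pairing_tm, hip]) y

/-- Pairing with `p` can be done before forms are represented, since `j_δ` is left linear: `⟨p, r⟩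
j_δ(ω) = j_δ(⟨p, r⟩ω)`. -/
theorem pairing_assocMap_evalRight
    {δ : A →ₗ[ℂ] CBHom B Q (ModTensor B Q (Omega1 B))} (hδ : IsCB δ) (p : P) (q s : Q)
    (u : ModTensor A P (Omega1 A)) :
    h''.pairing (tm _ p q) (assocMap (evalRight A B P s (mapRight P (formLift δ hδ).toLinearMap
      (formLift_cb δ hδ) (formLift_smul δ hδ) u))) =
    h'.pairing q ((formLift δ hδ (h.pairing p u)).app s) := by
  let L := mapRight P (formLift δ hδ).toLinearMap (formLift_cb δ hδ) (formLift_smul δ hδ)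
  let F : ModTensor A P (Omega1 A) →L[ℂ] Omega1 B :=
    (h''.pairing (tm _ p q)).comp (assocMap.comp ((evalRight A B P s).comp L))
  let G : ModTensor A P (Omega1 A) →ₗ[ℂ] Omega1 B :=
    (h'.pairing q).toLinearMap.comp ((CBHom.eval s).comp
      ((formLift δ hδ).toLinearMap.comp (h.pairing p).toLinearMap))
  have hG : Continuous G := (h'.pairing q).continuous.comp ((continuous_app s).comp
    ((formLift δ hδ).continuous.comp (h.pairing p).continuous))
  refine HT.ext_tm (f := F.toLinearMap.toAddMonoidHom) (g := G.toAddMonoidHom) F.continuous hG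
    (fun r ω => ?_) u
  show h''.pairing (tm _ p q) (assocMap (evalRight A B P s (L (tm _ r ω)))) =
    h'.pairing q ((formLift δ hδ (h.pairing p (tm _ r ω))).app s)
  have e1 : L (tm _ r ω) = tm _ r (formLift δ hδ ω) := mapRight_tm P _ _ _ r ω
  rw [e1, evalRight_tm s r, pairing_assocMap_tm h' h'' hip, h.pairing_tm, formLift_smul,
    CBHom.smul_app]

include h h' h''

/-- The product of Hermitian connections is Hermitian. -/
theorem IsProduct.isHermitian (hB : IsCStar B)
    (hadj : ∀ (a : A) (q r : Q), ip' (a • q) r = ip' q (star a • r))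
    {D : UnivConnection A P} {D' : UnivConnection B Q} {D'' : UnivConnection B (ModTensor A P Q)}
    (hD'' : IsProduct D D' D'') (hD : IsHermitian ip D) (hD' : IsHermitian ip' D') :
    IsHermitian ip'' D'' := by
  obtain ⟨invA, hinvA, hHA⟩ := hD.exists_inv h
  obtain ⟨inv, hinv, hH⟩ := hD'.exists_inv h'
  refine ⟨inv, h''.pairing, hinv, h''.pairing_tm, fun e f => ?_⟩
  have hval : ∀ (p r : P) (q s : Q), h''.pairing (tm _ p q) (D''.toFun (tm _ r s)) =
      h'.pairing q (ip p r • D'.toFun s) +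
        h'.pairing q ((formLift (commutator D') (commutator_cb D')
          (h.pairing p (D.toFun r))).app s) := fun p r q s => by
    rw [hD'', map_add assocMap, map_add (h''.pairing _), pairing_assocMap_tm h' h'' hip,
      ← pairing_assocMap_evalRight h h' h'' hip]
    rfl
  have hDc : Continuous D''.toFun := D''.cb.continuous
  -- The defect of the Hermitian identity is biadditive and continuous in each variable separately,
  -- so it suffices that it vanishes on elementary tensors.
  refine sub_eq_zero.1 (HT.eq_zero_of_tm_tm
    (R := fun e f => h''.pairing e (D''.toFun f) - inv (h''.pairing f (D''.toFun e)) -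
      univD B (ip'' e f)) (fun u u' v => ?_) (fun u v v' => ?_) (fun v => ?_) (fun u => ?_)
    (fun p q r s => ?_) e f)
  · simp only [map_add D''.toFun, h''.pairing_add, h''.add_left, univD_add,
      map_add (h''.pairing _), map_add inv]
    abel
  · simp only [map_add D''.toFun, h''.pairing_add, h''.add_right, univD_add,
      map_add (h''.pairing _), map_add inv]
    abel
  · exact ((h''.continuous_pairing_left _).sub (inv.continuous.comp
      ((h''.pairing v).continuous.comp hDc))).sub
      ((continuous_univD B).comp (h''.continuous_left hB v))
  · exact (((h''.pairing u).continuous.comp hDc).sub (inv.continuous.comp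
      (h''.continuous_pairing_left _))).sub ((continuous_univD B).comp (h''.continuous_right u))
  · have h1 := formLift_hermitian (d := D'.toFun) (commutator_cb D') (commutator_app D')
      (Φ := fun q => h'.pairing q) (h'.pairing_smul_left hadj) hinvA
      (dip := fun q s => univD B (ip' q s)) (fun a q s => congrArg (univD B) (hadj a q s)) hH
      (hHA p r) q s
    simp only [hval, hip]
    -- The scalar in front of `∇'q` in the second pairing is `⟨r, p⟩`, which is the adjoint of `⟨p,
    -- r⟩`.
    rw [h.star_ip] at h1
    exact sub_eq_zero.2 h1

end hermitian

end

end OpMod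

theorem mainTheorem8
    {A B P Q : Type*}
    -- unital operator algebras `A` and `B`
    [NormedRing A] [NormedAlgebra ℂ A] [OpMod.OperatorSpace A] [OpMod.OperatorAlgebra A]
    [NormedRing B] [NormedAlgebra ℂ B] [OpMod.OperatorSpace B] [OpMod.OperatorAlgebra B]
    -- a right operator `A`-module `P`
    [NormedAddCommGroup P] [NormedSpace ℂ P] [OpMod.OperatorSpace P] [CompleteSpace P]
    [Module Aᵐᵒᵖ P] [IsScalarTower ℂ Aᵐᵒᵖ P] [OpMod.RightOpModule A P]
    -- an operator `(A, B)`-bimodule `Q`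
    [NormedAddCommGroup Q] [NormedSpace ℂ Q] [OpMod.OperatorSpace Q] [CompleteSpace Q]
    [Module A Q] [IsScalarTower ℂ A Q] [OpMod.LeftOpModule A Q]
    [Module Bᵐᵒᵖ Q] [IsScalarTower ℂ Bᵐᵒᵖ Q] [OpMod.RightOpModule B Q] [SMulCommClass A Bᵐᵒᵖ Q]
    (hP : OpMod.IsProjectiveRigged A P) (hQ : OpMod.IsProjectiveRigged B Q)
    (D : OpMod.UnivConnection A P) (D' : OpMod.UnivConnection B Q) :
    OpMod.IsProjectiveRigged B (OpMod.ModTensor A P Q) ∧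
    ∃ D'' : OpMod.UnivConnection B (OpMod.ModTensor A P Q),
      OpMod.IsProduct D D' D'' ∧
      -- the case of C*-modules over C*-algebras, with `A` acting on `Q` by a *-homomorphism
      ∀ [StarRing A] [StarModule ℂ A] [StarRing B] [StarModule ℂ B]
        (ip : P → P → A) (ip' : Q → Q → B),
        OpMod.IsCStar A → OpMod.IsCStar B →
        OpMod.IsCStarModule ip → OpMod.IsCStarModule ip' →
        (∀ (a : A) (q r : Q), ip' (a • q) r = ip' q (star a • r)) →
        OpMod.IsHermitian ip D → OpMod.IsHermitian ip' D' →
        ∃ ip'' : OpMod.ModTensor A P Q → OpMod.ModTensor A P Q → B,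
          OpMod.IsCStarModule ip'' ∧
          (∀ (p r : P) (q s : Q), ip'' (OpMod.tm _ p q) (OpMod.tm _ r s) = ip' q (ip p r • s)) ∧
          OpMod.IsHermitian ip'' D'' := by
  -- The connection is fixed before any involution is given, so the same `∇''` serves for all
  -- C*-structures in the last part.
  obtain ⟨D'', hD''⟩ := OpMod.exists_productConnection hQ.app_mb D D'
  refine ⟨hP.tensor hQ, D'', hD'', ?_⟩
  intro _ _ _ _ ip ip' hA hB h h' hadj hD hD'
  obtain ⟨-, H, _, _, _, _, ι, π, h1, h2, h3, h4, h5⟩ := hP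
  obtain ⟨-, H', _, _, _, _, ι', π', h1', h2', h3', h4', h5'⟩ := hQ
  obtain ⟨ip'', h'', hip⟩ := OpMod.IsCStarModule.exists_tensor
    (⟨ι, π, h1, h2, h3, h4, h5⟩ : OpMod.ColumnSummand A P H)
    (⟨ι', π', h1', h2', h3', h4', h5'⟩ : OpMod.ColumnSummand B Q H') hA hB h h' hadj
  exact ⟨ip'', h'', hip, hD''.isHermitian h h' h'' hip hB hadj hD hD'⟩
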